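/- **Setting.** Let $F$ be a non-archimedean local field with ring of integers $\mathfrak o$, maximal ideal $\mathfrak p$, uniformizer $\pi$, and residue field of odd cardinality $q$; $|\cdot|$ is the normalized absolute value ($|\pi|=q^{-1}$). Let $\psi$ be a (continuous, unitary) additive character of $F$ of order $0$, i.e. trivial on $\mathfrak o$ but not on $\mathfrak p^{-1}$. Let $\chi(x)=\langle\pi,x\rangle$ ($x\in F^\times$), where $\langle\,,\rangle$ is the quadratic Hilbert symbol. Let $dx$ be the Haar measure on $F$ with $\int_{\mathfrak o}dx=1$. The Weil constant $\alpha_\psi(a)$, $a\in F^\times$, is the complex number such that for all locally constant, compactly supported $\phi:F\to\mathbb C$, with $\hat\phi(x)=\int_F\phi(y)\psi(xy)\,dy$, $$\int_F\phi(x)\psi(ax^2)\,dx=\alpha_\psi(a)\,|2a|^{-1/2}\int_F\hat\phi(x)\,\psi\Bigl(-\frac{x^2}{4a}\Bigr)dx .$$ Let $n\ge 1$, let $v_1,\dots,v_n\in\mathfrak o^\times$, let $0\le e_1\le\cdots\le e_n$ be integers, and let $B=\mathrm{diag}(v_1\pi^{e_1},\dots,v_n\pi^{e_n})$. **The Siegel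 series.** Let $G=\mathrm{Sp}_n(F)$ be the symplectic group of $2n\times 2n$ matrices, and let $\Gamma\subset \mathrm{Sp}_n(\mathfrak o)$ be the subgroup of the $\begin{pmatrix}A&B'\\C&D\end{pmatrix}$ with $C\equiv 0\bmod\mathfrak p$. For $0\le i\le n$ let $w_i\in G$ be the element with $n\times n$ blocks $$w_i=\begin{pmatrix}\mathrm{diag}(1_{n-i},0_i)&\mathrm{diag}(0_{n-i},-1_i)\\ \mathrm{diag}(0_{n-i},1_i)&\mathrm{diag}(1_{n-i},0_i)\end{pmatrix}.$$ For $s\in\mathbb C$ let $I_n(\chi,s)^{\Gamma,\chi}$ be the space of locally constant functions $f:G\to\mathbb C$ with $$f\Bigl(\begin{pmatrix}A&*\\0&{}^tA^{-1}\end{pmatrix}g\Bigr)=\chi(\det A)\,|\det A|^{s+\frac{n+1}2}f(g),\qquad f(gk)=\chi(\det D_k)f(g)\quad(k\in\Gamma),$$ where $D_k$ is the lower right block of $k$. Let $f_0$ be the element of $I_n\bigl(\chi,s-\tfrac{n+1}2\bigr)^{\Gamma,\chi}$ with $f_0(w_0)=1$ and $f_0(w_j)=0$ for $1\le j\le n$.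 The ramified Siegel series is $$S_0(B,s)^\chi=\int_{\mathrm{Sym}_n(F)}f_0\Bigl(w_n\begin{pmatrix}1&X\\0&1\end{pmatrix}\Bigr)\psi(-\mathrm{tr}(BX))\,dX,\qquad \int_{\mathrm{Sym}_n(\mathfrak o)}dX=1,$$ for $\mathrm{Re}\,s$ large, and it is extended to $s\in\mathbb C$ by meromorphic continuation. **Notation for the formula.** Put $I=\{1,\dots,n\}$. Let $\sigma\in\mathfrak S_n$ with $\sigma^2=1$, and let $I=I_0\cup\cdots\cup I_r$ be an ordered partition of $I$ into disjoint non-empty $\sigma$-stable subsets. Put $$c_2(\sigma)=\tfrac12\#\{i\mid\sigma(i)\ne i\},\qquad n^{(l)}=\sum_{m=l}^r\#I_m,$$ $$\tau(\{I_i\})=\sum_{l=1}^r\#\{(i,j)\in I_l\times(I_0\cup\cdots\cup I_{l-1})\mid j<i\},$$ $$t(\sigma,\{I_i\})=\sum_{l=0}^r\#\{(i,j)\in I_l\times I_l\mid i<j<\sigma(i),\ \sigma(j)<\sigma(i)\},$$ $$e_{\sigma,i,k}=\begin{cases}0&(k\le i,\ k\le\sigma(i))\\1&(\sigma(i)<k\le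 i\ \text{or}\ i<k\le\sigma(i))\\2&(i<k,\ \sigma(i)<k),\end{cases}$$ $$b_l(\sigma,B)=\min\bigl(\{e_i\mid i\in I_l,\ \sigma(i)>i\}\cup\{e_i+1\mid i\in I_l,\ \sigma(i)\le i\}\bigr).$$ For $\lambda\in\mathbb Z$ put $$\tilde\rho_{l,\lambda}(\sigma;B)=\tfrac12\sum_{i\in I_l}\sum_{k=1}^n\min\{e_k+e_{\sigma,i,k}+\lambda,\,0\},$$ $$B_i(\lambda)=\{k<i\mid e_k+\lambda<0,\ e_k\not\equiv\lambda\bmod 2\}\cup\{k>i\mid e_k+\lambda+2<0,\ e_k\not\equiv\lambda\bmod 2\},$$ and, for $e_i+\lambda\ge-1$, $$\xi_{i,\lambda}(B)_\chi=\prod_{k\in B_i(\lambda)}\chi(v_k)\times\begin{cases}0&e_i+\lambda\ge0,\ \#B_i(\lambda)\text{ even}\\(1-q^{-1})\chi(-1)^{[\#B_i(\lambda)/2]+1}&e_i+\lambda\ge0,\ \#B_i(\lambda)\text{ odd}\\\chi(v_i)\chi(-1)^{[\#B_i(\lambda)/2]+1}&e_i+\lambda=-1,\ \#B_i(\lambda)\text{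 even}\\-q^{-1/2}\chi(-1)^{[\#B_i(\lambda)/2]+1}&e_i+\lambda=-1,\ \#B_i(\lambda)\text{ odd}.\end{cases}$$ **Theorem.** The integral converges absolutely for $\mathrm{Re}\,s>n$, it has a unique meromorphic continuation $S_0(B,s)^\chi$ to $s\in\mathbb C$, and for all $s\in\mathbb C$ $$\begin{aligned}S_0(B,s)^\chi=\ &\alpha_\psi(\pi)^n\sum_{\substack{\sigma\in\mathfrak S_n\\\sigma^2=1}}(1-q^{-1})^{c_2(\sigma)}\sum_{I=I_0\cup\cdots\cup I_r}q^{-c_2(\sigma)-\tau(\{I_i\})-t(\sigma,\{I_i\})}\\&\times\sum_{\{\nu\}}\prod_{l=0}^r\chi(-1)^{\nu_ln^{(l)}}q^{\frac12\nu_ln^{(l)}(2s-1-n^{(l)})+\tilde\rho_{l,\nu_0+\cdots+\nu_l}(\sigma;B)}\prod_{\substack{i\in I_l\\\sigma(i)=i}}\xi_{i,\nu_0+\cdots+\nu_l}(B)_\chi .\end{aligned}$$ Here the second sum is over all ordered partitions of $I$ into disjoint non-empty $\sigma$-stable subsets (with any $r\ge0$), and $\{\nu\}$ runs over the finite set $$\{(\nu_0,\nu_1,\dots,\nu_r)\in\mathbb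 Z\times\mathbb Z_{>0}^r\mid -b_l(\sigma,B)\le\nu_0+\cdots+\nu_l\le-1\ (0\le l\le r)\}.$$ -/

import Mathlib

open ValuativeRel MeasureTheory
open scoped Matrix

noncomputable section

namespace RamifiedSiegel

section LocalField

variable (F : Type*) [Field F] [ValuativeRel F] [TopologicalSpace F]
  [IsNonarchimedeanLocalField F]

/-- The cardinality `q` of the residue field. -/
def resCard : ℕ := Nat.card 𝓀[F]

variable {F}

/-- The normalized additive valuation of `F` (uniformizers have order `1`; junk value `0` at `0`). -/
def ord (x : F) : ℤ :=
  -WithZero.log (IsNonarchimedeanLocalField.valueGroupWithZeroIsoInt F (valuation F x))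

open Classical in
/-- The normalized absolute value of `F`: `|x| = q ^ (-ord x)` for `x ≠ 0`, and `|0| = 0`. -/
def absF (x : F) : ℝ := if x = 0 then 0 else (resCard F : ℝ) ^ (-ord x)

variable (F) in
/-- The ring of integers as a compact set with non-empty interior. -/
def integerCompacts : TopologicalSpace.PositiveCompacts F where
  carrier := {x | valuation F x ≤ 1}
  isCompact' := IsNonarchimedeanLocalField.isCompact_closedBall F 1
  interior_nonempty' := by
    refine ⟨0, mem_interior_iff_mem_nhds.mpr ?_⟩
    refine Filter.mem_of_superset ((IsValuativeTopology.hasBasis_nhds_zero' F).mem_of_mem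
      (i := 1) one_ne_zero) ?_
    intro x (hx : valuation F x < 1)
    exact hx.le

variable (F) in
/-- The Haar measure on `F` that gives the ring of integers volume `1`. -/
def haarF [MeasurableSpace F] [BorelSpace F] : Measure F :=
  Measure.addHaarMeasure (integerCompacts F)

/-- The additive character `ψ` has order `0`: it is trivial on the ring of integers `𝔬`, but not on
`𝔭⁻¹`. -/
def HasOrderZero (ψ : AddChar F Circle) : Prop :=
  (∀ x ∈ 𝒪[F], ψ x = 1) ∧ ∃ x : F, -1 ≤ ord x ∧ ψ x ≠ 1

open Classical in
/-- The quadratic Hilbert symbol of `F`. -/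
def hilbertSymbol (a b : F) : ℤ :=
  if ∃ x y z : F, (x ≠ 0 ∨ y ≠ 0 ∨ z ≠ 0) ∧ a * x ^ 2 + b * y ^ 2 = z ^ 2 then 1 else -1

/-- The character `χ(x) = ⟨π, x⟩` of `Fˣ`, with complex values (only `x ≠ 0` matters). -/
def chi (π x : F) : ℂ := (hilbertSymbol π x : ℂ)

section Weil

variable [MeasurableSpace F] [BorelSpace F]

/-- The Fourier transform `φ̂(x) = ∫ φ(y) ψ(xy) dy`. -/
def fourier (ψ : AddChar F Circle) (φ : F → ℂ) (x : F) : ℂ :=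
  ∫ y, φ y * (ψ (x * y) : ℂ) ∂haarF F

/-- The defining property of the Weil constant `α_ψ(a)`. The Schwartz functions on `F` are the
locally constant functions with compact support. -/
def IsWeilConstant (ψ : AddChar F Circle) (a : F) (α : ℂ) : Prop :=
  ∀ φ : F → ℂ, IsLocallyConstant φ → HasCompactSupport φ →
    ∫ x, φ x * (ψ (a * x ^ 2) : ℂ) ∂haarF F =
      α * ((absF (2 * a) : ℝ) : ℂ) ^ (-(1 / 2) : ℂ) *
        ∫ x, fourier ψ φ x * (ψ (-(x ^ 2 / (4 * a))) : ℂ) ∂haarF F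

/-- The Weil constant `α_ψ(a)`: the complex number with the property above. -/
def weilConstant (ψ : AddChar F Circle) (a : F) : ℂ :=
  Classical.epsilon (IsWeilConstant ψ a)

end Weil

end LocalField

section Group

/-- The symmetric matrix with prescribed entries, indexed by the unordered pairs of indices. -/
def symMatrix {F : Type*} {n : ℕ} (x : Sym2 (Fin n) → F) : Matrix (Fin n) (Fin n) F :=
  Matrix.of fun i j => x s(i, j)

theorem symMatrix_isSymm {F : Type*} {n : ℕ} (x : Sym2 (Fin n) → F) : (symMatrix x).IsSymm := by
  ext i j
  simp [symMatrix, Sym2.eq_swap]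

variable {F : Type*} [Field F] {n : ℕ}

/-- The matrix `w_i`; its blocks are `diag(1_{n-i}, 0)`, `diag(0, -1_i)`, `diag(0, 1_i)` and
`diag(1_{n-i}, 0)`. -/
def wMatrix (F : Type*) [Field F] (n i : ℕ) : Matrix (Fin n ⊕ Fin n) (Fin n ⊕ Fin n) F :=
  Matrix.fromBlocks
    (Matrix.diagonal fun j => if (j : ℕ) + i < n then 1 else 0)
    (Matrix.diagonal fun j => if (j : ℕ) + i < n then 0 else -1)
    (Matrix.diagonal fun j => if (j : ℕ) + i < n then 0 else 1)
    (Matrix.diagonal fun j => if (j : ℕ) + i < n then 1 else 0)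

theorem wMatrix_mem (i : ℕ) : wMatrix F n i ∈ Matrix.symplecticGroup (Fin n) F := by
  rw [SymplecticGroup.mem_iff, wMatrix, Matrix.J, Matrix.fromBlocks_transpose,
    Matrix.fromBlocks_multiply, Matrix.fromBlocks_multiply]
  simp only [Matrix.diagonal_transpose, Matrix.mul_zero, Matrix.mul_one, Matrix.mul_neg,
    zero_add, add_zero, Matrix.neg_mul, Matrix.diagonal_mul_diagonal]
  congr 1
  · ext a b; by_cases h : (a : ℕ) + i < n <;> simp [Matrix.diagonal_apply, h]
  · ext a b
    by_cases hab : a = b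
    · subst hab
      by_cases h : (a : ℕ) + i < n <;> simp [h]
    · simp [hab]
  · ext a b; by_cases h : (a : ℕ) + i < n <;> simp [Matrix.diagonal_apply, Matrix.one_apply, h]
  · ext a b; by_cases h : (a : ℕ) + i < n <;> simp [Matrix.diagonal_apply, h]

/-- `w_i` as an element of `Sp_n(F)`. -/
def w (i : ℕ) : Matrix.symplecticGroup (Fin n) F := ⟨wMatrix F n i, wMatrix_mem i⟩

/-- The unipotent element with upper right block `X`, for the symmetric matrix `X` with the
entries `x`. -/
def unip (x : Sym2 (Fin n) → F) : Matrix.symplecticGroup (Fin n) F :=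
  ⟨Matrix.fromBlocks 1 (symMatrix x) 0 1, by
    rw [SymplecticGroup.mem_iff, Matrix.J, Matrix.fromBlocks_transpose,
      Matrix.fromBlocks_multiply, Matrix.fromBlocks_multiply]
    simp [(symMatrix_isSymm x).eq]⟩

variable [ValuativeRel F]

/-- Membership in `Γ`: integral entries, and lower left block congruent to `0` modulo the maximal
ideal. -/
def InGamma (g : Matrix.symplecticGroup (Fin n) F) : Prop :=
  (∀ i j, g.1 i j ∈ 𝒪[F]) ∧ ∀ i j, valuation F (g.1.toBlocks₂₁ i j) < 1

variable [TopologicalSpace F] [IsNonarchimedeanLocalField F]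

/-- Membership in the space `I_n(ω, s)^{Γ, ω}`: smooth functions on `Sp_n(F)` that transform on the
left under the Siegel parabolic subgroup by `ω(det A) |det A|^(s + (n+1)/2)`, and on the right under
`Γ` by `ω(det D)`. Here `ω` is a character of `Fˣ`; its value at `0` plays no role. -/
structure IsInduced (ω : F → ℂ) (s : ℂ) (f : Matrix.symplecticGroup (Fin n) F → ℂ) : Prop where
  smooth : IsLocallyConstant f
  left : ∀ p g : Matrix.symplecticGroup (Fin n) F, p.1.toBlocks₂₁ = 0 →
    f (p * g) = ω p.1.toBlocks₁₁.det *
      ((absF p.1.toBlocks₁₁.det : ℝ) : ℂ) ^ (s + ((n : ℂ) + 1) / 2) * f g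
  right : ∀ g k : Matrix.symplecticGroup (Fin n) F, InGamma k →
    f (g * k) = ω k.1.toBlocks₂₂.det * f g

/-- The function `f_t` in `I_n(ω, s)^{Γ, ω}` with `f_t(w_j) = δ_{tj}` for `0 ≤ j ≤ n`. -/
def basisFn (ω : F → ℂ) (s : ℂ) (t : ℕ) : Matrix.symplecticGroup (Fin n) F → ℂ :=
  Classical.epsilon fun f => IsInduced ω s f ∧ ∀ j ≤ n, f (w j) = if j = t then 1 else 0

/-- The integrand `f_t(w_n (1 X; 0 1)) ψ(-tr(BX))` of the Siegel series, where `f_t` is taken in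
`I_n(ω, s - (n+1)/2)^{Γ, ω}` and `X` is the symmetric matrix with the entries `x`. -/
def siegelIntegrand (ψ : AddChar F Circle) (ω : F → ℂ) (B : Matrix (Fin n) (Fin n) F) (t : ℕ)
    (s : ℂ) (x : Sym2 (Fin n) → F) : ℂ :=
  basisFn ω (s - ((n : ℂ) + 1) / 2) t (w n * unip x) *
    (ψ (-(B * symMatrix x).trace) : ℂ)

variable [MeasurableSpace F] [BorelSpace F]

variable (F n) in
/-- The Haar measure on `Sym_n(F)` that gives `Sym_n(𝔬)` volume `1`, in the coordinates given by
the entries `x_{ij}`, `i ≤ j`. -/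
def haarSym : Measure (Sym2 (Fin n) → F) := Measure.pi fun _ => haarF F

/-- The integral that defines the Siegel series `S_t(B, s)^ω` (where it converges). -/
def siegelIntegral (ψ : AddChar F Circle) (ω : F → ℂ) (B : Matrix (Fin n) (Fin n) F) (t : ℕ)
    (s : ℂ) : ℂ :=
  ∫ x, siegelIntegrand ψ ω B t s x ∂haarSym F n

/-- `S` is the Siegel series `S_t(B, ·)^ω` as a function on `ℂ`: a meromorphic function (in normal
form, so that its values are determined) which for `s` in some right half-plane is given by the
absolutely convergent integral. -/
def IsSiegelSeries (ψ : AddChar F Circle) (ω : F → ℂ) (B : Matrix (Fin n) (Fin n) F) (t : ℕ)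
    (S : ℂ → ℂ) : Prop :=
  MeromorphicNFOn S Set.univ ∧ ∃ c : ℝ, ∀ s : ℂ, c < s.re →
    Integrable (siegelIntegrand ψ ω B t s) (haarSym F n) ∧ S s = siegelIntegral ψ ω B t s

end Group

section Combinatorics

variable {n r : ℕ}

/-- `I_0, …, I_r` is a partition of `{1, …, n}` into `r + 1` disjoint non-empty `σ`-stable subsets
(in the given order). -/
def IsStablePartition (σ : Equiv.Perm (Fin n)) (I : Fin (r + 1) → Finset (Fin n)) : Prop :=
  (∀ l, (I l).Nonempty) ∧ (∀ l m, l ≠ m → Disjoint (I l) (I m)) ∧ (∀ i, ∃ l, i ∈ I l) ∧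
    ∀ l, ∀ i ∈ I l, σ i ∈ I l

/-- `c_2(σ)`; the division is exact when `σ ^ 2 = 1`. -/
def c2 (σ : Equiv.Perm (Fin n)) : ℕ := (Finset.univ.filter fun i => σ i ≠ i).card / 2

/-- `n^{(l)} = #I_l + ⋯ + #I_r`. -/
def nUpper (I : Fin (r + 1) → Finset (Fin n)) (l : Fin (r + 1)) : ℕ :=
  ∑ m ∈ Finset.univ.filter (fun m => l ≤ m), (I m).card

/-- `τ({I_i})`, the number of `(i, j)` in `I_l × (I_0 ∪ ⋯ ∪ I_{l-1})` with `j < i`, summed over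
`l`. -/
def tau (I : Fin (r + 1) → Finset (Fin n)) : ℕ :=
  ∑ l, (Finset.univ.filter fun p : Fin n × Fin n =>
    p.1 ∈ I l ∧ (∃ m, m < l ∧ p.2 ∈ I m) ∧ p.2 < p.1).card

/-- `t(σ, {I_i})`, the number of `(i, j)` in `I_l × I_l` with `i < j < σ(i)` and `σ(j) < σ(i)`,
summed over `l`. -/
def tInv (σ : Equiv.Perm (Fin n)) (I : Fin (r + 1) → Finset (Fin n)) : ℕ :=
  ∑ l, (Finset.univ.filter fun p : Fin n × Fin n =>
    p.1 ∈ I l ∧ p.2 ∈ I l ∧ p.1 < p.2 ∧ p.2 < σ p.1 ∧ σ p.2 < σ p.1).card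

/-- `e_{σ, i, k}`. -/
def eSig (σ : Equiv.Perm (Fin n)) (i k : Fin n) : ℤ :=
  if k ≤ i ∧ k ≤ σ i then 0 else if i < k ∧ σ i < k then 2 else 1

/-- `b_l(σ, B)` for the set `J = I_l` (a minimum over a non-empty set). -/
def bMin (σ : Equiv.Perm (Fin n)) (e : Fin n → ℕ) (J : Finset (Fin n)) : ℕ :=
  sInf ({m | ∃ i ∈ J, i < σ i ∧ m = e i} ∪ {m | ∃ i ∈ J, σ i ≤ i ∧ m = e i + 1})

/-- The partial sum `ν_0 + ⋯ + ν_l`. -/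
def partialSum (ν : Fin (r + 1) → ℤ) (l : Fin (r + 1)) : ℤ :=
  ∑ m ∈ Finset.univ.filter (fun m => m ≤ l), ν m

/-- The set of the tuples `(ν_0, …, ν_r)` in `ℤ × ℤ_{>0}^r` with
`-b_l(σ, B) ≤ ν_0 + ⋯ + ν_l ≤ -1` for all `l`. -/
def nuSet (σ : Equiv.Perm (Fin n)) (e : Fin n → ℕ) (I : Fin (r + 1) → Finset (Fin n)) :
    Set (Fin (r + 1) → ℤ) :=
  {ν | (∀ l, l ≠ 0 → 0 < ν l) ∧
    ∀ l, -(bMin σ e (I l) : ℤ) ≤ partialSum ν l ∧ partialSum ν l ≤ -1}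

theorem nuSet_finite (σ : Equiv.Perm (Fin n)) (e : Fin n → ℕ)
    (I : Fin (r + 1) → Finset (Fin n)) : (nuSet σ e I).Finite := by
  refine Set.Finite.of_finite_image (f := partialSum) ?_ ?_
  · refine (Set.Finite.pi' fun l => Set.finite_Icc (-(bMin σ e (I l) : ℤ)) (-1)).subset ?_
    rintro _ ⟨ν, hν, rfl⟩ l
    exact hν.2 l
  · intro ν _ μ _ h
    funext l
    induction l using Fin.induction with
    | zero =>
      have h0 := congrFun h 0
      have hf : Finset.univ.filter (fun m : Fin (r + 1) => m ≤ 0) = {0} := by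
        ext m; simp
      simpa only [partialSum, hf, Finset.sum_singleton] using h0
    | succ l _ =>
      have h1 := congrFun h l.succ
      have h2 := congrFun h l.castSucc
      have hf : Finset.univ.filter (fun m : Fin (r + 1) => m ≤ l.succ) =
          insert l.succ (Finset.univ.filter (fun m : Fin (r + 1) => m ≤ l.castSucc)) := by
        ext m
        simp only [Finset.mem_filter, Finset.mem_univ, true_and, Finset.mem_insert, Fin.le_def,
          Fin.ext_iff, Fin.val_succ, Fin.val_castSucc]
        omega
      have hn : l.succ ∉ Finset.univ.filter (fun m : Fin (r + 1) => m ≤ l.castSucc) := by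
        simp [Fin.le_def]
      simp only [partialSum, hf, Finset.sum_insert hn] at h1 h2
      linarith

/-- `B_i(λ)`. -/
def bSet (e : Fin n → ℕ) (i : Fin n) (lam : ℤ) : Finset (Fin n) :=
  Finset.univ.filter fun k =>
    (k < i ∧ (e k : ℤ) + lam < 0 ∧ ¬ (e k : ℤ) ≡ lam [ZMOD 2]) ∨
      (i < k ∧ (e k : ℤ) + lam + 2 < 0 ∧ ¬ (e k : ℤ) ≡ lam [ZMOD 2])

/-- `ρ̃_{l, λ}(σ; B)` for the set `J = I_l`. -/
def rhoTilde (σ : Equiv.Perm (Fin n)) (e : Fin n → ℕ) (J : Finset (Fin n)) (lam : ℤ) : ℂ :=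
  (1 / 2) * ((∑ i ∈ J, ∑ k, min ((e k : ℤ) + eSig σ i k + lam) 0 : ℤ) : ℂ)

end Combinatorics

section Formula

variable {F : Type*} [Field F] [ValuativeRel F] [TopologicalSpace F]
  [IsNonarchimedeanLocalField F] {n : ℕ}

/-- `ξ_{i, λ}(B)_χ` for `B = diag(v_i π^{e_i})` and `e_i + λ ≥ -1` (the value for
`e_i + λ ≤ -2` is not used). -/
def xi (π : F) (v : Fin n → F) (e : Fin n → ℕ) (i : Fin n) (lam : ℤ) : ℂ :=
  (∏ k ∈ bSet e i lam, chi π (v k)) *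
    if 0 ≤ (e i : ℤ) + lam then
      if Even (bSet e i lam).card then 0
      else (1 - (resCard F : ℂ)⁻¹) * chi π (-1) ^ ((bSet e i lam).card / 2 + 1)
    else if (e i : ℤ) + lam = -1 then
      if Even (bSet e i lam).card then
        chi π (v i) * chi π (-1) ^ ((bSet e i lam).card / 2 + 1)
      else -(resCard F : ℂ) ^ (-(1 / 2) : ℂ) * chi π (-1) ^ ((bSet e i lam).card / 2 + 1)
    else 0

variable [MeasurableSpace F] [BorelSpace F]

open Classical in
/-- The explicit formula, for `B = diag(v_i π^{e_i})`. -/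
def explicitFormula (ψ : AddChar F Circle) (π : F) (v : Fin n → F) (e : Fin n → ℕ) (s : ℂ) : ℂ :=
  weilConstant ψ π ^ n *
    ∑ σ : Equiv.Perm (Fin n) with σ ^ 2 = 1,
      (1 - (resCard F : ℂ)⁻¹) ^ c2 σ *
        ∑ r ∈ Finset.range n,
          ∑ I : Fin (r + 1) → Finset (Fin n) with IsStablePartition σ I,
            (resCard F : ℂ) ^ (-(c2 σ : ℤ) - tau I - tInv σ I) *
              ∑ ν ∈ (nuSet_finite σ e I).toFinset,
                ∏ l,
                  (chi π (-1) ^ (ν l * nUpper I l) *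
                    (resCard F : ℂ) ^ ((1 / 2) * (ν l : ℂ) * nUpper I l *
                        (2 * s - 1 - nUpper I l) + rhoTilde σ e (I l) (partialSum ν l)) *
                    ∏ i ∈ I l with σ i = i, xi π v e i (partialSum ν l))

end Formula

end RamifiedSiegel

end

/-! On the big cell the section is explicit: `f_0` takes the value `χ(det X) |det X|^{-s}` at `w_n
(1 X; 0 1)` if `X⁻¹ ≡ 0 mod 𝔭`, and `0` otherwise (`basisFn_w_mul_unip`; the function is `cellFn`).
The Siegel series is thus the integral of an explicit function of a symmetric matrix against
`ψ(-tr(BX))`, and this integral is computed by Gaussian elimination on `X`.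

Fix a level `L ≤ -1` and consider the matrices with entries in `𝔭^L` at the indices below `m` and in
`𝔭^{L+1}` elsewhere (`region`). When `m` is raised by one, the new row either has no entry of order
exactly `L` up to the diagonal, or has a last such entry, at `(m, j)` say. For `j = m` this is a `1
× 1` pivot. For `j < m` the indices `m` and `j` span a `2 × 2` pivot block dominated by its
off-diagonal entry. No entry of the region has order below `L`, so the rows and columns through the
pivot block are cleared by integral operations. Under this elimination `cellFn` is multiplicative
(`cellFn_elimination`), the Haar measure is preserved (`measurePreserving_schur`), and, `B` being
diagonal, the phase splits into a phase of the pivot, a phase of the Schur complement and one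
quadratic phase for each remaining index (`phase_schur`). The integrals over the cleared columns are
Gauss integrals: `quad_eq` for a `1 × 1` pivot, and `integral_hyperbolic` for a `2 × 2` pivot, whose
binary forms are unimodular and isotropic after scaling. The Schur complement runs over the region
with the same `L` and `m` and the pivot indices deleted. This is the recursion
`partialIntegral_succ`. It stops at level `0`, since an integral matrix of positive size has no
inverse with entries in `𝔭`.

Unfolding the recursion, each term records how the indices were grouped into pivots (an involution
`σ`, with the `1 × 1` pivots as fixed points) and at which level `λ_i` the index `i` was removed;
see `configs`, `sum_configs_succ` and `partialIntegral_eq`. The contribution of such a configuration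
is a product whose exponent of `q` is a sum over ordered pairs of indices (`pairTerm`). A level
function with `r + 1` values is the same as an ordered partition, formed by its level sets, together
with the increments `ν` of its values (`sum_partitions`); the quantities `n^{(l)}`, `τ`, `t` and
`ρ̃` of the formula become pair sums under this dictionary (`term_eq`). The integral of `ψ` over the
pivot block vanishes for levels too far below `-e_i`, so the sum over configurations no longer
changes once `L` is negative enough.

For convergence, the same recursion is run on absolute values. It bounds the integral over the
region of level `-N` by the exponential of a partial sum of a geometric series in `q^{-(Re s - n)}`.
The explicit formula is a finite sum of exponentials in `s`, hence entire, and the identity theorem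
makes it the only continuation. -/

noncomputable section

namespace RamifiedSiegel

/-! ### The normalized valuation, the fractional ideals and the topology of `F`. -/

section Ord
open scoped WithZero

variable {F : Type*} [Field F] [ValuativeRel F] [TopologicalSpace F]
  [IsNonarchimedeanLocalField F]

theorem valueIso_eq {x : F} (hx : x ≠ 0) :
    IsNonarchimedeanLocalField.valueGroupWithZeroIsoInt F (valuation F x) =
      WithZero.exp (-ord x) := by
  rw [ord, neg_neg, WithZero.exp_log]
  simpa using hx

theorem valuation_le_iff {x y : F} (hx : x ≠ 0) (hy : y ≠ 0) :
    valuation F x ≤ valuation F y ↔ ord y ≤ ord x := by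
  rw [← (IsNonarchimedeanLocalField.valueGroupWithZeroIsoInt F).strictMono.le_iff_le,
    valueIso_eq hx, valueIso_eq hy, WithZero.exp_le_exp]
  omega

@[simp] theorem ord_one : ord (1 : F) = 0 := by simp [ord]

@[simp] theorem ord_zero : ord (0 : F) = 0 := by simp [ord]

theorem ord_mul {x y : F} (hx : x ≠ 0) (hy : y ≠ 0) : ord (x * y) = ord x + ord y := by
  simp only [ord, map_mul]
  rw [WithZero.log_mul (by simpa using hx) (by simpa using hy)]
  omega

@[simp] theorem ord_neg (x : F) : ord (-x) = ord x := by simp [ord, Valuation.map_neg]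

@[simp] theorem ord_inv (x : F) : ord x⁻¹ = -ord x := by
  by_cases hx : x = 0
  · simp [hx]
  have := ord_mul hx (inv_ne_zero hx)
  rw [mul_inv_cancel₀ hx, ord_one] at this
  omega

theorem ord_div {x y : F} (hx : x ≠ 0) (hy : y ≠ 0) : ord (x / y) = ord x - ord y := by
  rw [div_eq_mul_inv, ord_mul hx (inv_ne_zero hy), ord_inv]; ring

@[simp] theorem ord_pow (x : F) (k : ℕ) : ord (x ^ k) = k * ord x := by
  by_cases hx : x = 0
  · subst hx
    cases k <;> simp
  induction k with
  | zero => simp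
  | succ k ih => rw [pow_succ, ord_mul (pow_ne_zero _ hx) hx, ih]; push_cast; ring

@[simp] theorem ord_zpow (x : F) (k : ℤ) : ord (x ^ k) = k * ord x := by
  cases k with
  | ofNat k => simp
  | negSucc k => rw [zpow_negSucc, ord_inv, ord_pow]; push_cast [Int.negSucc_eq]; ring

theorem ord_nonneg_iff {x : F} (hx : x ≠ 0) : 0 ≤ ord x ↔ x ∈ 𝒪[F] := by
  rw [← ord_one (F := F), ← valuation_le_iff hx one_ne_zero, map_one]
  rfl

theorem ord_add {x y : F} (hx : x ≠ 0) (hy : y ≠ 0) (h : x + y ≠ 0) {m : ℤ}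
    (h1 : m ≤ ord x) (h2 : m ≤ ord y) : m ≤ ord (x + y) := by
  rcases (valuation F).map_add' x y with h3 | h3
  · exact h1.trans ((valuation_le_iff h hx).mp h3)
  · exact h2.trans ((valuation_le_iff h hy).mp h3)

variable (F) in
/-- The fractional ideal `𝔭 ^ m`. -/
def P (m : ℤ) : AddSubgroup F where
  carrier := {x | x = 0 ∨ m ≤ ord x}
  zero_mem' := Or.inl rfl
  neg_mem' := by
    intro x hx
    simpa using hx
  add_mem' := by
    intro x y hx hy
    by_cases h : x + y = 0
    · exact Or.inl h
    rcases eq_or_ne x 0 with rfl | hx0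
    · simpa using hy
    rcases eq_or_ne y 0 with rfl | hy0
    · simpa using hx
    exact Or.inr (ord_add hx0 hy0 h (hx.resolve_left hx0) (hy.resolve_left hy0))

theorem mem_P {m : ℤ} {x : F} : x ∈ P F m ↔ x = 0 ∨ m ≤ ord x := Iff.rfl

theorem mem_P_of_le {m : ℤ} {x : F} (h : m ≤ ord x) : x ∈ P F m := Or.inr h

theorem mem_P_iff {m : ℤ} {x : F} (hx : x ≠ 0) : x ∈ P F m ↔ m ≤ ord x := by simp [mem_P, hx]

theorem mem_P_zero {x : F} : x ∈ P F 0 ↔ x ∈ 𝒪[F] := by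
  rcases eq_or_ne x 0 with rfl | hx
  · simp
  · rw [mem_P_iff hx, ord_nonneg_iff hx]

theorem mem_P_one {x : F} : x ∈ P F 1 ↔ valuation F x < 1 := by
  rcases eq_or_ne x 0 with rfl | hx
  · simp
  · rw [mem_P_iff hx, ← not_le, ← map_one (valuation F), valuation_le_iff one_ne_zero hx, ord_one]
    omega

theorem P_mono {a b : ℤ} (h : a ≤ b) {x : F} (hx : x ∈ P F b) : x ∈ P F a :=
  hx.imp id h.trans

theorem mul_mem_P {a b : ℤ} {x y : F} (hx : x ∈ P F a) (hy : y ∈ P F b) : x * y ∈ P F (a + b) := by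
  rcases eq_or_ne x 0 with rfl | hx0
  · simp
  rcases eq_or_ne y 0 with rfl | hy0
  · simp
  rw [mem_P_iff hx0] at hx
  rw [mem_P_iff hy0] at hy
  exact mem_P_of_le (by rw [ord_mul hx0 hy0]; omega)

theorem mul_mem_P_iff {a : ℤ} {x y : F} (hx : x ≠ 0) : x * y ∈ P F a ↔ y ∈ P F (a - ord x) := by
  rcases eq_or_ne y 0 with rfl | hy0
  · simp
  rw [mem_P_iff (mul_ne_zero hx hy0), mem_P_iff hy0, ord_mul hx hy0]
  constructor <;> intro h <;> omega

theorem natCast_mem_P (k : ℕ) : (k : F) ∈ P F 0 := mem_P_zero.mpr (natCast_mem _ k)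

theorem one_mem_P : (1 : F) ∈ P F 0 := mem_P_of_le (by simp)

variable (F) in
/-- The elements of order exactly `m`. -/
def shell (m : ℤ) : Set F := {x | x ≠ 0 ∧ ord x = m}

theorem mem_shell {m : ℤ} {x : F} : x ∈ shell F m ↔ x ≠ 0 ∧ ord x = m := Iff.rfl

theorem mem_shell_iff {m : ℤ} {x : F} : x ∈ shell F m ↔ x ∈ P F m ∧ x ∉ P F (m + 1) := by
  rcases eq_or_ne x 0 with rfl | hx
  · simp [mem_shell]
  · rw [mem_P_iff hx, mem_P_iff hx, mem_shell]
    simp only [hx, ne_eq, not_false_eq_true, true_and]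
    omega

/-- A summand of larger order cannot cancel the leading term. This is used throughout to read off
orders from a dominant term. -/
theorem shell_add {m : ℤ} {x y : F} (hx : x ∈ shell F m) (hy : y ∈ P F (m + 1)) :
    x + y ∈ shell F m := by
  rw [mem_shell_iff] at hx ⊢
  refine ⟨add_mem hx.1 (P_mono (by omega) hy), fun h => hx.2 ?_⟩
  simpa using sub_mem h hy

theorem shell_mul {a b : ℤ} {x y : F} (hx : x ∈ shell F a) (hy : y ∈ shell F b) :
    x * y ∈ shell F (a + b) :=
  ⟨mul_ne_zero hx.1 hy.1, by rw [ord_mul hx.1 hy.1, hx.2, hy.2]⟩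

theorem shell_inv {a : ℤ} {x : F} (hx : x ∈ shell F a) : x⁻¹ ∈ shell F (-a) :=
  ⟨inv_ne_zero hx.1, by rw [ord_inv, hx.2]⟩

theorem shell_neg {a : ℤ} {x : F} (hx : x ∈ shell F a) : -x ∈ shell F a :=
  ⟨neg_ne_zero.mpr hx.1, by rw [ord_neg, hx.2]⟩

theorem shell_subset_P {m : ℤ} {x : F} (hx : x ∈ shell F m) : x ∈ P F m := mem_P_of_le hx.2.ge

theorem ord_unit (u : 𝒪[F]ˣ) : (u : 𝒪[F]).1 ∈ shell F 0 := by
  have h : ((u : 𝒪[F]) : F) * ((u⁻¹ : 𝒪[F]ˣ) : 𝒪[F]) = 1 := by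
    exact_mod_cast congrArg (Subtype.val) u.mul_inv
  have h0 : ((u : 𝒪[F]) : F) ≠ 0 := left_ne_zero_of_mul_eq_one h
  have h1 : (((u⁻¹ : 𝒪[F]ˣ) : 𝒪[F]) : F) ≠ 0 := right_ne_zero_of_mul_eq_one h
  refine ⟨h0, ?_⟩
  have h2 := (ord_nonneg_iff h0).mpr (u : 𝒪[F]).2
  have h3 := (ord_nonneg_iff h1).mpr ((u⁻¹ : 𝒪[F]ˣ) : 𝒪[F]).2
  have h4 := ord_mul h0 h1
  rw [h, ord_one] at h4
  omega

theorem isUnit_iff_ord {x : 𝒪[F]} : IsUnit x ↔ (x : F) ∈ shell F 0 := by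
  constructor
  · rintro ⟨u, rfl⟩
    exact ord_unit u
  · rintro ⟨h0, h⟩
    have hm : (x : F)⁻¹ ∈ 𝒪[F] := by
      rw [← ord_nonneg_iff (inv_ne_zero h0), ord_inv, h]; simp
    exact IsUnit.of_mul_eq_one ⟨_, hm⟩ (Subtype.ext (mul_inv_cancel₀ h0))

variable (F) in
theorem exists_ord_eq_one : ∃ x : F, x ≠ 0 ∧ ord x = 1 := by
  obtain ⟨x, hx⟩ := valuation_surjective
    ((IsNonarchimedeanLocalField.valueGroupWithZeroIsoInt F).symm (WithZero.exp (-1)))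
  refine ⟨x, ?_, ?_⟩
  · rintro rfl
    rw [map_zero, eq_comm] at hx
    simp at hx
  · simp [ord, hx]

/-- Dividing by an element `x` of order `1` factors `π` over the integers as `x * (π / x)`; if `π`
had order other than `1`, neither factor would be a unit. -/
theorem ord_irreducible {π : 𝒪[F]} (hπ : Irreducible π) : (π : F) ∈ shell F 1 := by
  have h0 : (π : F) ≠ 0 := fun h => hπ.ne_zero (Subtype.ext h)
  refine ⟨h0, ?_⟩
  have h1 := (ord_nonneg_iff h0).mpr π.2
  have h2 : ord (π : F) ≠ 0 := fun h => hπ.not_isUnit (isUnit_iff_ord.mpr ⟨h0, h⟩)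
  obtain ⟨x, hx0, hx⟩ := exists_ord_eq_one F
  have hxm : x ∈ 𝒪[F] := (ord_nonneg_iff hx0).mp (by omega)
  by_contra hne
  have hy0 : (π : F) / x ≠ 0 := div_ne_zero h0 hx0
  have hy : (π : F) / x ∈ 𝒪[F] := (ord_nonneg_iff hy0).mp (by rw [ord_div h0 hx0]; omega)
  have hmul : π = ⟨x, hxm⟩ * ⟨_, hy⟩ := Subtype.ext (by simp; field_simp)
  rcases hπ.isUnit_or_isUnit hmul with h | h
  · have := (isUnit_iff_ord.mp h).2
    simp only at this; omega
  · have := (isUnit_iff_ord.mp h).2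
    simp only at this
    rw [ord_div h0 hx0] at this; omega

theorem exists_shell (m : ℤ) : ∃ x : F, x ∈ shell F m := by
  obtain ⟨x, hx0, hx⟩ := exists_ord_eq_one F
  exact ⟨x ^ m, zpow_ne_zero _ hx0, by simp [hx]⟩

theorem P_mem_nhds_zero (m : ℤ) : (P F m : Set F) ∈ nhds 0 := by
  obtain ⟨c, hc0, hc⟩ := exists_shell (F := F) m
  refine Filter.mem_of_superset ((IsValuativeTopology.hasBasis_nhds_zero' F).mem_of_mem
      (i := valuation F c) (by simpa using hc0)) ?_
  intro x hx
  rcases eq_or_ne x 0 with rfl | hx0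
  · exact zero_mem _
  · exact mem_P_of_le (by rw [← hc]; exact (valuation_le_iff hx0 hc0).mp (le_of_lt hx))

theorem isOpen_P (m : ℤ) : IsOpen (P F m : Set F) :=
  (P F m).isOpen_of_mem_nhds (P_mem_nhds_zero m)

theorem isClosed_P (m : ℤ) : IsClosed (P F m : Set F) :=
  (P F m).isClosed_of_isOpen (isOpen_P m)

theorem hasBasis_P : (nhds (0 : F)).HasBasis (fun _ : ℤ => True) (fun m => (P F m : Set F)) := by
  refine ⟨fun s => ⟨fun hs => ?_, ?_⟩⟩
  · obtain ⟨γ, hγ, h⟩ := (IsValuativeTopology.hasBasis_nhds_zero' F).mem_iff.mp hs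
    obtain ⟨c, rfl⟩ := valuation_surjective γ
    have hc : c ≠ 0 := by simpa using hγ
    refine ⟨ord c + 1, trivial, fun x hx => h ?_⟩
    rcases eq_or_ne x 0 with rfl | hx0
    · simpa [zero_lt_iff] using hc
    · have := (mem_P_iff hx0).mp hx
      show valuation F x < valuation F c
      rw [← not_le, valuation_le_iff hc hx0]; omega
  · rintro ⟨m, -, h⟩
    exact Filter.mem_of_superset (P_mem_nhds_zero m) h

theorem isOpen_shell (m : ℤ) : IsOpen (shell F m) := by
  have : shell F m = (P F m : Set F) \ P F (m + 1) := by ext x; exact mem_shell_iff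
  rw [this]
  exact (isOpen_P m).sdiff (isClosed_P _)

theorem isCompact_P (m : ℤ) : IsCompact (P F m : Set F) := by
  obtain ⟨c, hc0, hc⟩ := exists_shell (F := F) m
  convert IsNonarchimedeanLocalField.isCompact_closedBall F (valuation F c) using 1
  ext x
  rcases eq_or_ne x 0 with rfl | hx0
  · simp
  · simp only [SetLike.mem_coe, Set.mem_ofPred_eq, mem_P_iff hx0, valuation_le_iff hx0 hc0, hc]

theorem exists_mem_P (x : F) : ∃ m : ℤ, x ∈ P F m := ⟨ord x, mem_P_of_le le_rfl⟩

instance : T2Space F := by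
  let := IsTopologicalAddGroup.rightUniformSpace F
  have := isUniformAddGroup_of_addCommGroup (G := F)
  infer_instance

/-- The ideals `P F m` form a countable basis at `0`, so the uniformity comes from a pseudometric,
and the compact ideals `P F (-k)` exhaust `F`. Second countability makes the Borel structure on a
finite power of `F` the product structure, so that continuous functions of matrix entries are
measurable. -/
instance : SecondCountableTopology F := by
  let := IsTopologicalAddGroup.rightUniformSpace F
  have := isUniformAddGroup_of_addCommGroup (G := F)
  have : (uniformity F).IsCountablyGenerated := by
    have : (nhds (0 : F)).IsCountablyGenerated := hasBasis_P.isCountablyGenerated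
    exact IsUniformAddGroup.uniformity_countably_generated
  have : SigmaCompactSpace F := by
    refine ⟨⟨fun k : ℕ => (P F (-(k : ℤ)) : Set F), fun k => isCompact_P _, ?_⟩⟩
    rw [Set.eq_univ_iff_forall]
    intro x
    refine Set.mem_iUnion.mpr ⟨(ord x).natAbs, mem_P_of_le (by omega)⟩
  let := UniformSpace.pseudoMetricSpace F
  exact EMetric.secondCountable_of_sigmaCompact F

end Ord

/-! ### Haar measure of ideals and shells, and changes of variable. -/

section Haar

variable {F : Type*} [Field F] [ValuativeRel F] [TopologicalSpace F]
  [IsNonarchimedeanLocalField F]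

variable (F) in
theorem one_lt_resCard : 1 < resCard F := Finite.one_lt_card

variable (F) in
theorem resCard_pos : 0 < resCard F := (Nat.zero_lt_one).trans (one_lt_resCard F)

variable (F) in
theorem resCard_ne_zero : (resCard F : ℂ) ≠ 0 := by
  exact_mod_cast (resCard_pos F).ne'

/-- A representative in the ring of integers of a residue class. -/
def rep (a : 𝓀[F]) : 𝒪[F] := Function.surjInv IsLocalRing.residue_surjective a

theorem residue_rep (a : 𝓀[F]) : IsLocalRing.residue 𝒪[F] (rep a) = a :=
  Function.surjInv_eq _ a

theorem residue_eq_zero {x : 𝒪[F]} : IsLocalRing.residue 𝒪[F] x = 0 ↔ (x : F) ∈ P F 1 := by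
  rw [IsLocalRing.residue_eq_zero_iff, IsLocalRing.mem_maximalIdeal, mem_nonunits_iff,
    isUnit_iff_ord, mem_shell_iff, mem_P_zero]
  simp

theorem residue_eq {x y : 𝒪[F]} :
    IsLocalRing.residue 𝒪[F] x = IsLocalRing.residue 𝒪[F] y ↔ (x : F) - y ∈ P F 1 := by
  rw [← sub_eq_zero, ← map_sub, residue_eq_zero]; rfl

/-- `𝔭 ^ m` is the disjoint union of the translates of `𝔭 ^ (m + 1)` by `c * rep a`. -/
theorem P_eq_iUnion {m : ℤ} {c : F} (hc : c ∈ shell F m) :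
    (P F m : Set F) = ⋃ a : 𝓀[F], {x | x - c * rep a ∈ P F (m + 1)} := by
  ext x
  simp only [Set.mem_iUnion, SetLike.mem_coe]
  constructor
  · intro hx
    have h1 : c⁻¹ * x ∈ 𝒪[F] := by
      rw [← mem_P_zero, mul_mem_P_iff (inv_ne_zero hc.1), ord_inv, hc.2]; simpa using hx
    refine ⟨IsLocalRing.residue _ ⟨_, h1⟩, ?_⟩
    have h2 := residue_eq.mp (residue_rep (IsLocalRing.residue 𝒪[F] ⟨_, h1⟩)).symm
    have h3 := mul_mem_P (shell_subset_P hc) h2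
    rwa [mul_sub, mul_inv_cancel_left₀ hc.1] at h3
  · rintro ⟨a, ha⟩
    have h2 := mul_mem_P (shell_subset_P hc) (mem_P_zero.mpr (rep a).2)
    have := add_mem (P_mono (by omega : m ≤ m + 1) ha) (by simpa using h2)
    simpa using this

theorem P_disjoint {m : ℤ} {c : F} (hc : c ∈ shell F m) :
    Pairwise (Function.onFun Disjoint fun a : 𝓀[F] => {x | x - c * rep a ∈ P F (m + 1)}) := by
  intro a b hab
  rw [Function.onFun, Set.disjoint_left]
  intro x hxa hxb
  apply hab
  rw [← residue_rep a, ← residue_rep b, residue_eq]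
  have : x - c * rep b - (x - c * rep a) ∈ P F (m + 1) := sub_mem hxb hxa
  rw [sub_sub_sub_cancel_left, ← mul_sub, mul_mem_P_iff hc.1, hc.2] at this
  simpa using this

variable [MeasurableSpace F] [BorelSpace F]

instance : (haarF F).IsAddHaarMeasure := by unfold haarF; infer_instance

theorem measurableSet_P (m : ℤ) : MeasurableSet (P F m : Set F) := (isOpen_P m).measurableSet

theorem measurableSet_shell (m : ℤ) : MeasurableSet (shell F m) := (isOpen_shell m).measurableSet

theorem haar_P_zero : haarF F (P F 0) = 1 := by
  have : (P F 0 : Set F) = integerCompacts F := by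
    ext x; exact mem_P_zero
  rw [this, haarF, Measure.addHaarMeasure_self]

theorem haar_translate (c : F) (s : Set F) : haarF F {x | x - c ∈ s} = haarF F s := by
  simp only [sub_eq_add_neg]
  exact measure_preimage_add_right _ _ _

theorem haar_P_succ (m : ℤ) : haarF F (P F m) = resCard F * haarF F (P F (m + 1)) := by
  obtain ⟨c, hc⟩ := exists_shell (F := F) m
  have := Fintype.ofFinite 𝓀[F]
  rw [P_eq_iUnion hc, measure_iUnion (P_disjoint hc)]
  · have : ∀ a : 𝓀[F], haarF F {x | x - c * rep a ∈ P F (m + 1)} = haarF F (P F (m + 1)) :=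
      fun a => haar_translate _ _
    simp only [this, tsum_fintype, Finset.sum_const, Finset.card_univ, nsmul_eq_mul, resCard,
      Nat.card_eq_fintype_card]
  · exact fun a => (measurableSet_P (m + 1)).preimage (measurable_sub_const _)

theorem haar_P (m : ℤ) : haarF F (P F m) = ENNReal.ofReal ((resCard F : ℝ) ^ (-m)) := by
  have hq : (0 : ℝ) < resCard F := by exact_mod_cast resCard_pos F
  -- Neighbouring levels determine each other, so the formula spreads from level `0` in both
  -- directions.
  have key : ∀ m : ℤ, haarF F (P F m) = ENNReal.ofReal ((resCard F : ℝ) ^ (-m)) ↔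
      haarF F (P F (m + 1)) = ENNReal.ofReal ((resCard F : ℝ) ^ (-(m + 1))) := by
    intro m
    rw [haar_P_succ, show -m = 1 + -(m + 1) by ring, zpow_add₀ hq.ne', zpow_one,
      ENNReal.ofReal_mul hq.le, ENNReal.ofReal_natCast]
    refine ENNReal.mul_right_inj ?_ (ENNReal.natCast_ne_top _)
    exact_mod_cast (resCard_pos F).ne'
  induction m with
  | zero => rw [haar_P_zero]; simp
  | succ i ih => exact (key _).mp ih
  | pred i ih => rw [key]; simpa using ih

theorem haar_P_ne_top (m : ℤ) : haarF F (P F m) ≠ ⊤ := by rw [haar_P]; exact ENNReal.ofReal_ne_top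

theorem haar_real_P (m : ℤ) : (haarF F).real (P F m) = (resCard F : ℝ) ^ (-m) := by
  rw [Measure.real, haar_P, ENNReal.toReal_ofReal (by positivity)]

/-- The image of the Haar measure under a dilation is again translation invariant, hence a multiple
of the Haar measure. The multiple is the volume of the preimage of the ring of integers, which is `P
F (-ord c)`. -/
theorem map_mul_haar {c : F} (hc : c ≠ 0) :
    (haarF F).map (fun x => c * x) = ENNReal.ofReal ((resCard F : ℝ) ^ ord c) • haarF F := by
  have hm : Measurable fun x : F => c * x := (continuous_const_mul c).measurable
  have hinv : ((haarF F).map (fun x => c * x)).IsAddLeftInvariant := by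
    refine ⟨fun t => ?_⟩
    have hc' : Measurable fun x : F => t + x := (continuous_const_add t).measurable
    rw [Measure.map_map hc' hm]
    have : ((fun x : F => t + x) ∘ fun x => c * x) = (fun x => c * x) ∘ fun x => c⁻¹ * t + x := by
      funext x; simp [mul_add, mul_inv_cancel_left₀ hc]
    rw [this, ← Measure.map_map hm (continuous_const_add _).measurable, map_add_left_eq_self]
  have : SigmaFinite ((haarF F).map (fun x => c * x)) :=
    (Homeomorph.mulLeft₀ c hc).toMeasurableEquiv.sigmaFinite_map
  have h := Measure.addHaarMeasure_unique ((haarF F).map (fun x => c * x)) (integerCompacts F)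
  rw [h, Measure.map_apply hm (integerCompacts F).isCompact.measurableSet]
  congr 1
  have : (fun x : F => c * x) ⁻¹' (integerCompacts F) = (P F (-ord c) : Set F) := by
    ext x
    rw [SetLike.mem_coe, show -ord c = 0 - ord c by ring, ← mul_mem_P_iff hc, mem_P_zero]
    rfl
  rw [this, haar_P, neg_neg]

theorem integral_mul_left {c : F} (hc : c ≠ 0) (f : F → ℂ) :
    ∫ x, f (c * x) ∂haarF F = (resCard F : ℂ) ^ ord c * ∫ x, f x ∂haarF F := by
  have h := (Homeomorph.mulLeft₀ c hc).toMeasurableEquiv.measurableEmbedding.integral_map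
    (μ := haarF F) f
  have h2 : (haarF F).map (Homeomorph.mulLeft₀ c hc).toMeasurableEquiv =
    ENNReal.ofReal ((resCard F : ℝ) ^ ord c) • haarF F := map_mul_haar hc
  rw [h2, integral_smul_measure, ENNReal.toReal_ofReal (by positivity)] at h
  rw [Complex.real_smul] at h
  push_cast at h
  exact h.symm

theorem setIntegral_mul_left {c : F} (hc : c ≠ 0) {s : Set F} (hs : MeasurableSet s) (f : F → ℂ) :
    ∫ x in s, f x ∂haarF F =
      (resCard F : ℂ) ^ (-ord c) * ∫ x in {x | c * x ∈ s}, f (c * x) ∂haarF F := by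
  have hs' : MeasurableSet {x | c * x ∈ s} := hs.preimage (continuous_const_mul c).measurable
  rw [← integral_indicator hs, ← integral_indicator hs']
  have : (Set.indicator {x | c * x ∈ s} fun x => f (c * x)) = fun x => s.indicator f (c * x) := by
    funext x; simp [Set.indicator]
  rw [this, integral_mul_left hc, ← mul_assoc, ← zpow_add₀ (resCard_ne_zero F)]
  simp

theorem setIntegral_P_mul {c : F} {k : ℤ} (hc : c ∈ shell F k) (a : ℤ) (f : F → ℂ) :
    ∫ x in P F a, f x ∂haarF F =
      (resCard F : ℂ) ^ (-k) * ∫ x in P F (a - k), f (c * x) ∂haarF F := by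
  have h := setIntegral_mul_left hc.1 (measurableSet_P a) f
  have h2 : {x | c * x ∈ (P F a : Set F)} = P F (a - k) := by
    ext x
    rw [Set.mem_ofPred_eq, SetLike.mem_coe, SetLike.mem_coe, mul_mem_P_iff hc.1, hc.2]
  rw [h2, hc.2] at h
  exact h

theorem setIntegral_shell_mul {c : F} {k : ℤ} (hc : c ∈ shell F k) (a : ℤ) (f : F → ℂ) :
    ∫ x in shell F a, f x ∂haarF F =
      (resCard F : ℂ) ^ (-k) * ∫ x in shell F (a - k), f (c * x) ∂haarF F := by
  have h := setIntegral_mul_left hc.1 (measurableSet_shell a) f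
  have h2 : {x | c * x ∈ shell F a} = shell F (a - k) := by
    ext x
    rw [Set.mem_ofPred_eq, mem_shell_iff, mem_shell_iff, mul_mem_P_iff hc.1, mul_mem_P_iff hc.1,
      hc.2, show a + 1 - k = a - k + 1 by ring]
  rw [h2, hc.2] at h
  exact h

theorem setIntegral_add {t : F} {s : Set F} (hs : MeasurableSet s) (h : ∀ x, x + t ∈ s ↔ x ∈ s)
    (f : F → ℂ) : ∫ x in s, f (x + t) ∂haarF F = ∫ x in s, f x ∂haarF F := by
  rw [← integral_indicator hs, ← integral_indicator hs,
    ← integral_add_right_eq_self (s.indicator f) t]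
  congr 1
  funext x
  by_cases hx : x ∈ s
  · simp [Set.indicator, hx, (h x).mpr hx]
  · simp [Set.indicator, hx, mt (h x).mp hx]

theorem add_mem_P_iff {m : ℤ} {t : F} (ht : t ∈ P F m) (x : F) : x + t ∈ P F m ↔ x ∈ P F m :=
  add_mem_cancel_right ht

theorem add_mem_shell_iff {m : ℤ} {t : F} (ht : t ∈ P F (m + 1)) (x : F) :
    x + t ∈ shell F m ↔ x ∈ shell F m := by
  rw [mem_shell_iff, mem_shell_iff, add_mem_P_iff ht, add_mem_P_iff (P_mono (by omega) ht)]

theorem haar_shell_ne_top (m : ℤ) : haarF F (shell F m) ≠ ⊤ :=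
  measure_ne_top_of_subset (fun _ hx => shell_subset_P hx) (haar_P_ne_top m)

theorem integral_P_eq_add {m : ℤ} {f : F → ℂ} (hf : IntegrableOn f (P F m) (haarF F)) :
    ∫ x in P F m, f x ∂haarF F =
      ∫ x in shell F m, f x ∂haarF F + ∫ x in P F (m + 1), f x ∂haarF F := by
  have h : (P F m : Set F) = shell F m ∪ P F (m + 1) := by
    ext x
    simp only [Set.mem_union, SetLike.mem_coe, mem_shell_iff]
    constructor
    · intro hx
      by_cases h : x ∈ P F (m + 1)
      · exact Or.inr h
      · exact Or.inl ⟨hx, h⟩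
    · rintro (h | h)
      · exact h.1
      · exact P_mono (by omega) h
  rw [h, setIntegral_union]
  · rw [Set.disjoint_left]; intro x hx hx'
    exact (mem_shell_iff.mp hx).2 hx'
  · exact measurableSet_P _
  · exact hf.mono_set fun x hx => shell_subset_P hx
  · exact hf.mono_set fun x hx => P_mono (by omega) hx

theorem haar_real_shell (m : ℤ) :
    ((haarF F).real (shell F m) : ℂ) = (resCard F : ℂ) ^ (-m) * (1 - (resCard F : ℂ)⁻¹) := by
  have h := integral_P_eq_add (F := F) (m := m) (f := fun _ => 1)
    (integrableOn_const (haar_P_ne_top m))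
  have h1 : ((haarF F).real (P F m) : ℂ) = (haarF F).real (shell F m) +
      (haarF F).real (P F (m + 1)) := by
    simpa only [setIntegral_const, Complex.real_smul, mul_one] using h
  rw [haar_real_P, haar_real_P] at h1
  push_cast at h1
  rw [neg_add, zpow_add₀ (resCard_ne_zero F), zpow_neg_one] at h1
  linear_combination -h1

/-- If the averages of `g` over the cosets of `𝔭 ^ a` in `s` vanish, then so does the integral. -/
theorem setIntegral_eq_zero_of_average {s : Set F} (hs : MeasurableSet s) (hs' : haarF F s ≠ ⊤)
    {a : ℤ} (hsa : ∀ y ∈ P F a, ∀ x, x + y ∈ s ↔ x ∈ s) {g : F → ℂ} (hg : Measurable g) {C : ℝ}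
    (hC : ∀ x, ‖g x‖ ≤ C) (h : ∀ x ∈ s, ∫ y in P F a, g (x + y) ∂haarF F = 0) :
    ∫ x in s, g x ∂haarF F = 0 := by
  -- In this double integral the `y`-integral vanishes by hypothesis. In the other order, the
  -- invariance of `s` makes the `x`-integral independent of `y`, and the result is the wanted
  -- integral times the volume of `𝔭 ^ a`.
  have h1 : ∫ y in (P F a : Set F), ∫ x in s, g (x + y) ∂haarF F ∂haarF F = 0 := by
    rw [integral_integral_swap]
    · exact setIntegral_eq_zero_of_forall_eq_zero h
    · have : IsFiniteMeasure ((haarF F).restrict (P F a : Set F)) :=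
        ⟨by simpa using (haar_P_ne_top a).lt_top⟩
      have : IsFiniteMeasure ((haarF F).restrict s) := ⟨by simpa using hs'.lt_top⟩
      refine Integrable.of_bound (C := C) ?_ (Filter.Eventually.of_forall fun p => hC _)
      exact (hg.comp (measurable_snd.add measurable_fst)).aestronglyMeasurable
  rw [setIntegral_congr_fun (g := fun _ => ∫ x in s, g x ∂haarF F) (measurableSet_P a)
    (fun y hy => setIntegral_add hs (hsa y hy) g), setIntegral_const, haar_real_P] at h1
  refine (smul_eq_zero.mp h1).resolve_left (zpow_ne_zero _ ?_)
  exact_mod_cast (resCard_pos F).ne'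

/-- The integral over the ring of integers of a function that factors through the residue field. -/
theorem integral_P_zero_of_residue {f : F → ℂ} (hf : ∀ x ∈ P F 0, ∀ y ∈ P F 1, f (x + y) = f x)
    [Fintype 𝓀[F]] :
    ∫ x in P F 0, f x ∂haarF F = (resCard F : ℂ)⁻¹ * ∑ a : 𝓀[F], f (rep a) := by
  have hc : (1 : F) ∈ shell F 0 := ⟨one_ne_zero, ord_one⟩
  have hms : ∀ a : 𝓀[F], MeasurableSet {x : F | x - 1 * rep a ∈ P F (0 + 1)} := fun a =>
    (measurableSet_P (0 + 1)).preimage (measurable_sub_const _)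
  have hconst : ∀ a : 𝓀[F], ∀ x ∈ {x : F | x - 1 * rep a ∈ P F (0 + 1)}, f x = f (rep a) := by
    intro a x hx
    have := hf (rep a) (mem_P_zero.mpr (rep a).2) (x - rep a) (by simpa using hx)
    rw [← this]; congr 1; ring
  have hvol : ∀ a : 𝓀[F], haarF F {x : F | x - 1 * rep a ∈ P F (0 + 1)} = haarF F (P F (0 + 1)) :=
    fun a => haar_translate _ _
  rw [P_eq_iUnion hc, integral_iUnion_fintype hms (P_disjoint hc), Finset.mul_sum]
  · refine Finset.sum_congr rfl fun a _ => ?_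
    rw [setIntegral_congr_fun (hms a) (hconst a), setIntegral_const, Measure.real, hvol,
      ← Measure.real, haar_real_P]
    simp
  · intro a
    refine (integrableOn_const (C := f (rep a)) ?_).congr_fun (fun x hx => (hconst a x hx).symm)
      (hms a)
    rw [hvol]; exact haar_P_ne_top _

end Haar

/-! ### Hensel's lemma, the Hilbert symbol and the character `χ`. -/

section Chi

variable {F : Type*} [Field F] [ValuativeRel F] [TopologicalSpace F]
  [IsNonarchimedeanLocalField F]

open Polynomial in
-- Hensel's lemma: `2 x₀ + b` is the derivative at the approximate root `x₀`. It serves to extract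
-- square roots of units and to find isotropic vectors of binary forms.
theorem exists_root_quadratic (b c x₀ : 𝒪[F])
    (h : ((x₀ ^ 2 + b * x₀ + c : 𝒪[F]) : F) ∈ P F 1)
    (h' : ((2 * x₀ + b : 𝒪[F]) : F) ∈ shell F 0) :
    ∃ x : 𝒪[F], x ^ 2 + b * x + c = 0 ∧ ((x - x₀ : 𝒪[F]) : F) ∈ P F 1 := by
  let := IsTopologicalAddGroup.rightUniformSpace F
  have := isUniformAddGroup_of_addCommGroup (G := F)
  have hH : HenselianRing 𝒪[F] 𝓂[F] := inferInstance
  have hm : ∀ x : 𝒪[F], x ∈ 𝓂[F] ↔ (x : F) ∈ P F 1 := fun x => by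
    rw [← residue_eq_zero, IsLocalRing.residue_eq_zero_iff]
  have hmonic : (X ^ 2 + C b * X + C c : 𝒪[F][X]).Monic := by monicity!
  obtain ⟨x, hx, hx'⟩ := hH.is_henselian (X ^ 2 + C b * X + C c) hmonic x₀
    (by rw [hm]; simpa using h)
    (by
      apply IsUnit.map
      rw [isUnit_iff_ord]
      have he : (((X ^ 2 + C b * X + C c : 𝒪[F][X]).derivative.eval x₀ : 𝒪[F]) : F) =
          ((2 * x₀ + b : 𝒪[F]) : F) := by
        congr 1
        simp [one_add_one_eq_two]
      rw [he]; exact h')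
  refine ⟨x, ?_, (hm _).mp hx'⟩
  simpa using hx

variable (hq : Odd (resCard F))
include hq

theorem ringChar_ne_two : ringChar 𝓀[F] ≠ 2 := by
  have := Fintype.ofFinite 𝓀[F]
  intro h
  have := FiniteField.even_card_iff_char_two.mp h
  rw [resCard, Nat.card_eq_fintype_card, Nat.odd_iff] at hq
  omega

theorem two_mem_shell : (2 : F) ∈ shell F 0 := by
  have h : (2 : 𝓀[F]) ≠ 0 := Ring.two_ne_zero (ringChar_ne_two hq)
  have h2 : IsLocalRing.residue 𝒪[F] 2 ≠ 0 := by rwa [map_ofNat]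
  rw [Ne, residue_eq_zero] at h2
  rw [mem_shell_iff]
  exact ⟨by simpa using natCast_mem_P 2, h2⟩

open Classical in
theorem isSquare_iff_residue {u : 𝒪[F]} (hu : (u : F) ∈ shell F 0) :
    IsSquare (u : F) ↔ IsSquare (IsLocalRing.residue 𝒪[F] u) := by
  constructor
  · rintro ⟨w, hw⟩
    have hw0 : w ≠ 0 := by
      rintro rfl
      exact hu.1 (by simpa using hw)
    have h1 := hu.2
    rw [hw, ord_mul hw0 hw0] at h1
    have hwm : w ∈ 𝒪[F] := (ord_nonneg_iff hw0).mp (by omega)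
    exact ⟨IsLocalRing.residue 𝒪[F] ⟨w, hwm⟩, by rw [← map_mul]; congr 1; exact Subtype.ext hw⟩
  · rintro ⟨a, ha⟩
    have h0 : IsLocalRing.residue 𝒪[F] u ≠ 0 := by
      rw [Ne, residue_eq_zero]
      exact (mem_shell_iff.mp hu).2
    have ha0 : a ≠ 0 := by rintro rfl; exact h0 (by simpa using ha)
    have h1 : ((rep a ^ 2 + 0 * rep a + -u : 𝒪[F]) : F) ∈ P F 1 := by
      rw [← residue_eq_zero]
      simp [residue_rep, ha, sq]
    have h2 : ((2 * rep a + 0 : 𝒪[F]) : F) ∈ shell F 0 := by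
      have h3 : ((rep a : 𝒪[F]) : F) ∈ shell F 0 := by
        rw [mem_shell_iff]
        refine ⟨mem_P_zero.mpr (rep a).2, ?_⟩
        rw [zero_add, ← residue_eq_zero, residue_rep]
        exact ha0
      have h4 := shell_mul (two_mem_shell hq) h3
      rw [add_zero] at h4 ⊢
      exact h4
    obtain ⟨x, hx, -⟩ := exists_root_quadratic 0 (-u) (rep a) h1 h2
    refine ⟨x, ?_⟩
    have := congrArg (Subtype.val) hx
    simp at this
    linear_combination -this

omit hq in
theorem hilbertSymbol_eq_one_or (a b : F) : hilbertSymbol a b = 1 ∨ hilbertSymbol a b = -1 := by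
  unfold hilbertSymbol; split_ifs <;> simp

omit hq in
theorem chi_eq_one_or (a b : F) : chi a b = 1 ∨ chi a b = -1 := by
  rcases hilbertSymbol_eq_one_or a b with h | h <;> simp [chi, h]

omit hq in
theorem chi_mul_self (a b : F) : chi a b * chi a b = 1 := by
  rcases chi_eq_one_or a b with h | h <;> simp [h]

omit hq in
theorem chi_ne_zero (a b : F) : chi a b ≠ 0 := by
  rcases chi_eq_one_or a b with h | h <;> simp [h]

omit hq in
theorem norm_chi (a b : F) : ‖chi a b‖ = 1 := by
  rcases chi_eq_one_or a b with h | h <;> simp [h]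

omit hq in
theorem hilbertSymbol_congr {a b c d : F}
    (h : (∃ x y z : F, (x ≠ 0 ∨ y ≠ 0 ∨ z ≠ 0) ∧ a * x ^ 2 + b * y ^ 2 = z ^ 2) ↔
      ∃ x y z : F, (x ≠ 0 ∨ y ≠ 0 ∨ z ≠ 0) ∧ c * x ^ 2 + d * y ^ 2 = z ^ 2) :
    hilbertSymbol a b = hilbertSymbol c d := by
  unfold hilbertSymbol
  split_ifs with h1 h2 h2
  · rfl
  · exact absurd (h.mp h1) h2
  · exact absurd (h.mpr h2) h1
  · rfl

omit hq in
theorem hilbertSymbol_mul_sq (a b : F) {w : F} (hw : w ≠ 0) :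
    hilbertSymbol a (b * w ^ 2) = hilbertSymbol a b := by
  apply hilbertSymbol_congr
  constructor
  · rintro ⟨x, y, z, h, e⟩
    refine ⟨x, w * y, z, by simpa [hw] using h, by rw [← e]; ring⟩
  · rintro ⟨x, y, z, h, e⟩
    refine ⟨x, w⁻¹ * y, z, by simpa [hw] using h, by rw [← e]; field_simp⟩

omit hq in
-- Divide the equation by `a` and exchange the roles of `x` and `z`. For `b = 1` this evaluates the
-- symbol of `a` with itself as that of `a` with `-1`.
theorem hilbertSymbol_self_mul {a : F} (ha : a ≠ 0) (b : F) :
    hilbertSymbol a (a * b) = hilbertSymbol a (-b) := by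
  apply hilbertSymbol_congr
  constructor
  · rintro ⟨x, y, z, h, e⟩
    have hz : a * (a⁻¹ * z) ^ 2 = a⁻¹ * z ^ 2 := by field_simp
    refine ⟨a⁻¹ * z, y, x, ?_, ?_⟩
    · simp only [ne_eq, mul_eq_zero, inv_eq_zero, ha, false_or]; tauto
    · rw [hz, ← e]; field_simp; ring
  · rintro ⟨x, y, z, h, e⟩
    refine ⟨z, y, a * x, ?_, ?_⟩
    · simp only [ne_eq, mul_eq_zero, ha, false_or]; tauto
    · rw [← e]; ring

omit hq in
-- After division by `y`, a non-trivial zero has integral coordinates, and reduction modulo `𝔭`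
-- exhibits `u` as a square. Conversely a square root of `u` gives a zero with `x = 0`; the lifting
-- of the square root from the residue field is the hypothesis `hsq`.
theorem hilbertSymbol_unit {ϖ : F} (hϖ : ϖ ∈ shell F 1) {u : 𝒪[F]} (hu : (u : F) ∈ shell F 0)
    (hsq : IsSquare (IsLocalRing.residue 𝒪[F] u) → IsSquare (u : F)) :
    hilbertSymbol ϖ (u : F) = 1 ↔ IsSquare (IsLocalRing.residue 𝒪[F] u) := by
  unfold hilbertSymbol
  have hiff : (∃ x y z : F, (x ≠ 0 ∨ y ≠ 0 ∨ z ≠ 0) ∧ ϖ * x ^ 2 + (u : F) * y ^ 2 = z ^ 2) ↔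
      IsSquare (IsLocalRing.residue 𝒪[F] u) := by
    constructor
    · rintro ⟨x, y, z, h, e⟩
      -- With `y = 0` one side of the equation has odd order and the other even order.
      have hy : y ≠ 0 := by
        rintro rfl
        have e' : ϖ * x ^ 2 = z ^ 2 := by simpa using e
        rcases eq_or_ne x 0 with rfl | hx
        · have : z = 0 := by simpa using e'.symm
          simp [this] at h
        · have := congrArg ord e'
          rw [ord_mul hϖ.1 (pow_ne_zero _ hx), ord_pow, ord_pow, hϖ.2] at this
          push_cast at this
          omega
      have e2 : (z / y) ^ 2 = ϖ * (x / y) ^ 2 + u := by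
        field_simp; rw [← e]; ring
      have hz0 : z / y ∈ P F 0 ∧ ϖ * (x / y) ^ 2 ∈ P F 1 := by
        by_cases hx : x / y ∈ P F 0
        · have h1 : ϖ * (x / y) ^ 2 ∈ P F 1 := by
            rw [sq]; simpa using mul_mem_P (shell_subset_P hϖ) (mul_mem_P hx hx)
          refine ⟨?_, h1⟩
          have h2 := add_mem (P_mono (by omega : (0 : ℤ) ≤ 1) h1) (shell_subset_P hu)
          rw [← e2] at h2
          rcases eq_or_ne (z / y) 0 with h0 | h0
          · rw [h0]; exact zero_mem _
          · rw [mem_P_iff (pow_ne_zero _ h0), ord_pow] at h2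
            rw [mem_P_iff h0]; push_cast at h2; omega
        · exfalso
          -- If `x / y` is not integral, the term with `ϖ` dominates, and the square on the other
          -- side would have odd order.
          have hx0 : x / y ≠ 0 := fun h0 => hx (by rw [h0]; exact zero_mem _)
          rw [mem_P_iff hx0] at hx
          have h1 : ϖ * (x / y) ^ 2 ∈ shell F (1 + 2 * ord (x / y)) :=
            shell_mul hϖ ⟨pow_ne_zero _ hx0, by simp⟩
          have h2 := shell_add h1 (P_mono (by omega) (shell_subset_P hu))
          rw [← e2, mem_shell, ord_pow] at h2
          have := h2.2
          push_cast at this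
          omega
      refine ⟨IsLocalRing.residue 𝒪[F] ⟨z / y, mem_P_zero.mp hz0.1⟩, ?_⟩
      rw [← map_mul, residue_eq]
      have h3 : (u : F) - (z / y) * (z / y) = -(ϖ * (x / y) ^ 2) := by linear_combination -e2
      have := neg_mem hz0.2
      rw [← h3] at this
      exact this
    · intro h
      obtain ⟨w, hw⟩ := hsq h
      exact ⟨0, 1, w, by simp, by simp [hw, sq]⟩
  split_ifs with h
  · simpa using hiff.mp h
  · simpa using mt hiff.mpr h

open Classical in
theorem chi_unit [Fintype 𝓀[F]] {ϖ : F} (hϖ : ϖ ∈ shell F 1) {u : 𝒪[F]} (hu : (u : F) ∈ shell F 0) :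
    chi ϖ (u : F) = (quadraticChar 𝓀[F] (IsLocalRing.residue 𝒪[F] u) : ℤ) := by
  have h0 : IsLocalRing.residue 𝒪[F] u ≠ 0 := by
    rw [Ne, residue_eq_zero]; exact (mem_shell_iff.mp hu).2
  have h1 := hilbertSymbol_unit hϖ hu (isSquare_iff_residue hq hu).mpr
  rw [← quadraticChar_one_iff_isSquare h0] at h1
  rw [chi]
  congr 1
  rcases hilbertSymbol_eq_one_or ϖ (u : F) with h2 | h2 <;>
    rcases quadraticChar_dichotomy h0 with h3 | h3 <;> simp_all

omit hq in
theorem chi_mul_sq (a b : F) {w : F} (hw : w ≠ 0) : chi a (b * w ^ 2) = chi a b := by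
  rw [chi, hilbertSymbol_mul_sq a b hw, chi]

omit hq in
theorem chi_self_mul {a : F} (ha : a ≠ 0) (b : F) : chi a (a * b) = chi a (-b) := by
  rw [chi, hilbertSymbol_self_mul ha, chi]

theorem chi_mul_unit {ϖ : F} (hϖ : ϖ ∈ shell F 1) {x y : F} (hx : x ∈ shell F 0)
    (hy : y ∈ shell F 0) : chi ϖ (x * y) = chi ϖ x * chi ϖ y := by
  classical
  have := Fintype.ofFinite 𝓀[F]
  have hxm := mem_P_zero.mp (shell_subset_P hx)
  have hym := mem_P_zero.mp (shell_subset_P hy)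
  have h1 := chi_unit hq hϖ (u := ⟨x, hxm⟩) hx
  have h2 := chi_unit hq hϖ (u := ⟨y, hym⟩) hy
  have h3 := chi_unit hq hϖ (u := ⟨x, hxm⟩ * ⟨y, hym⟩) (by simpa using shell_mul hx hy)
  simp only at h1 h2
  rw [h1, h2]
  refine Eq.trans h3 ?_
  rw [map_mul, map_mul]; push_cast; rfl

omit hq in
theorem exists_unit_mul_zpow {ϖ : F} (hϖ : ϖ ∈ shell F 1) {x : F} (hx : x ≠ 0) :
    ∃ u ∈ shell F 0, x = u * ϖ ^ ord x :=
  ⟨x * ϖ ^ (-ord x), ⟨mul_ne_zero hx (zpow_ne_zero _ hϖ.1),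
    by rw [ord_mul hx (zpow_ne_zero _ hϖ.1), ord_zpow, hϖ.2]; ring⟩, by
    rw [mul_assoc, ← zpow_add₀ hϖ.1]; simp⟩

omit hq in
theorem neg_one_mem_shell : (-1 : F) ∈ shell F 0 := ⟨by simp, by simp⟩

omit hq in
theorem chi_zpow_sq (a b : F) : chi a b ^ (2 : ℤ) = 1 := by
  rw [zpow_two, chi_mul_self]

/-- Squares do not affect `χ`, so only the parity of `k` matters; for odd `k` the extra factor `ϖ`
is traded for `-1` by `chi_self_mul`. -/
theorem chi_unit_mul_zpow {ϖ : F} (hϖ : ϖ ∈ shell F 1) {u : F} (hu : u ∈ shell F 0) (k : ℤ) :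
    chi ϖ (u * ϖ ^ k) = chi ϖ u * chi ϖ (-1) ^ k := by
  rcases Int.even_or_odd' k with ⟨j, rfl | rfl⟩
  · rw [zpow_mul (chi ϖ (-1)), chi_zpow_sq, one_zpow, mul_one, mul_comm (2 : ℤ), zpow_mul,
      zpow_ofNat, chi_mul_sq _ _ (zpow_ne_zero _ hϖ.1)]
  · rw [zpow_add₀ (chi_ne_zero _ _), zpow_mul (chi ϖ (-1)), chi_zpow_sq, one_zpow, one_mul, zpow_one,
      zpow_add₀ hϖ.1, mul_comm (2 : ℤ), zpow_mul, zpow_ofNat, zpow_one, mul_comm _ ϖ, mul_left_comm,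
      ← mul_assoc ϖ, chi_mul_sq _ _ (zpow_ne_zero _ hϖ.1), chi_self_mul hϖ.1, ← chi_mul_unit hq hϖ hu
      neg_one_mem_shell]
    simp

/-- Bilinearity of the Hilbert symbol in the needed case: on units `χ` is the quadratic character of
the residue field, and powers of `ϖ` contribute powers of `χ(-1)`. -/
theorem chi_mul {ϖ : F} (hϖ : ϖ ∈ shell F 1) {x y : F} (hx : x ≠ 0) (hy : y ≠ 0) :
    chi ϖ (x * y) = chi ϖ x * chi ϖ y := by
  obtain ⟨u, hu, hxu⟩ := exists_unit_mul_zpow hϖ hx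
  obtain ⟨w, hw, hyw⟩ := exists_unit_mul_zpow hϖ hy
  rw [hxu, hyw, mul_mul_mul_comm, ← zpow_add₀ hϖ.1,
    chi_unit_mul_zpow hq hϖ (by simpa using shell_mul hu hw), chi_unit_mul_zpow hq hϖ hu,
    chi_unit_mul_zpow hq hϖ hw, chi_mul_unit hq hϖ hu hw, zpow_add₀ (chi_ne_zero _ _)]
  ring

omit hq in
@[simp] theorem chi_one (a : F) : chi a 1 = 1 := by
  have : hilbertSymbol a (1 : F) = 1 := by
    unfold hilbertSymbol
    rw [if_pos ⟨0, 1, 1, by simp, by simp⟩]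
  simp [chi, this]

omit hq in
theorem chi_inv (a b : F) : chi a b⁻¹ = chi a b := by
  rcases eq_or_ne b 0 with rfl | hb
  · simp
  · rw [← chi_mul_sq a b⁻¹ hb]; congr 1; field_simp

/-- `χ` is tamely ramified: it is trivial on `1 + 𝔭`, whose elements have residue `1`. -/
theorem chi_add {ϖ : F} (hϖ : ϖ ∈ shell F 1) {x y : F} {m : ℤ} (hx : x ∈ shell F m)
    (hy : y ∈ P F (m + 1)) : chi ϖ (x + y) = chi ϖ x := by
  classical
  have := Fintype.ofFinite 𝓀[F]
  have h1 : y * x⁻¹ ∈ P F 1 := by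
    simpa using mul_mem_P hy (shell_subset_P (shell_inv hx))
  have h2 : (1 : F) + y * x⁻¹ ∈ shell F 0 := shell_add ⟨one_ne_zero, ord_one⟩ (by simpa using h1)
  have h3 : x + y = x * (1 + y * x⁻¹) := by field_simp [hx.1]
  rw [h3, chi_mul hq hϖ hx.1 h2.1]
  have h4 := chi_unit hq hϖ (u := ⟨_, mem_P_zero.mp (shell_subset_P h2)⟩) h2
  have h5 : IsLocalRing.residue 𝒪[F] ⟨_, mem_P_zero.mp (shell_subset_P h2)⟩ = 1 := by
    rw [← map_one (IsLocalRing.residue 𝒪[F]), residue_eq]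
    simpa using h1
  rw [h5, map_one] at h4
  simp only at h4
  rw [h4]; simp

/-- `χ` is locally constant away from `0`, hence measurable. -/
theorem measurable_chi [MeasurableSpace F] [BorelSpace F] {ϖ : F} (hϖ : ϖ ∈ shell F 1) :
    Measurable (chi ϖ) := by
  have h1 : ∀ z : ℂ, IsOpen ({x | chi ϖ x = z} \ {0}) := by
    intro z
    rw [isOpen_iff_mem_nhds]
    rintro x ⟨hx, hx0⟩
    have hx0 : x ≠ 0 := hx0
    have hsh : x ∈ shell F (ord x) := ⟨hx0, rfl⟩
    have hmem : {y | y - x ∈ P F (ord x + 1)} ∈ nhds x := by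
      apply (continuous_sub_right x).continuousAt.preimage_mem_nhds
      simpa using P_mem_nhds_zero (F := F) (ord x + 1)
    refine Filter.mem_of_superset hmem fun y hy => ?_
    have hy1 : y - x ∈ P F (ord x + 1) := hy
    have hy2 : y = x + (y - x) := by ring
    refine ⟨?_, ?_⟩
    · rw [Set.mem_ofPred_eq, hy2, chi_add hq hϖ hsh hy1]; exact hx
    · rw [Set.mem_singleton_iff, hy2]
      exact (shell_add hsh hy1).1
  have h3 : MeasurableSet {x : F | chi ϖ x = 1} := by
    have h2 : {x : F | chi ϖ x = 1} = ({x | chi ϖ x = 1} \ {0}) ∪ ({x | chi ϖ x = 1} ∩ {0}) :=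
      (Set.sdiff_union_inter _ _).symm
    rw [h2]
    exact (h1 1).measurableSet.union (Set.Subsingleton.measurableSet
      (Set.subsingleton_singleton.anti Set.inter_subset_right))
  -- `χ` has only the values `1` and `-1`, at the argument `0` as well.
  have h4 : chi ϖ = Set.indicator {x : F | chi ϖ x = 1} (fun _ => (2 : ℂ)) + fun _ => (-1 : ℂ) := by
    funext x
    rcases chi_eq_one_or ϖ x with h | h
    · simp [Set.indicator, h]; norm_num
    · have : (-1 : ℂ) ≠ 1 := by norm_num
      simp [Set.indicator, h, this]
  rw [h4]
  exact (measurable_const.indicator h3).add measurable_const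

end Chi

/-! ### Gauss integrals of `ψ` and `χ`. -/

section Psi

variable {F : Type*} [Field F] [ValuativeRel F] [TopologicalSpace F]
  [IsNonarchimedeanLocalField F] {ψ : AddChar F Circle}

theorem psi_add (ψ : AddChar F Circle) (x y : F) : (ψ (x + y) : ℂ) = ψ x * ψ y := by
  rw [AddChar.map_add_eq_mul, Circle.coe_mul]

theorem psi_eq_one (hψ : HasOrderZero ψ) {x : F} (hx : x ∈ P F 0) : (ψ x : ℂ) = 1 := by
  rw [hψ.1 x (mem_P_zero.mp hx), Circle.coe_one]

/-- A witness `x` of order at least `-1` for the non-triviality of `ψ` is divided by `t`; the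
assumption on `t` puts the quotient into `P F a`. -/
theorem exists_psi_ne_one (hψ : HasOrderZero ψ) {t : F} {a : ℤ} (ht : t ∉ P F (-a)) :
    ∃ y ∈ P F a, (ψ (t * y) : ℂ) ≠ 1 := by
  obtain ⟨x, hx, hx1⟩ := hψ.2
  have ht0 : t ≠ 0 := fun h => ht (by rw [h]; exact zero_mem _)
  have hx0 : x ≠ 0 := by rintro rfl; simp at hx1
  rw [mem_P_iff ht0] at ht
  refine ⟨x / t, mem_P_of_le (by rw [ord_div hx0 ht0]; omega), ?_⟩
  rw [mul_div_cancel₀ _ ht0]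
  exact fun h => hx1 (Circle.ext (by rw [h, Circle.coe_one]))

theorem norm_psi (x : F) : ‖(ψ x : ℂ)‖ = 1 := Circle.norm_coe _

variable [MeasurableSpace F] [BorelSpace F]

theorem measurable_psi (hψc : Continuous ψ) : Measurable fun x : F => (ψ x : ℂ) :=
  (continuous_subtype_val.comp hψc).measurable

theorem integrableOn_of_bound {X : Type*} [MeasurableSpace X] {μ : Measure X} {s : Set X}
    (hs : μ s ≠ ⊤) {f : X → ℂ} (hf : Measurable f)
    {C : ℝ} (hC : ∀ x, ‖f x‖ ≤ C) : IntegrableOn f s μ := by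
  have : IsFiniteMeasure (μ.restrict s) := ⟨by simpa using hs.lt_top⟩
  exact Integrable.of_bound hf.aestronglyMeasurable C (Filter.Eventually.of_forall hC)

open Classical in
-- Orthogonality of characters: translation by some `y` with `ψ(ty) ≠ 1` multiplies the integral by
-- `ψ(ty)`.
theorem integral_psi (hψ : HasOrderZero ψ) (t : F) (a : ℤ) :
    ∫ x in P F a, (ψ (t * x) : ℂ) ∂haarF F =
      if t ∈ P F (-a) then (resCard F : ℂ) ^ (-a) else 0 := by
  split_ifs with h
  · rw [setIntegral_congr_fun (g := fun _ => 1) (measurableSet_P a)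
      (fun x hx => psi_eq_one hψ (by simpa using mul_mem_P h hx)), setIntegral_const, haar_real_P]
    simp
  · obtain ⟨y, hy, hy1⟩ := exists_psi_ne_one hψ h
    have h2 := setIntegral_add (measurableSet_P a) (add_mem_P_iff hy) fun x => (ψ (t * x) : ℂ)
    simp only [mul_add, psi_add] at h2
    rw [integral_mul_const] at h2
    have h3 : (∫ x in P F a, (ψ (t * x) : ℂ) ∂haarF F) * ((ψ (t * y) : ℂ) - 1) = 0 := by
      linear_combination h2
    exact (mul_eq_zero.mp h3).resolve_right (sub_ne_zero.mpr hy1)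

/-- The quadratic Gauss integral `∫_𝔬 ψ(t x²) dx`. -/
def quad (ψ : AddChar F Circle) (t : F) : ℂ := ∫ x in P F 0, (ψ (t * x ^ 2) : ℂ) ∂haarF F

theorem quad_of_mem (hψ : HasOrderZero ψ) {t : F} (ht : t ∈ P F 0) : quad ψ t = 1 := by
  rw [quad, setIntegral_congr_fun (g := fun _ => 1) (measurableSet_P 0)
    (fun x hx => psi_eq_one hψ (by rw [sq]; simpa using mul_mem_P ht (mul_mem_P hx hx))),
    setIntegral_const, haar_real_P]
  simp

theorem integrableOn_psi (hψc : Continuous ψ) {s : Set F} (hs : haarF F s ≠ ⊤) {f : F → F}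
    (hf : Measurable f) : IntegrableOn (fun x => (ψ (f x) : ℂ)) s (haarF F) :=
  integrableOn_of_bound (C := 1) hs ((measurable_psi hψc).comp hf) fun _ => (norm_psi _).le

/-- Substituting `x = c * y` in a Gauss integral over `𝔭 ^ a`. -/
theorem integral_psi_sq (t : F) {c : F} {a : ℤ} (hc : c ∈ shell F a) :
    ∫ x in P F a, (ψ (t * x ^ 2) : ℂ) ∂haarF F =
      (resCard F : ℂ) ^ (-a) * quad ψ (t * c ^ 2) := by
  rw [setIntegral_P_mul hc, sub_self, quad]
  simp only [mul_pow, mul_assoc]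

variable (hq : Odd (resCard F)) (hψc : Continuous ψ) (hψ : HasOrderZero ψ)
  {ϖ : F} (hϖ : ϖ ∈ shell F 1)

include hq hψc hψ in
-- Translate `x` by `y` of order at least `-ord t - 1`. Then `t y²` is integral because `ord t ≤
-- -2`, while the cross term `2 t x y` runs through a non-trivial character of `y`, because `2 x` is
-- a unit. So all averages over these cosets vanish.
theorem integral_shell_psi_sq {t : F} (ht : t ≠ 0) (h : ord t ≤ -2) :
    ∫ x in shell F 0, (ψ (t * x ^ 2) : ℂ) ∂haarF F = 0 := by
  have hm : Measurable fun x : F => t * x ^ 2 := by fun_prop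
  refine setIntegral_eq_zero_of_average (measurableSet_shell 0) (haar_shell_ne_top 0)
    (a := -ord t - 1) ?_ ((measurable_psi hψc).comp hm) (C := 1) (fun _ => (norm_psi _).le) ?_
  · intro y hy x
    exact add_mem_shell_iff (P_mono (by omega) hy) x
  · intro x hx
    have h1 : ∀ y ∈ (P F (-ord t - 1) : Set F), ((fun x => (ψ (t * x ^ 2) : ℂ)) ∘ id) (x + y) =
        ψ (t * x ^ 2) * ψ (2 * t * x * y) := by
      intro y hy
      have h2 : t * y ^ 2 ∈ P F 0 := by
        have := mul_mem_P (mem_P_of_le (le_refl (ord t))) (mul_mem_P hy hy)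
        rw [sq]; exact P_mono (by omega) this
      have h3 : t * (x + y) ^ 2 = t * x ^ 2 + (2 * t * x * y + t * y ^ 2) := by ring
      simp only [Function.comp, id, h3, psi_add, psi_eq_one hψ h2, mul_one]
    refine (setIntegral_congr_fun (measurableSet_P _) h1).trans ?_
    rw [integral_const_mul, integral_psi hψ, if_neg, mul_zero]
    have h4 : 2 * t * x ∈ shell F (ord t) := by
      have := shell_mul (shell_mul (two_mem_shell hq) (⟨ht, rfl⟩ : t ∈ shell F (ord t))) hx
      simpa using this
    rw [mem_P_iff h4.1, h4.2]
    omega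

include hq hψc hψ hϖ in
theorem quad_step {t : F} (ht : t ≠ 0) (h : ord t ≤ -2) :
    quad ψ t = (resCard F : ℂ)⁻¹ * quad ψ (t * ϖ ^ 2) := by
  rw [quad, integral_P_eq_add (integrableOn_psi hψc (haar_P_ne_top 0) (by fun_prop)),
    integral_shell_psi_sq hq hψc hψ ht h, zero_add, zero_add, integral_psi_sq t hϖ, zpow_neg_one]

/-- The additive character of the residue field given by `ψ(t x)`. -/
def psiBar (hψ : HasOrderZero ψ) {t : F} (ht : t ∈ P F (-1)) : AddChar 𝓀[F] ℂ where
  toFun a := ψ (t * rep a)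
  map_zero_eq_one' := by
    apply psi_eq_one hψ
    have : ((rep (0 : 𝓀[F]) : 𝒪[F]) : F) ∈ P F 1 := by rw [← residue_eq_zero, residue_rep]
    simpa using mul_mem_P ht this
  map_add_eq_mul' a b := by
    have h : ((rep (a + b) : 𝒪[F]) : F) - (rep a + rep b : 𝒪[F]) ∈ P F 1 := by
      rw [← residue_eq, residue_rep, map_add, residue_rep, residue_rep]
    have h1 : t * (((rep (a + b) : 𝒪[F]) : F) - (rep a + rep b : 𝒪[F])) ∈ P F 0 := by
      simpa only [neg_add_cancel] using mul_mem_P ht h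
    have h2 : t * ((rep (a + b) : 𝒪[F]) : F) =
        t * (((rep (a + b) : 𝒪[F]) : F) - (rep a + rep b : 𝒪[F])) +
          (t * (rep a : 𝒪[F]) + t * (rep b : 𝒪[F])) := by push_cast; ring
    rw [h2, psi_add, psi_add, psi_eq_one hψ h1, one_mul]

omit [MeasurableSpace F] [BorelSpace F] in
theorem psiBar_residue {t : F} (ht : t ∈ P F (-1)) (x : 𝒪[F]) :
    psiBar hψ ht (IsLocalRing.residue 𝒪[F] x) = ψ (t * (x : F)) := by
  have h : ((rep (IsLocalRing.residue 𝒪[F] x) : 𝒪[F]) : F) - x ∈ P F 1 := by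
    rw [← residue_eq, residue_rep]
  have h1 := psi_eq_one hψ (by simpa using mul_mem_P ht h)
  show (ψ (t * ((rep _ : 𝒪[F]) : F)) : ℂ) = _
  have h2 : t * ((rep (IsLocalRing.residue 𝒪[F] x) : 𝒪[F]) : F) =
    t * (((rep (IsLocalRing.residue 𝒪[F] x) : 𝒪[F]) : F) - x) + t * x := by ring
  rw [h2, psi_add, h1, one_mul]

omit [MeasurableSpace F] [BorelSpace F] in
theorem psiBar_ne_one {t : F} (ht : t ∈ shell F (-1)) :
    psiBar hψ (shell_subset_P ht) ≠ 1 := by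
  intro h
  have h1 : t ∉ P F (-0) := by rw [mem_P_iff ht.1, ht.2]; omega
  obtain ⟨y, hy, hy1⟩ := exists_psi_ne_one hψ h1
  apply hy1
  have := psiBar_residue hψ (shell_subset_P ht) ⟨y, mem_P_zero.mp hy⟩
  rw [h] at this
  simpa using this.symm

open Classical in
variable (F) in
/-- The quadratic character of the residue field with complex values. -/
def quadChar [Fintype 𝓀[F]] : MulChar 𝓀[F] ℂ :=
  (quadraticChar 𝓀[F]).ringHomComp (Int.castRingHom ℂ)

open Classical in
include hq hψ in
-- A residue class `b` has `1 + quadraticChar b` square roots, and the summand `1` contributes the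
-- sum of a non-trivial character, which is zero.
theorem quad_eq_gaussSum [Fintype 𝓀[F]] {t : F} (ht : t ∈ shell F (-1)) :
    quad ψ t = (resCard F : ℂ)⁻¹ *
      gaussSum (quadChar F) (psiBar hψ (shell_subset_P ht)) := by
  set ψ' := psiBar hψ (shell_subset_P ht) with hψ'
  rw [quad, integral_P_zero_of_residue]
  · congr 1
    have h1 : ∀ a : 𝓀[F], (ψ (t * ((rep a : 𝒪[F]) : F) ^ 2) : ℂ) = ψ' (a ^ 2) := by
      intro a
      have := psiBar_residue hψ (shell_subset_P ht) (rep a ^ 2)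
      rw [map_pow, residue_rep] at this
      rw [hψ', this]; rfl
    simp only [h1]
    have h2 : ∑ a : 𝓀[F], ψ' (a ^ 2) = ∑ b : 𝓀[F], ((quadraticChar 𝓀[F] b : ℤ) + 1 : ℂ) * ψ' b := by
      have h3 : ∀ b : 𝓀[F], ((quadraticChar 𝓀[F] b : ℤ) + 1 : ℂ) =
          ((Finset.univ.filter fun a : 𝓀[F] => a ^ 2 = b).card : ℂ) := by
        intro b
        have h4 := quadraticChar_card_sqrts (ringChar_ne_two hq) b
        have h5 : ({x : 𝓀[F] | x ^ 2 = b}).toFinset =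
            Finset.univ.filter fun a : 𝓀[F] => a ^ 2 = b := by ext; simp
        rw [h5] at h4
        exact_mod_cast h4.symm
      simp only [h3]
      rw [← Finset.sum_fiberwise Finset.univ (fun a : 𝓀[F] => a ^ 2)]
      refine Finset.sum_congr rfl fun b _ => ?_
      rw [Finset.sum_congr rfl (g := fun _ => ψ' b)
        (fun a ha => by rw [(Finset.mem_filter.mp ha).2]), Finset.sum_const, nsmul_eq_mul]
    rw [h2]
    simp only [add_mul, one_mul, Finset.sum_add_distrib]
    rw [AddChar.sum_eq_zero_of_ne_one (psiBar_ne_one hψ ht), add_zero]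
    rfl
  · intro x hx y hy
    have h1 : t * (2 * x * y + y ^ 2) ∈ P F 0 := by
      have h2 : 2 * x * y + y ^ 2 ∈ P F 1 := by
        refine add_mem ?_ ?_
        · simpa using mul_mem_P (mul_mem_P (shell_subset_P (two_mem_shell hq)) hx) hy
        · rw [sq]; exact P_mono (by omega) (mul_mem_P hy hy)
      simpa using mul_mem_P (shell_subset_P ht) h2
    have h3 : t * (x + y) ^ 2 = t * (2 * x * y + y ^ 2) + t * x ^ 2 := by ring
    rw [h3, psi_add, psi_eq_one hψ h1, one_mul]

open Classical in
include hq hψ hϖ in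
theorem integral_chi_psi_eq_gaussSum [Fintype 𝓀[F]] {t : F} (ht : t ∈ shell F (-1)) :
    ∫ x in shell F 0, chi ϖ x * (ψ (t * x) : ℂ) ∂haarF F = (resCard F : ℂ)⁻¹ *
      gaussSum (quadChar F) (psiBar hψ (shell_subset_P ht)) := by
  rw [← integral_indicator (measurableSet_shell 0)]
  set f := (shell F 0).indicator fun x => chi ϖ x * (ψ (t * x) : ℂ) with hf
  have hsub : Function.support f ⊆ (P F 0 : Set F) := by
    intro x hx
    by_contra h
    exact hx (Set.indicator_of_notMem (fun h' => h (shell_subset_P h')) _)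
  rw [← setIntegral_eq_integral_of_forall_compl_eq_zero (s := (P F 0 : Set F))
    (fun x hx => by_contra fun h => hx (hsub h)), integral_P_zero_of_residue]
  · congr 1
    refine Finset.sum_congr rfl fun a _ => ?_
    rw [quadChar, MulChar.ringHomComp_apply, hf]
    by_cases ha : a = 0
    · rw [Set.indicator_of_notMem]
      · simp [ha]
      · intro h
        rw [mem_shell_iff, zero_add, ← residue_eq_zero, residue_rep] at h
        exact h.2 ha
    · have hmem : ((rep a : 𝒪[F]) : F) ∈ shell F 0 := by
        rw [mem_shell_iff, zero_add, ← residue_eq_zero, residue_rep, mem_P_zero]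
        exact ⟨(rep a).2, ha⟩
      rw [Set.indicator_of_mem hmem, chi_unit hq hϖ hmem, residue_rep]
      rfl
  · intro x hx y hy
    by_cases hxs : x ∈ shell F 0
    · have h1 := shell_add hxs (y := y) (by simpa using hy)
      rw [hf, Set.indicator_of_mem hxs, Set.indicator_of_mem h1,
        chi_add hq hϖ hxs (by simpa using hy), mul_add, psi_add,
        psi_eq_one hψ (x := t * y) (by simpa using mul_mem_P (shell_subset_P ht) hy), mul_one]
    · have h1 := mt (add_mem_shell_iff (m := 0) (t := y) (by simpa using hy) x).mp hxs
      rw [hf, Set.indicator_of_notMem hxs, Set.indicator_of_notMem h1]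

include hq hψ hϖ in
-- Both sides reduce to the same Gauss sum over the residue field. The linear form of the integral
-- makes the dependence on `t` visible.
theorem integral_chi_psi {t : F} (ht : t ∈ shell F (-1)) :
    ∫ x in shell F 0, chi ϖ x * (ψ (t * x) : ℂ) ∂haarF F = quad ψ t := by
  have := Fintype.ofFinite 𝓀[F]
  rw [integral_chi_psi_eq_gaussSum hq hψ hϖ ht, quad_eq_gaussSum hq hψ ht]

include hq hψ hϖ in
-- In the form with `χ(x) ψ(tx)`, a unit multiplying `t` is absorbed by a substitution, which costs
-- one value of `χ`.
theorem quad_unit_mul {t u : F} (ht : t ∈ shell F (-1)) (hu : u ∈ shell F 0) :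
    quad ψ (u * t) = chi ϖ u * quad ψ t := by
  rw [← integral_chi_psi hq hψ hϖ ht, ← integral_chi_psi hq hψ hϖ (t := u * t)
    (by simpa using shell_mul hu ht), setIntegral_shell_mul hu 0 (fun x => chi ϖ x * ψ (t * x))]
  rw [neg_zero, zpow_zero, one_mul, sub_zero, ← integral_const_mul]
  refine setIntegral_congr_fun (measurableSet_shell 0) fun x hx => ?_
  rw [chi_mul hq hϖ hu.1 hx.1, ← mul_assoc, ← mul_assoc, chi_mul_self, one_mul]
  congr 3
  ring

include hq hψ hϖ in
-- The square of the quadratic Gauss sum is `χ(-1) q`, and the integral carries the factor `q⁻¹`.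
theorem quad_sq {t : F} (ht : t ∈ shell F (-1)) :
    quad ψ t ^ 2 = chi ϖ (-1) * (resCard F : ℂ)⁻¹ := by
  classical
  have := Fintype.ofFinite 𝓀[F]
  have hinj : Function.Injective (Int.castRingHom ℂ) := Int.cast_injective
  have h1 : quadChar F ≠ 1 := by
    rw [quadChar, Ne, MulChar.ringHomComp_eq_one_iff hinj]
    exact quadraticChar_ne_one (ringChar_ne_two hq)
  have h2 : (quadChar F).IsQuadratic := (quadraticChar_isQuadratic 𝓀[F]).comp _
  rw [quad_eq_gaussSum hq hψ ht, mul_pow,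
    gaussSum_sq h1 h2 (AddChar.IsPrimitive.of_ne_one (psiBar_ne_one hψ ht))]
  have h3 : chi ϖ (-1) = quadChar F (-1) := by
    have h4 := chi_unit hq hϖ (u := -1) (by simpa using neg_one_mem_shell)
    rw [map_neg, map_one] at h4
    exact h4
  rw [h3, resCard, Nat.card_eq_fintype_card]
  have : (Fintype.card 𝓀[F] : ℂ) ≠ 0 := by simp
  field_simp

include hq hϖ in
theorem exists_chi_eq_neg_one : ∃ u ∈ shell F 0, chi ϖ u = -1 := by
  classical
  have := Fintype.ofFinite 𝓀[F]
  obtain ⟨a, ha⟩ := quadraticChar_exists_neg_one (F := 𝓀[F]) (ringChar_ne_two hq)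
  have hmem : ((rep a : 𝒪[F]) : F) ∈ shell F 0 := by
    rw [mem_shell_iff, zero_add, ← residue_eq_zero, residue_rep, mem_P_zero]
    refine ⟨(rep a).2, ?_⟩
    rintro rfl
    simp at ha
  refine ⟨_, hmem, ?_⟩
  rw [chi_unit hq hϖ hmem, residue_rep, ha]
  simp

include hq hϖ in
-- Substitute `x ↦ u x` with a unit `u` such that `χ(u) = -1`.
theorem integral_chi : ∫ x in shell F 0, chi ϖ x ∂haarF F = 0 := by
  obtain ⟨u, hu, hu1⟩ := exists_chi_eq_neg_one hq hϖ
  have h := setIntegral_shell_mul hu 0 (chi ϖ)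
  rw [neg_zero, zpow_zero, one_mul, sub_zero,
    setIntegral_congr_fun (g := fun x => -chi ϖ x) (measurableSet_shell 0)
    (fun x hx => (show chi ϖ (u * x) = -chi ϖ x by rw [chi_mul hq hϖ hu.1 hx.1, hu1]; ring)),
    integral_neg] at h
  linear_combination h / 2

include hψ hψc in
theorem integral_shell_psi {t : F} (ht : t ∈ shell F (-1)) :
    ∫ x in shell F 0, (ψ (t * x) : ℂ) ∂haarF F = -(resCard F : ℂ)⁻¹ := by
  have h := integral_P_eq_add (integrableOn_psi hψc (haar_P_ne_top 0) (measurable_const_mul t))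
  rw [integral_psi hψ, integral_psi hψ, if_neg, if_pos] at h
  · rw [zero_add, zpow_neg_one] at h
    linear_combination -h
  · rw [zero_add]; exact shell_subset_P ht
  · rw [mem_P_iff ht.1, ht.2]; omega

include hq hψ hϖ in
-- The conductors do not match: `χ` is invariant under translations by `𝔭` on the units, whereas `y
-- ↦ ψ(ty)` is non-trivial on `𝔭` once `ord t ≤ -2`.
theorem integral_chi_pow_psi {t : F} (ht : t ≠ 0) (h : ord t ≤ -2) (k : ℕ) :
    ∫ x in shell F 0, chi ϖ x ^ k * (ψ (t * x) : ℂ) ∂haarF F = 0 := by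
  have h1 : t ∉ P F (-1) := by rw [mem_P_iff ht]; omega
  obtain ⟨y, hy, hy1⟩ := exists_psi_ne_one hψ h1
  have h2 := setIntegral_add (measurableSet_shell 0)
    (add_mem_shell_iff (m := 0) (by simpa using hy)) fun x => chi ϖ x ^ k * (ψ (t * x) : ℂ)
  rw [setIntegral_congr_fun (g := fun x => (chi ϖ x ^ k * (ψ (t * x) : ℂ)) * ψ (t * y))
    (measurableSet_shell 0) (fun x hx => by
      simp only [mul_add, psi_add, chi_add hq hϖ hx (y := y) (by simpa using hy)]; ring),
    integral_mul_const] at h2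
  have h3 : (∫ x in shell F 0, chi ϖ x ^ k * (ψ (t * x) : ℂ) ∂haarF F) *
      ((ψ (t * y) : ℂ) - 1) = 0 := by
    linear_combination h2
  exact (mul_eq_zero.mp h3).resolve_right (sub_ne_zero.mpr hy1)

end Psi

/-! ### The Weil constant, and Gauss integrals of unary and binary forms. -/

section Weil

variable {F : Type*} [Field F] [ValuativeRel F] [TopologicalSpace F]
  [IsNonarchimedeanLocalField F] {ψ : AddChar F Circle}

theorem absF_of_ne_zero {x : F} (hx : x ≠ 0) : absF x = (resCard F : ℝ) ^ (-ord x) := by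
  rw [absF, if_neg hx]

theorem absF_cpow {x : F} (hx : x ≠ 0) (z : ℂ) :
    ((absF x : ℝ) : ℂ) ^ z = (resCard F : ℂ) ^ (-(ord x : ℂ) * z) := by
  have hq : (0 : ℝ) < resCard F := by exact_mod_cast resCard_pos F
  have h1 : ((absF x : ℝ) : ℂ) ≠ 0 := by
    rw [absF_of_ne_zero hx]
    exact_mod_cast (zpow_ne_zero _ hq.ne')
  rw [Complex.cpow_def_of_ne_zero h1, Complex.cpow_def_of_ne_zero (resCard_ne_zero F),
    absF_of_ne_zero hx, ← Complex.ofReal_log (by positivity), Real.log_zpow]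
  have h2 : Complex.log (resCard F : ℂ) = (Real.log (resCard F : ℝ) : ℝ) := by
    rw [Complex.ofReal_log hq.le]; simp
  rw [h2]
  push_cast
  congr 1
  ring

theorem resCard_cpow_add (x y : ℂ) :
    (resCard F : ℂ) ^ (x + y) = (resCard F : ℂ) ^ x * (resCard F : ℂ) ^ y :=
  Complex.cpow_add _ _ (resCard_ne_zero F)

theorem resCard_cpow_half_mul_self :
    (resCard F : ℂ) ^ (1 / 2 : ℂ) * (resCard F : ℂ) ^ (1 / 2 : ℂ) = resCard F := by
  rw [← resCard_cpow_add]; norm_num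

variable [MeasurableSpace F] [BorelSpace F]

/-- Local constancy becomes uniform by compactness: finitely many cosets cover the support, and the
smallest of the ideals works for all of them. -/
theorem exists_invariant {φ : F → ℂ} (h1 : IsLocallyConstant φ) (h2 : HasCompactSupport φ) :
    ∃ M : ℤ, ∀ x, ∀ z ∈ P F M, φ (x + z) = φ x := by
  have hloc : ∀ x : F, ∃ m : ℤ, ∀ z ∈ P F m, φ (x + z) = φ x := by
    intro x
    have h3 : {y | φ y = φ x} ∈ nhds x := (h1.isOpen_fiber (φ x)).mem_nhds rfl
    have h4 : {z | φ (x + z) = φ x} ∈ nhds (0 : F) := by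
      have := (continuous_const_add x).continuousAt.preimage_mem_nhds (x := (0 : F))
        (t := {y | φ y = φ x}) (by simpa using h3)
      exact this
    obtain ⟨m, -, hm⟩ := hasBasis_P.mem_iff.mp h4
    exact ⟨m, fun z hz => hm hz⟩
  choose m hm using hloc
  obtain ⟨t, -, ht⟩ := h2.isCompact.elim_nhds_subcover (fun x => {y | y - x ∈ P F (m x)}) (by
    intro x _
    apply (continuous_sub_right x).continuousAt.preimage_mem_nhds
    simpa using P_mem_nhds_zero (F := F) (m x))
  obtain ⟨M, hM⟩ := (t.finite_toSet.image m).bddAbove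
  have key : ∀ x ∈ tsupport φ, ∀ z ∈ P F M, φ (x + z) = φ x := by
    intro x hx z hz
    obtain ⟨i, hi, hxi⟩ := Set.mem_iUnion₂.mp (ht hx)
    have h5 : x - i ∈ P F (m i) := hxi
    have h6 : z ∈ P F (m i) := P_mono (hM ⟨i, hi, rfl⟩) hz
    have h7 := hm i _ h5
    have h8 := hm i _ (add_mem h5 h6)
    rw [show i + (x - i) = x by ring] at h7
    rw [show i + (x - i + z) = x + z by ring] at h8
    rw [h7, h8]
  refine ⟨M, fun x z hz => ?_⟩
  by_cases hx : x ∈ tsupport φ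
  · exact key x hx z hz
  by_cases hxz : x + z ∈ tsupport φ
  -- If only the translate lies in the support, the argument is applied there, with the opposite
  -- translation.
  · have := key _ hxz _ (neg_mem hz)
    rw [add_neg_cancel_right] at this
    exact this.symm
  · rw [image_eq_zero_of_notMem_tsupport hx, image_eq_zero_of_notMem_tsupport hxz]

theorem exists_support_subset {φ : F → ℂ} (h2 : HasCompactSupport φ) :
    ∃ M : ℤ, ∀ x, x ∉ P F M → φ x = 0 := by
  obtain ⟨t, ht⟩ := h2.isCompact.elim_finite_subcover (fun k : ℤ => (P F k : Set F))
    (fun k => isOpen_P k) (fun x _ => by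
      obtain ⟨k, hk⟩ := exists_mem_P x
      exact Set.mem_iUnion.mpr ⟨k, hk⟩)
  obtain ⟨M, hM⟩ := t.finite_toSet.bddBelow
  refine ⟨M, fun x hx => image_eq_zero_of_notMem_tsupport fun h => hx ?_⟩
  obtain ⟨i, hi, hxi⟩ := Set.mem_iUnion₂.mp (ht h)
  exact P_mono (hM hi) hxi

variable (hq : Odd (resCard F)) (hψc : Continuous ψ) (hψ : HasOrderZero ψ)
  {ϖ : F} (hϖ : ϖ ∈ shell F 1)

include hψ in
theorem fourier_eq_zero {φ : F → ℂ} {M : ℤ} (hM : ∀ x, ∀ z ∈ P F M, φ (x + z) = φ x) {x : F}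
    (hx : x ∉ P F (-M)) : fourier ψ φ x = 0 := by
  obtain ⟨z, hz, hz1⟩ := exists_psi_ne_one hψ hx
  have h : fourier ψ φ x = fourier ψ φ x * ψ (x * z) := by
    conv_lhs => rw [fourier, ← integral_add_right_eq_self _ z]
    rw [fourier, ← integral_mul_const]
    congr 1
    funext y
    rw [hM y z hz, mul_add, psi_add]
    ring
  have h3 : fourier ψ φ x * ((ψ (x * z) : ℂ) - 1) = 0 := by linear_combination -h
  exact (mul_eq_zero.mp h3).resolve_right (sub_ne_zero.mpr hz1)

include hq hψc hψ hϖ in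
-- Enlarging the ball adds only shells on which the quadratic character integrates to zero;
-- `quad_step` expresses this.
theorem integral_P_neg_psi_sq {t : F} (ht : t ∈ shell F (-1)) (M : ℕ) :
    ∫ x in P F (-(M : ℤ)), (ψ (t * x ^ 2) : ℂ) ∂haarF F = quad ψ t := by
  induction M with
  | zero => simp [quad]
  | succ M ih =>
    have hc : ∀ k : ℤ, ϖ ^ k ∈ shell F k := fun k => ⟨zpow_ne_zero _ hϖ.1, by simp [hϖ.2]⟩
    rw [← ih, integral_psi_sq t (hc _), integral_psi_sq t (hc _), quad_step hq hψc hψ hϖ]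
    · rw [← mul_assoc, ← zpow_sub_one₀ (resCard_ne_zero F)]
      push_cast
      congr 2
      · ring
      · rw [mul_assoc, ← mul_pow, ← zpow_add_one₀ hϖ.1]
        congr 3; ring
    · exact mul_ne_zero ht.1 (pow_ne_zero _ (hc _).1)
    · rw [ord_mul ht.1 (pow_ne_zero _ (hc _).1), ht.2, ord_pow, (hc _).2]
      push_cast; omega

include hq hψc hψ hϖ in
-- Insert the definition of the Fourier transform, exchange the integrals and complete the square:
-- with `t = -1/(4ϖ)` one has `xy + t x² = t (x - 2ϖy)² + ϖ y²`. The Fourier transform has bounded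
-- support, so `x` may be kept in a large ball, which makes the exchange legitimate.
theorem integral_fourier_mul {φ : F → ℂ} (h1 : IsLocallyConstant φ) (h2 : HasCompactSupport φ) :
    ∫ x, fourier ψ φ x * (ψ (-(x ^ 2 / (4 * ϖ))) : ℂ) ∂haarF F =
      quad ψ (-(4 * ϖ)⁻¹) * ∫ x, φ x * (ψ (ϖ * x ^ 2) : ℂ) ∂haarF F := by
  have h4 : (4 : F) ∈ shell F 0 := by
    have := shell_mul (two_mem_shell hq) (two_mem_shell hq)
    norm_num at this
    exact this
  have ht0 : -(4 * ϖ)⁻¹ ∈ shell F (-1) := by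
    simpa using shell_neg (shell_inv (shell_mul h4 hϖ))
  set t := -(4 * ϖ)⁻¹ with ht
  have hϖ0 := hϖ.1
  have h40 := h4.1
  obtain ⟨M₁, hM₁⟩ := exists_invariant h1 h2
  obtain ⟨M₂, hM₂⟩ := exists_support_subset h2
  -- The bound by `M₁` makes the ball contain the support of the Fourier transform; the bound by
  -- `M₂` makes it stable under the shifts `2ϖy` for `y` in the support of `φ`.
  obtain ⟨M, hM₁', hM₂'⟩ : ∃ M : ℕ, M₁ ≤ M ∧ -M₂ - 1 ≤ M := ⟨M₁.natAbs + M₂.natAbs + 1, by omega, by omega⟩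
  have hphi : Measurable φ := h1.continuous.measurable
  have hint : Integrable φ (haarF F) := h1.continuous.integrable_of_hasCompactSupport h2
  have e1 : ∀ x, (ψ (-(x ^ 2 / (4 * ϖ))) : ℂ) = ψ (t * x ^ 2) := by
    intro x; rw [ht]; congr 2; field_simp
  simp only [e1]
  have e2 : ∫ x, fourier ψ φ x * (ψ (t * x ^ 2) : ℂ) ∂haarF F =
      ∫ x in (P F (-(M : ℤ)) : Set F), ∫ y, φ y * (ψ (x * y + t * x ^ 2) : ℂ) ∂haarF F ∂haarF F := by
    rw [← setIntegral_eq_integral_of_forall_compl_eq_zero (s := (P F (-(M : ℤ)) : Set F))]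
    · refine setIntegral_congr_fun (measurableSet_P _) fun x _ => ?_
      rw [fourier, ← integral_mul_const]
      simp only [psi_add, mul_assoc]
    · intro x hx
      rw [fourier_eq_zero hψ hM₁ (fun h => hx (P_mono (by omega) h)), zero_mul]
  rw [e2, integral_integral_swap]
  · rw [← integral_const_mul]
    congr 1
    funext y
    by_cases hy : y ∈ P F M₂
    · rw [integral_const_mul]
      have h5 : -(2 * ϖ * y) ∈ P F (-(M : ℤ)) := by
        refine neg_mem (P_mono ?_ (mul_mem_P (mul_mem_P (shell_subset_P (two_mem_shell hq))
          (shell_subset_P hϖ)) hy))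
        omega
      have h6 := setIntegral_add (measurableSet_P (-(M : ℤ))) (add_mem_P_iff h5)
        fun x => (ψ (t * x ^ 2) : ℂ)
      rw [integral_P_neg_psi_sq hq hψc hψ hϖ ht0] at h6
      have h7 : ∫ x in P F (-(M : ℤ)), (ψ (x * y + t * x ^ 2) : ℂ) ∂haarF F =
          ψ (ϖ * y ^ 2) * quad ψ t := by
        rw [← h6, ← integral_const_mul]
        congr 1
        funext x
        rw [← psi_add]
        congr 2
        rw [ht]
        field_simp
        ring
      rw [h7]
      ring
    · simp [hM₂ y hy]
  · have : IsFiniteMeasure ((haarF F).restrict (P F (-(M : ℤ)) : Set F)) :=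
      ⟨by simpa using (haar_P_ne_top _).lt_top⟩
    have h7 : Integrable (fun p : F × F => φ p.2)
        (((haarF F).restrict (P F (-(M : ℤ)) : Set F)).prod (haarF F)) := hint.comp_snd _
    refine h7.mul_bdd (c := 1) ?_ (Filter.Eventually.of_forall fun p => (norm_psi _).le)
    exact ((measurable_psi hψc).comp (by fun_prop :
      Measurable fun p : F × F => p.1 * p.2 + t * p.1 ^ 2)).aestronglyMeasurable

include hq hψc hψ hϖ in
/-- The normalized Gauss integral is the Weil constant. -/
theorem isWeilConstant_quad :
    IsWeilConstant ψ ϖ ((resCard F : ℂ) ^ (1 / 2 : ℂ) * quad ψ ϖ⁻¹) := by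
  intro φ h1 h2
  have h4 : (4 : F) ∈ shell F 0 := by
    have := shell_mul (two_mem_shell hq) (two_mem_shell hq)
    norm_num at this
    exact this
  have h2ϖ := shell_mul (two_mem_shell hq) hϖ
  rw [integral_fourier_mul hq hψc hψ hϖ h1 h2, absF_cpow h2ϖ.1, h2ϖ.2]
  have e1 : -(4 * ϖ)⁻¹ = (-1 * 4⁻¹) * ϖ⁻¹ := by rw [mul_inv]; ring
  have hinv : ϖ⁻¹ ∈ shell F (-1) := shell_inv hϖ
  have h4i : (4 : F)⁻¹ ∈ shell F 0 := by simpa using shell_inv h4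
  have hchi4 : chi ϖ (4 : F)⁻¹ = 1 := by
    have := chi_mul_sq ϖ 1 (inv_ne_zero (two_mem_shell hq).1)
    rw [chi_one, one_mul] at this
    rw [← this]; congr 1; norm_num
  rw [e1, quad_unit_mul hq hψ hϖ hinv (by simpa using shell_mul neg_one_mem_shell h4i),
    chi_mul hq hϖ (by simp) h4i.1, hchi4, mul_one]
  have e2 : -((0 + 1 : ℤ) : ℂ) * -(1 / 2) = 1 / 2 := by push_cast; ring
  rw [e2]
  have e3 := quad_sq hq hψ hϖ hinv
  have e4 := chi_mul_self ϖ (-1)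
  have e5 := resCard_cpow_half_mul_self (F := F)
  have e6 : (resCard F : ℂ) * (resCard F : ℂ)⁻¹ = 1 := mul_inv_cancel₀ (resCard_ne_zero F)
  set I := ∫ x, φ x * (ψ (ϖ * x ^ 2) : ℂ) ∂haarF F
  set a := (resCard F : ℂ) ^ (1 / 2 : ℂ)
  set g := quad ψ ϖ⁻¹
  set c := chi ϖ (-1)
  -- What is needed is `a² c g² = 1`, and this follows from `a² = q`, `g² = c q⁻¹` and `c² = 1`.
  linear_combination -(a * a * c * I) * e3 - (a * a * (resCard F : ℂ)⁻¹ * I) * e4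
    - ((resCard F : ℂ)⁻¹ * I) * e5 - I * e6

include hq hψc hψ hϖ in
-- The defining identity determines the constant as soon as one test function has a non-zero left
-- side. The indicator function of the ring of integers has left side `1`.
theorem weilConstant_eq :
    weilConstant ψ ϖ = (resCard F : ℂ) ^ (1 / 2 : ℂ) * quad ψ ϖ⁻¹ := by
  have h0 := isWeilConstant_quad hq hψc hψ hϖ
  have h1 : IsWeilConstant ψ ϖ (weilConstant ψ ϖ) := Classical.epsilon_spec ⟨_, h0⟩
  set φ : F → ℂ := (P F 0 : Set F).indicator fun _ => 1 with hφ
  have hlc : IsLocallyConstant φ := by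
    rw [IsLocallyConstant.iff_exists_open]
    intro x
    by_cases hx : x ∈ P F 0
    · exact ⟨P F 0, isOpen_P 0, hx, fun y hy => by
        rw [hφ, Set.indicator_of_mem hy, Set.indicator_of_mem (show x ∈ (P F 0 : Set F) from hx)]⟩
    · exact ⟨(P F 0 : Set F)ᶜ, (isClosed_P 0).isOpen_compl, hx, fun y hy => by
        rw [hφ, Set.indicator_of_notMem hy, Set.indicator_of_notMem (show x ∉ (P F 0 : Set F) from hx)]⟩
  have hcs : HasCompactSupport φ := HasCompactSupport.intro (isCompact_P 0) fun x hx =>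
    Set.indicator_of_notMem hx _
  have hI : ∫ x, φ x * (ψ (ϖ * x ^ 2) : ℂ) ∂haarF F = 1 := by
    have : (fun x => φ x * (ψ (ϖ * x ^ 2) : ℂ)) =
        (P F 0 : Set F).indicator fun x => (ψ (ϖ * x ^ 2) : ℂ) := by
      funext x
      by_cases hx : x ∈ (P F 0 : Set F)
      · rw [hφ, Set.indicator_of_mem hx, Set.indicator_of_mem hx, one_mul]
      · rw [hφ, Set.indicator_of_notMem hx, Set.indicator_of_notMem hx, zero_mul]
    rw [this, integral_indicator (measurableSet_P 0)]
    exact quad_of_mem hψ (mem_P_of_le (by rw [hϖ.2]; omega))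
  have e0 := h0 φ hlc hcs
  have e1 := h1 φ hlc hcs
  rw [hI, mul_assoc] at e0 e1
  have hne := right_ne_zero_of_mul_eq_one e0.symm
  exact mul_right_cancel₀ hne (e1.symm.trans e0)

include hq hψc hψ hϖ in
-- This relation reduces the powers of the Weil constant that arise from Gauss integrals to signs
-- `χ(-1)`, with a single factor left for each index.
theorem weilConstant_sq : weilConstant ψ ϖ ^ 2 = chi ϖ (-1) := by
  rw [weilConstant_eq hq hψc hψ hϖ, mul_pow, quad_sq hq hψ hϖ (shell_inv hϖ), sq,
    resCard_cpow_half_mul_self, mul_left_comm, mul_inv_cancel₀ (resCard_ne_zero F), mul_one]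

include hq hψc hψ hϖ in
open Classical in
-- Each replacement of `t` by `t ϖ²` costs a factor `q⁻¹` while `ord t ≤ -2`. The process ends with
-- `ord t = -1`, where a Gauss sum appears, or with `t` integral, where the value is `1`; the parity
-- of `ord t` decides which.
theorem quad_eq {t : F} (ht : t ≠ 0) :
    quad ψ t = (resCard F : ℂ) ^ (((min (ord t) 0 : ℤ) : ℂ) / 2) *
      if ord t < 0 ∧ Odd (ord t) then chi ϖ (-t) * weilConstant ψ ϖ else 1 := by
  obtain ⟨k, hk⟩ : ∃ k : ℕ, -ord t ≤ k := ⟨(ord t).natAbs, by omega⟩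
  induction k using Nat.strong_induction_on generalizing t with
  | _ k ih =>
  rcases lt_trichotomy (ord t) (-1) with h | h | h
  · have hsq := pow_ne_zero 2 hϖ.1
    have h1 : ord (t * ϖ ^ 2) = ord t + 2 := by rw [ord_mul ht hsq, ord_pow, hϖ.2]; norm_num
    have h2 := ih (k - 2) (by omega) (mul_ne_zero ht hsq) (by omega)
    rw [quad_step hq hψc hψ hϖ ht (by omega), h2, h1, ← neg_mul, chi_mul_sq _ _ hϖ.1]
    have h3 : Odd (ord t + 2) ↔ Odd (ord t) := by
      rw [Int.odd_add]; simp
    have h4 : (ord t + 2 < 0 ∧ Odd (ord t + 2)) ↔ (ord t < 0 ∧ Odd (ord t)) := by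
      rw [h3]
      constructor
      · exact fun h5 => ⟨by omega, h5.2⟩
      · rintro ⟨h5, j, hj⟩
        exact ⟨by omega, j, hj⟩
    rw [← mul_assoc]
    congr 1
    · rw [min_eq_left (by omega), min_eq_left (by omega), ← Complex.cpow_neg_one,
        ← resCard_cpow_add]
      congr 1; push_cast; ring
    · simp only [h4]
  · have hs : t ∈ shell F (-1) := ⟨ht, h⟩
    have hu : t * ϖ ∈ shell F 0 := shell_mul hs hϖ
    have e1 : t = t * ϖ * ϖ⁻¹ := by field_simp [hϖ.1]
    rw [if_pos ⟨by omega, by rw [h]; decide⟩, weilConstant_eq hq hψc hψ hϖ, h]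
    conv_lhs => rw [e1]
    rw [quad_unit_mul hq hψ hϖ (shell_inv hϖ) hu, mul_comm t ϖ, chi_self_mul hϖ.1]
    have e2 : (resCard F : ℂ) ^ (((min (-1) 0 : ℤ) : ℂ) / 2) * (resCard F : ℂ) ^ (1 / 2 : ℂ) = 1 := by
      rw [← resCard_cpow_add]; norm_num
    linear_combination -(chi ϖ (-t) * quad ψ ϖ⁻¹) * e2
  · rw [if_neg (by omega), quad_of_mem hψ (mem_P_of_le (by omega)), min_eq_right (by omega)]
    simp

include hq hψc hψ in
/-- The Gauss integral of a binary quadratic form that is unimodular and isotropic. -/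
theorem integral_hyperbolic {t α β γ : F} (ht : t ≠ 0) (hα : α ∈ P F 1) (hβ : β ∈ shell F 0)
    (hγ : γ ∈ P F 0) :
    ∫ y in P F 0, ∫ x in P F 0, (ψ (t * (α * x ^ 2 + 2 * β * x * y + γ * y ^ 2)) : ℂ)
      ∂haarF F ∂haarF F = (resCard F : ℂ) ^ (min (ord t) 0) := by
  -- The root is `z = -γ / (2β + w)`, with `w ∈ 𝔭` a root of `w² + 2βw + αγ` supplied by Hensel's
  -- lemma. This avoids a division by `α`, which may be zero.
  obtain ⟨z, hz, hroot⟩ : ∃ z ∈ P F 0, α * z ^ 2 + 2 * β * z + γ = 0 := by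
    have hαm : α ∈ 𝒪[F] := mem_P_zero.mp (P_mono (by omega) hα)
    have hβm : β ∈ 𝒪[F] := mem_P_zero.mp (shell_subset_P hβ)
    have hγm : γ ∈ 𝒪[F] := mem_P_zero.mp hγ
    have h2β : 2 * β ∈ shell F 0 := shell_mul (two_mem_shell hq) hβ
    obtain ⟨w, hw, hw1⟩ := exists_root_quadratic (⟨2 * β, mem_P_zero.mp (shell_subset_P h2β)⟩ : 𝒪[F])
      (⟨α, hαm⟩ * ⟨γ, hγm⟩) 0 (by simpa using mul_mem_P hα hγ) (by simpa using h2β)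
    have hw2 : (w : F) ∈ P F 1 := by simpa using hw1
    have hs : 2 * β + w ∈ shell F 0 := shell_add h2β (by simpa using hw2)
    have hs0 := hs.1
    have e := congrArg Subtype.val hw
    simp only [Subring.coe_add, Subring.coe_pow, Subring.coe_mul, Subring.coe_zero] at e
    have e : (w : F) ^ 2 + 2 * β * w + α * γ = 0 := e
    refine ⟨-γ * (2 * β + w)⁻¹, by
      simpa using mul_mem_P (neg_mem hγ) (shell_subset_P (shell_inv hs)), ?_⟩
    field_simp
    linear_combination γ * e
  set β' := β + α * z with hβ'
  have hs : 2 * β' ∈ shell F 0 := shell_mul (two_mem_shell hq)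
    (shell_add hβ (by simpa using mul_mem_P hα hz))
  have hinner : ∀ y ∈ (P F 0 : Set F),
      ∫ x in P F 0, (ψ (t * (α * x ^ 2 + 2 * β * x * y + γ * y ^ 2)) : ℂ) ∂haarF F =
      ∫ x in P F 0, (ψ (t * α * x ^ 2 + t * (2 * β') * x * y) : ℂ) ∂haarF F := by
    intro y hy
    have hzy : z * y ∈ P F 0 := by simpa using mul_mem_P hz hy
    rw [← setIntegral_add (measurableSet_P 0) (add_mem_P_iff hzy)]
    refine setIntegral_congr_fun (measurableSet_P 0) fun x _ => ?_
    congr 2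
    rw [hβ']
    linear_combination t * y ^ 2 * hroot
  rw [setIntegral_congr_fun (measurableSet_P 0) hinner, integral_integral_swap]
  · have h1 : ∀ x ∈ (P F 0 : Set F),
        ∫ y in P F 0, (ψ (t * α * x ^ 2 + t * (2 * β') * x * y) : ℂ) ∂haarF F =
        (P F (-min (ord t) 0) : Set F).indicator (fun _ => 1) x := by
      intro x hx
      simp only [psi_add]
      rw [integral_const_mul, integral_psi hψ]
      have hts : t * (2 * β') ∈ shell F (ord t) := by
        simpa using shell_mul (⟨ht, rfl⟩ : t ∈ shell F (ord t)) hs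
      have hiff : t * (2 * β') * x ∈ P F (-0) ↔ x ∈ P F (-min (ord t) 0) := by
        rw [mul_mem_P_iff hts.1, hts.2]
        rcases eq_or_ne x 0 with rfl | hx0
        · simp
        have := (mem_P_iff hx0).mp hx
        rw [mem_P_iff hx0, mem_P_iff hx0]
        omega
      by_cases hxx : x ∈ P F (-min (ord t) 0)
      · rw [if_pos (hiff.mpr hxx), Set.indicator_of_mem (show x ∈ (_ : Set F) from hxx)]
        have : t * α * x ^ 2 ∈ P F 0 := by
          have := mul_mem_P (mul_mem_P (mul_mem_P (mem_P_of_le (le_refl (ord t))) hα) hxx) hx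
          rw [sq, ← mul_assoc]
          exact P_mono (by omega) this
        rw [psi_eq_one hψ this]; simp
      · rw [if_neg (mt hiff.mp hxx), Set.indicator_of_notMem (show x ∉ (_ : Set F) from hxx), mul_zero]
    rw [setIntegral_congr_fun (measurableSet_P 0) h1, setIntegral_indicator (measurableSet_P _)]
    have h2 : (P F 0 : Set F) ∩ P F (-min (ord t) 0) = P F (-min (ord t) 0) :=
      Set.inter_eq_right.mpr fun x hx => P_mono (by omega) hx
    rw [h2, setIntegral_const, haar_real_P, neg_neg]
    simp
  · have : IsFiniteMeasure ((haarF F).restrict (P F 0 : Set F)) :=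
      ⟨by simpa using (haar_P_ne_top _).lt_top⟩
    refine Integrable.of_bound (C := 1) ?_ (Filter.Eventually.of_forall fun p => (norm_psi _).le)
    exact ((measurable_psi hψc).comp (by fun_prop :
      Measurable fun p : F × F => t * α * p.2 ^ 2 + t * (2 * β') * p.2 * p.1)).aestronglyMeasurable

end Weil

/-! ### Integral matrices and diagonalization by integral congruence. -/

section IntegralMatrices

variable {F : Type*} [Field F] [ValuativeRel F] [TopologicalSpace F]
  [IsNonarchimedeanLocalField F] {ι κ l : Type*}

/-- All entries of the matrix `M` lie in `𝔭 ^ a`. -/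
def MemP (a : ℤ) (M : Matrix ι κ F) : Prop := ∀ i j, M i j ∈ P F a

theorem MemP.mul [Fintype κ] {a b : ℤ} {M : Matrix ι κ F} {N : Matrix κ l F} (hM : MemP a M)
    (hN : MemP b N) : MemP (a + b) (M * N) := fun i j =>
  sum_mem fun k _ => mul_mem_P (hM i k) (hN k j)

theorem MemP.mul₀ [Fintype κ] {a : ℤ} {M : Matrix ι κ F} {N : Matrix κ l F} (hM : MemP a M)
    (hN : MemP 0 N) : MemP a (M * N) := by simpa using hM.mul hN

theorem MemP.mul₀' [Fintype κ] {a : ℤ} {M : Matrix ι κ F} {N : Matrix κ l F} (hM : MemP 0 M)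
    (hN : MemP a N) : MemP a (M * N) := by simpa using hM.mul hN

theorem MemP.add {a : ℤ} {M N : Matrix ι κ F} (hM : MemP a M) (hN : MemP a N) : MemP a (M + N) :=
  fun i j => add_mem (hM i j) (hN i j)

theorem MemP.neg {a : ℤ} {M : Matrix ι κ F} (hM : MemP a M) : MemP a (-M) :=
  fun i j => neg_mem (hM i j)

theorem MemP.transpose {a : ℤ} {M : Matrix ι κ F} (hM : MemP a M) : MemP a Mᵀ :=
  fun i j => hM j i

theorem MemP.mono {a b : ℤ} (h : a ≤ b) {M : Matrix ι κ F} (hM : MemP b M) : MemP a M :=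
  fun i j => P_mono h (hM i j)

theorem memP_zero (a : ℤ) : MemP a (0 : Matrix ι κ F) := fun _ _ => zero_mem _

theorem memP_diagonal [DecidableEq ι] {a : ℤ} {d : ι → F} (h : ∀ i, d i ∈ P F a) :
    MemP a (Matrix.diagonal d) := by
  intro i j
  rw [Matrix.diagonal_apply]
  split_ifs
  exacts [h i, zero_mem _]

theorem memP_one [DecidableEq ι] : MemP 0 (1 : Matrix ι ι F) := memP_diagonal fun _ => one_mem_P

theorem MemP.exists_lift {M : Matrix ι κ F} (hM : MemP 0 M) :
    ∃ M' : Matrix ι κ 𝒪[F], M = M'.map (algebraMap 𝒪[F] F) :=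
  ⟨Matrix.of fun i j => ⟨M i j, mem_P_zero.mp (hM i j)⟩, rfl⟩

variable [Fintype ι] [DecidableEq ι]

theorem MemP.det {M : Matrix ι ι F} (hM : MemP 0 M) : M.det ∈ P F 0 := by
  obtain ⟨M', rfl⟩ := hM.exists_lift
  rw [← RingHom.mapMatrix_apply, ← RingHom.map_det, mem_P_zero]
  exact M'.det.2

theorem MemP.inv {M : Matrix ι ι F} (hM : MemP 0 M) (h : M.det ∈ shell F 0) : MemP 0 M⁻¹ := by
  obtain ⟨M', rfl⟩ := hM.exists_lift
  intro i j
  rw [Matrix.inv_def, Ring.inverse_eq_inv', Matrix.smul_apply, smul_eq_mul,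
    ← RingHom.mapMatrix_apply, ← RingHom.map_adjugate]
  have := mul_mem_P (shell_subset_P (shell_inv h))
    (mem_P_zero.mpr (M'.adjugate i j).2)
  rw [neg_zero, add_zero] at this
  exact this

theorem MemP.det_sub {M N : Matrix ι ι F} (hM : MemP 0 M) (hN : MemP 0 N) (h : MemP 1 (M - N)) :
    M.det - N.det ∈ P F 1 := by
  obtain ⟨M', rfl⟩ := hM.exists_lift
  obtain ⟨N', rfl⟩ := hN.exists_lift
  have h1 : IsLocalRing.residue 𝒪[F] M'.det = IsLocalRing.residue 𝒪[F] N'.det := by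
    rw [RingHom.map_det, RingHom.map_det]
    congr 1
    ext i j
    simp only [RingHom.mapMatrix_apply, Matrix.map_apply]
    rw [residue_eq]
    exact h i j
  rw [residue_eq] at h1
  rwa [← RingHom.mapMatrix_apply, ← RingHom.mapMatrix_apply, ← RingHom.map_det, ← RingHom.map_det]

theorem det_mem_shell {M N : Matrix ι ι F} (hM : MemP 0 M) (hN : MemP 0 N)
    (h : M.det * N.det ∈ shell F 0) : M.det ∈ shell F 0 := by
  have h1 := left_ne_zero_of_mul h.1
  have h2 := right_ne_zero_of_mul h.1
  have h3 := (mem_P_iff h1).mp hM.det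
  have h4 := (mem_P_iff h2).mp hN.det
  have h5 := h.2
  rw [ord_mul h1 h2] at h5
  exact ⟨h1, by omega⟩

/-- Congruence of matrices over the ring of integers. -/
def IntCongr (X Y : Matrix ι ι F) : Prop :=
  ∃ U U' : Matrix ι ι F, MemP 0 U ∧ MemP 0 U' ∧ U * U' = 1 ∧ Y = U * X * Uᵀ

theorem IntCongr.refl (X : Matrix ι ι F) : IntCongr X X :=
  ⟨1, 1, memP_one, memP_one, by simp, by simp⟩

theorem IntCongr.trans {X Y Z : Matrix ι ι F} (h : IntCongr X Y) (h' : IntCongr Y Z) :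
    IntCongr X Z := by
  obtain ⟨U, U', h1, h2, h3, rfl⟩ := h
  obtain ⟨V, V', k1, k2, k3, rfl⟩ := h'
  refine ⟨V * U, U' * V', k1.mul₀ h1, h2.mul₀ k2, ?_, ?_⟩
  · rw [Matrix.mul_assoc, ← Matrix.mul_assoc U, h3, Matrix.one_mul, k3]
  · simp only [Matrix.transpose_mul, Matrix.mul_assoc]

theorem IntCongr.isSymm {X Y : Matrix ι ι F} (h : IntCongr X Y) (hX : X.IsSymm) : Y.IsSymm := by
  obtain ⟨U, U', h1, h2, h3, rfl⟩ := h
  rw [Matrix.IsSymm, Matrix.transpose_mul, Matrix.transpose_mul, hX.eq, Matrix.transpose_transpose,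
    Matrix.mul_assoc]

/-- The elementary operation that subtracts multiples of the `i`-th row from the other rows. -/
theorem intCongr_elementary (Y : Matrix ι ι F) (i : ι) {c : ι → F} (hc : ∀ k, c k ∈ P F 0)
    (hi : c i = 0) :
    IntCongr Y (Matrix.of fun k l => Y k l - c k * Y i l - c l * Y k i + c k * c l * Y i i) := by
  have hv : MemP 0 (Matrix.vecMulVec c (Pi.single i 1)) := by
    intro k l
    rw [Matrix.vecMulVec_apply]
    simpa using mul_mem_P (hc k) (b := 0) (y := (Pi.single i 1 : ι → F) l) (by
      rw [Pi.single_apply]; split_ifs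
      exacts [one_mem_P, zero_mem _])
  refine ⟨1 + -Matrix.vecMulVec c (Pi.single i 1), 1 + Matrix.vecMulVec c (Pi.single i 1),
    memP_one.add hv.neg, memP_one.add hv, ?_, ?_⟩
  · have : Matrix.vecMulVec c (Pi.single i 1) * Matrix.vecMulVec c (Pi.single i 1) = 0 := by
      rw [Matrix.vecMulVec_mul_vecMulVec]
      simp [hi]
    rw [add_mul, mul_add, mul_add, neg_mul, neg_mul, this]
    simp
  · have h1 : Matrix.vecMulVec c (Pi.single i 1) * Y = Matrix.of fun k l => c k * Y i l := by
      ext k l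
      simp [Matrix.mul_apply, Matrix.vecMulVec_apply, Pi.single_apply]
    have h2 : ∀ Z : Matrix ι ι F, Z * (Matrix.vecMulVec c (Pi.single i 1))ᵀ =
        Matrix.of fun k l => Z k i * c l := by
      intro Z
      ext k l
      simp [Matrix.mul_apply, Matrix.vecMulVec_apply, Pi.single_apply]
    rw [add_mul, one_mul, neg_mul, h1, Matrix.transpose_add, Matrix.transpose_one,
      Matrix.transpose_neg, mul_add, mul_one, mul_neg, h2]
    ext k l
    simp only [Matrix.of_apply, Matrix.add_apply, Matrix.neg_apply]
    ring

theorem exists_min_entry {Y : Matrix ι ι F} {T : Finset ι}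
    (h : ∃ i ∈ T, ∃ j ∈ T, Y i j ≠ 0) :
    ∃ i ∈ T, ∃ j ∈ T, Y i j ≠ 0 ∧ ∀ k ∈ T, ∀ l ∈ T, Y k l ∈ P F (ord (Y i j)) := by
  classical
  obtain ⟨i, hi, j, hj, hij⟩ := h
  obtain ⟨p, hp, hmin⟩ := Finset.exists_min_image
    ((T ×ˢ T).filter fun p => Y p.1 p.2 ≠ 0) (fun p => ord (Y p.1 p.2))
    ⟨(i, j), by simp [hi, hj, hij]⟩
  simp only [Finset.mem_filter, Finset.mem_product] at hp hmin
  refine ⟨p.1, hp.1.1, p.2, hp.1.2, hp.2, fun k hk l hl => ?_⟩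
  by_cases h0 : Y k l = 0
  · rw [h0]; exact zero_mem _
  · exact mem_P_of_le (hmin (k, l) ⟨⟨hk, hl⟩, h0⟩)

/-- If no diagonal entry outside `S` attains the minimal order, it is attained off the diagonal, at
`(i, j)`. Adding row and column `j` to row and column `i` then gives the diagonal entry `2 Y i j + Y
i i + Y j j`, which has minimal order since `2` is a unit. -/
theorem exists_min_diagonal (hq : Odd (resCard F)) {Y : Matrix ι ι F} (hY : Y.IsSymm) {S : Finset ι}
    (hS : ∀ i ∈ S, ∀ k, k ≠ i → Y i k = 0) (h : ∃ i ∉ S, ∃ j ∉ S, Y i j ≠ 0) :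
    ∃ Y', IntCongr Y Y' ∧ (∀ i ∈ S, ∀ k, k ≠ i → Y' i k = 0) ∧
      ∃ i ∉ S, Y' i i ≠ 0 ∧ ∀ k ∉ S, Y' k i ∈ P F (ord (Y' i i)) := by
  obtain ⟨i, hi, j, hj, hij⟩ := h
  obtain ⟨i, hi, j, hj, h0, hmin⟩ := exists_min_entry (Y := Y) (T := Sᶜ)
    ⟨i, by simpa using hi, j, by simpa using hj, hij⟩
  simp only [Finset.mem_compl] at hi hj hmin
  by_cases hd : ∃ k ∉ S, Y k k ∈ shell F (ord (Y i j))
  · obtain ⟨k, hk, hkk⟩ := hd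
    exact ⟨Y, .refl Y, hS, k, hk, hkk.1, fun m hm => by rw [hkk.2]; exact hmin m hm k hk⟩
  push Not at hd
  have hd' : ∀ k ∉ S, Y k k ∈ P F (ord (Y i j) + 1) := fun k hk => by
    by_contra h
    exact hd k hk (mem_shell_iff.mpr ⟨hmin k hk k hk, h⟩)
  have hne : i ≠ j := by
    rintro rfl
    exact hd i hi ⟨h0, rfl⟩
  have hsym : ∀ a b, Y a b = Y b a := fun a b => hY.apply b a
  set c : ι → F := Pi.single i (-1) with hc
  have hci : c i = -1 := by simp [hc]
  have hcne : ∀ k, k ≠ i → c k = 0 := fun k hk => by simp [hc, hk]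
  have hcP : ∀ k, c k ∈ P F 0 := fun k => by
    by_cases hk : k = i
    · rw [hk, hci]; exact shell_subset_P neg_one_mem_shell
    · rw [hcne k hk]; exact zero_mem _
  refine ⟨_, intCongr_elementary Y j hcP (hcne j hne.symm), ?_, i, hi, ?_⟩
  · intro k hk m hm
    have hki : k ≠ i := fun h => hi (h ▸ hk)
    have hkj : j ≠ k := fun h => hj (h ▸ hk)
    simp [hS k hk m hm, hcne k hki, hS k hk j hkj]
  · have h2 : 2 * Y i j ∈ shell F (ord (Y i j)) := by
      simpa using shell_mul (two_mem_shell hq) (⟨h0, rfl⟩ : Y i j ∈ shell F (ord (Y i j)))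
    have h3 : 2 * Y i j + (Y i i + Y j j) ∈ shell F (ord (Y i j)) :=
      shell_add h2 (add_mem (hd' i hi) (hd' j hj))
    have h4 : (Matrix.of fun k l => Y k l - c k * Y j l - c l * Y k j + c k * c l * Y j j) i i =
        2 * Y i j + (Y i i + Y j j) := by
      simp only [Matrix.of_apply, hci, hsym j i]; ring
    rw [h4]
    refine ⟨h3.1, fun k hk => ?_⟩
    rw [h3.2]
    have h5 : ∀ x y, x ∈ P F 0 → y ∈ P F (ord (Y i j)) → x * y ∈ P F (ord (Y i j)) :=
      fun x y hx hy => by simpa using mul_mem_P hx hy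
    simp only [Matrix.of_apply]
    refine add_mem (sub_mem (sub_mem (hmin k hk i hi) (h5 _ _ (hcP k) (hmin j hj i hi)))
      (h5 _ _ (hcP i) (hmin k hk j hj))) (h5 _ _ ?_ (hmin j hj j hj))
    simpa using mul_mem_P (hcP k) (hcP i)

/-- The set `S` collects the indices already split off. A diagonal entry of minimal order divides
its column over the integers, so that column can be cleared without disturbing `S`. -/
theorem exists_diagonalize_step (hq : Odd (resCard F)) {X : Matrix ι ι F} (hX : X.IsSymm) (m : ℕ)
    (hm : m ≤ Fintype.card ι) :
    ∃ Y, IntCongr X Y ∧ ∃ S : Finset ι, S.card = m ∧ ∀ i ∈ S, ∀ k, k ≠ i → Y i k = 0 := by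
  induction m with
  | zero => exact ⟨X, .refl X, ∅, rfl, by simp⟩
  | succ m ih =>
    obtain ⟨Y, hXY, S, hS, h⟩ := ih (by omega)
    have hY := hXY.isSymm hX
    by_cases hall : ∃ i ∉ S, ∃ j ∉ S, Y i j ≠ 0
    · obtain ⟨Y', hYY', h', i, hi, h0, hmin⟩ := exists_min_diagonal hq hY h hall
      have hY' := hYY'.isSymm hY
      have hsym : ∀ a b, Y' a b = Y' b a := fun a b => hY'.apply b a
      set c : ι → F := fun k => if k ∈ S ∨ k = i then 0 else Y' k i / Y' i i with hc
      have hcS : ∀ k ∈ S, c k = 0 := fun k hk => by simp [hc, hk]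
      have hci : c i = 0 := by simp [hc]
      have hcP : ∀ k, c k ∈ P F 0 := by
        intro k
        by_cases hk : k ∈ S ∨ k = i
        · simp only [hc, if_pos hk]; exact zero_mem _
        · simp only [hc, if_neg hk, div_eq_mul_inv]
          push Not at hk
          simpa using mul_mem_P (hmin k hk.1) (mem_P_of_le (le_refl (ord (Y' i i)⁻¹)))
      refine ⟨_, (hXY.trans hYY').trans (intCongr_elementary Y' i hcP hci), insert i S,
        by rw [Finset.card_insert_of_notMem hi, hS], ?_⟩
      intro a ha k hk
      rw [Finset.mem_insert] at ha
      rcases ha with rfl | ha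
      · simp only [Matrix.of_apply, hci]
        by_cases hkS : k ∈ S
        · have : Y' a k = 0 := by rw [hsym]; exact h' k hkS a hk.symm
          simp [this, hcS k hkS]
        · have : c k = Y' k a / Y' a a := by simp [hc, hkS, hk]
          rw [this, hsym a k]; field_simp; ring
      · have hia : i ≠ a := fun h => hi (h ▸ ha)
        simp [h' a ha k hk, h' a ha i hia, hcS a ha]
    -- The part outside `S` is zero, so any further index is already split off.
    · push Not at hall
      have hlt : S.card < Fintype.card ι := by omega
      obtain ⟨i, hi⟩ : ∃ i, i ∉ S := by
        by_contra hcon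
        push Not at hcon
        rw [Finset.eq_univ_of_forall hcon, Finset.card_univ] at hlt
        omega
      refine ⟨Y, hXY, insert i S, by rw [Finset.card_insert_of_notMem hi, hS], ?_⟩
      intro a ha k hk
      rw [Finset.mem_insert] at ha
      rcases ha with rfl | ha
      · by_cases hkS : k ∈ S
        · rw [← hY.apply]; exact h k hkS a hk.symm
        · exact hall a hi k hkS
      · exact h a ha k hk

/-- Over a local field of odd residue characteristic, symmetric matrices can be diagonalized by
congruence over the ring of integers. -/
theorem exists_diagonalize (hq : Odd (resCard F)) {X : Matrix ι ι F} (hX : X.IsSymm) :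
    ∃ (A A' : Matrix ι ι F) (d : ι → F), MemP 0 A ∧ MemP 0 A' ∧ A * A' = 1 ∧
      X = A * Matrix.diagonal d * Aᵀ := by
  obtain ⟨Y, ⟨U, U', h1, h2, h3, rfl⟩, S, hS, h⟩ := exists_diagonalize_step hq hX _ le_rfl
  have hSu : S = Finset.univ := Finset.eq_univ_of_card S hS
  subst hSu
  have h4 := mul_eq_one_comm.mp h3
  have hd : Matrix.diagonal (fun i => (U * X * Uᵀ) i i) = U * X * Uᵀ := by
    ext i j
    by_cases hij : i = j
    · subst hij; simp
    · rw [Matrix.diagonal_apply_ne _ hij, h i (Finset.mem_univ _) j (Ne.symm hij)]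
  refine ⟨U', U, fun i => (U * X * Uᵀ) i i, h2, h1, h4, ?_⟩
  rw [hd]
  have h5 : Uᵀ * U'ᵀ = 1 := by rw [← Matrix.transpose_mul, h4, Matrix.transpose_one]
  calc X = (U' * U) * X * (Uᵀ * U'ᵀ) := by rw [h4, h5, Matrix.one_mul, Matrix.mul_one]
    _ = _ := by simp only [Matrix.mul_assoc]

/-- Moving the integral diagonal entries to the last `j` places matches them with the coordinates in
which `w_j` is not the identity. -/
theorem exists_diagonalize_sorted (hq : Odd (resCard F)) {n : ℕ} {X : Matrix (Fin n) (Fin n) F}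
    (hX : X.IsSymm) :
    ∃ (A A' : Matrix (Fin n) (Fin n) F) (d : Fin n → F) (j : ℕ), MemP 0 A ∧ MemP 0 A' ∧ A * A' = 1 ∧
      X = A * Matrix.diagonal d * Aᵀ ∧ j ≤ n ∧ ∀ i : Fin n, d i ∈ P F 0 ↔ n ≤ i + j := by
  classical
  obtain ⟨A, A', d, h1, h2, h3, h4⟩ := exists_diagonalize hq hX
  -- An increasing rearrangement of this indicator puts the non-integral entries before the integral
  -- ones.
  let f : Fin n → ℕ := fun i => if d i ∈ P F 0 then 1 else 0
  have hf : ∀ i, d i ∈ P F 0 ↔ f i = 1 := fun i => by simp [f]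
  have hmono := Tuple.monotone_sort f
  set τ := Tuple.sort f
  obtain ⟨j, hj, hj'⟩ : ∃ j ≤ n, ∀ i : Fin n, f (τ i) = 1 ↔ n ≤ i + j := by
    by_cases hex : ∃ k : ℕ, ∃ hk : k < n, f (τ ⟨k, hk⟩) = 1
    · obtain ⟨hk, hk1⟩ := Nat.find_spec hex
      refine ⟨n - Nat.find hex, by omega, fun i => ⟨fun hi => ?_, fun hi => ?_⟩⟩
      · have := Nat.find_min' hex ⟨i.2, hi⟩
        omega
      · have h5 : f (τ ⟨_, hk⟩) ≤ f (τ i) := hmono (by rw [Fin.le_def]; simp only; omega)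
        have h6 : f (τ i) ≤ 1 := by simp only [f]; split_ifs <;> simp
        omega
    · push Not at hex
      exact ⟨0, by omega, fun i => ⟨fun hi => absurd hi (hex i i.2), fun hi => by omega⟩⟩
  refine ⟨A.submatrix id τ, A'.submatrix τ id, d ∘ τ, j, fun _ _ => h1 _ _, fun _ _ => h2 _ _,
    ?_, ?_, hj, fun i => by rw [← hj' i, ← hf]; rfl⟩
  · rw [Matrix.submatrix_mul_equiv, h3]; simp
  · have h5 : Matrix.diagonal (d ∘ τ) = (Matrix.diagonal d).submatrix τ τ := by
      ext a b; simp [Matrix.diagonal_apply]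
    rw [h5, Matrix.submatrix_mul_equiv, Matrix.transpose_submatrix, Matrix.submatrix_mul_equiv, ← h4]
    simp

end IntegralMatrices

/-! ### The function on symmetric matrices that represents `f_0` on the big cell. -/

section CellFn

variable {F : Type*} [Field F] [ValuativeRel F] [TopologicalSpace F]
  [IsNonarchimedeanLocalField F] {ι : Type*} [Fintype ι] [DecidableEq ι]

open Classical in
/-- The function `χ(det X) |det X|^{-s}` on the symmetric matrices with `X⁻¹ ≡ 0 mod 𝔭`. -/
def cellFn (ϖ : F) (s : ℂ) (X : Matrix ι ι F) : ℂ :=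
  if X.det ≠ 0 ∧ MemP 1 X⁻¹ then chi ϖ X.det * ((absF X.det : ℝ) : ℂ) ^ (-s) else 0

end CellFn

/-! ### Block computations in the symplectic group. -/

section Symplectic

variable {F : Type*} [Field F] {n : ℕ}

theorem symplectic_block (g : Matrix.symplecticGroup (Fin n) F) :
    g.1.toBlocks₂₂ * g.1.toBlocks₁₁ᵀ - g.1.toBlocks₂₁ * g.1.toBlocks₁₂ᵀ = 1 := by
  have h := SymplecticGroup.mem_iff.mp g.2
  rw [← Matrix.fromBlocks_toBlocks g.1, Matrix.J, Matrix.fromBlocks_transpose,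
    Matrix.fromBlocks_multiply, Matrix.fromBlocks_multiply, Matrix.fromBlocks_inj] at h
  simpa [sub_eq_add_neg, add_comm] using h.2.2.1

theorem symplectic_mul₂₁ (g k : Matrix.symplecticGroup (Fin n) F) :
    (g * k).1.toBlocks₂₁ =
      g.1.toBlocks₂₁ * k.1.toBlocks₁₁ + g.1.toBlocks₂₂ * k.1.toBlocks₂₁ := by
  have : (g * k).1 = g.1 * k.1 := rfl
  rw [this, ← Matrix.fromBlocks_toBlocks g.1, ← Matrix.fromBlocks_toBlocks k.1,
    Matrix.fromBlocks_multiply]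
  simp

theorem symplectic_mul₂₂ (g k : Matrix.symplecticGroup (Fin n) F) :
    (g * k).1.toBlocks₂₂ =
      g.1.toBlocks₂₁ * k.1.toBlocks₁₂ + g.1.toBlocks₂₂ * k.1.toBlocks₂₂ := by
  have : (g * k).1 = g.1 * k.1 := rfl
  rw [this, ← Matrix.fromBlocks_toBlocks g.1, ← Matrix.fromBlocks_toBlocks k.1,
    Matrix.fromBlocks_multiply]
  simp

theorem symplectic_inv (g : Matrix.symplecticGroup (Fin n) F) :
    (g⁻¹).1 = Matrix.fromBlocks g.1.toBlocks₂₂ᵀ (-g.1.toBlocks₁₂ᵀ) (-g.1.toBlocks₂₁ᵀ)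
      g.1.toBlocks₁₁ᵀ := by
  rw [SymplecticGroup.coe_inv]
  conv_lhs => rw [← Matrix.fromBlocks_toBlocks g.1]
  rw [Matrix.J, Matrix.fromBlocks_transpose, Matrix.neg_mul, Matrix.neg_mul,
    Matrix.fromBlocks_multiply, Matrix.fromBlocks_multiply, Matrix.fromBlocks_neg]
  simp

theorem diagonal_mem_symplectic {a b c d : Fin n → F} (h : ∀ i, a i * d i - b i * c i = 1) :
    Matrix.fromBlocks (Matrix.diagonal a) (Matrix.diagonal b) (Matrix.diagonal c)
      (Matrix.diagonal d) ∈ Matrix.symplecticGroup (Fin n) F := by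
  rw [SymplecticGroup.mem_iff, Matrix.J, Matrix.fromBlocks_transpose,
    Matrix.fromBlocks_multiply, Matrix.fromBlocks_multiply]
  simp only [Matrix.diagonal_transpose, Matrix.mul_zero, Matrix.mul_one, Matrix.mul_neg,
    zero_add, add_zero, Matrix.neg_mul, Matrix.diagonal_mul_diagonal]
  congr 1 <;> ext i j <;> by_cases hij : i = j
  · subst hij; simp; ring
  · simp [hij]
  · subst hij; simp; linear_combination -(h i)
  · simp [hij]
  · subst hij; simp; linear_combination h i
  · simp [hij]
  · subst hij; simp; ring
  · simp [hij]

/-- An element of `SL₂(F)ⁿ` as an element of `Sp_n(F)`. -/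
def diagSp (a b c d : Fin n → F) (h : ∀ i, a i * d i - b i * c i = 1) :
    Matrix.symplecticGroup (Fin n) F := ⟨_, diagonal_mem_symplectic h⟩

theorem levi_mem_symplectic {A A' : Matrix (Fin n) (Fin n) F} (h : A * A' = 1) :
    Matrix.fromBlocks A 0 0 A'ᵀ ∈ Matrix.symplecticGroup (Fin n) F := by
  have h' := mul_eq_one_comm.mp h
  rw [SymplecticGroup.mem_iff, Matrix.J, Matrix.fromBlocks_transpose,
    Matrix.fromBlocks_multiply, Matrix.fromBlocks_multiply]
  simp [h, ← Matrix.transpose_mul]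

/-- The element `diag(A, ᵗA⁻¹)` of the Levi subgroup. -/
def levi (A A' : Matrix (Fin n) (Fin n) F) (h : A * A' = 1) : Matrix.symplecticGroup (Fin n) F :=
  ⟨_, levi_mem_symplectic h⟩

end Symplectic

/-! ### Construction of `f_0` and its values on the big cell. -/

section BasisFn

variable {F : Type*} [Field F] [ValuativeRel F] [TopologicalSpace F]
  [IsNonarchimedeanLocalField F] {n : ℕ}

theorem inGamma_iff {g : Matrix.symplecticGroup (Fin n) F} :
    InGamma g ↔ MemP 0 g.1 ∧ MemP 1 g.1.toBlocks₂₁ := by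
  simp only [InGamma, MemP, mem_P_zero, mem_P_one]

theorem InGamma.memP₁₁ {g : Matrix.symplecticGroup (Fin n) F} (h : InGamma g) :
    MemP 0 g.1.toBlocks₁₁ := fun _ _ => (inGamma_iff.mp h).1 _ _

theorem InGamma.memP₁₂ {g : Matrix.symplecticGroup (Fin n) F} (h : InGamma g) :
    MemP 0 g.1.toBlocks₁₂ := fun _ _ => (inGamma_iff.mp h).1 _ _

theorem InGamma.memP₂₁ {g : Matrix.symplecticGroup (Fin n) F} (h : InGamma g) :
    MemP 1 g.1.toBlocks₂₁ := (inGamma_iff.mp h).2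

theorem InGamma.memP₂₂ {g : Matrix.symplecticGroup (Fin n) F} (h : InGamma g) :
    MemP 0 g.1.toBlocks₂₂ := fun _ _ => (inGamma_iff.mp h).1 _ _

theorem inGamma_of_blocks {g : Matrix.symplecticGroup (Fin n) F} (h₁₁ : MemP 0 g.1.toBlocks₁₁)
    (h₁₂ : MemP 0 g.1.toBlocks₁₂) (h₂₁ : MemP 1 g.1.toBlocks₂₁) (h₂₂ : MemP 0 g.1.toBlocks₂₂) :
    InGamma g := by
  rw [inGamma_iff]
  refine ⟨?_, h₂₁⟩
  rintro (i | i) (j | j)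
  exacts [h₁₁ i j, h₁₂ i j, P_mono (by omega) (h₂₁ i j), h₂₂ i j]

theorem InGamma.inv {g : Matrix.symplecticGroup (Fin n) F} (h : InGamma g) : InGamma g⁻¹ := by
  apply inGamma_of_blocks <;> rw [symplectic_inv] <;> simp
  exacts [h.memP₂₂.transpose, h.memP₁₂.transpose.neg, h.memP₂₁.transpose.neg, h.memP₁₁.transpose]

/-- Modulo `𝔭` the symplectic relation reads `D ᵗA = 1`. -/
theorem InGamma.det₂₂ {g : Matrix.symplecticGroup (Fin n) F} (h : InGamma g) :
    g.1.toBlocks₂₂.det ∈ shell F 0 := by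
  have h1 : MemP 1 (g.1.toBlocks₂₂ * g.1.toBlocks₁₁ᵀ - 1) := by
    rw [← symplectic_block g, sub_sub_cancel]
    exact h.memP₂₁.mul₀ h.memP₁₂.transpose
  have h2 := (h.memP₂₂.mul₀ h.memP₁₁.transpose).det_sub memP_one h1
  rw [Matrix.det_one] at h2
  have h3 := shell_add (m := 0) ⟨one_ne_zero, ord_one⟩ (by rwa [zero_add])
  rw [add_sub_cancel, Matrix.det_mul] at h3
  exact det_mem_shell h.memP₂₂ h.memP₁₁.transpose h3

open Classical in
/-- The section supported on `P Γ`. -/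
def bigSection (ϖ : F) (z : ℂ) (g : Matrix.symplecticGroup (Fin n) F) : ℂ :=
  if g.1.toBlocks₂₂.det ≠ 0 ∧ MemP 1 (g.1.toBlocks₂₂⁻¹ * g.1.toBlocks₂₁) then
    chi ϖ g.1.toBlocks₂₂.det * ((absF g.1.toBlocks₂₂.det : ℝ) : ℂ) ^ (-z) else 0

variable {ϖ : F} (hϖ : ϖ ∈ shell F 1) (hq : Odd (resCard F))

/-- Write the lower blocks of `g` as `D W` and `D` with `W ≡ 0 mod 𝔭`. The lower right block of the
product is `D` times an integral matrix congruent to that of `k`, and the new quotient is again `0`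
modulo `𝔭`. -/
theorem mul_gamma_blocks (g k : Matrix.symplecticGroup (Fin n) F) (hk : InGamma k)
    (h0 : g.1.toBlocks₂₂.det ≠ 0) (h1 : MemP 1 (g.1.toBlocks₂₂⁻¹ * g.1.toBlocks₂₁)) :
    ∃ δ ∈ shell F 0, δ - k.1.toBlocks₂₂.det ∈ P F 1 ∧
      (g * k).1.toBlocks₂₂.det = g.1.toBlocks₂₂.det * δ ∧
      MemP 1 ((g * k).1.toBlocks₂₂⁻¹ * (g * k).1.toBlocks₂₁) := by
  rw [symplectic_mul₂₁, symplectic_mul₂₂]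
  set C := g.1.toBlocks₂₁
  set D := g.1.toBlocks₂₂
  set W := D⁻¹ * C with hW
  have hD : IsUnit D.det := h0.isUnit
  have hC : C = D * W := by rw [hW, ← Matrix.mul_assoc, Matrix.mul_nonsing_inv _ hD, Matrix.one_mul]
  have hd : MemP 1 (W * k.1.toBlocks₁₂) := h1.mul₀ hk.memP₁₂
  have hint : MemP 0 (W * k.1.toBlocks₁₂ + k.1.toBlocks₂₂) := (hd.mono (by omega)).add hk.memP₂₂
  have h2 : (W * k.1.toBlocks₁₂ + k.1.toBlocks₂₂).det - k.1.toBlocks₂₂.det ∈ P F 1 :=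
    hint.det_sub hk.memP₂₂ (by simpa using hd)
  have h3 : (W * k.1.toBlocks₁₂ + k.1.toBlocks₂₂).det ∈ shell F 0 := by
    have := shell_add hk.det₂₂ (by simpa using h2)
    simpa using this
  have e2 : C * k.1.toBlocks₁₂ + D * k.1.toBlocks₂₂ = D * (W * k.1.toBlocks₁₂ + k.1.toBlocks₂₂) := by
    rw [hC, Matrix.mul_add, Matrix.mul_assoc]
  have e1 : C * k.1.toBlocks₁₁ + D * k.1.toBlocks₂₁ = D * (W * k.1.toBlocks₁₁ + k.1.toBlocks₂₁) := by
    rw [hC, Matrix.mul_add, Matrix.mul_assoc]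
  refine ⟨_, h3, h2, by rw [e2, Matrix.det_mul], ?_⟩
  rw [e1, e2, Matrix.mul_inv_rev, Matrix.mul_assoc, ← Matrix.mul_assoc D⁻¹,
    Matrix.nonsing_inv_mul _ hD, Matrix.one_mul]
  exact (hint.inv h3).mul₀' ((h1.mul₀ hk.memP₁₁).add hk.memP₂₁)

include hϖ hq

theorem bigSection_mul_gamma (z : ℂ) (g k : Matrix.symplecticGroup (Fin n) F) (hk : InGamma k) :
    bigSection ϖ z (g * k) = chi ϖ k.1.toBlocks₂₂.det * bigSection ϖ z g := by
  by_cases h : g.1.toBlocks₂₂.det ≠ 0 ∧ MemP 1 (g.1.toBlocks₂₂⁻¹ * g.1.toBlocks₂₁)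
  · obtain ⟨δ, hδ, h2, h3, h4⟩ := mul_gamma_blocks g k hk h.1 h.2
    have hne : (g * k).1.toBlocks₂₂.det ≠ 0 := by rw [h3]; exact mul_ne_zero h.1 hδ.1
    rw [bigSection, bigSection, if_pos h, if_pos ⟨hne, h4⟩, absF_cpow hne, absF_cpow h.1, h3,
      ord_mul h.1 hδ.1, hδ.2, add_zero, chi_mul hq hϖ h.1 hδ.1]
    have h5 := chi_add hq hϖ hk.det₂₂ (y := δ - k.1.toBlocks₂₂.det) (by simpa using h2)
    rw [add_sub_cancel] at h5
    rw [h5]; ring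
  -- Applying the same computation to `k⁻¹` shows that the support is stable under `Γ` in both
  -- directions.
  · rw [bigSection, bigSection, if_neg h, mul_zero, if_neg]
    intro h'
    obtain ⟨δ, hδ, h2, h3, h4⟩ := mul_gamma_blocks (g * k) k⁻¹ hk.inv h'.1 h'.2
    rw [mul_inv_cancel_right] at h3 h4
    exact h ⟨by rw [h3]; exact mul_ne_zero h'.1 hδ.1, h4⟩

/-- This existence statement is what gives content to `basisFn`, which is chosen among the sections
with the prescribed values. -/
theorem bigSection_isInduced (s : ℂ) :
    IsInduced (n := n) (chi ϖ) s (bigSection ϖ (s + ((n : ℂ) + 1) / 2)) where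
  right g k hk := bigSection_mul_gamma hϖ hq _ g k hk
  left p g hp := by
    set z := s + ((n : ℂ) + 1) / 2
    have h1 := symplectic_block p
    rw [hp, Matrix.zero_mul, sub_zero] at h1
    have h2 : p.1.toBlocks₂₂.det * p.1.toBlocks₁₁.det = 1 := by
      rw [← Matrix.det_transpose p.1.toBlocks₁₁, ← Matrix.det_mul, h1, Matrix.det_one]
    have hd := left_ne_zero_of_mul_eq_one h2
    have ha := right_ne_zero_of_mul_eq_one h2
    have hdi : p.1.toBlocks₂₂.det = p.1.toBlocks₁₁.det⁻¹ := eq_inv_of_mul_eq_one_left h2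
    have e1 : (p * g).1.toBlocks₂₁ = p.1.toBlocks₂₂ * g.1.toBlocks₂₁ := by
      rw [symplectic_mul₂₁, hp, Matrix.zero_mul, zero_add]
    have e2 : (p * g).1.toBlocks₂₂ = p.1.toBlocks₂₂ * g.1.toBlocks₂₂ := by
      rw [symplectic_mul₂₂, hp, Matrix.zero_mul, zero_add]
    have e3 : (p * g).1.toBlocks₂₂⁻¹ * (p * g).1.toBlocks₂₁ =
        g.1.toBlocks₂₂⁻¹ * g.1.toBlocks₂₁ := by
      rw [e1, e2, Matrix.mul_inv_rev, Matrix.mul_assoc, ← Matrix.mul_assoc p.1.toBlocks₂₂⁻¹,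
        Matrix.nonsing_inv_mul _ hd.isUnit, Matrix.one_mul]
    have e4 : (p * g).1.toBlocks₂₂.det = p.1.toBlocks₁₁.det⁻¹ * g.1.toBlocks₂₂.det := by
      rw [e2, Matrix.det_mul, hdi]
    by_cases h : g.1.toBlocks₂₂.det ≠ 0 ∧ MemP 1 (g.1.toBlocks₂₂⁻¹ * g.1.toBlocks₂₁)
    · have hne : (p * g).1.toBlocks₂₂.det ≠ 0 := by
        rw [e4]; exact mul_ne_zero (inv_ne_zero ha) h.1
      rw [bigSection, bigSection, if_pos h, if_pos ⟨hne, by rw [e3]; exact h.2⟩, absF_cpow hne,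
        absF_cpow h.1, absF_cpow ha, e4, ord_mul (inv_ne_zero ha) h.1, ord_inv,
        chi_mul hq hϖ (inv_ne_zero ha) h.1, chi_inv]
      have e5 : -((-ord p.1.toBlocks₁₁.det + ord g.1.toBlocks₂₂.det : ℤ) : ℂ) * -z =
        -(ord p.1.toBlocks₁₁.det : ℂ) * z + -(ord g.1.toBlocks₂₂.det : ℂ) * -z := by
        push_cast; ring
      rw [e5, resCard_cpow_add]; ring
    · rw [bigSection, bigSection, if_neg h, mul_zero, if_neg]
      rw [e3, e4]
      intro h'
      exact h ⟨right_ne_zero_of_mul h'.1, h'.2⟩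
  smooth := by
    set z := s + ((n : ℂ) + 1) / 2
    rw [IsLocallyConstant.iff_exists_open]
    intro g
    -- For `g'` in this neighbourhood, `g⁻¹ g'` lies in `Γ` and is congruent to `1`, so `χ` is
    -- trivial on the determinant of its lower right block.
    refine ⟨{g' | MemP 1 ((g⁻¹).1 * g'.1 - 1)}, ?_, ?_, ?_⟩
    · have : {g' : Matrix.symplecticGroup (Fin n) F | MemP 1 ((g⁻¹).1 * g'.1 - 1)} =
          ⋂ i, ⋂ j, {g' | ((g⁻¹).1 * g'.1 - 1) i j ∈ P F 1} := by
        ext; simp [MemP]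
      rw [this]
      refine isOpen_iInter_of_finite fun i => isOpen_iInter_of_finite fun j => ?_
      have hc : Continuous fun g' : Matrix.symplecticGroup (Fin n) F =>
          ((g⁻¹).1 * g'.1 - 1) i j := by
        have h1 : Continuous fun g' : Matrix.symplecticGroup (Fin n) F => (g⁻¹).1 * g'.1 - 1 :=
          (continuous_const.matrix_mul continuous_subtype_val).sub continuous_const
        exact h1.matrix_elem i j
      exact (isOpen_P 1).preimage hc
    · show MemP 1 ((g⁻¹).1 * g.1 - 1)
      have : (g⁻¹).1 * g.1 = 1 := congrArg Subtype.val (inv_mul_cancel g)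
      rw [this, sub_self]
      exact memP_zero 1
    · intro g' hg'
      have hk : MemP 1 ((g⁻¹ * g').1 - 1) := hg'
      have hint : MemP 0 (g⁻¹ * g').1 := by
        have := (hk.mono (show (0 : ℤ) ≤ 1 by omega)).add memP_one
        simpa using this
      have hG : InGamma (g⁻¹ * g') := by
        rw [inGamma_iff]
        refine ⟨hint, fun i j => ?_⟩
        simpa [Matrix.toBlocks₂₁] using hk (Sum.inr i) (Sum.inl j)
      have h1 : MemP 1 ((g⁻¹ * g').1.toBlocks₂₂ - 1) := by
        intro i j
        have := hk (Sum.inr i) (Sum.inr j)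
        simpa [Matrix.toBlocks₂₂, Matrix.one_apply] using this
      have h2 := hG.memP₂₂.det_sub memP_one h1
      rw [Matrix.det_one] at h2
      have h3 := chi_add hq hϖ (m := 0) ⟨one_ne_zero, ord_one⟩ (by rwa [zero_add])
      rw [add_sub_cancel, chi_one] at h3
      have h4 := bigSection_mul_gamma hϖ hq z g _ hG
      rw [h3, one_mul, mul_inv_cancel_left] at h4
      exact h4

omit hϖ hq in
theorem bigSection_w (z : ℂ) {j : ℕ} (hj : j ≤ n) :
    bigSection ϖ z (w j : Matrix.symplecticGroup (Fin n) F) = if j = 0 then 1 else 0 := by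
  have e1 : (w j : Matrix.symplecticGroup (Fin n) F).1.toBlocks₂₂ =
      Matrix.diagonal fun i : Fin n => if (i : ℕ) + j < n then 1 else 0 := by
    simp [w, wMatrix]
  have e2 : (w j : Matrix.symplecticGroup (Fin n) F).1.toBlocks₂₁ =
      Matrix.diagonal fun i : Fin n => if (i : ℕ) + j < n then 0 else 1 := by
    simp [w, wMatrix]
  rw [bigSection, e1, e2, Matrix.det_diagonal]
  split_ifs with h0 h1 h1
  · subst h1
    simp [absF]
  · exfalso
    refine h0.1 (Finset.prod_eq_zero (Finset.mem_univ ⟨n - 1, by omega⟩) ?_)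
    rw [if_neg]; simp only; omega
  · exfalso
    subst h1
    apply h0
    have : ∀ i : Fin n, (i : ℕ) + 0 < n := fun i => by omega
    simp only [this, if_true]
    refine ⟨by simp, ?_⟩
    rw [Matrix.diagonal_zero, Matrix.mul_zero]
    exact memP_zero 1
  · rfl

omit hϖ hq in
theorem w_mul_unip (x : Sym2 (Fin n) → F) :
    (w n * unip x : Matrix.symplecticGroup (Fin n) F).1 =
      Matrix.fromBlocks 0 (-1) 1 (symMatrix x) := by
  have : (w n * unip x : Matrix.symplecticGroup (Fin n) F).1 = wMatrix F n n * (unip x).1 := rfl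
  rw [this, wMatrix, unip]
  have h : ∀ i : Fin n, ¬ ((i : ℕ) + n < n) := fun i => by omega
  simp only [h, if_false, Matrix.fromBlocks_multiply]
  have h1 : (Matrix.diagonal fun _ : Fin n => (-1 : F)) = -1 := by
    rw [← Matrix.diagonal_one, ← Matrix.diagonal_neg]
  rw [h1]
  simp

omit hq hϖ in
/-- Any section with the defining properties of `f_0` is given by `cellFn` on the big cell. -/
theorem induced_w_mul_unip (hq : Odd (resCard F)) {s : ℂ} {f : Matrix.symplecticGroup (Fin n) F → ℂ}
    (hf : IsInduced (chi ϖ) (s - ((n : ℂ) + 1) / 2) f)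
    (hw : ∀ j ≤ n, f (w j) = if j = 0 then 1 else 0) (x : Sym2 (Fin n) → F) :
    f (w n * unip x) = cellFn ϖ s (symMatrix x) := by
  have hX := symMatrix_isSymm x
  have hwu := w_mul_unip x
  set X := symMatrix x
  by_cases h : X.det ≠ 0 ∧ MemP 1 X⁻¹
  · have hu : IsUnit X.det := h.1.isUnit
    have hXi : X⁻¹ᵀ = X⁻¹ := by rw [Matrix.transpose_nonsing_inv, hX.eq]
    have hp : Matrix.fromBlocks X⁻¹ (-1) 0 X ∈ Matrix.symplecticGroup (Fin n) F := by
      rw [SymplecticGroup.mem_iff, Matrix.J, Matrix.fromBlocks_transpose,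
        Matrix.fromBlocks_multiply, Matrix.fromBlocks_multiply]
      simp [hX.eq, hXi, Matrix.nonsing_inv_mul _ hu, Matrix.mul_nonsing_inv _ hu]
    have hk : Matrix.fromBlocks 1 0 X⁻¹ 1 ∈ Matrix.symplecticGroup (Fin n) F := by
      rw [SymplecticGroup.mem_iff, Matrix.J, Matrix.fromBlocks_transpose,
        Matrix.fromBlocks_multiply, Matrix.fromBlocks_multiply]
      simp [hXi]
    -- The identity behind this is `(0 -1; 1 X) = (X⁻¹ -1; 0 X) (1 0; X⁻¹ 1)`, and the second factor
    -- lies in `Γ` exactly because `X⁻¹ ≡ 0 mod 𝔭`.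
    have e : (w n * unip x : Matrix.symplecticGroup (Fin n) F) = ⟨_, hp⟩ * (w 0 * ⟨_, hk⟩) := by
      apply Subtype.ext
      rw [hwu]
      have h0 : wMatrix F n 0 = 1 := by
        have : ∀ i : Fin n, (i : ℕ) + 0 < n := fun i => by omega
        simp [wMatrix]
      show _ = Matrix.fromBlocks X⁻¹ (-1) 0 X * (wMatrix F n 0 * Matrix.fromBlocks 1 0 X⁻¹ 1)
      rw [h0, one_mul, Matrix.fromBlocks_multiply]
      simp [Matrix.mul_nonsing_inv _ hu]
    rw [e, hf.left _ _ (by simp), hf.right _ _ (inGamma_of_blocks (by simpa using memP_one)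
      (by simpa using memP_zero 0) (by simpa using h.2) (by simpa using memP_one)), hw 0 (by omega),
      cellFn, if_pos h]
    have hdet : X⁻¹.det = X.det⁻¹ := by rw [Matrix.det_nonsing_inv, Ring.inverse_eq_inv']
    simp only [Matrix.toBlocks_fromBlocks₁₁, Matrix.toBlocks_fromBlocks₂₂, Matrix.det_one, chi_one,
      hdet, chi_inv, if_true, mul_one, sub_add_cancel]
    rw [absF_cpow h.1, absF_cpow (inv_ne_zero h.1), ord_inv]
    congr 2
    push_cast; ring
  · rw [cellFn, if_neg h]
    obtain ⟨A, A', d, j, hA, hA', hAA, hXA, hj, hd⟩ := exists_diagonalize_sorted hq hX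
    have hA'A := mul_eq_one_comm.mp hAA
    -- If no diagonal entry were integral, `X` would be invertible with inverse in `𝔭`.
    have hj0 : j ≠ 0 := by
      rintro rfl
      apply h
      have hd' : ∀ i, d i ∉ P F 0 := fun i hi => by have := (hd i).mp hi; omega
      have hd0 : ∀ i, d i ≠ 0 := fun i hi => hd' i (by rw [hi]; exact zero_mem _)
      have hinv : X * (A'ᵀ * Matrix.diagonal (fun i => (d i)⁻¹) * A') = 1 := by
        have h1 : Aᵀ * A'ᵀ = 1 := by rw [← Matrix.transpose_mul, hA'A, Matrix.transpose_one]
        have h2 : Matrix.diagonal d * Matrix.diagonal (fun i => (d i)⁻¹) = 1 := by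
          rw [Matrix.diagonal_mul_diagonal, ← Matrix.diagonal_one]
          congr 1; funext i; exact mul_inv_cancel₀ (hd0 i)
        calc _ = A * (Matrix.diagonal d * (Aᵀ * A'ᵀ) * Matrix.diagonal (fun i => (d i)⁻¹)) * A' := by
              rw [hXA]; simp only [Matrix.mul_assoc]
          _ = 1 := by rw [h1, Matrix.mul_one, h2, Matrix.mul_one, hAA]
      refine ⟨fun h0 => ?_, ?_⟩
      · have := congrArg Matrix.det hinv
        rw [Matrix.det_mul, h0, zero_mul, Matrix.det_one] at this
        exact zero_ne_one this
      · rw [Matrix.inv_eq_right_inv hinv]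
        refine (hA'.transpose.mul₀' (memP_diagonal fun i => ?_)).mul₀ hA'
        have := hd' i
        rw [mem_P_iff (hd0 i)] at this
        exact mem_P_of_le (by rw [ord_inv]; omega)
    have hdne : ∀ i : Fin n, (i : ℕ) + j < n → d i ≠ 0 ∧ (d i)⁻¹ ∈ P F 1 := by
      intro i hi
      have h1 : d i ∉ P F 0 := fun h2 => by have := (hd i).mp h2; omega
      have h0 : d i ≠ 0 := fun h2 => h1 (by rw [h2]; exact zero_mem _)
      rw [mem_P_iff h0] at h1
      exact ⟨h0, mem_P_of_le (by rw [ord_inv]; omega)⟩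
    have hS : ∀ i : Fin n, (i : ℕ) + j < n ∨ (¬ ((i : ℕ) + j < n) ∧ d i ∈ P F 0) := by
      intro i
      by_cases hi : (i : ℕ) + j < n
      · exact Or.inl hi
      · exact Or.inr ⟨hi, (hd i).mpr (by omega)⟩
    -- The factorization is made coordinatewise. A non-integral `d` uses `(0 -1; 1 d) = (d⁻¹ -1; 0
    -- d) (1 0; d⁻¹ 1)`, an integral `d` uses `(0 -1; 1 d) = (0 -1; 1 0) (1 d; 0 1)`. Thus the
    -- element lies in the double coset of `w j` with `j ≠ 0`, where the section vanishes.
    let p := diagSp (fun i => if (i : ℕ) + j < n then (d i)⁻¹ else 1)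
      (fun i => if (i : ℕ) + j < n then -1 else 0) (fun _ => 0)
      (fun i => if (i : ℕ) + j < n then d i else 1) (by
        intro i
        split_ifs with hi
        · simp [(hdne i hi).1]
        · simp)
    let k := diagSp (fun _ => 1) (fun i => if (i : ℕ) + j < n then 0 else d i)
      (fun i => if (i : ℕ) + j < n then (d i)⁻¹ else 0) (fun _ => 1) (by
        intro i
        split_ifs with hi <;> simp)
    have hA'At : A'ᵀ * Aᵀ = 1 := by rw [← Matrix.transpose_mul, hAA, Matrix.transpose_one]
    have e : (w n * unip x : Matrix.symplecticGroup (Fin n) F) =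
        levi A'ᵀ Aᵀ hA'At * (p * ((w j * k) * levi A' A hA'A)) := by
      apply Subtype.ext
      rw [hwu]
      show _ = Matrix.fromBlocks A'ᵀ 0 0 Aᵀᵀ * (Matrix.fromBlocks _ _ _ _ *
        ((wMatrix F n j * Matrix.fromBlocks _ _ _ _) * Matrix.fromBlocks A' 0 0 Aᵀ))
      have e1 : Matrix.fromBlocks (Matrix.diagonal fun i : Fin n => if (i : ℕ) + j < n then (d i)⁻¹ else 1)
          (Matrix.diagonal fun i : Fin n => if (i : ℕ) + j < n then -1 else 0)
          (Matrix.diagonal fun _ => 0)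
          (Matrix.diagonal fun i : Fin n => if (i : ℕ) + j < n then d i else 1) *
          (wMatrix F n j * Matrix.fromBlocks (Matrix.diagonal fun _ => 1)
            (Matrix.diagonal fun i : Fin n => if (i : ℕ) + j < n then 0 else d i)
            (Matrix.diagonal fun i : Fin n => if (i : ℕ) + j < n then (d i)⁻¹ else 0)
            (Matrix.diagonal fun _ => 1)) =
          Matrix.fromBlocks 0 (-1) 1 (Matrix.diagonal d) := by
        rw [wMatrix, Matrix.fromBlocks_multiply, Matrix.fromBlocks_multiply]
        simp only [Matrix.diagonal_mul_diagonal, Matrix.diagonal_add]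
        have hneg : (-1 : Matrix (Fin n) (Fin n) F) = Matrix.diagonal fun _ => -1 := by
          rw [← Matrix.diagonal_one, ← Matrix.diagonal_neg]
        rw [hneg, ← Matrix.diagonal_zero, ← Matrix.diagonal_one]
        congr 1 <;> congr 1 <;> funext i <;> by_cases hi : (i : ℕ) + j < n <;>
          simp [hi]
        simp [(hdne i hi).1]
      rw [← Matrix.mul_assoc (Matrix.fromBlocks _ _ _ _) (_ * _), e1, Matrix.fromBlocks_multiply,
        Matrix.fromBlocks_multiply]
      simp [hA'At, hAA, hXA, Matrix.mul_assoc]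
    rw [e, hf.left _ _ (by simp [levi]), hf.left _ _ (by simp [p, diagSp]), hf.right, hf.right, hw j hj,
      if_neg hj0]
    · simp
    · refine inGamma_of_blocks ?_ ?_ ?_ ?_
      · simpa [k, diagSp] using memP_one
      · simp only [k, diagSp, Matrix.toBlocks_fromBlocks₁₂]
        refine memP_diagonal fun i => ?_
        rcases hS i with hi | hi
        · simp [hi]
        · simp [hi]
      · simp only [k, diagSp, Matrix.toBlocks_fromBlocks₂₁]
        refine memP_diagonal fun i => ?_
        split_ifs with hi
        · exact (hdne i hi).2
        · exact zero_mem _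
      · simpa [k, diagSp] using memP_one
    · refine inGamma_of_blocks ?_ ?_ ?_ ?_
      · simpa [levi] using hA'
      · simpa [levi] using memP_zero 0
      · simpa [levi] using memP_zero 1
      · simpa [levi] using hA.transpose

/-- A section with the required values exists, so the chosen one has them too; on the big cell these
values determine it. -/
theorem basisFn_w_mul_unip (s : ℂ) (x : Sym2 (Fin n) → F) :
    basisFn (chi ϖ) (s - ((n : ℂ) + 1) / 2) 0 (w n * unip x) = cellFn ϖ s (symMatrix x) := by
  have h : IsInduced (chi ϖ) (s - ((n : ℂ) + 1) / 2)
      (basisFn (F := F) (n := n) (chi ϖ) (s - ((n : ℂ) + 1) / 2) 0) ∧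
      ∀ j ≤ n, basisFn (F := F) (n := n) (chi ϖ) (s - ((n : ℂ) + 1) / 2) 0 (w j) =
        if j = 0 then 1 else 0 :=
    Classical.epsilon_spec (p := fun f => IsInduced (n := n) (chi ϖ) (s - ((n : ℂ) + 1) / 2) f ∧
      ∀ j ≤ n, f (w j) = if j = 0 then 1 else 0)
      ⟨_, bigSection_isInduced hϖ hq _, fun j hj => bigSection_w _ hj⟩
  exact induced_w_mul_unip hq h.1 h.2 x

end BasisFn

/-! ### Coordinates of a symmetric matrix assembled from blocks. -/

section SymMatrices

variable {F : Type*} {ι O K : Type*}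

/-- The symmetric matrix with prescribed entries, over an arbitrary index type. -/
def symM (x : Sym2 ι → F) : Matrix ι ι F := Matrix.of fun i j => x s(i, j)

theorem symM_isSymm (x : Sym2 ι → F) : (symM x).IsSymm := by
  ext i j
  simp [symM, Sym2.eq_swap]

/-- The unordered pairs in a disjoint union. -/
def symSum (ε : O ⊕ K ≃ ι) : Sym2 O ⊕ (K × O) ⊕ Sym2 K → Sym2 ι
  | .inl t => t.map fun o => ε (.inl o)
  | .inr (.inl p) => s(ε (.inl p.2), ε (.inr p.1))
  | .inr (.inr t) => t.map fun k => ε (.inr k)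

theorem symSum_bijective (ε : O ⊕ K ≃ ι) : Function.Bijective (symSum ε) := by
  constructor
  · rintro (a | a | a) (b | b | b) h <;> simp only [symSum] at h
    · exact congrArg _ (Sym2.map.injective
        (fun x y hxy => Sum.inl_injective (ε.injective hxy)) h)
    · induction a with | _ a a' => simp at h
    · induction a with | _ a a' => induction b with | _ b b' => simp at h
    · induction b with | _ b b' => simp at h
    · simp at h
      exact congrArg _ (congrArg _ (Prod.ext h.2 h.1))
    · induction b with | _ b b' => simp at h
    · induction a with | _ a a' => induction b with | _ b b' => simp at h
    · induction a with | _ a a' => simp at h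
    · exact congrArg _ (congrArg _ (Sym2.map.injective
        (fun x y hxy => Sum.inr_injective (ε.injective hxy)) h))
  · intro t
    induction t with | _ a b =>
    obtain ⟨a, rfl⟩ := ε.surjective a
    obtain ⟨b, rfl⟩ := ε.surjective b
    rcases a with a | a <;> rcases b with b | b
    · exact ⟨.inl s(a, b), rfl⟩
    · exact ⟨.inr (.inl (b, a)), rfl⟩
    · exact ⟨.inr (.inl (a, b)), Sym2.eq_swap⟩
    · exact ⟨.inr (.inr s(a, b)), rfl⟩

/-- The equivalence between the unordered pairs of a disjoint union and their three kinds. -/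
def symEquiv (ε : O ⊕ K ≃ ι) : Sym2 O ⊕ (K × O) ⊕ Sym2 K ≃ Sym2 ι :=
  Equiv.ofBijective _ (symSum_bijective ε)

/-- The coordinates of a symmetric matrix assembled from its blocks. -/
def asm (ε : O ⊕ K ≃ ι) (p : ((Sym2 O → F) × (K → O → F)) × (Sym2 K → F)) : Sym2 ι → F := fun t =>
  match (symEquiv ε).symm t with
  | .inl t => p.1.1 t
  | .inr (.inl q) => p.1.2 q.1 q.2
  | .inr (.inr t) => p.2 t

variable (ε : O ⊕ K ≃ ι) (p : ((Sym2 O → F) × (K → O → F)) × (Sym2 K → F))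

theorem asm_symEquiv_inl (t : Sym2 O) : asm ε p (symEquiv ε (.inl t)) = p.1.1 t := by simp [asm]

theorem asm_symEquiv_inr_inl (q : K × O) :
    asm ε p (symEquiv ε (.inr (.inl q))) = p.1.2 q.1 q.2 := by simp [asm]

theorem asm_symEquiv_inr_inr (t : Sym2 K) :
    asm ε p (symEquiv ε (.inr (.inr t))) = p.2 t := by simp [asm]

theorem asm_inl_inl (o o' : O) : asm ε p s(ε (.inl o), ε (.inl o')) = p.1.1 s(o, o') :=
  asm_symEquiv_inl ε p s(o, o')

theorem asm_inl_inr (o : O) (k : K) : asm ε p s(ε (.inl o), ε (.inr k)) = p.1.2 k o :=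
  asm_symEquiv_inr_inl ε p (k, o)

theorem asm_inr_inl (o : O) (k : K) : asm ε p s(ε (.inr k), ε (.inl o)) = p.1.2 k o := by
  rw [Sym2.eq_swap, asm_inl_inr]

theorem asm_inr_inr (k k' : K) : asm ε p s(ε (.inr k), ε (.inr k')) = p.2 s(k, k') :=
  asm_symEquiv_inr_inr ε p s(k, k')

theorem symM_asm : (symM (asm ε p)).submatrix ε ε =
    Matrix.fromBlocks (symM p.1.1) (Matrix.of fun o k => p.1.2 k o) (Matrix.of fun k o => p.1.2 k o)
      (symM p.2) := by
  ext (i | i) (j | j) <;> simp [symM, asm_inl_inl, asm_inl_inr, asm_inr_inl, asm_inr_inr]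

end SymMatrices

/-! ### Multiplicativity and measurability of `cellFn`. -/

section CellFnLemmas

variable {F : Type*} [Field F] [ValuativeRel F] [TopologicalSpace F]
  [IsNonarchimedeanLocalField F] {ι O K : Type*} [Fintype ι] [DecidableEq ι] [Fintype O]
  [DecidableEq O] [Fintype K] [DecidableEq K]

theorem cellFn_congr (ϖ : F) (s : ℂ) {X : Matrix ι ι F} {Y : Matrix O O F} (hdet : X.det = Y.det)
    (h : MemP 1 X⁻¹ ↔ MemP 1 Y⁻¹) : cellFn ϖ s X = cellFn ϖ s Y := by
  by_cases hX : X.det ≠ 0 ∧ MemP 1 X⁻¹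
  · rw [cellFn, cellFn, if_pos hX, if_pos ⟨hdet ▸ hX.1, h.mp hX.2⟩, hdet]
  · rw [cellFn, cellFn, if_neg hX, if_neg fun hY => hX ⟨hdet ▸ hY.1, h.mpr hY.2⟩]

theorem cellFn_of_not {ϖ : F} {s : ℂ} {X : Matrix ι ι F} (h : ¬ MemP 1 X⁻¹) :
    cellFn ϖ s X = 0 := by
  rw [cellFn, if_neg fun h' => h h'.2]

theorem cellFn_submatrix (ϖ : F) (s : ℂ) (X : Matrix ι ι F) (ε : O ≃ ι) :
    cellFn ϖ s (X.submatrix ε ε) = cellFn ϖ s X := by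
  have h : MemP 1 (X.submatrix ε ε)⁻¹ ↔ MemP 1 X⁻¹ := by
    rw [Matrix.inv_submatrix_equiv]
    refine ⟨fun h i j => ?_, fun h i j => h _ _⟩
    simpa using h (ε.symm i) (ε.symm j)
  exact cellFn_congr ϖ s (Matrix.det_submatrix_equiv_self _ _) h

theorem cellFn_eq_cpow (ϖ : F) (s : ℂ) (X : Matrix ι ι F) (h : X.det ≠ 0 ∧ MemP 1 X⁻¹) :
    cellFn ϖ s X = chi ϖ X.det * (resCard F : ℂ) ^ ((ord X.det : ℂ) * s) := by
  rw [cellFn, if_pos h, absF_cpow h.1, neg_mul_neg]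

theorem cellFn_unipotent_mul {ϖ : F} (s : ℂ) {U U' V V' : Matrix ι ι F} (hU : MemP 0 U)
    (hU' : MemP 0 U') (hV : MemP 0 V) (hV' : MemP 0 V') (hUU : U * U' = 1) (hVV : V * V' = 1)
    (hdU : U.det = 1) (hdV : V.det = 1) (X : Matrix ι ι F) :
    cellFn ϖ s (U * X * V) = cellFn ϖ s X := by
  have hUi : U⁻¹ = U' := Matrix.inv_eq_right_inv hUU
  have hVi : V⁻¹ = V' := Matrix.inv_eq_right_inv hVV
  have hdet : (U * X * V).det = X.det := by simp [Matrix.det_mul, hdU, hdV]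
  have hinv : (U * X * V)⁻¹ = V' * X⁻¹ * U' := by
    rw [Matrix.mul_inv_rev, Matrix.mul_inv_rev, hUi, hVi, Matrix.mul_assoc]
  have h : MemP 1 (U * X * V)⁻¹ ↔ MemP 1 X⁻¹ := by
    rw [hinv]
    refine ⟨fun h => ?_, fun h => (hV'.mul₀' h).mul₀ hU'⟩
    have h1 := (hV.mul₀' h).mul₀ hU
    have e : V * (V' * X⁻¹ * U') * U = (V * V') * X⁻¹ * (U' * U) := by simp only [Matrix.mul_assoc]
    rwa [e, hVV, mul_eq_one_comm.mp hUU, Matrix.one_mul, Matrix.mul_one] at h1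
  exact cellFn_congr ϖ s hdet h

theorem cellFn_blockDiag (hq : Odd (resCard F)) {ϖ : F} (hϖ : ϖ ∈ shell F 1) (s : ℂ)
    (A : Matrix O O F) (D : Matrix K K F) :
    cellFn ϖ s (Matrix.fromBlocks A 0 0 D) = cellFn ϖ s A * cellFn ϖ s D := by
  have hdet : (Matrix.fromBlocks A 0 0 D).det = A.det * D.det := Matrix.det_fromBlocks_zero₂₁ A 0 D
  by_cases hA : A.det = 0
  · simp [cellFn, hdet, hA]
  by_cases hD : D.det = 0
  · simp [cellFn, hdet, hD]
  have hAD : IsUnit A ↔ IsUnit D := by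
    rw [Matrix.isUnit_iff_isUnit_det, Matrix.isUnit_iff_isUnit_det]
    simp [hA, hD]
  have hinv : (Matrix.fromBlocks A 0 0 D)⁻¹ = Matrix.fromBlocks A⁻¹ 0 0 D⁻¹ := by
    rw [Matrix.inv_fromBlocks_zero₂₁_of_isUnit_iff _ _ _ hAD]; simp
  have hmem : MemP 1 (Matrix.fromBlocks A 0 0 D)⁻¹ ↔ MemP 1 A⁻¹ ∧ MemP 1 D⁻¹ := by
    rw [hinv]
    constructor
    · exact fun h => ⟨fun i j => by simpa using h (.inl i) (.inl j),
        fun i j => by simpa using h (.inr i) (.inr j)⟩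
    · rintro ⟨h1, h2⟩ (i | i) (j | j)
      · simpa using h1 i j
      · simp
      · simp
      · simpa using h2 i j
  by_cases h1 : MemP 1 A⁻¹
  · by_cases h2 : MemP 1 D⁻¹
    · rw [cellFn_eq_cpow ϖ s A ⟨hA, h1⟩, cellFn_eq_cpow ϖ s D ⟨hD, h2⟩,
        cellFn_eq_cpow ϖ s _ ⟨by rw [hdet]; exact mul_ne_zero hA hD, hmem.mpr ⟨h1, h2⟩⟩, hdet,
        chi_mul hq hϖ hA hD, ord_mul hA hD]
      push_cast
      rw [add_mul, resCard_cpow_add]; ring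
    · rw [cellFn_of_not (fun h => h2 (hmem.mp h).2), cellFn_of_not h2, mul_zero]
  · rw [cellFn_of_not (fun h => h1 (hmem.mp h).1), cellFn_of_not h1, zero_mul]

/-- In the block `LDU` decomposition the unipotent factors have the entries of `A⁻¹ * Y` and its
transpose. These are integral by hypothesis, so the factors change neither the determinant nor the
condition on the inverse. -/
theorem cellFn_elimination (hq : Odd (resCard F)) {ϖ : F} (hϖ : ϖ ∈ shell F 1) (s : ℂ)
    {A : Matrix O O F} (hA : A.IsSymm) (hdet : A.det ≠ 0) {Y : Matrix O K F} (hY : MemP 0 (A⁻¹ * Y))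
    (Z : Matrix K K F) :
    cellFn ϖ s (Matrix.fromBlocks A Y Yᵀ (Z + Yᵀ * A⁻¹ * Y)) = cellFn ϖ s A * cellFn ϖ s Z := by
  have hu : IsUnit A.det := hdet.isUnit
  have hAi : A⁻¹ᵀ = A⁻¹ := by rw [Matrix.transpose_nonsing_inv, hA.eq]
  have hYt : Yᵀ * A⁻¹ = (A⁻¹ * Y)ᵀ := by rw [Matrix.transpose_mul, hAi]
  have e : Matrix.fromBlocks A Y Yᵀ (Z + Yᵀ * A⁻¹ * Y) =
      Matrix.fromBlocks 1 0 (Yᵀ * A⁻¹) 1 * Matrix.fromBlocks A 0 0 Z *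
        Matrix.fromBlocks 1 (A⁻¹ * Y) 0 1 := by
    rw [Matrix.fromBlocks_multiply, Matrix.fromBlocks_multiply]
    simp [Matrix.mul_assoc, Matrix.nonsing_inv_mul _ hu, Matrix.mul_nonsing_inv_cancel_left _ _ hu,
      add_comm]
  have hYt' : MemP 0 (Yᵀ * A⁻¹) := by rw [hYt]; exact hY.transpose
  have hlow : ∀ M : Matrix K O F, MemP 0 M → MemP 0 (Matrix.fromBlocks (1 : Matrix O O F) 0 M (1 : Matrix K K F)) := by
    rintro M hM (i | i) (j | j)
    exacts [memP_one i j, memP_zero 0 i j, hM i j, memP_one i j]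
  have hupp : ∀ M : Matrix O K F, MemP 0 M → MemP 0 (Matrix.fromBlocks (1 : Matrix O O F) M 0 (1 : Matrix K K F)) := by
    rintro M hM (i | i) (j | j)
    exacts [memP_one i j, hM i j, memP_zero 0 i j, memP_one i j]
  rw [e, cellFn_unipotent_mul s (hlow _ hYt') (hlow _ hYt'.neg) (hupp _ hY) (hupp _ hY.neg),
    cellFn_blockDiag hq hϖ]
  · simp [Matrix.fromBlocks_multiply]
  · simp [Matrix.fromBlocks_multiply]
  · rw [Matrix.det_fromBlocks_zero₁₂]; simp
  · rw [Matrix.det_fromBlocks_zero₂₁]; simp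

variable [MeasurableSpace F] [BorelSpace F]

theorem measurable_ord : Measurable (ord : F → ℤ) := by
  refine measurable_to_countable' fun k => ?_
  -- The convention `ord 0 = 0` adds the point `0` to the fibre over `0`.
  have : ord ⁻¹' {k} = shell F k ∪ (if k = 0 then {(0 : F)} else ∅) := by
    ext x
    simp only [Set.mem_preimage, Set.mem_singleton_iff, Set.mem_union, mem_shell]
    rcases eq_or_ne x 0 with rfl | hx
    · by_cases hk : k = 0
      · simp [hk]
      · simp [hk, Ne.symm hk]
    · by_cases hk : k = 0 <;> simp [hk, hx]
  rw [this]
  refine (measurableSet_shell k).union ?_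
  split_ifs
  exacts [measurableSet_singleton _, MeasurableSet.empty]

theorem continuous_symM : Continuous (symM : (Sym2 ι → F) → Matrix ι ι F) :=
  continuous_matrix fun i j => continuous_apply (s(i, j) : Sym2 ι)

theorem measurable_det_symM : Measurable fun x : Sym2 ι → F => (symM x).det :=
  continuous_symM.matrix_det.measurable

theorem measurable_inv_symM (i j : ι) : Measurable fun x : Sym2 ι → F => (symM x)⁻¹ i j := by
  simp only [Matrix.inv_def, Ring.inverse_eq_inv', Matrix.smul_apply, smul_eq_mul]
  refine measurable_det_symM.inv.mul ?_
  exact (continuous_symM.matrix_adjugate.matrix_elem i j).measurable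

theorem measurable_cellFn (hq : Odd (resCard F)) {ϖ : F} (hϖ : ϖ ∈ shell F 1) (s : ℂ) :
    Measurable fun x : Sym2 ι → F => cellFn ϖ s (symM x) := by
  classical
  have hset : MeasurableSet {x : Sym2 ι → F | (symM x).det ≠ 0 ∧ MemP 1 (symM x)⁻¹} := by
    refine MeasurableSet.inter ?_ ?_
    · exact (measurable_det_symM (measurableSet_singleton 0)).compl
    · have : {x : Sym2 ι → F | MemP 1 (symM x)⁻¹} =
          ⋂ i, ⋂ j, {x | (symM x)⁻¹ i j ∈ (P F 1 : Set F)} := by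
        ext; simp [MemP]
      change MeasurableSet {x : Sym2 ι → F | MemP 1 (symM x)⁻¹}
      rw [this]
      exact MeasurableSet.iInter fun i => MeasurableSet.iInter fun j =>
        measurable_inv_symM i j (measurableSet_P 1)
  set A := {x : Sym2 ι → F | (symM x).det ≠ 0 ∧ MemP 1 (symM x)⁻¹} with hA
  have h2 : (fun x : Sym2 ι → F => cellFn ϖ s (symM x)) =
      A.indicator fun x => chi ϖ (symM x).det * (resCard F : ℂ) ^ ((ord (symM x).det : ℂ) * s) := by
    funext x
    by_cases h : (symM x).det ≠ 0 ∧ MemP 1 (symM x)⁻¹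
    · rw [Set.indicator_of_mem (show x ∈ A from h), cellFn_eq_cpow _ _ _ h]
    · rw [Set.indicator_of_notMem (show x ∉ A from h), cellFn, if_neg h]
  rw [h2]
  refine Measurable.indicator ?_ hset
  refine ((measurable_chi hq hϖ).comp measurable_det_symM).mul ?_
  exact (measurable_from_top (f := fun k : ℤ => (resCard F : ℂ) ^ ((k : ℂ) * s))).comp
    (measurable_ord.comp measurable_det_symM)

end CellFnLemmas

/-! ### Elimination of a pivot block under the integral. -/

section Elimination

variable {F : Type*} [Field F] [ValuativeRel F] [TopologicalSpace F]
  [IsNonarchimedeanLocalField F] {ι O K : Type*} [Fintype ι] [DecidableEq ι] [Fintype O]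
  [DecidableEq O] [Fintype K] [DecidableEq K]

/-- The correction `ᵗY X⁻¹ Y` in the elimination of the block `X`. -/
def corr (a : (Sym2 O → F) × (K → O → F)) : Sym2 K → F :=
  Sym2.lift ⟨fun k l => a.2 k ⬝ᵥ (symM a.1)⁻¹ *ᵥ a.2 l, fun k l => by
    change a.2 k ⬝ᵥ (symM a.1)⁻¹ *ᵥ a.2 l = a.2 l ⬝ᵥ (symM a.1)⁻¹ *ᵥ a.2 k
    rw [Matrix.dotProduct_mulVec, ← Matrix.mulVec_transpose, Matrix.transpose_nonsing_inv,
      (symM_isSymm a.1).eq, dotProduct_comm]⟩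

theorem corr_mk (a : (Sym2 O → F) × (K → O → F)) (k l : K) :
    corr a s(k, l) = a.2 k ⬝ᵥ (symM a.1)⁻¹ *ᵥ a.2 l := rfl

/-- The coordinates of the matrix with upper left block `X`, off-diagonal block `Y` and Schur
complement `Z`. -/
def schur (ε : O ⊕ K ≃ ι) (p : ((Sym2 O → F) × (K → O → F)) × (Sym2 K → F)) : Sym2 ι → F :=
  asm ε (p.1, p.2 + corr p.1)

theorem symM_schur (ε : O ⊕ K ≃ ι) (p : ((Sym2 O → F) × (K → O → F)) × (Sym2 K → F)) :
    (symM (schur ε p)).submatrix ε ε =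
      Matrix.fromBlocks (symM p.1.1) (Matrix.of fun o k => p.1.2 k o)
        (Matrix.of fun o k => p.1.2 k o)ᵀ (symM p.2 + (Matrix.of fun o k => p.1.2 k o)ᵀ *
          (symM p.1.1)⁻¹ * (Matrix.of fun o k => p.1.2 k o)) := by
  rw [schur, symM_asm]
  congr 1
  ext k l
  simp only [symM, Matrix.of_apply, Pi.add_apply, Matrix.add_apply, corr_mk]
  rw [Matrix.mul_assoc, Matrix.mul_apply]
  rfl

/-- The inverse of the pivot block has order at least `-L` and the columns have order at least `L`,
so the elimination is integral. -/
theorem cellFn_schur (hq : Odd (resCard F)) {ϖ : F} (hϖ : ϖ ∈ shell F 1) (s : ℂ) (ε : O ⊕ K ≃ ι)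
    (p : ((Sym2 O → F) × (K → O → F)) × (Sym2 K → F)) {L : ℤ} (hdet : (symM p.1.1).det ≠ 0)
    (hinv : MemP (-L) (symM p.1.1)⁻¹) (hY : ∀ k o, p.1.2 k o ∈ P F L) :
    cellFn ϖ s (symM (schur ε p)) = cellFn ϖ s (symM p.1.1) * cellFn ϖ s (symM p.2) := by
  rw [← cellFn_submatrix ϖ s _ ε, symM_schur, cellFn_elimination hq hϖ s (symM_isSymm _) hdet]
  have h1 : MemP L (Matrix.of fun o k => p.1.2 k o) := fun o k => hY k o
  simpa using hinv.mul h1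

theorem psi_sum (ψ : AddChar F Circle) {α : Type*} (s : Finset α) (f : α → F) :
    (ψ (∑ i ∈ s, f i) : ℂ) = ∏ i ∈ s, (ψ (f i) : ℂ) := by
  classical
  induction s using Finset.induction_on with
  | empty => simp
  | insert a s ha ih => rw [Finset.sum_insert ha, Finset.prod_insert ha, psi_add, ih]

/-- The character `ψ(-tr(bX))` for the diagonal matrix `b`. -/
def phase (ψ : AddChar F Circle) (b : ι → F) (x : Sym2 ι → F) : ℂ :=
  ∏ i, (ψ (-(b i * x s(i, i))) : ℂ)

/-- Since `b` is diagonal, only the diagonal of the correction `ᵗY X⁻¹ Y` enters. The phase thus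
separates the columns: column `k` meets only the quadratic form of `X⁻¹` evaluated at itself. -/
theorem phase_schur (ψ : AddChar F Circle) (b : ι → F) (ε : O ⊕ K ≃ ι)
    (p : ((Sym2 O → F) × (K → O → F)) × (Sym2 K → F)) :
    phase ψ b (schur ε p) = phase ψ (fun o => b (ε (.inl o))) p.1.1 *
      (∏ k, (ψ (-(b (ε (.inr k)) * (p.1.2 k ⬝ᵥ (symM p.1.1)⁻¹ *ᵥ p.1.2 k))) : ℂ)) *
      phase ψ (fun k => b (ε (.inr k))) p.2 := by
  rw [phase, ← Equiv.prod_comp ε, Fintype.prod_sum_type, mul_assoc, phase, phase]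
  congr 1
  · simp only [schur, asm_inl_inl]
  · rw [← Finset.prod_mul_distrib]
    refine Finset.prod_congr rfl fun k _ => ?_
    have h : schur ε p s(ε (.inr k), ε (.inr k)) =
        p.2 s(k, k) + p.1.2 k ⬝ᵥ (symM p.1.1)⁻¹ *ᵥ p.1.2 k := by
      rw [schur, asm_inr_inr]; rfl
    rw [← psi_add, h]
    congr 2; ring

theorem norm_phase (ψ : AddChar F Circle) (b : ι → F) (x : Sym2 ι → F) : ‖phase ψ b x‖ = 1 := by
  rw [phase, norm_prod]
  exact Finset.prod_eq_one fun i _ => norm_psi _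

variable [MeasurableSpace F] [BorelSpace F]

variable (F ι) in
/-- The Haar measure on the symmetric matrices in the coordinates given by the entries. -/
abbrev haarS : Measure (Sym2 ι → F) := Measure.pi fun _ => haarF F

theorem measurePreserving_asm (ε : O ⊕ K ≃ ι) :
    MeasurePreserving (asm (F := F) ε)
      (((haarS F O).prod (Measure.pi fun _ : K => Measure.pi fun _ : O => haarF F)).prod (haarS F K))
      (haarS F ι) := by
  have hm : Measurable (asm (F := F) ε) := by
    refine measurable_pi_lambda _ fun t => ?_
    obtain ⟨t, rfl⟩ := (symEquiv ε).surjective t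
    rcases t with t | t | t
    · simp only [asm_symEquiv_inl]; fun_prop
    · simp only [asm_symEquiv_inr_inl]; fun_prop
    · simp only [asm_symEquiv_inr_inr]; fun_prop
  refine ⟨hm, (Measure.pi_eq fun s hs => ?_).symm⟩
  rw [Measure.map_apply hm (MeasurableSet.univ_pi hs)]
  have hpre : asm (F := F) ε ⁻¹' (Set.univ.pi s) =
      ((Set.univ.pi fun t => s (symEquiv ε (.inl t))) ×ˢ
        (Set.univ.pi fun k => Set.univ.pi fun o => s (symEquiv ε (.inr (.inl (k, o)))))) ×ˢ
        (Set.univ.pi fun t => s (symEquiv ε (.inr (.inr t)))) := by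
    ext p
    simp only [Set.mem_preimage, Set.mem_univ_pi, Set.mem_prod]
    constructor
    · intro h
      refine ⟨⟨fun t => ?_, fun k o => ?_⟩, fun t => ?_⟩
      · rw [← asm_symEquiv_inl ε]; exact h _
      · have := h (symEquiv ε (.inr (.inl (k, o))))
        rwa [asm_symEquiv_inr_inl] at this
      · rw [← asm_symEquiv_inr_inr ε]; exact h _
    · rintro ⟨⟨h1, h2⟩, h3⟩ t
      obtain ⟨t, rfl⟩ := (symEquiv ε).surjective t
      rcases t with t | t | t
      · rw [asm_symEquiv_inl]; exact h1 t
      · rw [asm_symEquiv_inr_inl]; exact h2 t.1 t.2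
      · rw [asm_symEquiv_inr_inr]; exact h3 t
  rw [hpre, Measure.prod_prod, Measure.prod_prod, Measure.pi_pi, Measure.pi_pi, Measure.pi_pi,
    ← Equiv.prod_comp (symEquiv ε), Fintype.prod_sum_type, Fintype.prod_sum_type,
    Fintype.prod_prod_type, mul_assoc]
  simp only [Measure.pi_pi]

theorem measurable_corr : Measurable (corr : (Sym2 O → F) × (K → O → F) → Sym2 K → F) := by
  refine measurable_pi_lambda _ fun t => ?_
  induction t with | _ k l =>
  simp only [corr_mk, dotProduct, Matrix.mulVec]
  have h : ∀ i j, Measurable fun a : (Sym2 O → F) × (K → O → F) => (symM a.1)⁻¹ i j :=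
    fun i j => (measurable_inv_symM i j).comp measurable_fst
  have h' : ∀ k o, Measurable fun a : (Sym2 O → F) × (K → O → F) => a.2 k o := fun k o =>
    (measurable_pi_apply o).comp ((measurable_pi_apply k).comp measurable_snd)
  exact Finset.measurable_sum _ fun o _ => (h' k o).mul
    (Finset.measurable_sum _ fun o' _ => (h o o').mul (h' l o'))

/-- Adding the correction is a translation of the last block by a measurable function of the others,
hence a measure-preserving shear; the assembly of blocks only permutes coordinates. -/
theorem measurePreserving_schur (ε : O ⊕ K ≃ ι) :
    MeasurePreserving (schur (F := F) ε)
      (((haarS F O).prod (Measure.pi fun _ : K => Measure.pi fun _ : O => haarF F)).prod (haarS F K))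
      (haarS F ι) := by
  have h1 : MeasurePreserving
      (fun p : ((Sym2 O → F) × (K → O → F)) × (Sym2 K → F) => (p.1, p.2 + corr p.1))
      (((haarS F O).prod (Measure.pi fun _ : K => Measure.pi fun _ : O => haarF F)).prod (haarS F K))
      (((haarS F O).prod (Measure.pi fun _ : K => Measure.pi fun _ : O => haarF F)).prod
        (haarS F K)) := by
    have hμ : SFinite ((haarS F O).prod (Measure.pi fun _ : K => Measure.pi fun _ : O => haarF F)) :=
      inferInstance
    revert hμ
    generalize (haarS F O).prod (Measure.pi fun _ : K => Measure.pi fun _ : O => haarF F) = μ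
    intro hμ
    have hc : Measurable (corr : (Sym2 O → F) × (K → O → F) → Sym2 K → F) := measurable_corr
    revert hc
    generalize (corr : (Sym2 O → F) × (K → O → F) → Sym2 K → F) = c
    intro hc
    have hg : Measurable (Function.uncurry fun (a : (Sym2 O → F) × (K → O → F)) (z : Sym2 K → F) =>
        z + c a) := measurable_snd.add (hc.comp measurable_fst)
    exact (MeasurePreserving.id μ).skew_product hg
      (Filter.Eventually.of_forall fun a => map_add_right_eq_self _ _)
  have h2 : schur (F := F) ε = asm ε ∘
      fun p : ((Sym2 O → F) × (K → O → F)) × (Sym2 K → F) => (p.1, p.2 + corr p.1) := rfl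
  rw [h2]
  exact (measurePreserving_asm ε).comp h1

/-- The integrand of the Siegel series. -/
def integrand (ψ : AddChar F Circle) (ϖ : F) (s : ℂ) (b : ι → F) (x : Sym2 ι → F) : ℂ :=
  cellFn ϖ s (symM x) * phase ψ b x

theorem measurable_phase {ψ : AddChar F Circle} (hψc : Continuous ψ) (b : ι → F) :
    Measurable (phase ψ b) := by
  refine Finset.measurable_prod _ fun i _ => ?_
  exact (measurable_psi hψc).comp (by fun_prop)

theorem measurable_integrand (hq : Odd (resCard F)) {ψ : AddChar F Circle} (hψc : Continuous ψ)
    {ϖ : F} (hϖ : ϖ ∈ shell F 1) (s : ℂ) (b : ι → F) : Measurable (integrand ψ ϖ s b) :=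
  (measurable_cellFn hq hϖ s).mul (measurable_phase hψc b)

theorem enorm_integrand (ψ : AddChar F Circle) (ϖ : F) (s : ℂ) (b : ι → F) (x : Sym2 ι → F) :
    ‖integrand ψ ϖ s b x‖ₑ = ‖cellFn ϖ s (symM x)‖ₑ := by
  rw [integrand, enorm_mul, ← ofReal_norm (phase ψ b x), norm_phase]
  simp

theorem measurable_enorm_cellFn (hq : Odd (resCard F)) {ϖ : F} (hϖ : ϖ ∈ shell F 1) (s : ℂ) :
    Measurable fun x : Sym2 ι → F => ‖cellFn ϖ s (symM x)‖ₑ :=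
  (measurable_cellFn hq hϖ s).enorm

/-- The data of a pivot cell: the integral over the cell splits off the pivot block. -/
structure PivotCell (ε : O ⊕ K ≃ ι) (L : ℤ) (cell : Set (Sym2 ι → F)) (CO : Set (Sym2 O → F))
    (CY : K → Set (O → F)) (RK : Set (Sym2 K → F)) : Prop where
  mem_iff : ∀ x y z, schur ε ((x, y), z) ∈ cell ↔ x ∈ CO ∧ (∀ k, y k ∈ CY k) ∧ z ∈ RK
  det_ne : ∀ x ∈ CO, (symM x).det ≠ 0
  inv_mem : ∀ x ∈ CO, MemP (-L) (symM x)⁻¹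
  col_mem : ∀ k, ∀ y ∈ CY k, ∀ o, y o ∈ P F L
  measurableSet_cell : MeasurableSet cell
  measurableSet_CO : MeasurableSet CO
  measurableSet_CY : ∀ k, MeasurableSet (CY k)
  measurableSet_RK : MeasurableSet RK

variable {ε : O ⊕ K ≃ ι} {L : ℤ} {cell : Set (Sym2 ι → F)} {CO : Set (Sym2 O → F)}
  {CY : K → Set (O → F)} {RK : Set (Sym2 K → F)} (h : PivotCell ε L cell CO CY RK)
  (hq : Odd (resCard F)) {ψ : AddChar F Circle} (hψc : Continuous ψ) {ϖ : F} (hϖ : ϖ ∈ shell F 1)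
  (s : ℂ) (b : ι → F)

include h hq hψc hϖ in
-- The phases have absolute value one, so in absolute value the columns contribute just their
-- volumes. This version drives the proof of convergence.
theorem PivotCell.lintegral_eq :
    ∫⁻ x in cell, ‖integrand ψ ϖ s b x‖ₑ ∂haarS F ι =
      (∫⁻ x in CO, ‖cellFn ϖ s (symM x)‖ₑ ∂haarS F O) *
        (∏ k, (Measure.pi fun _ : O => haarF F) (CY k)) *
        ∫⁻ z in RK, ‖integrand ψ ϖ s (fun k => b (ε (.inr k))) z‖ₑ ∂haarS F K := by
  simp only [enorm_integrand]
  rw [← lintegral_indicator h.measurableSet_cell, ← (measurePreserving_schur ε).lintegral_comp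
    ((measurable_cellFn hq hϖ s).enorm.indicator h.measurableSet_cell)]
  have hpi : MeasurableSet (Set.univ.pi CY) := MeasurableSet.univ_pi h.measurableSet_CY
  have e : ∀ p : ((Sym2 O → F) × (K → O → F)) × (Sym2 K → F),
      cell.indicator (fun x => ‖cellFn ϖ s (symM x)‖ₑ) (schur ε p) =
      (CO.indicator (fun x => ‖cellFn ϖ s (symM x)‖ₑ) p.1.1 *
        (Set.univ.pi CY).indicator (fun _ => 1) p.1.2) *
        RK.indicator (fun z => ‖cellFn ϖ s (symM z)‖ₑ) p.2 := by
    rintro ⟨⟨x, y⟩, z⟩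
    have hiff := h.mem_iff x y z
    by_cases h1 : x ∈ CO
    · by_cases h2 : y ∈ Set.univ.pi CY
      · by_cases h3 : z ∈ RK
        · rw [Set.indicator_of_mem (hiff.mpr ⟨h1, fun k => h2 k trivial, h3⟩),
            Set.indicator_of_mem h1, Set.indicator_of_mem h2, Set.indicator_of_mem h3,
            cellFn_schur hq hϖ s ε _ (h.det_ne x h1) (h.inv_mem x h1)
            (fun k o => h.col_mem k _ (h2 k trivial) o), enorm_mul, mul_one]
        · rw [Set.indicator_of_notMem (fun h' => h3 (hiff.mp h').2.2),
            Set.indicator_of_notMem h3, mul_zero]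
      · rw [Set.indicator_of_notMem (fun h' => h2 fun k _ => (hiff.mp h').2.1 k),
          Set.indicator_of_notMem h2, mul_zero, zero_mul]
    · rw [Set.indicator_of_notMem (fun h' => h1 (hiff.mp h').1),
        Set.indicator_of_notMem h1, zero_mul, zero_mul]
  simp only [e]
  rw [lintegral_prod_mul (f := fun a : (Sym2 O → F) × (K → O → F) =>
      CO.indicator (fun x => ‖cellFn ϖ s (symM x)‖ₑ) a.1 *
        (Set.univ.pi CY).indicator (fun _ => 1) a.2)
    (g := RK.indicator fun z => ‖cellFn ϖ s (symM z)‖ₑ),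
    lintegral_prod_mul (f := CO.indicator fun x => ‖cellFn ϖ s (symM x)‖ₑ)
      (g := (Set.univ.pi CY).indicator fun _ => 1),
    lintegral_indicator h.measurableSet_CO, lintegral_indicator h.measurableSet_RK,
    lintegral_indicator hpi, setLIntegral_one, Measure.pi_pi]
  · exact ((measurable_enorm_cellFn hq hϖ s).indicator h.measurableSet_CO).aemeasurable
  · exact (measurable_const.indicator hpi).aemeasurable
  · exact ((((measurable_enorm_cellFn hq hϖ s).indicator h.measurableSet_CO).comp measurable_fst).mul
      ((measurable_const.indicator hpi).comp measurable_snd)).aemeasurable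
  · exact ((measurable_enorm_cellFn hq hϖ s).indicator h.measurableSet_RK).aemeasurable

include h hq hψc hϖ in
-- The Schur complement splits off as an independent factor. Fubini is needed only between the pivot
-- block and the columns, where the integrand is bounded on a set of finite measure.
theorem PivotCell.integral_eq (hCO : haarS F O CO ≠ ⊤)
    (hCY : ∀ k, (Measure.pi fun _ : O => haarF F) (CY k) ≠ ⊤) {C : ℝ}
    (hC : ∀ x ∈ CO, ‖cellFn ϖ s (symM x)‖ ≤ C) :
    ∫ x in cell, integrand ψ ϖ s b x ∂haarS F ι =
      (∫ x in CO, integrand ψ ϖ s (fun o => b (ε (.inl o))) x *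
        (∏ k, ∫ y in CY k, (ψ (-(b (ε (.inr k)) * (y ⬝ᵥ (symM x)⁻¹ *ᵥ y))) : ℂ)
          ∂Measure.pi fun _ : O => haarF F) ∂haarS F O) *
        ∫ z in RK, integrand ψ ϖ s (fun k => b (ε (.inr k))) z ∂haarS F K := by
  have hpi : MeasurableSet (Set.univ.pi CY) := MeasurableSet.univ_pi h.measurableSet_CY
  set G : (Sym2 O → F) → (K → O → F) → ℂ := fun x y =>
    integrand ψ ϖ s (fun o => b (ε (.inl o))) x *
      ∏ k, (ψ (-(b (ε (.inr k)) * (y k ⬝ᵥ (symM x)⁻¹ *ᵥ y k))) : ℂ) with hG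
  rw [← integral_indicator h.measurableSet_cell, ← (measurePreserving_schur ε).map_eq,
    integral_map (measurePreserving_schur ε).measurable.aemeasurable
    ((measurable_integrand hq hψc hϖ s b).indicator h.measurableSet_cell).aestronglyMeasurable]
  have e : ∀ p : ((Sym2 O → F) × (K → O → F)) × (Sym2 K → F),
      cell.indicator (integrand ψ ϖ s b) (schur ε p) =
      (CO ×ˢ Set.univ.pi CY).indicator (fun a => G a.1 a.2) p.1 *
        RK.indicator (integrand ψ ϖ s fun k => b (ε (.inr k))) p.2 := by
    rintro ⟨⟨x, y⟩, z⟩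
    have hiff := h.mem_iff x y z
    by_cases h1 : (x, y) ∈ CO ×ˢ Set.univ.pi CY
    · by_cases h3 : z ∈ RK
      · have h2 : ∀ k, y k ∈ CY k := fun k => h1.2 k trivial
        rw [Set.indicator_of_mem (hiff.mpr ⟨h1.1, h2, h3⟩),
          Set.indicator_of_mem h1, Set.indicator_of_mem h3, integrand,
          cellFn_schur hq hϖ s ε _ (h.det_ne x h1.1) (h.inv_mem x h1.1)
          (fun k o => h.col_mem k _ (h2 k) o), phase_schur, hG]
        simp only [integrand]
        ring
      · rw [Set.indicator_of_notMem (fun h' => h3 (hiff.mp h').2.2),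
          Set.indicator_of_notMem h3, mul_zero]
    · rw [Set.indicator_of_notMem (fun h' => h1 ⟨(hiff.mp h').1, fun k _ => (hiff.mp h').2.1 k⟩),
        Set.indicator_of_notMem h1, zero_mul]
  simp only [e]
  have hGm : Measurable fun a : (Sym2 O → F) × (K → O → F) => G a.1 a.2 := by
    refine ((measurable_integrand hq hψc hϖ s _).comp measurable_fst).mul
      (Finset.measurable_prod _ fun k _ => (measurable_psi hψc).comp ?_)
    have h0 := (measurable_pi_apply (s(k, k) : Sym2 K)).comp (measurable_corr (F := F) (O := O))
    exact (h0.const_mul _).neg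
  rw [integral_prod_mul, integral_indicator h.measurableSet_RK,
    integral_indicator (h.measurableSet_CO.prod hpi), setIntegral_prod]
  · congr 1
    refine setIntegral_congr_fun h.measurableSet_CO fun x _ => ?_
    simp only [hG]
    rw [integral_const_mul]
    congr 1
    rw [← integral_indicator hpi]
    have e2 : (Set.univ.pi CY).indicator (fun y : K → O → F =>
        ∏ k, (ψ (-(b (ε (.inr k)) * (y k ⬝ᵥ (symM x)⁻¹ *ᵥ y k))) : ℂ)) = fun y =>
        ∏ k, (CY k).indicator (fun y => (ψ (-(b (ε (.inr k)) * (y ⬝ᵥ (symM x)⁻¹ *ᵥ y))) : ℂ)) (y k) := by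
      funext y
      by_cases hy : y ∈ Set.univ.pi CY
      · rw [Set.indicator_of_mem hy]
        exact Finset.prod_congr rfl fun k _ => (Set.indicator_of_mem (hy k trivial) (fun y : O → F =>
          (ψ (-(b (ε (.inr k)) * (y ⬝ᵥ (symM x)⁻¹ *ᵥ y))) : ℂ))).symm
      · rw [Set.indicator_of_notMem hy]
        obtain ⟨k, hk⟩ : ∃ k, y k ∉ CY k := by simpa using hy
        exact (Finset.prod_eq_zero (Finset.mem_univ k) (Set.indicator_of_notMem hk _)).symm
    rw [e2, integral_fintype_prod_eq_prod (f := fun k => (CY k).indicator (fun y =>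
      (ψ (-(b (ε (.inr k)) * (y ⬝ᵥ (symM x)⁻¹ *ᵥ y))) : ℂ)))]
    exact Finset.prod_congr rfl fun k _ => integral_indicator (h.measurableSet_CY k)
  · have hfin : ((haarS F O).prod (Measure.pi fun _ : K => Measure.pi fun _ : O => haarF F))
        (CO ×ˢ Set.univ.pi CY) ≠ ⊤ := by
      rw [Measure.prod_prod, Measure.pi_pi]
      exact ENNReal.mul_ne_top hCO (ENNReal.prod_ne_top fun k _ => hCY k)
    have : IsFiniteMeasure (((haarS F O).prod (Measure.pi fun _ : K => Measure.pi fun _ : O =>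
        haarF F)).restrict (CO ×ˢ Set.univ.pi CY)) := ⟨by simpa using hfin.lt_top⟩
    refine Integrable.of_bound (C := C) hGm.aestronglyMeasurable ?_
    refine (ae_restrict_iff' (h.measurableSet_CO.prod hpi)).mpr (Filter.Eventually.of_forall ?_)
    rintro ⟨x, y⟩ hxy
    simp only [hG, integrand]
    rw [norm_mul, norm_mul, norm_phase, norm_prod, Finset.prod_eq_one fun k _ => norm_psi _, mul_one,
      mul_one]
    exact hC x hxy.1

end Elimination

/-! ### Filtration of the symmetric matrices by regions and pivot cells. -/

section Regions

variable {F : Type*} [Field F] [ValuativeRel F] [TopologicalSpace F]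
  [IsNonarchimedeanLocalField F] {ι O K : Type*}

/-- The level of the entry `(k, l)` of the matrices in `region r L m`. -/
def level (r : ι → ℕ) (L : ℤ) (m : ℕ) (k l : ι) : ℤ := if r k < m ∧ r l < m then L else L + 1

theorem level_comm (r : ι → ℕ) (L : ℤ) (m : ℕ) (k l : ι) : level r L m k l = level r L m l k := by
  simp only [level, and_comm]

theorem le_level (r : ι → ℕ) (L : ℤ) (m : ℕ) (k l : ι) : L ≤ level r L m k l := by
  unfold level; split_ifs <;> omega

variable (F) in
/-- The symmetric matrices with entries in `𝔭 ^ L` at the indices of rank less than `m`, and in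
`𝔭 ^ (L + 1)` elsewhere. -/
def region (r : ι → ℕ) (L : ℤ) (m : ℕ) : Set (Sym2 ι → F) :=
  {x | ∀ k l, x s(k, l) ∈ P F (level r L m k l)}

theorem mem_region {r : ι → ℕ} {L : ℤ} {m : ℕ} {x : Sym2 ι → F} :
    x ∈ region F r L m ↔ ∀ k l, x s(k, l) ∈ P F (level r L m k l) := Iff.rfl

/-- This is the passage from one level to the next: when no index is admitted at level `L`, all
indices are admitted at level `L + 1`. -/
theorem region_zero (r : ι → ℕ) (L : ℤ) {N : ℕ} (hN : ∀ k, r k < N) :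
    region F r L 0 = region F r (L + 1) N := by
  ext x
  simp [mem_region, level, hN]

theorem region_subset (r : ι → ℕ) (L : ℤ) (m : ℕ) : region F r L m ⊆ region F r L (m + 1) := by
  intro x hx k l
  refine P_mono ?_ (hx k l)
  unfold level; split_ifs <;> omega

theorem region_succ_of_forall_ne {r : ι → ℕ} {m : ℕ} (h : ∀ k, r k ≠ m) (L : ℤ) :
    region F r L (m + 1) = region F r L m := by
  have e : ∀ k, r k < m + 1 ↔ r k < m := fun k => by have := h k; omega
  simp only [region, level, e]

variable (F) in
/-- The matrices in `region r L (m + 1)` with pivot at the index `o` of rank `m` and the index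
`j`. -/
def cell (r : ι → ℕ) (L : ℤ) (m : ℕ) (o j : ι) : Set (Sym2 ι → F) :=
  {x | x ∈ region F r L (m + 1) ∧ x s(o, j) ∉ P F (L + 1) ∧
    ∀ k, r j < r k → r k ≤ m → x s(o, k) ∈ P F (L + 1)}

/-- In the row of the new index `o`, either all entries at indices of rank at most `m` lie in `𝔭 ^
(L + 1)`, and the matrix is already in the smaller region, or among the others there is one of
largest rank, which is the pivot position `j`. -/
theorem region_succ [Finite ι] {r : ι → ℕ} (hr : Function.Injective r) {m : ℕ} {o : ι}
    (ho : r o = m) (L : ℤ) :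
    region F r L (m + 1) = region F r L m ∪ ⋃ j ∈ {j | r j ≤ m}, cell F r L m o j := by
  ext x
  simp only [Set.mem_union, Set.mem_iUnion, exists_prop]
  constructor
  · intro hx
    by_cases h : ∀ k, r k ≤ m → x s(o, k) ∈ P F (L + 1)
    · left
      intro k l
      by_cases hk : r k = m
      · have : k = o := hr (hk.trans ho.symm)
        subst this
        have e1 : level r L m k l = L + 1 := by simp [level, hk]
        rw [e1]
        by_cases hl : r l ≤ m
        · exact h l hl
        · have := hx k l
          have e2 : level r L (m + 1) k l = L + 1 := by simp [level]; omega
          rwa [e2] at this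
      · by_cases hl : r l = m
        · have : l = o := hr (hl.trans ho.symm)
          subst this
          have e1 : level r L m k l = L + 1 := by simp [level, hl]
          rw [e1]
          by_cases hk' : r k ≤ m
          · rw [Sym2.eq_swap]; exact h k hk'
          · have := hx k l
            have e2 : level r L (m + 1) k l = L + 1 := by simp [level]; omega
            rwa [e2] at this
        · have := hx k l
          have e2 : level r L (m + 1) k l = level r L m k l := by
            unfold level; split_ifs <;> omega
          rwa [e2] at this
    · right
      push Not at h
      have hne : {k : ι | r k ≤ m ∧ x s(o, k) ∉ P F (L + 1)}.Nonempty := h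
      obtain ⟨j, hj, hmax⟩ := Set.exists_max_image _ r (Set.toFinite _) hne
      refine ⟨j, hj.1, hx, hj.2, fun k hk hkm => ?_⟩
      by_contra hk'
      have := hmax k ⟨hkm, hk'⟩
      omega
  · rintro (hx | ⟨j, -, hx⟩)
    exacts [region_subset r L m hx, hx.1]

theorem disjoint_region_cell {r : ι → ℕ} {m : ℕ} {o j : ι} (ho : r o = m) (L : ℤ) :
    Disjoint (region F r L m) (cell F r L m o j) := by
  rw [Set.disjoint_left]
  intro x hx hc
  refine hc.2.1 ?_
  have := hx o j
  have e : level r L m o j = L + 1 := by simp [level, ho]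
  rwa [e] at this

theorem disjoint_cell {r : ι → ℕ} (hr : Function.Injective r) {m : ℕ} {o j j' : ι} (hj : r j ≤ m)
    (hj' : r j' ≤ m) (h : j ≠ j') (L : ℤ) : Disjoint (cell F r L m o j) (cell F r L m o j') := by
  rw [Set.disjoint_left]
  intro x hx hx'
  rcases lt_trichotomy (r j) (r j') with h1 | h1 | h1
  · exact hx'.2.1 (hx.2.2 j' h1 hj')
  · exact h (hr h1)
  · exact hx.2.1 (hx'.2.2 j h1 hj)

variable [MeasurableSpace F] [BorelSpace F]

theorem measurableSet_region [Finite ι] (r : ι → ℕ) (L : ℤ) (m : ℕ) :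
    MeasurableSet (region F r L m) := by
  have : region F r L m = ⋂ k, ⋂ l, (fun x : Sym2 ι → F => x s(k, l)) ⁻¹'
      (P F (level r L m k l) : Set F) := by
    ext; simp [mem_region]
  rw [this]
  exact MeasurableSet.iInter fun k => MeasurableSet.iInter fun l =>
    measurable_pi_apply _ (measurableSet_P _)

theorem measurableSet_cell [Finite ι] (r : ι → ℕ) (L : ℤ) (m : ℕ) (o j : ι) :
    MeasurableSet (cell F r L m o j) := by
  have : cell F r L m o j = region F r L (m + 1) ∩ (((fun x : Sym2 ι → F => x s(o, j)) ⁻¹'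
      (P F (L + 1) : Set F))ᶜ ∩ ⋂ k ∈ {k | r j < r k ∧ r k ≤ m},
        (fun x : Sym2 ι → F => x s(o, k)) ⁻¹' (P F (L + 1) : Set F)) := by
    ext; simp only [cell, Set.mem_inter_iff, Set.mem_compl_iff, Set.mem_preimage, Set.mem_iInter,
      SetLike.mem_coe, Set.mem_ofPred_eq, and_imp]
  rw [this]
  refine (measurableSet_region r L _).inter ((measurable_pi_apply _ (measurableSet_P _)).compl.inter
    (MeasurableSet.biInter (Set.to_countable _) fun k _ => measurable_pi_apply _ (measurableSet_P _)))

variable [Fintype ι] [DecidableEq ι] [Fintype O] [DecidableEq O] [Fintype K] [DecidableEq K]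

theorem haarS_region_ne_top (r : ι → ℕ) (L : ℤ) (m : ℕ) : haarS F ι (region F r L m) ≠ ⊤ := by
  have h : region F r L m ⊆ Set.univ.pi fun _ => (P F L : Set F) := by
    intro x hx t _
    induction t with | _ k l => exact P_mono (le_level r L m k l) (hx k l)
  refine ((measure_mono h).trans_lt ?_).ne
  rw [Measure.pi_pi]
  exact ENNReal.prod_lt_top fun _ _ => (haar_P_ne_top L).lt_top

omit [MeasurableSpace F] [BorelSpace F] in
theorem MemP.det_mem {a : ℤ} {M : Matrix ι ι F} (hM : MemP a M) :
    M.det ∈ P F (Fintype.card ι * a) := by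
  have h : ∀ (t : Finset ι) (f : ι → F), (∀ i, f i ∈ P F a) → ∏ i ∈ t, f i ∈ P F (t.card * a) := by
    intro t f hf
    induction t using Finset.induction_on with
    | empty => simpa using (mem_P_zero (F := F)).mpr (one_mem _)
    | insert i t hi ih =>
      rw [Finset.prod_insert hi, Finset.card_insert_of_notMem hi]
      have := mul_mem_P (hf i) ih
      rwa [show ((t.card + 1 : ℕ) : ℤ) * a = a + t.card * a by push_cast; ring]
  rw [Matrix.det_apply]
  refine AddSubgroup.sum_mem _ fun σ _ => ?_
  rw [Units.smul_def]
  exact AddSubgroup.zsmul_mem _ (h _ _ fun i => hM _ _) _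

/-- The order of the determinant takes finitely many values: the entries bound it from below, and
the condition on the inverse bounds it from above. -/
theorem exists_norm_cellFn_le (hq : Odd (resCard F)) (ϖ : F) (s : ℂ) (r : ι → ℕ) (L : ℤ) (m : ℕ) :
    ∃ C : ℝ, ∀ x ∈ region F r L m, ‖cellFn ϖ s (symM x)‖ ≤ C := by
  obtain ⟨C, hC⟩ := ((Set.finite_Icc ((Fintype.card ι : ℤ) * L) (-(Fintype.card ι : ℤ))).image
    fun k : ℤ => ‖(resCard F : ℂ) ^ ((k : ℂ) * s)‖).bddAbove
  refine ⟨max C 0, fun x hx => ?_⟩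
  by_cases h : (symM x).det ≠ 0 ∧ MemP 1 (symM x)⁻¹
  · refine le_max_of_le_left ?_
    rw [cellFn_eq_cpow _ _ _ h, norm_mul, norm_chi, one_mul]
    refine hC ⟨_, ⟨?_, ?_⟩, rfl⟩
    · have h1 : MemP L (symM x) := fun k l => P_mono (le_level r L m k l) (hx k l)
      have := h1.det_mem
      rwa [mem_P_iff h.1] at this
    · have := h.2.det_mem
      rw [Matrix.det_nonsing_inv, Ring.inverse_eq_inv', mem_P_iff (inv_ne_zero h.1), ord_inv] at this
      linarith
  · rw [cellFn, if_neg h]; simp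

theorem integrableOn_region (hq : Odd (resCard F)) {ψ : AddChar F Circle} (hψc : Continuous ψ)
    {ϖ : F} (hϖ : ϖ ∈ shell F 1) (s : ℂ) (b : ι → F) (r : ι → ℕ) (L : ℤ) (m : ℕ) :
    IntegrableOn (integrand ψ ϖ s b) (region F r L m) (haarS F ι) := by
  obtain ⟨C, hC⟩ := exists_norm_cellFn_le hq ϖ s r L m
  have : IsFiniteMeasure ((haarS F ι).restrict (region F r L m)) :=
    ⟨by simpa using (haarS_region_ne_top r L m).lt_top⟩
  refine Integrable.of_bound (C := C) (measurable_integrand hq hψc hϖ s b).aestronglyMeasurable ?_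
  refine (ae_restrict_iff' (measurableSet_region r L m)).mpr (Filter.Eventually.of_forall ?_)
  intro x hx
  rw [integrand, norm_mul, norm_phase, mul_one]
  exact hC x hx

theorem setIntegral_region_succ (hq : Odd (resCard F)) {ψ : AddChar F Circle} (hψc : Continuous ψ)
    {ϖ : F} (hϖ : ϖ ∈ shell F 1) (s : ℂ) (b : ι → F) {r : ι → ℕ} (hr : Function.Injective r)
    {m : ℕ} {o : ι} (ho : r o = m) (L : ℤ) :
    ∫ x in region F r L (m + 1), integrand ψ ϖ s b x ∂haarS F ι =
      ∫ x in region F r L m, integrand ψ ϖ s b x ∂haarS F ι +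
        ∑ j with r j ≤ m, ∫ x in cell F r L m o j, integrand ψ ϖ s b x ∂haarS F ι := by
  have hI := integrableOn_region hq hψc hϖ s b r L (m + 1)
  have e : (⋃ j ∈ {j | r j ≤ m}, cell F r L m o j) =
      ⋃ j ∈ (Finset.univ.filter fun j => r j ≤ m), cell F r L m o j := by simp
  rw [region_succ hr ho, e] at hI ⊢
  rw [setIntegral_union _ _ hI.left_of_union hI.right_of_union, integral_biUnion_finset]
  · exact fun j _ => measurableSet_cell r L m o j
  · intro j hj j' hj' h
    exact disjoint_cell hr (by simpa using hj) (by simpa using hj') h L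
  · intro j hj
    exact hI.right_of_union.mono_set (Set.subset_biUnion_of_mem (u := fun j => cell F r L m o j) hj)
  · simp only [Set.disjoint_iUnion_right]
    exact fun j _ => disjoint_region_cell ho L
  · exact Finset.measurableSet_biUnion _ fun j _ => measurableSet_cell r L m o j

theorem setLIntegral_region_succ (f : (Sym2 ι → F) → ENNReal) {r : ι → ℕ}
    (hr : Function.Injective r) {m : ℕ} {o : ι} (ho : r o = m) (L : ℤ) :
    ∫⁻ x in region F r L (m + 1), f x ∂haarS F ι ≤
      ∫⁻ x in region F r L m, f x ∂haarS F ι +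
        ∑ j with r j ≤ m, ∫⁻ x in cell F r L m o j, f x ∂haarS F ι := by
  have e : (⋃ j ∈ {j | r j ≤ m}, cell F r L m o j) =
      ⋃ j ∈ (Finset.univ.filter fun j => r j ≤ m), cell F r L m o j := by simp
  rw [region_succ hr ho, e]
  refine (lintegral_union_le _ _ _).trans (add_le_add le_rfl ?_)
  rw [lintegral_biUnion_finset]
  · intro j hj j' hj' h
    exact disjoint_cell hr (by simpa using hj) (by simpa using hj') h L
  · exact fun j _ => measurableSet_cell r L m o j

omit [MeasurableSpace F] [BorelSpace F] [DecidableEq O] [Fintype K] [DecidableEq K] [Fintype ι]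
  [DecidableEq ι] [Fintype O] in
-- The levels of the two columns add up and the inverse of the pivot subtracts `L`. The result is
-- `L` if both indices have rank below `m`, and at least `L + 1` otherwise, which is the level of
-- the entry `(k, l)`.
theorem corr_mem [Fintype O] [DecidableEq O] {r : ι → ℕ} {L : ℤ} {m : ℕ} {ε : O ⊕ K ≃ ι}
    {x : Sym2 O → F} {y : K → O → F} (hx : MemP (-L) (symM x)⁻¹)
    (hy : ∀ k o, y k o ∈ P F (if r (ε (.inr k)) < m then L else L + 1)) (k l : K) :
    corr (x, y) s(k, l) ∈ P F (level (fun k => r (ε (.inr k))) L m k l) := by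
  change y k ⬝ᵥ (symM x)⁻¹ *ᵥ y l ∈ _
  rw [dotProduct]
  refine AddSubgroup.sum_mem _ fun o _ => ?_
  rw [Matrix.mulVec, dotProduct, Finset.mul_sum]
  refine AddSubgroup.sum_mem _ fun o' _ => ?_
  refine P_mono ?_ (mul_mem_P (hy k o) (mul_mem_P (hx o o') (hy l o')))
  simp only [level]
  split_ifs <;> omega

omit [MeasurableSpace F] [BorelSpace F] [DecidableEq K] [Fintype K] [Fintype ι] [DecidableEq ι] in
-- The correction lies in the same region as the Schur complement, so that adding it does not affect
-- membership.
theorem schur_mem_region_iff {r : ι → ℕ} {L : ℤ} {m : ℕ} {ε : O ⊕ K ≃ ι} {x : Sym2 O → F}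
    {y : K → O → F} (hm : ∀ k, r (ε (.inr k)) ≠ m) (hx : MemP (-L) (symM x)⁻¹)
    (hy : ∀ k o, y k o ∈ P F (if r (ε (.inr k)) < m then L else L + 1)) (z : Sym2 K → F)
    (ho : ∀ o, r (ε (.inl o)) ≤ m) :
    schur ε ((x, y), z) ∈ region F r L (m + 1) ↔
      (∀ o o', x s(o, o') ∈ P F L) ∧ z ∈ region F (fun k => r (ε (.inr k))) L m := by
  -- No remaining index has rank `m`, so for these indices the bounds `m + 1` and `m` describe the
  -- same region.
  have hlt : ∀ k, r (ε (.inr k)) < m + 1 ↔ r (ε (.inr k)) < m := fun k => by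
    have := hm k; omega
  have hlt' : ∀ o, r (ε (.inl o)) < m + 1 := fun o => Nat.lt_succ_of_le (ho o)
  constructor
  · intro h
    refine ⟨fun o o' => ?_, fun k l => ?_⟩
    · have := h (ε (.inl o)) (ε (.inl o'))
      rw [schur, asm_inl_inl] at this
      simpa [level, hlt'] using this
    · have := h (ε (.inr k)) (ε (.inr l))
      rw [schur, asm_inr_inr] at this
      have h2 := AddSubgroup.sub_mem _ this (show corr (x, y) s(k, l) ∈
        P F (level r L (m + 1) (ε (.inr k)) (ε (.inr l))) by
          simpa only [level, hlt] using corr_mem (r := r) (m := m) hx hy k l)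
      have e : (z + corr (x, y)) s(k, l) - corr (x, y) s(k, l) = z s(k, l) := by simp
      change (z + corr (x, y)) s(k, l) - corr (x, y) s(k, l) ∈ _ at h2
      rw [e] at h2
      simpa only [level, hlt] using h2
  · rintro ⟨h1, h2⟩ k l
    obtain ⟨k, rfl⟩ := ε.surjective k
    obtain ⟨l, rfl⟩ := ε.surjective l
    have hox : ∀ o k, y k o ∈ P F (level r L (m + 1) (ε (.inl o)) (ε (.inr k))) := fun o k => by
      have := hy k o
      simpa [level, hlt', hlt] using this
    rcases k with k | k <;> rcases l with l | l
    · rw [schur, asm_inl_inl]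
      simpa [level, hlt'] using h1 k l
    · rw [schur, asm_inl_inr]
      exact hox k l
    · rw [schur, asm_inr_inl, level_comm]
      exact hox l k
    · rw [schur, asm_inr_inr]
      have := AddSubgroup.add_mem _ (h2 k l) (corr_mem (r := r) (m := m) hx hy k l)
      simp only [level, hlt] at this ⊢
      exact this

end Regions

/-! ### Pivot cells of size one and two. -/

section Cells

variable {F : Type*} [Field F] [ValuativeRel F] [TopologicalSpace F]
  [IsNonarchimedeanLocalField F] {ι K : Type*} [Fintype ι] [DecidableEq ι] [Fintype K]
  [DecidableEq K] [MeasurableSpace F] [BorelSpace F]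

omit [MeasurableSpace F] [BorelSpace F] in
theorem inv_symM_unit (x : Sym2 Unit → F) (o o' : Unit) :
    (symM x)⁻¹ o o' = (x s((), ()))⁻¹ := by
  rw [Matrix.inv_subsingleton, Ring.inverse_eq_inv']; simp [symM]

omit [MeasurableSpace F] [BorelSpace F] in
theorem det_symM_unit (x : Sym2 Unit → F) : (symM x).det = x s((), ()) := by
  simp [symM]

/-- For a pivot on the diagonal, no index of rank at most `m` comes after the pivot column. The
condition on later entries of the row is void, and the column levels are those of the region. -/
theorem pivotCell_unit {ε : Unit ⊕ K ≃ ι} {r : ι → ℕ} (hr : Function.Injective r) {m : ℕ}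
    (hm : r (ε (.inl ())) = m) (L : ℤ) :
    PivotCell ε L (cell F r L m (ε (.inl ())) (ε (.inl ())))
      {x | x s((), ()) ∈ shell F L}
      (fun k => {y | y () ∈ P F (if r (ε (.inr k)) < m then L else L + 1)})
      (region F (fun k => r (ε (.inr k))) L m) := by
  have hk : ∀ k, r (ε (.inr k)) ≠ m := fun k h => by
    simpa using ε.injective (hr (h.trans hm.symm))
  have hinv : ∀ x : Sym2 Unit → F, x s((), ()) ∈ shell F L → MemP (-L) (symM x)⁻¹ :=
    fun x hx o o' => by
      rw [inv_symM_unit]; exact shell_subset_P (shell_inv hx)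
  constructor
  · intro x y z
    have hcell : schur ε ((x, y), z) ∈ cell F r L m (ε (.inl ())) (ε (.inl ())) ↔
        schur ε ((x, y), z) ∈ region F r L (m + 1) ∧ x s((), ()) ∉ P F (L + 1) := by
      constructor
      · rintro ⟨h1, h2, -⟩
        rw [schur, asm_inl_inl] at h2
        exact ⟨h1, h2⟩
      · rintro ⟨h1, h2⟩
        refine ⟨h1, by rwa [schur, asm_inl_inl], fun k hk hk' => ?_⟩
        omega
    rw [hcell]
    constructor
    · rintro ⟨h1, h2⟩
      have hx : x s((), ()) ∈ shell F L := by
        rw [mem_shell_iff]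
        refine ⟨?_, h2⟩
        have := h1 (ε (.inl ())) (ε (.inl ()))
        rw [schur, asm_inl_inl] at this
        simpa [level, hm] using this
      have hy : ∀ k o, y k o ∈ P F (if r (ε (.inr k)) < m then L else L + 1) := by
        rintro k ⟨⟩
        have := h1 (ε (.inl ())) (ε (.inr k))
        rw [schur, asm_inl_inr] at this
        have hlt : r (ε (.inr k)) < m + 1 ↔ r (ε (.inr k)) < m := by have := hk k; omega
        simpa [level, hm, hlt] using this
      exact ⟨hx, fun k => hy k (),
        ((schur_mem_region_iff hk (hinv x hx) hy z fun _ => hm.le).mp h1).2⟩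
    · rintro ⟨hx, hy, hz⟩
      refine ⟨(schur_mem_region_iff hk (hinv x hx) (fun k _ => hy k) z fun _ => hm.le).mpr
        ⟨fun o o' => shell_subset_P hx, hz⟩, (mem_shell_iff.mp hx).2⟩
  · intro x hx
    rw [det_symM_unit]; exact hx.1
  · exact hinv
  · rintro k y hy ⟨⟩
    exact P_mono (by split_ifs <;> omega) hy
  · exact measurableSet_cell _ _ _ _ _
  · exact measurable_pi_apply _ (measurableSet_shell L)
  · exact fun k => measurable_pi_apply _ (measurableSet_P _)
  · exact measurableSet_region _ _ _

omit [MeasurableSpace F] [BorelSpace F] in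
theorem det_symM_two (x : Sym2 (Fin 2) → F) :
    (symM x).det = x s(0, 0) * x s(1, 1) - x s(0, 1) ^ 2 := by
  rw [Matrix.det_fin_two]; simp [symM, Sym2.eq_swap (a := (1 : Fin 2)) (b := 0), sq]

omit [MeasurableSpace F] [BorelSpace F] in
-- The square of the off-diagonal entry has order `2L`, while the product of the diagonal entries
-- has order at least `2L + 1`.
theorem det_symM_two_mem {L : ℤ} {x : Sym2 (Fin 2) → F} (h0 : x s(0, 0) ∈ P F (L + 1))
    (h1 : x s(0, 1) ∈ shell F L) (h2 : x s(1, 1) ∈ P F L) : (symM x).det ∈ shell F (2 * L) := by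
  rw [det_symM_two, sub_eq_neg_add]
  refine shell_add (shell_neg ?_) (P_mono ?_ (mul_mem_P h0 h2))
  · have := shell_mul h1 h1
    rwa [← sq, ← two_mul] at this
  · omega

omit [MeasurableSpace F] [BorelSpace F] in
theorem inv_symM_two (x : Sym2 (Fin 2) → F) :
    (symM x)⁻¹ = (symM x).det⁻¹ • !![x s(1, 1), -x s(0, 1); -x s(0, 1), x s(0, 0)] := by
  rw [Matrix.inv_def, Ring.inverse_eq_inv', Matrix.adjugate_fin_two]
  simp [symM, Sym2.eq_swap (a := (1 : Fin 2)) (b := 0)]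

/-- Within the block, `0` stands for the index of rank `m` and `1` for the pivot column. The last
entry of order `L` in row `0` is at column `1`, so all later entries of that row, the diagonal one
included, lie in `𝔭 ^ (L + 1)`. This is why the two column entries have different thresholds `j` and
`m`. -/
theorem pivotCell_two {ε : Fin 2 ⊕ K ≃ ι} {r : ι → ℕ} (hr : Function.Injective r) {m : ℕ}
    (hm : r (ε (.inl 0)) = m) {j : ℕ} (hj : r (ε (.inl 1)) = j) (hjm : j < m) (L : ℤ) :
    PivotCell ε L (cell F r L m (ε (.inl 0)) (ε (.inl 1)))
      {x | x s(0, 0) ∈ P F (L + 1) ∧ x s(0, 1) ∈ shell F L ∧ x s(1, 1) ∈ P F L}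
      (fun k => {y | y 0 ∈ P F (if r (ε (.inr k)) < j then L else L + 1) ∧
        y 1 ∈ P F (if r (ε (.inr k)) < m then L else L + 1)})
      (region F (fun k => r (ε (.inr k))) L m) := by
  have hk : ∀ k, r (ε (.inr k)) ≠ m := fun k h => by
    simpa using ε.injective (hr (h.trans hm.symm))
  have hkj : ∀ k, r (ε (.inr k)) ≠ j := fun k h => by
    simpa using ε.injective (hr (h.trans hj.symm))
  have ho : ∀ o, r (ε (.inl o)) ≤ m := fun o => by
    fin_cases o
    exacts [hm.le, hj.le.trans hjm.le]
  have hinv : ∀ x : Sym2 (Fin 2) → F, x s(0, 0) ∈ P F (L + 1) → x s(0, 1) ∈ shell F L →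
      x s(1, 1) ∈ P F L → MemP (-L) (symM x)⁻¹ := by
    intro x h0 h1 h2 a b
    have hd := shell_subset_P (shell_inv (det_symM_two_mem h0 h1 h2))
    have h1' : -x s(0, 1) ∈ P F L := AddSubgroup.neg_mem _ (shell_subset_P h1)
    have e : -L = -(2 * L) + L := by ring
    rw [inv_symM_two, e]
    fin_cases a <;> fin_cases b <;> simp only [Matrix.smul_apply, smul_eq_mul]
    · exact mul_mem_P hd h2
    · exact mul_mem_P hd h1'
    · exact mul_mem_P hd h1'
    · exact mul_mem_P hd (P_mono (by omega) h0)
  have hy' : ∀ y : K → Fin 2 → F, (∀ k, y k 0 ∈ P F (if r (ε (.inr k)) < j then L else L + 1) ∧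
      y k 1 ∈ P F (if r (ε (.inr k)) < m then L else L + 1)) →
      ∀ k o, y k o ∈ P F (if r (ε (.inr k)) < m then L else L + 1) := by
    intro y hy k o
    fin_cases o
    · refine P_mono ?_ (hy k).1
      split_ifs <;> omega
    · exact (hy k).2
  constructor
  · intro x y z
    have hcell : schur ε ((x, y), z) ∈ cell F r L m (ε (.inl 0)) (ε (.inl 1)) ↔
        schur ε ((x, y), z) ∈ region F r L (m + 1) ∧ x s(0, 1) ∉ P F (L + 1) ∧
          x s(0, 0) ∈ P F (L + 1) ∧ ∀ k, j < r (ε (.inr k)) → r (ε (.inr k)) ≤ m →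
            y k 0 ∈ P F (L + 1) := by
      refine and_congr Iff.rfl (and_congr ?_ ?_)
      · rw [schur, asm_inl_inl]
      · constructor
        · intro h
          refine ⟨?_, fun k h1 h2 => ?_⟩
          · have := h (ε (.inl 0)) (by omega) hm.le
            rwa [schur, asm_inl_inl] at this
          · have := h (ε (.inr k)) (by omega) h2
            rwa [schur, asm_inl_inr] at this
        · rintro ⟨h1, h2⟩ k
          obtain ⟨k, rfl⟩ := ε.surjective k
          intro h3 h4
          rcases k with k | k
          · rw [schur, asm_inl_inl]
            fin_cases k
            · exact h1
            · exact absurd h3 (lt_irrefl _)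
          · rw [schur, asm_inl_inr]
            exact h2 k (by omega) h4
    rw [hcell]
    constructor
    · rintro ⟨h1, h2, h3, h4⟩
      have hx : x s(0, 1) ∈ shell F L := by
        rw [mem_shell_iff]
        refine ⟨?_, h2⟩
        have := h1 (ε (.inl 0)) (ε (.inl 1))
        rw [schur, asm_inl_inl] at this
        have hj1 : j < m + 1 := by omega
        simpa [level, hm, hj, hj1] using this
      have hx1 : x s(1, 1) ∈ P F L := by
        have := h1 (ε (.inl 1)) (ε (.inl 1))
        rw [schur, asm_inl_inl] at this
        have hj1 : j < m + 1 := by omega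
        simpa [level, hm, hj, hj1] using this
      have hy : ∀ k, y k 0 ∈ P F (if r (ε (.inr k)) < j then L else L + 1) ∧
          y k 1 ∈ P F (if r (ε (.inr k)) < m then L else L + 1) := by
        intro k
        have hlt : r (ε (.inr k)) < m + 1 ↔ r (ε (.inr k)) < m := by have := hk k; omega
        have hj1 : j < m + 1 := by omega
        constructor
        · have := h1 (ε (.inl 0)) (ε (.inr k))
          rw [schur, asm_inl_inr] at this
          by_cases hkj' : r (ε (.inr k)) < j
          · rw [if_pos hkj']
            have hkm : r (ε (.inr k)) < m := by omega
            simpa [level, hm, hlt, hkm] using this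
          · rw [if_neg hkj']
            by_cases hkm : r (ε (.inr k)) < m
            · exact h4 k (by have := hkj k; omega) hkm.le
            · simpa [level, hm, hlt, hkm] using this
        · have := h1 (ε (.inl 1)) (ε (.inr k))
          rw [schur, asm_inl_inr] at this
          simpa [level, hj, hlt, hj1] using this
      exact ⟨⟨h3, hx, hx1⟩, hy,
        ((schur_mem_region_iff hk (hinv x h3 hx hx1) (hy' y hy) z ho).mp h1).2⟩
    · rintro ⟨⟨h0, h1, h2⟩, hy, hz⟩
      refine ⟨(schur_mem_region_iff hk (hinv x h0 h1 h2) (hy' y hy) z ho).mpr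
        ⟨fun o o' => ?_, hz⟩, (mem_shell_iff.mp h1).2, h0, fun k hk1 hk2 => ?_⟩
      · fin_cases o <;> fin_cases o'
        · exact P_mono (by omega) h0
        · exact shell_subset_P h1
        · rw [Sym2.eq_swap]; exact shell_subset_P h1
        · exact h2
      · have := (hy k).1
        rwa [if_neg (by omega)] at this
  · exact fun x hx => (det_symM_two_mem hx.1 hx.2.1 hx.2.2).1
  · exact fun x hx => hinv x hx.1 hx.2.1 hx.2.2
  · intro k y hy o
    fin_cases o
    · exact P_mono (by split_ifs <;> omega) hy.1
    · exact P_mono (by split_ifs <;> omega) hy.2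
  · exact measurableSet_cell _ _ _ _ _
  · exact (measurable_pi_apply _ (measurableSet_P _)).inter
      ((measurable_pi_apply _ (measurableSet_shell L)).inter (measurable_pi_apply _ (measurableSet_P _)))
  · exact fun k => (measurable_pi_apply _ (measurableSet_P _)).inter
      (measurable_pi_apply _ (measurableSet_P _))
  · exact measurableSet_region _ _ _

end Cells

/-! ### Evaluation of the integrals over columns and pivot blocks. -/

section Weights

variable {F : Type*} [Field F] [ValuativeRel F] [TopologicalSpace F]
  [IsNonarchimedeanLocalField F] [MeasurableSpace F] [BorelSpace F] {K : Type*} [Fintype K]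
  [DecidableEq K]

omit [MeasurableSpace F] [BorelSpace F] in
theorem zpow_mem_shell {ϖ : F} (hϖ : ϖ ∈ shell F 1) (l : ℤ) : ϖ ^ l ∈ shell F l :=
  ⟨zpow_ne_zero l hϖ.1, by rw [ord_zpow, hϖ.2, mul_one]⟩

variable (hq : Odd (resCard F)) {ψ : AddChar F Circle} (hψc : Continuous ψ) (hψ : HasOrderZero ψ)
  {ϖ : F} (hϖ : ϖ ∈ shell F 1)

include hq hψc hψ hϖ

/-- Scale the ball to the ring of integers and apply `quad_eq`. The argument of `χ` is `b a⁻¹` up to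
a square, so `χ` separates the entry `b` from the pivot `a`. -/
theorem integral_psi_quadratic {a b : F} {e L : ℤ} (hb : b ∈ shell F e) (ha : a ∈ shell F L)
    (l : ℤ) :
    ∫ y in P F l, (ψ (-(b * (y * (a⁻¹ * y)))) : ℂ) ∂haarF F =
      (resCard F : ℂ) ^ (-l) * (resCard F : ℂ) ^ (((min (e - L + 2 * l) 0 : ℤ) : ℂ) / 2) *
        if e - L + 2 * l < 0 ∧ Odd (e - L) then
          chi ϖ b * weilConstant ψ ϖ * chi ϖ a else 1 := by
  have hz := zpow_mem_shell hϖ l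
  have e1 : ∀ y : F, -(b * (y * (a⁻¹ * y))) = -(b * a⁻¹) * y ^ 2 := fun y => by ring
  simp only [e1]
  have hba : b * a⁻¹ ∈ shell F (e - L) := by
    have := shell_mul hb (shell_inv ha)
    rwa [← sub_eq_add_neg] at this
  have ht : -(b * a⁻¹) * (ϖ ^ l) ^ 2 ∈ shell F (e - L + 2 * l) := by
    have := shell_mul (shell_neg hba) (shell_mul hz hz)
    rwa [← sq, ← two_mul] at this
  rw [integral_psi_sq _ hz, quad_eq hq hψc hψ hϖ ht.1, ht.2, mul_assoc]
  have hodd : Odd (e - L + 2 * l) ↔ Odd (e - L) := by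
    rw [Int.odd_add]; simp
  simp only [hodd]
  congr 3
  rw [neg_mul, neg_neg, chi_mul_sq _ _ hz.1, chi_mul hq hϖ hb.1 (inv_ne_zero ha.1), chi_inv]
  ring

/-- In the exponent, `N` counts the Gauss integrals that contribute a factor `χ(x)`, and the extra
one comes from `cellFn`. After scaling to units, the parity of `N` leaves `χ` or the trivial
character. The cases are those in which the additive character is trivial, of the same conductor as
`χ`, or of larger conductor. -/
theorem integral_chi_pow_psi_shell {c : F} {e : ℤ} (hc : c ∈ shell F e) (L : ℤ) (N : ℕ) :
    ∫ x in shell F L, chi ϖ x ^ (N + 1) * (ψ (-(c * x)) : ℂ) ∂haarF F =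
      (resCard F : ℂ) ^ (-L) * (chi ϖ (-1) ^ L) ^ (N + 1) *
        if 0 ≤ e + L then if Even N then 0 else 1 - (resCard F : ℂ)⁻¹
        else if e + L = -1 then
          if Even N then (resCard F : ℂ) ^ (-(1 / 2) : ℂ) * chi ϖ c * chi ϖ (-1) ^ L *
            weilConstant ψ ϖ
          else -(resCard F : ℂ)⁻¹
        else 0 := by
  have hz := zpow_mem_shell hϖ L
  have ht : -(c * ϖ ^ L) ∈ shell F (e + L) := shell_neg (shell_mul hc hz)
  rw [setIntegral_shell_mul hz, sub_self, mul_assoc]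
  congr 1
  have h1 : ∫ x in shell F 0, chi ϖ (ϖ ^ L * x) ^ (N + 1) * (ψ (-(c * (ϖ ^ L * x))) : ℂ) ∂haarF F =
      ∫ x in shell F 0, (chi ϖ (-1) ^ L) ^ (N + 1) * (chi ϖ x ^ (N + 1) *
        (ψ (-(c * ϖ ^ L) * x) : ℂ)) ∂haarF F := by
    refine setIntegral_congr_fun (measurableSet_shell 0) fun x hx => ?_
    rw [mul_comm (ϖ ^ L) x, chi_unit_mul_zpow hq hϖ hx]
    have : -(c * (x * ϖ ^ L)) = -(c * ϖ ^ L) * x := by ring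
    rw [this]; ring
  rw [h1, integral_const_mul]
  congr 1
  have hpow : ∀ x : F, Even N → chi ϖ x ^ (N + 1) = chi ϖ x := by
    rintro x ⟨k, rfl⟩
    rw [pow_succ, ← two_mul, pow_mul, sq, chi_mul_self, one_pow, one_mul]
  have hpow' : ∀ x : F, ¬ Even N → chi ϖ x ^ (N + 1) = 1 := by
    intro x h
    obtain ⟨k, hk⟩ := (Nat.not_even_iff_odd.mp h).add_one
    rw [hk, ← two_mul, pow_mul, sq, chi_mul_self, one_pow]
  by_cases h0 : 0 ≤ e + L
  · rw [if_pos h0]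
    have hone : ∫ x in shell F 0, chi ϖ x ^ (N + 1) * (ψ (-(c * ϖ ^ L) * x) : ℂ) ∂haarF F =
        ∫ x in shell F 0, chi ϖ x ^ (N + 1) ∂haarF F := by
      refine setIntegral_congr_fun (measurableSet_shell 0) fun x hx => ?_
      rw [psi_eq_one hψ (P_mono (by omega) (shell_subset_P (shell_mul ht hx))), mul_one]
    rw [hone]
    split_ifs with hN
    · simp only [hpow _ hN]; exact integral_chi hq hϖ
    · simp only [hpow' _ hN]
      rw [setIntegral_const, Complex.real_smul, haar_real_shell]; simp
  · rw [if_neg h0]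
    split_ifs with h1 hN
    · simp only [hpow _ hN]
      rw [h1] at ht
      rw [integral_chi_psi hq hψ hϖ ht, quad_eq hq hψc hψ hϖ ht.1, ht.2,
        if_pos ⟨by norm_num, by decide⟩, neg_neg, mul_comm c, ← mul_comm c]
      have e3 : chi ϖ (c * ϖ ^ L) = chi ϖ c * chi ϖ (-1) ^ L := by
        rw [chi_mul hq hϖ hc.1 hz.1]
        congr 1
        have := chi_unit_mul_zpow hq hϖ (u := 1) (by simp [mem_shell]) L
        rwa [one_mul, chi_one, one_mul] at this
      rw [e3]
      have e4 : (((min (-1) 0 : ℤ) : ℂ) / 2) = -(1 / 2) := by norm_num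
      rw [e4]; ring
    · simp only [hpow' _ hN, one_mul]
      rw [h1] at ht
      exact integral_shell_psi hψc hψ ht
    · exact integral_chi_pow_psi hq hψ hϖ ht.1 (by rw [ht.2]; omega) _

omit hψc hψ in
theorem cellFn_unit (s : ℂ) {L : ℤ} (hL : L ≤ -1) {x : Sym2 Unit → F}
    (hx : x s((), ()) ∈ shell F L) :
    cellFn ϖ s (symM x) = chi ϖ (x s((), ())) * (resCard F : ℂ) ^ ((L : ℂ) * s) := by
  rw [cellFn_eq_cpow, det_symM_unit, hx.2]
  rw [det_symM_unit]
  refine ⟨hx.1, fun o o' => ?_⟩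
  rw [inv_symM_unit]
  exact P_mono (by omega) (shell_subset_P (shell_inv hx))

omit hψc hψ in
theorem cellFn_two (s : ℂ) {L : ℤ} (hL : L ≤ -1) {x : Sym2 (Fin 2) → F}
    (h0 : x s(0, 0) ∈ P F (L + 1)) (h1 : x s(0, 1) ∈ shell F L) (h2 : x s(1, 1) ∈ P F L) :
    cellFn ϖ s (symM x) = chi ϖ (-1) * (resCard F : ℂ) ^ (((2 * L : ℤ) : ℂ) * s) := by
  have hd := det_symM_two_mem h0 h1 h2
  rw [cellFn_eq_cpow, hd.2]
  · congr 1
    rw [det_symM_two, sub_eq_neg_add]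
    have hm : -x s(0, 1) ^ 2 ∈ shell F (2 * L) := shell_neg (by
      have := shell_mul h1 h1
      rwa [← sq, ← two_mul] at this)
    rw [chi_add hq hϖ hm (P_mono (by omega) (mul_mem_P h0 h2)), ← neg_one_mul, chi_mul_sq _ _ h1.1]
  · refine ⟨hd.1, fun a b => ?_⟩
    have h1' : -x s(0, 1) ∈ P F L := AddSubgroup.neg_mem _ (shell_subset_P h1)
    refine P_mono (show 1 ≤ -(2 * L) + L by omega) ?_
    have hd' := shell_subset_P (shell_inv hd)
    rw [inv_symM_two]
    fin_cases a <;> fin_cases b <;> simp only [Matrix.smul_apply, smul_eq_mul]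
    · exact mul_mem_P hd' h2
    · exact mul_mem_P hd' h1'
    · exact mul_mem_P hd' h1'
    · exact mul_mem_P hd' (P_mono (by omega) h0)

omit hq hψc hψ hϖ in
theorem setIntegral_pi_unique {α : Type*} [Unique α] (a : α) (S : Set F) (f : F → ℂ) :
    ∫ y in {y : α → F | y a ∈ S}, f (y a) ∂(Measure.pi fun _ => haarF F) =
      ∫ y in S, f y ∂haarF F := by
  obtain rfl := Unique.eq_default a
  exact (measurePreserving_funUnique (haarF F) α).setIntegral_preimage_emb
    (MeasurableEquiv.measurableEmbedding _) f S

/-- Only columns whose Gauss integral has odd negative exponent depend on the pivot, and they do so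
through `χ` of it. Collecting these factors leaves an integral in one variable. -/
theorem integral_pivot_unit (s : ℂ) {b : K → F} {e : K → ℤ} (hb : ∀ k, b k ∈ shell F (e k)) {c : F}
    {e0 : ℤ} (hc : c ∈ shell F e0) {L : ℤ} (hL : L ≤ -1) (l : K → ℤ) :
    ∫ x in {x : Sym2 Unit → F | x s((), ()) ∈ shell F L}, integrand ψ ϖ s (fun _ => c) x *
      (∏ k, ∫ y in {y : Unit → F | y () ∈ P F (l k)},
        (ψ (-(b k * (y ⬝ᵥ (symM x)⁻¹ *ᵥ y))) : ℂ) ∂Measure.pi fun _ : Unit => haarF F)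
      ∂haarS F Unit =
    (resCard F : ℂ) ^ ((L : ℂ) * s) * (∏ k, ((resCard F : ℂ) ^ (-l k) *
      (resCard F : ℂ) ^ (((min (e k - L + 2 * l k) 0 : ℤ) : ℂ) / 2))) *
      (∏ k with e k - L + 2 * l k < 0 ∧ Odd (e k - L), (chi ϖ (b k) * weilConstant ψ ϖ)) *
      ∫ x in shell F L, chi ϖ x ^ ((Finset.univ.filter fun k => e k - L + 2 * l k < 0 ∧
        Odd (e k - L)).card + 1) * (ψ (-(c * x)) : ℂ) ∂haarF F := by
  set S := Finset.univ.filter fun k => e k - L + 2 * l k < 0 ∧ Odd (e k - L) with hS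
  rw [← integral_const_mul, ← setIntegral_pi_unique (s((), ()) : Sym2 Unit) (shell F L)]
  refine setIntegral_congr_fun (measurable_pi_apply _ (measurableSet_shell L)) fun x hx => ?_
  have hx' : x s((), ()) ∈ shell F L := hx
  have hin : ∀ k, ∫ y in {y : Unit → F | y () ∈ P F (l k)},
      (ψ (-(b k * (y ⬝ᵥ (symM x)⁻¹ *ᵥ y))) : ℂ) ∂(Measure.pi fun _ : Unit => haarF F) =
      (resCard F : ℂ) ^ (-l k) * (resCard F : ℂ) ^ (((min (e k - L + 2 * l k) 0 : ℤ) : ℂ) / 2) *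
        if e k - L + 2 * l k < 0 ∧ Odd (e k - L) then
          chi ϖ (b k) * weilConstant ψ ϖ * chi ϖ (x s((), ())) else 1 := fun k => by
    rw [← integral_psi_quadratic hq hψc hψ hϖ (hb k) hx' (l k),
      ← setIntegral_pi_unique () (P F (l k) : Set F)]
    simp [dotProduct, Matrix.mulVec, inv_symM_unit]
  simp only [hin]
  have hpr : ∏ k ∈ S, (chi ϖ (b k) * weilConstant ψ ϖ * chi ϖ (x s((), ()))) =
      (∏ k ∈ S, (chi ϖ (b k) * weilConstant ψ ϖ)) * chi ϖ (x s((), ())) ^ S.card := by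
    rw [Finset.prod_mul_distrib, Finset.prod_const]
  rw [integrand, cellFn_unit hq hϖ s hL hx', phase, Finset.prod_mul_distrib, Finset.prod_ite,
    Finset.prod_const_one, mul_one, ← hS, hpr, pow_succ]
  simp only [Finset.univ_unique, Finset.prod_singleton, PUnit.default_eq_unit]
  ring

/-- Scaling both coordinates to the ring of integers turns the form into a multiple of a form with
unit cross term. The relation between `l0` and `l1` guarantees that one of the square terms has its
coefficient in `𝔭`, as `integral_hyperbolic` requires. -/
theorem integral_psi_binary {x : Sym2 (Fin 2) → F} {b : F} {e L : ℤ} (hb : b ∈ shell F e)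
    (h0 : x s(0, 0) ∈ P F (L + 1)) (h1 : x s(0, 1) ∈ shell F L) (h2 : x s(1, 1) ∈ P F L)
    {l0 l1 : ℤ} (hl : l0 = l1 ∨ l0 = l1 + 1) :
    ∫ y in {y : Fin 2 → F | y 0 ∈ P F l0 ∧ y 1 ∈ P F l1},
      (ψ (-(b * (y ⬝ᵥ (symM x)⁻¹ *ᵥ y))) : ℂ) ∂(Measure.pi fun _ : Fin 2 => haarF F) =
      (resCard F : ℂ) ^ (-l0) * (resCard F : ℂ) ^ (-l1) *
        (resCard F : ℂ) ^ (min (e + l0 + l1 - L) 0) := by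
  have hd := det_symM_two_mem h0 h1 h2
  set d := (symM x).det with hd'
  set f : F × F → ℂ := fun p => (ψ (-(b * (d⁻¹ * (x s(1, 1) * p.1 ^ 2 - 2 * x s(0, 1) * p.1 * p.2 +
    x s(0, 0) * p.2 ^ 2)))) : ℂ) with hf
  have hfm : Measurable f := by
    refine (measurable_psi hψc).comp ?_
    fun_prop
  have hA : ∫ y in {y : Fin 2 → F | y 0 ∈ P F l0 ∧ y 1 ∈ P F l1},
      (ψ (-(b * (y ⬝ᵥ (symM x)⁻¹ *ᵥ y))) : ℂ) ∂(Measure.pi fun _ : Fin 2 => haarF F) =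
      ∫ p in (P F l0 : Set F) ×ˢ (P F l1 : Set F), f p ∂(haarF F).prod (haarF F) := by
    rw [← (measurePreserving_finTwoArrow (haarF F)).setIntegral_preimage_emb
      (MeasurableEquiv.measurableEmbedding _) f]
    have hset : {y : Fin 2 → F | y 0 ∈ P F l0 ∧ y 1 ∈ P F l1} = MeasurableEquiv.finTwoArrow ⁻¹'
        ((P F l0 : Set F) ×ˢ (P F l1 : Set F)) := by
      ext y; simp [MeasurableEquiv.finTwoArrow]
    rw [hset]
    congr 1
    funext y
    simp only [hf]
    congr 3
    rw [inv_symM_two, ← hd']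
    simp only [dotProduct, Matrix.mulVec, Fin.sum_univ_two, Matrix.smul_apply, Matrix.of_apply,
      Matrix.cons_val_zero, Matrix.cons_val_one, Matrix.cons_val', Matrix.cons_val_fin_one,
      smul_eq_mul, MeasurableEquiv.finTwoArrow, MeasurableEquiv.piFinTwo_apply]
    ring
  have hint : IntegrableOn f ((P F l0 : Set F) ×ˢ (P F l1 : Set F)) ((haarF F).prod (haarF F)) := by
    refine integrableOn_of_bound ?_ hfm (C := 1) fun p => (norm_psi _).le
    rw [Measure.prod_prod]
    exact ENNReal.mul_ne_top (haar_P_ne_top _) (haar_P_ne_top _)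
  have hz0 := zpow_mem_shell hϖ l0
  have hz1 := zpow_mem_shell hϖ l1
  have hzL := zpow_mem_shell hϖ L
  have hne := hϖ.1
  -- This multiplier absorbs the scaling and the order `2L` of the determinant, so that the
  -- remaining cross coefficient is a unit.
  set t := -(b * d⁻¹ * (ϖ ^ l0 * ϖ ^ l1 * ϖ ^ L)) with ht
  have htm : t ∈ shell F (e + l0 + l1 - L) := by
    have := shell_neg (shell_mul (shell_mul hb (shell_inv hd)) (shell_mul (shell_mul hz0 hz1) hzL))
    convert this using 1; ring
  have hval : ∀ u v : F, f (ϖ ^ l0 * u, ϖ ^ l1 * v) = (ψ (t * (x s(1, 1) * ϖ ^ (l0 - l1 - L) * u ^ 2 +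
      2 * (-(x s(0, 1) * ϖ ^ (-L))) * u * v + x s(0, 0) * ϖ ^ (l1 - l0 - L) * v ^ 2)) : ℂ) := by
    intro u v
    simp only [hf, ht]
    congr 2
    have hL0 := hzL.1
    have h00 := hz0.1
    have h11 := hz1.1
    rw [zpow_sub₀ hne, zpow_sub₀ hne, zpow_sub₀ hne, zpow_sub₀ hne, zpow_neg]
    field_simp
    ring
  have hβ : -(x s(0, 1) * ϖ ^ (-L)) ∈ shell F 0 := by
    have := shell_neg (shell_mul h1 (zpow_mem_shell hϖ (-L)))
    rwa [add_neg_cancel] at this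
  rw [hA]
  rcases hl with hl | hl
  · rw [setIntegral_prod _ hint, setIntegral_P_mul hz0, sub_self, mul_assoc]
    congr 1
    simp only [setIntegral_P_mul hz1 l1, sub_self, hval]
    rw [integral_const_mul]
    congr 1
    rw [← htm.2, ← integral_hyperbolic hq hψc hψ htm.1 (α := x s(0, 0) * ϖ ^ (l1 - l0 - L)) _ hβ
      (γ := x s(1, 1) * ϖ ^ (l0 - l1 - L))]
    · refine integral_congr_ae (Filter.Eventually.of_forall fun u => ?_)
      refine integral_congr_ae (Filter.Eventually.of_forall fun v => ?_)
      simp only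
      congr 3; ring
    · have := mul_mem_P h2 (shell_subset_P (zpow_mem_shell hϖ (l0 - l1 - L)))
      exact P_mono (by omega) this
    · have := mul_mem_P h0 (shell_subset_P (zpow_mem_shell hϖ (l1 - l0 - L)))
      exact P_mono (by omega) this
  -- Here the coefficient in `𝔭` belongs to the other variable, so the order of integration is
  -- exchanged to make that variable the inner one.
  · rw [← setIntegral_prod_swap, setIntegral_prod (fun z => f z.swap) hint.swap, setIntegral_P_mul hz1, sub_self,
      mul_comm ((resCard F : ℂ) ^ (-l0)), mul_assoc]
    congr 1
    simp only [Prod.swap, setIntegral_P_mul hz0 l0, sub_self, hval]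
    rw [integral_const_mul]
    congr 1
    rw [← htm.2, ← integral_hyperbolic hq hψc hψ htm.1 (α := x s(1, 1) * ϖ ^ (l0 - l1 - L)) _ hβ
      (γ := x s(0, 0) * ϖ ^ (l1 - l0 - L))]
    · have := mul_mem_P h0 (shell_subset_P (zpow_mem_shell hϖ (l1 - l0 - L)))
      exact P_mono (by omega) this
    · have := mul_mem_P h2 (shell_subset_P (zpow_mem_shell hϖ (l0 - l1 - L)))
      exact P_mono (by omega) this

/-- On such a cell both `cellFn` and the column integrals are constant. The diagonal entries carry
additive characters, whose integrals vanish unless both are trivial on their ideals, and the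
off-diagonal entry does not meet `B` and contributes the volume of a shell. -/
theorem integral_pivot_two (s : ℂ) {b : K → F} {e : K → ℤ} (hb : ∀ k, b k ∈ shell F (e k))
    {c : Fin 2 → F} {e0 : Fin 2 → ℤ} (hc : ∀ i, c i ∈ shell F (e0 i)) {L : ℤ} (hL : L ≤ -1)
    (l0 l1 : K → ℤ) (hl : ∀ k, l0 k = l1 k ∨ l0 k = l1 k + 1) :
    ∫ x in {x : Sym2 (Fin 2) → F | x s(0, 0) ∈ P F (L + 1) ∧ x s(0, 1) ∈ shell F L ∧
        x s(1, 1) ∈ P F L}, integrand ψ ϖ s c x *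
      (∏ k, ∫ y in {y : Fin 2 → F | y 0 ∈ P F (l0 k) ∧ y 1 ∈ P F (l1 k)},
        (ψ (-(b k * (y ⬝ᵥ (symM x)⁻¹ *ᵥ y))) : ℂ) ∂Measure.pi fun _ : Fin 2 => haarF F)
      ∂haarS F (Fin 2) =
    chi ϖ (-1) * (resCard F : ℂ) ^ (((2 * L : ℤ) : ℂ) * s) *
      (∏ k, ((resCard F : ℂ) ^ (-l0 k) * (resCard F : ℂ) ^ (-l1 k) *
        (resCard F : ℂ) ^ (min (e k + l0 k + l1 k - L) 0))) *
      ((1 - (resCard F : ℂ)⁻¹) * (resCard F : ℂ)⁻¹ * (resCard F : ℂ) ^ (-3 * L)) *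
      if 0 ≤ e0 0 + L + 1 ∧ 0 ≤ e0 1 + L then 1 else 0 := by
  set A : ℂ := chi ϖ (-1) * (resCard F : ℂ) ^ (((2 * L : ℤ) : ℂ) * s) *
      (∏ k, ((resCard F : ℂ) ^ (-l0 k) * (resCard F : ℂ) ^ (-l1 k) *
        (resCard F : ℂ) ^ (min (e k + l0 k + l1 k - L) 0))) with hA
  set S : Sym2 (Fin 2) → Set F := fun t => if t = s(0, 0) then (P F (L + 1) : Set F) else
    if t = s(0, 1) then shell F L else (P F L : Set F) with hS
  set f : Sym2 (Fin 2) → F → ℂ := fun t x => if t = s(0, 0) then (ψ (-c 0 * x) : ℂ) else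
    if t = s(0, 1) then 1 else (ψ (-c 1 * x) : ℂ) with hf
  have huniv : (Finset.univ : Finset (Sym2 (Fin 2))) = {s(0, 0), s(0, 1), s(1, 1)} := by decide
  have n1 : (s(0, 1) : Sym2 (Fin 2)) ≠ s(0, 0) := by decide
  have n2 : (s(1, 1) : Sym2 (Fin 2)) ≠ s(0, 0) := by decide
  have n3 : (s(1, 1) : Sym2 (Fin 2)) ≠ s(0, 1) := by decide
  have hset : {x : Sym2 (Fin 2) → F | x s(0, 0) ∈ P F (L + 1) ∧ x s(0, 1) ∈ shell F L ∧
        x s(1, 1) ∈ P F L} = Set.univ.pi S := by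
    ext x
    have : x ∈ Set.univ.pi S ↔ ∀ t ∈ (Finset.univ : Finset (Sym2 (Fin 2))), x t ∈ S t := by
      simp [Set.mem_pi]
    rw [this, huniv]
    simp [hS, n1, n2, n3]
  have hSm : ∀ t, MeasurableSet (S t) := by
    intro t; simp only [hS]; split_ifs
    exacts [measurableSet_P _, measurableSet_shell _, measurableSet_P _]
  have hcong : ∀ x ∈ Set.univ.pi S, integrand ψ ϖ s c x *
      (∏ k, ∫ y in {y : Fin 2 → F | y 0 ∈ P F (l0 k) ∧ y 1 ∈ P F (l1 k)},
        (ψ (-(b k * (y ⬝ᵥ (symM x)⁻¹ *ᵥ y))) : ℂ) ∂Measure.pi fun _ : Fin 2 => haarF F) =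
      A * ∏ t, f t (x t) := by
    intro x hx
    rw [← hset] at hx
    obtain ⟨h0, h1, h2⟩ := hx
    simp only [fun k => integral_psi_binary hq hψc hψ hϖ (hb k) h0 h1 h2 (hl k)]
    rw [integrand, cellFn_two hq hϖ s hL h0 h1 h2, huniv, Finset.prod_insert (by simp [n1.symm, n2.symm]),
      Finset.prod_insert (by simp [n3.symm]), Finset.prod_singleton, hA, phase, Fin.prod_univ_two]
    simp only [hf, if_true, if_neg n1, if_neg n2, if_neg n3, neg_mul]
    ring
  rw [hset, setIntegral_congr_fun (MeasurableSet.univ_pi hSm) hcong, integral_const_mul, mul_assoc A]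
  congr 1
  rw [Measure.restrict_pi_pi, integral_fintype_prod_eq_prod, huniv,
    Finset.prod_insert (by simp [n1.symm, n2.symm]), Finset.prod_insert (by simp [n3.symm]),
    Finset.prod_singleton]
  simp only [hS, hf, if_true, if_neg n1, if_neg n2, if_neg n3]
  rw [integral_psi hψ, integral_psi hψ, setIntegral_const, Complex.real_smul, haar_real_shell,
    mem_P_iff (neg_ne_zero.mpr (hc 0).1), mem_P_iff (neg_ne_zero.mpr (hc 1).1), ord_neg, ord_neg,
    (hc 0).2, (hc 1).2]
  have hq0 := resCard_ne_zero F
  have i0 : -(L + 1) ≤ e0 0 ↔ 0 ≤ e0 0 + L + 1 := by omega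
  have i1 : -L ≤ e0 1 ↔ 0 ≤ e0 1 + L := by omega
  rw [i0, i1]
  by_cases c0 : 0 ≤ e0 0 + L + 1
  · by_cases c1 : 0 ≤ e0 1 + L
    · rw [if_pos c0, if_pos c1, if_pos ⟨c0, c1⟩, show -3 * L = -L + -L + -L by ring,
        show -(L + 1) = -L + -1 by ring, zpow_add₀ hq0, zpow_add₀ hq0, zpow_add₀ hq0, zpow_neg_one]
      ring
    · simp [c0, c1]
  · simp [c0]

end Weights

/-! ### The contribution of a pivot in the shape of the formula. -/

section PivotWeights

variable {F : Type*} [Field F] [ValuativeRel F] [TopologicalSpace F]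
  [IsNonarchimedeanLocalField F] {n : ℕ}

/-- `ξ_{i, λ}(B)_χ` with the set `B_i(λ)` replaced by `S`. -/
def xiOn (ϖ : F) (v : Fin n → F) (e : Fin n → ℕ) (S : Finset (Fin n)) (i : Fin n) (lam : ℤ) : ℂ :=
  (∏ k ∈ S, chi ϖ (v k)) *
    if 0 ≤ (e i : ℤ) + lam then
      if Even S.card then 0
      else (1 - (resCard F : ℂ)⁻¹) * chi ϖ (-1) ^ (S.card / 2 + 1)
    else if (e i : ℤ) + lam = -1 then
      if Even S.card then
        chi ϖ (v i) * chi ϖ (-1) ^ (S.card / 2 + 1)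
      else -(resCard F : ℂ) ^ (-(1 / 2) : ℂ) * chi ϖ (-1) ^ (S.card / 2 + 1)
    else 0

/-- Twice the exponent of `q` (without the part that depends on `s`) for a pivot at `(i, i)`. -/
def diagExp (e : Fin n → ℕ) (J : Finset (Fin n)) (i : Fin n) (L : ℤ) : ℤ :=
  ∑ k ∈ J, (-2 * (if k < i then L else L + 1) +
    min ((e k : ℤ) + (if k < i then 0 else 2) + L) 0) + min ((e i : ℤ) + L) 0

/-- Twice the exponent of `q` (without the part that depends on `s`) for a pivot at `(m, j)`. -/
def pairExp (e : Fin n → ℕ) (J : Finset (Fin n)) (m j : Fin n) (L : ℤ) : ℤ :=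
  ∑ k ∈ J, (-2 * ((if k < j then L else L + 1) + (if k < m then L else L + 1)) +
    2 * min ((e k : ℤ) + ((if k < j then 0 else 1) + (if k < m then 0 else 1)) + L) 0) - 2 * L

variable [MeasurableSpace F] [BorelSpace F]

/-- The contribution of a pivot at `(i, i)`, with remaining indices `J`. -/
def diagWeight (ψ : AddChar F Circle) (ϖ : F) (v : Fin n → F) (e : Fin n → ℕ) (s : ℂ)
    (J : Finset (Fin n)) (i : Fin n) (L : ℤ) : ℂ :=
  weilConstant ψ ϖ * chi ϖ (-1) ^ L *
    (resCard F : ℂ) ^ ((s - 1) * L + (diagExp e J i L : ℂ) / 2) * xiOn ϖ v e (bSet e i L ∩ J) i L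

/-- The contribution of a pivot at `(m, j)`, with remaining indices `J`. -/
def pairWeight (ψ : AddChar F Circle) (ϖ : F) (e : Fin n → ℕ) (s : ℂ)
    (J : Finset (Fin n)) (m j : Fin n) (L : ℤ) : ℂ :=
  if 0 ≤ (e m : ℤ) + L + 1 ∧ 0 ≤ (e j : ℤ) + L then
    weilConstant ψ ϖ ^ 2 * ((1 - (resCard F : ℂ)⁻¹) * (resCard F : ℂ)⁻¹) *
      (resCard F : ℂ) ^ ((s - 1) * (2 * L) + (pairExp e J m j L : ℂ) / 2)
  else 0

variable (hq : Odd (resCard F)) {ψ : AddChar F Circle} (hψc : Continuous ψ) (hψ : HasOrderZero ψ)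
  {ϖ : F} (hϖ : ϖ ∈ shell F 1) {v : Fin n → F} (hv : ∀ i, v i ∈ shell F 0) (e : Fin n → ℕ)

include hϖ hv in
theorem entry_mem_shell (i : Fin n) : v i * ϖ ^ e i ∈ shell F (e i) := by
  have := shell_mul (hv i) (zpow_mem_shell hϖ (e i))
  rwa [zero_add, zpow_natCast] at this

include hq hϖ hv in
theorem chi_entry (i : Fin n) : chi ϖ (v i * ϖ ^ e i) = chi ϖ (v i) * chi ϖ (-1) ^ e i := by
  have := chi_unit_mul_zpow hq hϖ (hv i) (e i)
  simpa only [zpow_natCast] using this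

omit [MeasurableSpace F] [BorelSpace F] in
theorem prod_resCard_cpow {α : Type*} (t : Finset α) (f : α → ℂ) :
    ∏ k ∈ t, (resCard F : ℂ) ^ f k = (resCard F : ℂ) ^ ∑ k ∈ t, f k := by
  classical
  induction t using Finset.induction_on with
  | empty => simp
  | insert a t ha ih => rw [Finset.prod_insert ha, Finset.sum_insert ha, resCard_cpow_add, ih]

/-- The exponent of the Gauss integral for the column `k` involves `L` or `L + 1` according to the
position of `k`; its being odd and negative is the condition that defines `B_i(L)`. -/
theorem bSet_inter (J : Finset (Fin n)) (i : Fin n) (hi : i ∉ J) (L : ℤ) :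
    bSet e i L ∩ J = J.filter fun k => (e k : ℤ) - L + 2 * (if k < i then L else L + 1) < 0 ∧
      Odd ((e k : ℤ) - L) := by
  ext k
  simp only [bSet, Finset.mem_inter, Finset.mem_filter, Finset.mem_univ, true_and]
  rw [and_comm]
  refine and_congr_right fun hk => ?_
  have hki : k ≠ i := fun h => hi (h ▸ hk)
  have hodd : Odd ((e k : ℤ) - L) ↔ ¬ (e k : ℤ) ≡ L [ZMOD 2] := by
    rw [Int.odd_iff, Int.ModEq]; omega
  rw [hodd]
  rcases lt_or_gt_of_ne hki with h | h
  · have h' : ¬ i < k := not_lt.mpr h.le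
    simp only [h, h', true_and, false_and, or_false, if_true]
    refine and_congr_left fun _ => ?_
    omega
  · have h' : ¬ k < i := not_lt.mpr h.le
    simp only [h, h', true_and, false_and, false_or, if_false]
    refine and_congr_left fun _ => ?_
    omega

include hq hψc hψ hϖ hv

/-- The sign is found from `α² = χ(-1)` and `χ(-1)² = 1`: the powers of the Weil constant `α`
collapse to a single factor `α` times a power of `χ(-1)`, whose exponent is read off from the parity
of the number of odd columns. -/
theorem diagWeight_eq (s : ℂ) (J : Finset (Fin n)) {i : Fin n} (hi : i ∉ J) (L : ℤ) :
    (resCard F : ℂ) ^ ((L : ℂ) * s) *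
      (∏ k ∈ J, ((resCard F : ℂ) ^ (-(if k < i then L else L + 1)) *
        (resCard F : ℂ) ^ (((min ((e k : ℤ) - L + 2 * (if k < i then L else L + 1)) 0 : ℤ) : ℂ) / 2))) *
      (∏ k ∈ bSet e i L ∩ J, (chi ϖ (v k * ϖ ^ e k) * weilConstant ψ ϖ)) *
      ∫ x in shell F L, chi ϖ x ^ ((bSet e i L ∩ J).card + 1) * (ψ (-(v i * ϖ ^ e i * x)) : ℂ)
        ∂haarF F = diagWeight ψ ϖ v e s J i L := by
  have hη := chi_mul_self ϖ (-1 : F)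
  have hα := weilConstant_sq hq hψc hψ hϖ
  rw [integral_chi_pow_psi_shell hq hψc hψ hϖ (entry_mem_shell hϖ hv e i), chi_entry hq hϖ hv]
  have hS : ∏ k ∈ bSet e i L ∩ J, (chi ϖ (v k * ϖ ^ e k) * weilConstant ψ ϖ) =
      (∏ k ∈ bSet e i L ∩ J, chi ϖ (v k)) *
        (chi ϖ (-1) * chi ϖ (-1) ^ L * weilConstant ψ ϖ) ^ (bSet e i L ∩ J).card := by
    rw [← Finset.prod_const, ← Finset.prod_mul_distrib]
    refine Finset.prod_congr rfl fun k hk => ?_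
    rw [bSet_inter e J i hi, Finset.mem_filter] at hk
    -- On this set `e k` and `L` have opposite parity, so that `χ(ϖ) ^ e k` is the same sign for all
    -- columns involved.
    obtain ⟨c, hc⟩ := hk.2.2
    have hz : chi ϖ (-1 : F) ^ e k = chi ϖ (-1) * chi ϖ (-1) ^ L := by
      rw [← zpow_natCast, show (e k : ℤ) = 2 * c + (1 + L) by omega, zpow_add₀ (chi_ne_zero _ _),
        zpow_mul, chi_zpow_sq, one_zpow, one_mul, zpow_add₀ (chi_ne_zero _ _), zpow_one]
    rw [chi_entry hq hϖ hv, hz]; ring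
  have hg : chi ϖ (-1 : F) ^ L * chi ϖ (-1) ^ L = 1 := by
    rw [← mul_zpow, hη, one_zpow]
  have hexp : (resCard F : ℂ) ^ ((L : ℂ) * s) *
      (∏ k ∈ J, ((resCard F : ℂ) ^ (-(if k < i then L else L + 1)) *
        (resCard F : ℂ) ^ (((min ((e k : ℤ) - L + 2 * (if k < i then L else L + 1)) 0 : ℤ) : ℂ) / 2))) *
      (resCard F : ℂ) ^ (-L) * (resCard F : ℂ) ^ (((min ((e i : ℤ) + L) 0 : ℤ) : ℂ) / 2) =
      (resCard F : ℂ) ^ ((s - 1) * L + (diagExp e J i L : ℂ) / 2) := by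
    have h1 : ∀ k ∈ J, (resCard F : ℂ) ^ (-(if k < i then L else L + 1)) *
        (resCard F : ℂ) ^ (((min ((e k : ℤ) - L + 2 * (if k < i then L else L + 1)) 0 : ℤ) : ℂ) / 2) =
        (resCard F : ℂ) ^ (((-2 * (if k < i then L else L + 1) +
          min ((e k : ℤ) + (if k < i then 0 else 2) + L) 0 : ℤ) : ℂ) / 2) := fun k _ => by
      rw [← Complex.cpow_intCast, ← resCard_cpow_add]
      have : (e k : ℤ) - L + 2 * (if k < i then L else L + 1) =
          (e k : ℤ) + (if k < i then 0 else 2) + L := by split_ifs <;> ring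
      rw [this]
      congr 1
      push_cast
      ring
    rw [Finset.prod_congr rfl h1, prod_resCard_cpow, ← Complex.cpow_intCast, ← resCard_cpow_add,
      ← resCard_cpow_add, ← resCard_cpow_add, diagExp]
    congr 1
    push_cast
    rw [← Finset.sum_div]
    ring
  rw [hS, diagWeight, ← hexp, xiOn]
  generalize (∏ k ∈ J, ((resCard F : ℂ) ^ (-(if k < i then L else L + 1)) *
        (resCard F : ℂ) ^ (((min ((e k : ℤ) - L + 2 * (if k < i then L else L + 1)) 0 : ℤ) : ℂ) / 2))) = R
  generalize (∏ k ∈ bSet e i L ∩ J, chi ϖ (v k)) = V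
  generalize (bSet e i L ∩ J).card = N
  by_cases h0 : 0 ≤ (e i : ℤ) + L
  · rw [if_pos h0, if_pos h0, min_eq_right h0]
    split_ifs with hN
    · ring
    · obtain ⟨k, rfl⟩ := Nat.not_even_iff_odd.mp hN
      rw [show (2 * k + 1) / 2 = k by omega, show 2 * k + 1 + 1 = 2 * (k + 1) by ring]
      generalize chi ϖ (-1 : F) ^ L = g at *
      generalize chi ϖ (-1 : F) = η at *
      generalize weilConstant ψ ϖ = α at *
      have e1 : (η * g * α) ^ (2 * k + 1) * g ^ (2 * (k + 1)) =
          (η * η) ^ k * (g * g) ^ k * (α ^ 2) ^ k * (g * g) ^ (k + 1) * (η * g * α) := by ring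
      have e2 : (η * g * α) ^ (2 * k + 1) * g ^ (2 * (k + 1)) = η ^ (k + 1) * g * α := by
        rw [e1, hη, hg, hα]; ring
      simp only [Int.cast_zero, zero_div, Complex.cpow_zero]
      linear_combination (resCard F : ℂ) ^ ((L : ℂ) * s) * R * V * (resCard F : ℂ) ^ (-L) *
        (1 - (resCard F : ℂ)⁻¹) * e2
  · rw [if_neg h0, if_neg h0]
    by_cases h1 : (e i : ℤ) + L = -1
    · rw [if_pos h1, if_pos h1, h1]
      have hmin : (((min (-1) 0 : ℤ) : ℂ) / 2) = -(1 / 2) := by norm_num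
      rw [hmin]
      -- One factor `q^{-1/2}` is already counted in `diagExp`, through `min (e_i + L) 0`. In the
      -- odd case the integral gives `-q⁻¹`, of which the factor `-q^{-1/2}` therefore remains.
      have hhalf : (resCard F : ℂ) ^ (-(1 / 2) : ℂ) * (resCard F : ℂ) ^ (-(1 / 2) : ℂ) =
          (resCard F : ℂ)⁻¹ := by
        rw [← resCard_cpow_add, ← Complex.cpow_neg_one]; norm_num
      have hz : chi ϖ (-1 : F) ^ e i = chi ϖ (-1) * chi ϖ (-1) ^ L := by
        rw [← zpow_natCast, show (e i : ℤ) = 2 * (-1 - L) + (1 + L) by omega,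
          zpow_add₀ (chi_ne_zero _ _),
          zpow_mul, chi_zpow_sq, one_zpow, one_mul, zpow_add₀ (chi_ne_zero _ _), zpow_one]
      rw [hz]
      generalize chi ϖ (-1 : F) ^ L = g at *
      generalize chi ϖ (-1 : F) = η at *
      generalize weilConstant ψ ϖ = α at *
      generalize (resCard F : ℂ) ^ (-(1 / 2) : ℂ) = h at *
      split_ifs with hN
      · obtain ⟨k, rfl⟩ := hN
        rw [show (k + k) / 2 = k by omega]
        have e1 : (η * g * α) ^ (k + k) * g ^ (k + k + 1) =
            (η * η) ^ k * (g * g) ^ k * (α ^ 2) ^ k * (g * g) ^ k * g := by ring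
        have e2 : (η * g * α) ^ (k + k) * g ^ (k + k + 1) = η ^ k * g := by
          rw [e1, hη, hg, hα]; ring
        linear_combination (resCard F : ℂ) ^ ((L : ℂ) * s) * R * V * (resCard F : ℂ) ^ (-L) *
          (h * (chi ϖ (v i) * (η * g)) * g * α) * e2 + (resCard F : ℂ) ^ ((L : ℂ) * s) * R * V *
          (resCard F : ℂ) ^ (-L) * h * chi ϖ (v i) * η ^ (k + 1) * g * α * hg
      · obtain ⟨k, rfl⟩ := Nat.not_even_iff_odd.mp hN
        rw [show (2 * k + 1) / 2 = k by omega, show 2 * k + 1 + 1 = 2 * (k + 1) by ring]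
        have e1 : (η * g * α) ^ (2 * k + 1) * g ^ (2 * (k + 1)) =
            (η * η) ^ k * (g * g) ^ k * (α ^ 2) ^ k * (g * g) ^ (k + 1) * (η * g * α) := by ring
        have e2 : (η * g * α) ^ (2 * k + 1) * g ^ (2 * (k + 1)) = η ^ (k + 1) * g * α := by
          rw [e1, hη, hg, hα]; ring
        rw [← hhalf]
        linear_combination -(resCard F : ℂ) ^ ((L : ℂ) * s) * R * V * (resCard F : ℂ) ^ (-L) *
          (h * h) * e2
    · rw [if_neg h1, if_neg h1]; ring

omit hv in
-- The sign `χ(-1)` of the determinant of the block is the square of the Weil constant, so each of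
-- the two indices again accounts for one factor.
theorem pairWeight_eq (s : ℂ) (J : Finset (Fin n)) (m j : Fin n) (L : ℤ) :
    chi ϖ (-1) * (resCard F : ℂ) ^ (((2 * L : ℤ) : ℂ) * s) *
      (∏ k ∈ J, ((resCard F : ℂ) ^ (-(if k < j then L else L + 1)) *
        (resCard F : ℂ) ^ (-(if k < m then L else L + 1)) *
        (resCard F : ℂ) ^ (min ((e k : ℤ) + (if k < j then L else L + 1) +
          (if k < m then L else L + 1) - L) 0))) *
      ((1 - (resCard F : ℂ)⁻¹) * (resCard F : ℂ)⁻¹ * (resCard F : ℂ) ^ (-3 * L)) *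
      (if 0 ≤ (e m : ℤ) + L + 1 ∧ 0 ≤ (e j : ℤ) + L then 1 else 0) =
    pairWeight ψ ϖ e s J m j L := by
  rw [pairWeight]
  split_ifs with h
  · rw [weilConstant_sq hq hψc hψ hϖ]
    have hexp : (resCard F : ℂ) ^ (((2 * L : ℤ) : ℂ) * s) *
      (∏ k ∈ J, ((resCard F : ℂ) ^ (-(if k < j then L else L + 1)) *
        (resCard F : ℂ) ^ (-(if k < m then L else L + 1)) *
        (resCard F : ℂ) ^ (min ((e k : ℤ) + (if k < j then L else L + 1) +
          (if k < m then L else L + 1) - L) 0))) * (resCard F : ℂ) ^ (-3 * L) =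
      (resCard F : ℂ) ^ ((s - 1) * (2 * L) + (pairExp e J m j L : ℂ) / 2) := by
      have h1 : ∀ k ∈ J, (resCard F : ℂ) ^ (-(if k < j then L else L + 1)) *
        (resCard F : ℂ) ^ (-(if k < m then L else L + 1)) *
        (resCard F : ℂ) ^ (min ((e k : ℤ) + (if k < j then L else L + 1) +
          (if k < m then L else L + 1) - L) 0) = (resCard F : ℂ) ^
          (((-2 * ((if k < j then L else L + 1) + (if k < m then L else L + 1)) +
          2 * min ((e k : ℤ) + ((if k < j then 0 else 1) + (if k < m then 0 else 1)) + L) 0 : ℤ) : ℂ)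
            / 2) := fun k _ => by
        rw [← zpow_add₀ (resCard_ne_zero F), ← zpow_add₀ (resCard_ne_zero F), ← Complex.cpow_intCast]
        have : (e k : ℤ) + (if k < j then L else L + 1) + (if k < m then L else L + 1) - L =
          (e k : ℤ) + ((if k < j then 0 else 1) + (if k < m then 0 else 1)) + L := by
          split_ifs <;> ring
        rw [this]
        congr 1
        push_cast
        ring
      rw [Finset.prod_congr rfl h1, prod_resCard_cpow, ← Complex.cpow_intCast, ← resCard_cpow_add,
        ← resCard_cpow_add, pairExp]
      congr 1
      push_cast
      rw [← Finset.sum_div, sub_div]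
      ring
    rw [← hexp]; ring
  · ring

end PivotWeights

/-! ### The recursion for the integral and for its absolute value. -/

section Recursion

variable {n : ℕ}

/-- The decomposition of a set of indices into one index and the rest. -/
def eraseEquiv (J : Finset (Fin n)) {i : Fin n} (hi : i ∈ J) : Unit ⊕ ↥(J.erase i) ≃ ↥J :=
  Equiv.ofBijective (Sum.elim (fun _ => ⟨i, hi⟩) fun k => ⟨k, Finset.mem_of_mem_erase k.2⟩) <| by
    constructor
    · rintro (a | ⟨a, ha⟩) (b | ⟨b, hb⟩) h
      · rfl
      · simp only [Sum.elim_inl, Sum.elim_inr, Subtype.mk.injEq] at h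
        exact absurd h.symm (Finset.ne_of_mem_erase hb)
      · simp only [Sum.elim_inl, Sum.elim_inr, Subtype.mk.injEq] at h
        exact absurd h (Finset.ne_of_mem_erase ha)
      · simpa using h
    · rintro ⟨k, hk⟩
      by_cases h : k = i
      · subst h; exact ⟨.inl (), rfl⟩
      · exact ⟨.inr ⟨k, Finset.mem_erase.mpr ⟨h, hk⟩⟩, rfl⟩

/-- The decomposition of a set of indices into two indices and the rest. -/
def eraseTwoEquiv (J : Finset (Fin n)) {i j : Fin n} (hi : i ∈ J) (hj : j ∈ J) (hij : j ≠ i) :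
    Fin 2 ⊕ ↥((J.erase i).erase j) ≃ ↥J :=
  Equiv.ofBijective (Sum.elim ![⟨i, hi⟩, ⟨j, hj⟩] fun k =>
    ⟨k, Finset.mem_of_mem_erase (Finset.mem_of_mem_erase k.2)⟩) <| by
    have hne : ∀ a (k : ↥((J.erase i).erase j)), (![(⟨i, hi⟩ : ↥J), ⟨j, hj⟩] a : Fin n) ≠ k := by
      rintro a ⟨k, hk⟩
      rw [Finset.mem_erase, Finset.mem_erase] at hk
      fin_cases a
      · exact fun h => hk.2.1 h.symm
      · exact fun h => hk.1 h.symm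
    constructor
    · rintro (a | a) (b | b) h
      · fin_cases a <;> fin_cases b
        · rfl
        · exact absurd (congrArg Subtype.val h).symm hij
        · exact absurd (congrArg Subtype.val h) hij
        · rfl
      · exact absurd (congrArg Subtype.val h) (hne a b)
      · exact absurd (congrArg Subtype.val h).symm (hne b a)
      · exact congrArg _ (Subtype.ext (congrArg Subtype.val h :))
    · rintro ⟨k, hk⟩
      by_cases h : k = i
      · subst h; exact ⟨.inl 0, rfl⟩
      by_cases h' : k = j
      · subst h'; exact ⟨.inl 1, rfl⟩
      · exact ⟨.inr ⟨k, Finset.mem_erase.mpr ⟨h', Finset.mem_erase.mpr ⟨h, hk⟩⟩⟩, rfl⟩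

variable {F : Type*} [Field F] [ValuativeRel F] [TopologicalSpace F]
  [IsNonarchimedeanLocalField F] [MeasurableSpace F] [BorelSpace F]

/-- The part of the Siegel integral over the region with parameters `L`, `m`, for the symmetric
matrices with indices in `J`. -/
def partialIntegral (ψ : AddChar F Circle) (ϖ : F) (v : Fin n → F) (e : Fin n → ℕ) (s : ℂ)
    (J : Finset (Fin n)) (L : ℤ) (m : ℕ) : ℂ :=
  ∫ x in region F (fun k : ↥J => (k : ℕ)) L m,
    integrand ψ ϖ s (fun k : ↥J => v k * ϖ ^ e k) x ∂haarS F ↥J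

/-- The analogue of `partialIntegral` for the absolute value of the integrand. -/
def partialLIntegral (ϖ : F) (s : ℂ) (J : Finset (Fin n)) (L : ℤ) (m : ℕ) : ENNReal :=
  ∫⁻ x in region F (fun k : ↥J => (k : ℕ)) L m, ‖cellFn ϖ s (symM x)‖ₑ ∂haarS F ↥J

theorem val_injective (J : Finset (Fin n)) : Function.Injective fun k : ↥J => (k : ℕ) :=
  fun _ _ h => Subtype.ext (Fin.ext h)

theorem partialIntegral_zero (ψ : AddChar F Circle) (ϖ : F) (v : Fin n → F) (e : Fin n → ℕ) (s : ℂ)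
    (J : Finset (Fin n)) (L : ℤ) :
    partialIntegral ψ ϖ v e s J L 0 = partialIntegral ψ ϖ v e s J (L + 1) n := by
  rw [partialIntegral, partialIntegral, region_zero _ _ fun k => k.1.2]

theorem partialLIntegral_zero (ϖ : F) (s : ℂ) (J : Finset (Fin n)) (L : ℤ) :
    partialLIntegral ϖ s J L 0 = partialLIntegral ϖ s J (L + 1) n := by
  rw [partialLIntegral, partialLIntegral, region_zero _ _ fun k => k.1.2]

theorem partialIntegral_succ_of_notMem (ψ : AddChar F Circle) (ϖ : F) (v : Fin n → F)
    (e : Fin n → ℕ) (s : ℂ) {J : Finset (Fin n)} {m : Fin n} (hm : m ∉ J) (L : ℤ) :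
    partialIntegral ψ ϖ v e s J L (m + 1) = partialIntegral ψ ϖ v e s J L m := by
  rw [partialIntegral, partialIntegral, region_succ_of_forall_ne]
  exact fun k h => hm (by have := k.2; rwa [Fin.ext h] at this)

theorem partialLIntegral_succ_of_notMem (ϖ : F) (s : ℂ) {J : Finset (Fin n)} {m : Fin n}
    (hm : m ∉ J) (L : ℤ) : partialLIntegral ϖ s J L (m + 1) = partialLIntegral ϖ s J L m := by
  rw [partialLIntegral, partialLIntegral, region_succ_of_forall_ne]
  exact fun k h => hm (by have := k.2; rwa [Fin.ext h] at this)

theorem cellFn_isEmpty {ι : Type*} [Fintype ι] [DecidableEq ι] [IsEmpty ι] (ϖ : F) (s : ℂ)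
    (X : Matrix ι ι F) : cellFn ϖ s X = 1 := by
  have hd : X.det = 1 := Matrix.det_isEmpty
  rw [cellFn_eq_cpow _ _ _ ⟨by rw [hd]; exact one_ne_zero, fun i => isEmptyElim i⟩, hd, chi_one,
    ord_one]
  simp

/-- If `X` is integral and its inverse has entries in `𝔭`, then so does the identity matrix. This
ends the recursion at level `0`. -/
theorem cellFn_integral {ι : Type*} [Fintype ι] [DecidableEq ι] [Nonempty ι] (ϖ : F) (s : ℂ)
    {X : Matrix ι ι F} (hX : MemP 0 X) : cellFn ϖ s X = 0 := by
  rw [cellFn, if_neg]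
  rintro ⟨hd, hi⟩
  have h1 := hX.mul hi
  rw [Matrix.mul_nonsing_inv _ hd.isUnit] at h1
  obtain ⟨i⟩ := ‹Nonempty ι›
  have := h1 i i
  rw [Matrix.one_apply_eq, mem_P_iff one_ne_zero, ord_one] at this
  omega

theorem region_mem_P {ι : Type*} {r : ι → ℕ} {x : Sym2 ι → F} {L : ℤ} {m : ℕ}
    (hx : x ∈ region F r L m) : MemP L (symM x) :=
  fun k l => P_mono (le_level r L m k l) (hx k l)

theorem haarS_region_empty (J : Finset (Fin n)) (hJ : J = ∅) (L : ℤ) (m : ℕ) :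
    haarS F ↥J (region F (fun k : ↥J => (k : ℕ)) L m) = 1 := by
  subst hJ
  have : region F (fun k : ↥(∅ : Finset (Fin n)) => (k : ℕ)) L m = Set.univ := by
    ext x; simp [mem_region]
  rw [this, ← Set.pi_univ Set.univ, Measure.pi_pi]
  have : IsEmpty (Sym2 ↥(∅ : Finset (Fin n))) := ⟨fun t => by
    induction t with | _ a b => exact absurd a.2 (Finset.notMem_empty _)⟩
  simp

theorem partialIntegral_integral (ψ : AddChar F Circle) (ϖ : F) (v : Fin n → F) (e : Fin n → ℕ)
    (s : ℂ) (J : Finset (Fin n)) (m : ℕ) :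
    partialIntegral ψ ϖ v e s J 0 m = if J = ∅ then 1 else 0 := by
  split_ifs with h
  · have hI : IsEmpty ↥J := by subst h; infer_instance
    have : partialIntegral ψ ϖ v e s J 0 m =
        ∫ x in region F (fun k : ↥J => (k : ℕ)) 0 m, (1 : ℂ) ∂haarS F ↥J := by
      refine integral_congr_ae (Filter.Eventually.of_forall fun x => ?_)
      simp [integrand, cellFn_isEmpty, phase]
    rw [this, setIntegral_const, Measure.real, haarS_region_empty J h]
    simp
  · have : Nonempty ↥J := (Finset.nonempty_iff_ne_empty.mpr h).to_subtype
    rw [partialIntegral, setIntegral_congr_fun (g := fun _ => 0) (measurableSet_region _ _ _)]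
    · simp
    · intro x hx
      simp only [integrand, cellFn_integral ϖ s (region_mem_P hx), zero_mul]

theorem partialLIntegral_integral (ϖ : F) (s : ℂ) (J : Finset (Fin n)) (m : ℕ) :
    partialLIntegral ϖ s J 0 m ≤ 1 := by
  by_cases h : J = ∅
  · have hI : IsEmpty ↥J := by subst h; infer_instance
    have : partialLIntegral ϖ s J 0 m =
        ∫⁻ x in region F (fun k : ↥J => (k : ℕ)) 0 m, 1 ∂haarS F ↥J := by
      refine lintegral_congr fun x => ?_
      simp [cellFn_isEmpty]
    rw [this, setLIntegral_one, haarS_region_empty J h]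
  · have : Nonempty ↥J := (Finset.nonempty_iff_ne_empty.mpr h).to_subtype
    rw [partialLIntegral, setLIntegral_congr_fun (g := fun _ => 0) (measurableSet_region _ _ _)]
    · simp
    · intro x hx
      simp only [cellFn_integral ϖ s (region_mem_P hx), enorm_zero]

theorem sum_filter_coe (J : Finset (Fin n)) {m : Fin n} (hm : m ∈ J) {M : Type*} [AddCommMonoid M]
    (f : ↥J → M) :
    ∑ j ∈ (Finset.univ : Finset ↥J).filter (fun j : ↥J => (j : ℕ) ≤ m), f j = f ⟨m, hm⟩ +
      ∑ j : ↥(J.filter (· < m)), f ⟨j, (Finset.mem_filter.mp j.2).1⟩ := by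
  classical
  have h1 : (Finset.univ.filter fun j : ↥J => (j : ℕ) ≤ m) =
      insert ⟨m, hm⟩ (Finset.univ.filter fun j : ↥J => (j : Fin n) < m) := by
    ext j
    simp only [Finset.mem_filter, Finset.mem_univ, true_and, Finset.mem_insert, Subtype.ext_iff,
      Fin.ext_iff, Fin.lt_def]
    omega
  rw [h1, Finset.sum_insert (by simp)]
  congr 1
  refine (Finset.sum_bij (fun j _ => ⟨j.1, (Finset.mem_filter.mp j.2).1⟩) ?_ ?_ ?_ ?_).symm
  · intro j _
    simpa using (Finset.mem_filter.mp j.2).2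
  · intro a _ b _ hab
    exact Subtype.ext (congrArg (fun z : ↥J => (z : Fin n)) hab)
  · intro j hj
    exact ⟨⟨j, Finset.mem_filter.mpr ⟨j.2, (Finset.mem_filter.mp hj).2⟩⟩, Finset.mem_univ _, rfl⟩
  · intro j _; rfl

variable (hq : Odd (resCard F)) {ψ : AddChar F Circle} (hψc : Continuous ψ) (hψ : HasOrderZero ψ)
  {ϖ : F} (hϖ : ϖ ∈ shell F 1) {v : Fin n → F} (hv : ∀ i, v i ∈ shell F 0) (e : Fin n → ℕ)

include hq hψc hψ hϖ hv in
theorem setIntegral_cell_diag (s : ℂ) {J : Finset (Fin n)} {m : Fin n} (hm : m ∈ J) {L : ℤ}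
    (hL : L ≤ -1) :
    ∫ x in cell F (fun k : ↥J => (k : ℕ)) L m ⟨m, hm⟩ ⟨m, hm⟩,
      integrand ψ ϖ s (fun k : ↥J => v k * ϖ ^ e k) x ∂haarS F ↥J =
    diagWeight ψ ϖ v e s (J.erase m) m L * partialIntegral ψ ϖ v e s (J.erase m) L m := by
  have hC := pivotCell_unit (F := F) (ε := eraseEquiv J hm) (val_injective J) (m := m) rfl L
  -- A region on a single index contains the pivot set, and supplies the bound and the finite volume
  -- that Fubini requires.
  obtain ⟨C, hC'⟩ := exists_norm_cellFn_le (ι := Unit) hq ϖ s (fun _ => 0) L 1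
  have hint := hC.integral_eq hq hψc hϖ s (fun k : ↥J => v k * ϖ ^ e k) (C := C) ?_ ?_ ?_
  · refine hint.trans ?_
    congr 1
    rw [← diagWeight_eq hq hψc hψ hϖ hv e s _ (Finset.notMem_erase m J) L]
    have h := integral_pivot_unit hq hψc hψ hϖ s (K := ↥(J.erase m))
      (fun k => entry_mem_shell hϖ hv e k) (entry_mem_shell hϖ hv e m) hL
      (fun k => if (k : Fin n) < m then L else L + 1)
    refine h.trans ?_
    rw [bSet_inter e _ m (Finset.notMem_erase m J)]
    have hp : ∀ f : Fin n → ℂ, ∏ k : ↥(J.erase m), f k = ∏ k ∈ J.erase m, f k := fun f =>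
      Finset.prod_coe_sort _ f
    have hp2 : ∀ (f : Fin n → ℂ) (p : Fin n → Prop) [DecidablePred p],
        ∏ k ∈ (Finset.univ : Finset ↥(J.erase m)).filter (fun k : ↥(J.erase m) => p k), f k = ∏ k ∈ (J.erase m).filter p, f k := fun f p _ => by
      rw [Finset.prod_filter, Finset.prod_filter]
      exact hp fun k => if p k then f k else 1
    have hc2 : ∀ (p : Fin n → Prop) [DecidablePred p],
        (Finset.univ.filter fun k : ↥(J.erase m) => p k).card = ((J.erase m).filter p).card :=
      fun p _ => by
        rw [Finset.card_filter, Finset.card_filter]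
        exact Finset.sum_coe_sort _ fun k => if p k then 1 else 0
    rw [← hp, ← hp2, ← hc2]
  · refine (measure_mono ?_ |>.trans_lt (haarS_region_ne_top (F := F) (fun _ : Unit => 0) L 1).lt_top).ne
    intro x hx k l
    have := shell_subset_P (show x s((), ()) ∈ shell F L from hx)
    simpa [level] using this
  · intro k
    rw [show {y : Unit → F | y () ∈ P F (if ((eraseEquiv J hm (.inr k) : ↥J) : ℕ) < m then L else L + 1)}
      = Set.univ.pi fun _ => (P F (if ((eraseEquiv J hm (.inr k) : ↥J) : ℕ) < m then L else L + 1) : Set F)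
      by
        ext y
        simp only [Set.mem_univ_pi]
        exact ⟨fun h _ => h, fun h => h ()⟩, Measure.pi_pi]
    exact ENNReal.prod_ne_top fun _ _ => haar_P_ne_top _
  · intro x hx
    refine hC' x fun k l => ?_
    have := shell_subset_P (show x s((), ()) ∈ shell F L from hx)
    simpa [level] using this

include hq hψc hψ hϖ hv in
theorem setIntegral_cell_pair (s : ℂ) {J : Finset (Fin n)} {m j : Fin n} (hm : m ∈ J) (hj : j ∈ J)
    (hjm : j < m) {L : ℤ} (hL : L ≤ -1) :
    ∫ x in cell F (fun k : ↥J => (k : ℕ)) L m ⟨m, hm⟩ ⟨j, hj⟩,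
      integrand ψ ϖ s (fun k : ↥J => v k * ϖ ^ e k) x ∂haarS F ↥J =
    pairWeight ψ ϖ e s ((J.erase m).erase j) m j L *
      partialIntegral ψ ϖ v e s ((J.erase m).erase j) L m := by
  have hC := pivotCell_two (F := F) (ε := eraseTwoEquiv J hm hj hjm.ne) (val_injective J) (m := m)
    rfl (j := j) rfl hjm L
  obtain ⟨C, hC'⟩ := exists_norm_cellFn_le (ι := Fin 2) hq ϖ s (fun _ => 0) L 1
  have hsub : ∀ x : Sym2 (Fin 2) → F, x s(0, 0) ∈ P F (L + 1) ∧ x s(0, 1) ∈ shell F L ∧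
      x s(1, 1) ∈ P F L → x ∈ region F (fun _ : Fin 2 => 0) L 1 := by
    rintro x ⟨h0, h1, h2⟩ k l
    have : level (fun _ : Fin 2 => 0) L 1 k l = L := by simp [level]
    rw [this]
    fin_cases k <;> fin_cases l
    · exact P_mono (by omega) h0
    · exact shell_subset_P h1
    · rw [Sym2.eq_swap]; exact shell_subset_P h1
    · exact h2
  have hint := hC.integral_eq hq hψc hϖ s (fun k : ↥J => v k * ϖ ^ e k) (C := C) ?_ ?_ ?_
  · refine hint.trans ?_
    congr 1
    rw [← pairWeight_eq hq hψc hψ hϖ e s _ m j L]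
    have h := integral_pivot_two hq hψc hψ hϖ s (K := ↥((J.erase m).erase j))
      (fun k => entry_mem_shell hϖ hv e k)
      (c := fun o => v (eraseTwoEquiv J hm hj hjm.ne (.inl o)) *
        ϖ ^ e (eraseTwoEquiv J hm hj hjm.ne (.inl o)))
      (e0 := fun o => e (eraseTwoEquiv J hm hj hjm.ne (.inl o)))
      (fun o => entry_mem_shell hϖ hv e _) hL
      (fun k => if (k : Fin n) < j then L else L + 1) (fun k => if (k : Fin n) < m then L else L + 1)
      (fun k => by
        have hjm' : (k : Fin n) < j → (k : Fin n) < m := fun h => h.trans hjm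
        split_ifs <;> omega)
    refine h.trans ?_
    have hp : ∀ f : Fin n → ℂ, ∏ k : ↥((J.erase m).erase j), f k =
        ∏ k ∈ (J.erase m).erase j, f k := fun f => Finset.prod_coe_sort _ f
    rw [← hp]
    rfl
  · exact (measure_mono hsub |>.trans_lt (haarS_region_ne_top (F := F) (fun _ : Fin 2 => 0) L 1).lt_top).ne
  · intro k
    have hsub2 : {y : Fin 2 → F |
        y 0 ∈ P F (if ((eraseTwoEquiv J hm hj hjm.ne (.inr k) : ↥J) : ℕ) < j then L else L + 1) ∧
        y 1 ∈ P F (if ((eraseTwoEquiv J hm hj hjm.ne (.inr k) : ↥J) : ℕ) < m then L else L + 1)} ⊆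
        Set.univ.pi fun _ => (P F L : Set F) := by
      rintro y ⟨h0, h1⟩ a -
      fin_cases a
      · exact P_mono (by split_ifs <;> omega) h0
      · exact P_mono (by split_ifs <;> omega) h1
    refine (measure_mono hsub2 |>.trans_lt ?_).ne
    rw [Measure.pi_pi]
    exact ENNReal.prod_lt_top fun _ _ => (haar_P_ne_top _).lt_top
  · exact fun x hx => hC' x (hsub x hx)

include hq hψc hψ hϖ hv in
-- The central recursion: row `m` has no pivot, a pivot on the diagonal, or a pivot at an earlier
-- column `j`. The indices of the pivot are removed, and the level and the rank of what remains are
-- unchanged.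
theorem partialIntegral_succ (s : ℂ) {J : Finset (Fin n)} {m : Fin n} (hm : m ∈ J) {L : ℤ}
    (hL : L ≤ -1) :
    partialIntegral ψ ϖ v e s J L (m + 1) = partialIntegral ψ ϖ v e s J L m +
      (diagWeight ψ ϖ v e s (J.erase m) m L * partialIntegral ψ ϖ v e s (J.erase m) L m +
        ∑ j ∈ J.filter (· < m), pairWeight ψ ϖ e s ((J.erase m).erase j) m j L *
          partialIntegral ψ ϖ v e s ((J.erase m).erase j) L m) := by
  rw [partialIntegral, setIntegral_region_succ hq hψc hϖ s _ (val_injective J) (o := ⟨m, hm⟩) rfl L,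
    sum_filter_coe J hm, setIntegral_cell_diag hq hψc hψ hϖ hv e s hm hL]
  congr 2
  rw [← Finset.sum_coe_sort (J.filter (· < m))]
  exact Finset.sum_congr rfl fun j _ => setIntegral_cell_pair hq hψc hψ hϖ hv e s hm _
    (Finset.mem_filter.mp j.2).2 hL

omit [BorelSpace F] [MeasurableSpace F] in
theorem enorm_chi_mul_cpow (x : F) (k : ℤ) (s : ℂ) :
    ‖chi ϖ x * (resCard F : ℂ) ^ ((k : ℂ) * s)‖ₑ =
      ENNReal.ofReal ((resCard F : ℝ) ^ ((k : ℝ) * s.re)) := by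
  rw [← ofReal_norm, norm_mul, norm_chi, one_mul,
    Complex.norm_natCast_cpow_of_pos (resCard_pos F)]
  simp

theorem haar_pi_le {α : Type*} [Fintype α] {S : Set (α → F)} {L : ℤ}
    (hS : ∀ y ∈ S, ∀ a, y a ∈ P F L) :
    (Measure.pi fun _ : α => haarF F) S ≤
      ENNReal.ofReal ((resCard F : ℝ) ^ (-L)) ^ Fintype.card α := by
  have h : S ⊆ Set.univ.pi fun _ => (P F L : Set F) := fun y hy a _ => hS y hy a
  refine (measure_mono h).trans ?_
  rw [Measure.pi_pi, haar_P, Finset.prod_const, Finset.card_univ]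

/-- The bound for the contribution of a pivot. -/
def weightBound (F : Type*) [Field F] [ValuativeRel F] [TopologicalSpace F]
    [IsNonarchimedeanLocalField F] (n : ℕ) (s : ℂ) (L : ℤ) : ENNReal :=
  ENNReal.ofReal ((resCard F : ℝ) ^ ((L : ℝ) * (s.re - n)))

omit [BorelSpace F] [MeasurableSpace F] in
theorem weightBound_eq (s : ℂ) (L : ℤ) :
    weightBound F n s L = ENNReal.ofReal ((resCard F : ℝ) ^ ((L : ℝ) * s.re)) *
      ENNReal.ofReal ((resCard F : ℝ) ^ (-L)) ^ n := by
  have hq0 : (0 : ℝ) < resCard F := by exact_mod_cast resCard_pos F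
  rw [weightBound, ← ENNReal.ofReal_pow (by positivity), ← ENNReal.ofReal_mul (by positivity),
    ← Real.rpow_intCast, ← Real.rpow_natCast, ← Real.rpow_mul hq0.le, ← Real.rpow_add hq0]
  congr 2
  push_cast; ring

omit [BorelSpace F] [MeasurableSpace F] in
theorem one_le_ofReal_zpow {L : ℤ} (hL : L ≤ -1) :
    1 ≤ ENNReal.ofReal ((resCard F : ℝ) ^ (-L)) := by
  rw [ENNReal.one_le_ofReal]
  have h1 : (1 : ℝ) ≤ resCard F := by exact_mod_cast resCard_pos F
  exact one_le_zpow₀ h1 (by omega)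

omit [BorelSpace F] [MeasurableSpace F] in
theorem weightBound_le_one {s : ℂ} (hs : (n : ℝ) ≤ s.re) {L : ℤ} (hL : L ≤ -1) :
    weightBound F n s L ≤ 1 := by
  rw [weightBound, ENNReal.ofReal_le_one]
  have h1 : (1 : ℝ) ≤ resCard F := by exact_mod_cast resCard_pos F
  refine Real.rpow_le_one_of_one_le_of_nonpos h1 ?_
  have : (L : ℝ) ≤ -1 := by exact_mod_cast hL
  nlinarith

include hq hψc hϖ in
-- The determinant contributes `q^{L Re s}`, and the pivot with its column has at most `n` entries,
-- each from `𝔭 ^ L`.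
theorem setLIntegral_cell_diag (s : ℂ) {J : Finset (Fin n)} {m : Fin n} (hm : m ∈ J) {L : ℤ}
    (hL : L ≤ -1) :
    ∫⁻ x in cell F (fun k : ↥J => (k : ℕ)) L m ⟨m, hm⟩ ⟨m, hm⟩, ‖cellFn ϖ s (symM x)‖ₑ
      ∂haarS F ↥J ≤ weightBound F n s L * partialLIntegral ϖ s (J.erase m) L m := by
  have hC := pivotCell_unit (F := F) (ε := eraseEquiv J hm) (val_injective J) (m := m) rfl L
  have hint := hC.lintegral_eq hq hψc hϖ s (fun _ => 0)
  simp only [enorm_integrand] at hint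
  refine hint.trans_le (mul_le_mul' ?_ le_rfl)
  set t := ENNReal.ofReal ((resCard F : ℝ) ^ (-L)) with ht
  have h1 : ∫⁻ x in {x : Sym2 Unit → F | x s((), ()) ∈ shell F L}, ‖cellFn ϖ s (symM x)‖ₑ
      ∂haarS F Unit ≤ ENNReal.ofReal ((resCard F : ℝ) ^ ((L : ℝ) * s.re)) * t := by
    rw [setLIntegral_congr_fun (g := fun _ => ENNReal.ofReal ((resCard F : ℝ) ^ ((L : ℝ) * s.re)))
      hC.measurableSet_CO, setLIntegral_const]
    · refine mul_le_mul' le_rfl ((haar_pi_le (L := L) fun x hx k => ?_).trans_eq (pow_one t))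
      rw [Unique.eq_default k]
      exact shell_subset_P (show x s((), ()) ∈ shell F L from hx)
    · intro x hx
      simp only
      rw [cellFn_unit hq hϖ s hL hx, enorm_chi_mul_cpow]
  have h2 : ∏ k, (Measure.pi fun _ : Unit => haarF F)
      {y | y () ∈ P F (if ((eraseEquiv J hm (.inr k) : ↥J) : ℕ) < m then L else L + 1)} ≤
      t ^ (J.erase m).card := by
    refine (Finset.prod_le_prod' fun k _ => (haar_pi_le (L := L) fun y hy a =>
      P_mono (by split_ifs <;> omega) hy).trans_eq (pow_one t)).trans_eq ?_
    rw [Finset.prod_const, Finset.card_univ, Fintype.card_coe]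
  refine (mul_le_mul' h1 h2).trans ?_
  rw [weightBound_eq, mul_assoc, ← pow_succ']
  refine mul_le_mul' le_rfl (pow_le_pow_right₀ (one_le_ofReal_zpow hL) ?_)
  rw [Finset.card_erase_add_one hm]
  simpa using Finset.card_le_univ J

include hq hψc hϖ in
theorem setLIntegral_cell_pair {s : ℂ} (hs : (n : ℝ) ≤ s.re) {J : Finset (Fin n)} {m j : Fin n}
    (hm : m ∈ J) (hj : j ∈ J) (hjm : j < m) {L : ℤ} (hL : L ≤ -1) :
    ∫⁻ x in cell F (fun k : ↥J => (k : ℕ)) L m ⟨m, hm⟩ ⟨j, hj⟩, ‖cellFn ϖ s (symM x)‖ₑ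
      ∂haarS F ↥J ≤ weightBound F n s L * partialLIntegral ϖ s ((J.erase m).erase j) L m := by
  have hC := pivotCell_two (F := F) (ε := eraseTwoEquiv J hm hj hjm.ne) (val_injective J) (m := m)
    rfl (j := j) rfl hjm L
  have hint := hC.lintegral_eq hq hψc hϖ s (fun _ => 0)
  simp only [enorm_integrand] at hint
  refine hint.trans_le (mul_le_mul' ?_ le_rfl)
  set t := ENNReal.ofReal ((resCard F : ℝ) ^ (-L)) with ht
  set R := ENNReal.ofReal ((resCard F : ℝ) ^ ((L : ℝ) * s.re)) with hR
  have hRR : ENNReal.ofReal ((resCard F : ℝ) ^ (((2 * L : ℤ) : ℝ) * s.re)) = R * R := by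
    rw [hR, ← ENNReal.ofReal_mul (by positivity), ← Real.rpow_add (by exact_mod_cast resCard_pos F)]
    congr 2
    push_cast; ring
  have h1 : ∫⁻ x in {x : Sym2 (Fin 2) → F | x s(0, 0) ∈ P F (L + 1) ∧ x s(0, 1) ∈ shell F L ∧
      x s(1, 1) ∈ P F L}, ‖cellFn ϖ s (symM x)‖ₑ ∂haarS F (Fin 2) ≤ R * R * t ^ 3 := by
    rw [setLIntegral_congr_fun (g := fun _ => R * R) hC.measurableSet_CO, setLIntegral_const]
    · refine mul_le_mul' le_rfl ((haar_pi_le (L := L) ?_).trans_eq ?_)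
      · rintro x ⟨h0, h1, h2⟩ k
        have hk : k ∈ (Finset.univ : Finset (Sym2 (Fin 2))) := Finset.mem_univ _
        have huniv : (Finset.univ : Finset (Sym2 (Fin 2))) = {s(0, 0), s(0, 1), s(1, 1)} := by decide
        rw [huniv] at hk
        simp only [Finset.mem_insert, Finset.mem_singleton] at hk
        rcases hk with rfl | rfl | rfl
        exacts [P_mono (by omega) h0, shell_subset_P h1, h2]
      · rw [show Fintype.card (Sym2 (Fin 2)) = 3 by decide]
    · rintro x ⟨h0, h1, h2⟩
      simp only
      rw [cellFn_two hq hϖ s hL h0 h1 h2, enorm_chi_mul_cpow, hRR]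
  have h2 : ∏ k, (Measure.pi fun _ : Fin 2 => haarF F)
      {y | y 0 ∈ P F (if ((eraseTwoEquiv J hm hj hjm.ne (.inr k) : ↥J) : ℕ) < j then L else L + 1) ∧
        y 1 ∈ P F (if ((eraseTwoEquiv J hm hj hjm.ne (.inr k) : ↥J) : ℕ) < m then L else L + 1)} ≤
      (t ^ 2) ^ ((J.erase m).erase j).card := by
    refine (Finset.prod_le_prod' fun k _ => (haar_pi_le (L := L) fun y hy a => ?_).trans_eq
      (congrArg _ (Fintype.card_fin 2))).trans_eq ?_
    · fin_cases a
      · exact P_mono (by split_ifs <;> omega) hy.1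
      · exact P_mono (by split_ifs <;> omega) hy.2
    · rw [Finset.prod_const, Finset.card_univ, Fintype.card_coe]
  refine (mul_le_mul' h1 h2).trans ?_
  -- Block and columns have `3 + 2 (#J - 2)` entries, fewer than `2n`. This gives the square of the
  -- bound for a single pivot, and the square is no larger than the bound itself.
  have hle : R * R * t ^ 3 * (t ^ 2) ^ ((J.erase m).erase j).card ≤
      weightBound F n s L * weightBound F n s L := by
    rw [weightBound_eq, mul_mul_mul_comm, ← pow_add, mul_assoc, ← pow_mul, ← pow_add]
    refine mul_le_mul' le_rfl (pow_le_pow_right₀ (one_le_ofReal_zpow hL) ?_)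
    have c1 := Finset.card_erase_add_one hm
    have c2 := Finset.card_erase_add_one (Finset.mem_erase.mpr ⟨hjm.ne, hj⟩)
    have c3 : J.card ≤ n := by simpa using Finset.card_le_univ J
    omega
  exact hle.trans (mul_le_of_le_one_left' (weightBound_le_one hs hL))

include hq hψc hϖ in
theorem partialLIntegral_succ {s : ℂ} (hs : (n : ℝ) ≤ s.re) {J : Finset (Fin n)} {m : Fin n}
    (hm : m ∈ J) {L : ℤ} (hL : L ≤ -1) :
    partialLIntegral ϖ s J L (m + 1) ≤ partialLIntegral ϖ s J L m +
      (weightBound F n s L * partialLIntegral ϖ s (J.erase m) L m +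
        ∑ j ∈ J.filter (· < m), weightBound F n s L *
          partialLIntegral ϖ s ((J.erase m).erase j) L m) := by
  refine (setLIntegral_region_succ _ (val_injective J) (o := ⟨m, hm⟩) rfl L).trans ?_
  refine add_le_add le_rfl ?_
  rw [sum_filter_coe J hm, ← Finset.sum_coe_sort (J.filter (· < m))]
  exact add_le_add (setLIntegral_cell_diag hq hψc hϖ s hm hL) (Finset.sum_le_sum fun j _ =>
    setLIntegral_cell_pair hq hψc hϖ hs hm _ (Finset.mem_filter.mp j.2).2 hL)

end Recursion

/-! ### Involutions with level functions, and their recursion. -/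

section Configurations

variable {n : ℕ}

/-- Twice the exponent of `q` that belongs to the pair `(i, k)`. -/
def pairTerm (e : Fin n → ℕ) (p : Equiv.Perm (Fin n) × (Fin n → ℤ)) (i k : Fin n) : ℤ :=
  (if i = k then 0 else -min (p.2 i) (p.2 k)) - 2 * (if p.2 k < p.2 i ∧ k < i then 1 else 0) -
    2 * (if p.2 i = p.2 k ∧ i < k ∧ k < p.1 i ∧ p.1 k < p.1 i then 1 else 0) +
    min ((e k : ℤ) + eSig p.1 i k + p.2 i) 0

/-- The lower bound of the admissible `-λ` at the index `i`. -/
def levelBound (σ : Equiv.Perm (Fin n)) (e : Fin n → ℕ) (i : Fin n) : ℤ :=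
  if i < σ i then e i else e i + 1

/-- The pairs of an involution `σ` of `J` and a `σ`-invariant function `λ` on `J` with values
between `L` and `-1`, where the value `L` is only allowed on orbits below `m`. -/
def configs (J : Finset (Fin n)) (L : ℤ) (m : ℕ) : Finset (Equiv.Perm (Fin n) × (Fin n → ℤ)) :=
  (Finset.univ ×ˢ Fintype.piFinset fun i => if i ∈ J then Finset.Icc L (-1) else {0}).filter
    fun p => (∀ i, p.1 (p.1 i) = i) ∧ (∀ i, i ∉ J → p.1 i = i) ∧ (∀ i, p.2 (p.1 i) = p.2 i) ∧
      ∀ i ∈ J, p.2 i = L → (i : ℕ) < m ∧ (p.1 i : ℕ) < m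

theorem mem_configs {J : Finset (Fin n)} {L : ℤ} {m : ℕ}
    {p : Equiv.Perm (Fin n) × (Fin n → ℤ)} :
    p ∈ configs J L m ↔ (∀ i ∈ J, L ≤ p.2 i ∧ p.2 i ≤ -1) ∧ (∀ i, i ∉ J → p.2 i = 0) ∧
      (∀ i, p.1 (p.1 i) = i) ∧ (∀ i, i ∉ J → p.1 i = i) ∧ (∀ i, p.2 (p.1 i) = p.2 i) ∧
      ∀ i ∈ J, p.2 i = L → (i : ℕ) < m ∧ (p.1 i : ℕ) < m := by
  rw [configs, Finset.mem_filter, Finset.mem_product, Fintype.mem_piFinset]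
  simp only [Finset.mem_univ, true_and]
  constructor
  · rintro ⟨h1, h2⟩
    refine ⟨fun i hi => ?_, fun i hi => ?_, h2⟩
    · have := h1 i
      rwa [if_pos hi, Finset.mem_Icc] at this
    · have := h1 i
      rwa [if_neg hi, Finset.mem_singleton] at this
  · rintro ⟨h1, h2, h3⟩
    refine ⟨fun i => ?_, h3⟩
    split_ifs with hi
    · exact Finset.mem_Icc.mpr (h1 i hi)
    · exact Finset.mem_singleton.mpr (h2 i hi)

theorem mapsTo_of_mem_configs {J : Finset (Fin n)} {L : ℤ} {m : ℕ}
    {p : Equiv.Perm (Fin n) × (Fin n → ℤ)} (hp : p ∈ configs J L m) {i : Fin n} (hi : i ∈ J) :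
    p.1 i ∈ J := by
  rw [mem_configs] at hp
  by_contra h
  have h1 := hp.2.2.2.1 _ h
  rw [hp.2.2.1 i] at h1
  exact h (h1 ▸ hi)

/-- The counterpart of `region_zero`: if no orbit may have the value `L`, all values are at least `L
+ 1`. -/
theorem configs_zero_right (J : Finset (Fin n)) (L : ℤ) : configs J L 0 = configs J (L + 1) n := by
  ext p
  simp only [mem_configs]
  constructor
  · rintro ⟨h1, h2, h3, h4, h5, h6⟩
    refine ⟨fun i hi => ⟨?_, (h1 i hi).2⟩, h2, h3, h4, h5, fun i _ _ => ⟨i.2, (p.1 i).2⟩⟩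
    have := (h1 i hi).1
    have : p.2 i ≠ L := fun h => absurd (h6 i hi h).1 (Nat.not_lt_zero _)
    omega
  · rintro ⟨h1, h2, h3, h4, h5, -⟩
    refine ⟨fun i hi => ⟨?_, (h1 i hi).2⟩, h2, h3, h4, h5, fun i hi h => ?_⟩
    · have := (h1 i hi).1; omega
    · have := (h1 i hi).1; omega

theorem configs_zero_left (J : Finset (Fin n)) (m : ℕ) :
    configs J 0 m = if J = ∅ then {(1, 0)} else ∅ := by
  ext p
  split_ifs with h
  · subst h
    rw [mem_configs, Finset.mem_singleton]
    constructor
    · rintro ⟨-, h2, -, h4, -⟩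
      exact Prod.ext (Equiv.ext fun i => h4 i (Finset.notMem_empty i))
        (funext fun i => h2 i (Finset.notMem_empty i))
    · rintro rfl; simp
  · rw [mem_configs]
    obtain ⟨i, hi⟩ := Finset.nonempty_iff_ne_empty.mpr h
    simp only [Finset.notMem_empty, iff_false]
    rintro ⟨h1, -⟩
    have := h1 i hi
    omega

theorem configs_succ_of_notMem {J : Finset (Fin n)} {m : Fin n} (hm : m ∉ J) (L : ℤ) :
    configs J L (m + 1) = configs J L m := by
  ext p
  simp only [mem_configs]
  refine and_congr_right fun h1 => and_congr_right fun h2 => and_congr_right fun h3 =>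
    and_congr_right fun h4 => and_congr_right fun h5 => ?_
  refine forall_congr' fun i => forall_congr' fun hi => forall_congr' fun h => ?_
  have n1 : (i : ℕ) ≠ m := fun h' => hm (Fin.ext h' ▸ hi)
  have n2 : (p.1 i : ℕ) ≠ m := fun h' => by
    have h7 : p.1 i = m := Fin.ext h'
    have h8 := h3 i
    rw [h7, h4 m hm] at h8
    exact hm (h8 ▸ hi)
  omega

/-- The configuration obtained from a configuration on the other indices by adding the pivot
`(m, j)` of level `L`. -/
def insertPivot (m j : Fin n) (L : ℤ) (p : Equiv.Perm (Fin n) × (Fin n → ℤ)) :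
    Equiv.Perm (Fin n) × (Fin n → ℤ) :=
  (p.1 * Equiv.swap m j, Function.update (Function.update p.2 m L) j L)

section Insert

variable {J : Finset (Fin n)} {L : ℤ} {m j : Fin n} {p : Equiv.Perm (Fin n) × (Fin n → ℤ)}

theorem insertPivot_snd_left : (insertPivot m j L p).2 m = L := by
  simp only [insertPivot]
  by_cases h : m = j
  · subst h; simp
  · simp [Function.update_of_ne h]

theorem insertPivot_snd_right : (insertPivot m j L p).2 j = L := by simp [insertPivot]

theorem insertPivot_snd_of_ne {i : Fin n} (hm : i ≠ m) (hj : i ≠ j) :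
    (insertPivot m j L p).2 i = p.2 i := by
  simp [insertPivot, Function.update_of_ne hm, Function.update_of_ne hj]

theorem insertPivot_fst_of_ne {i : Fin n} (hm : i ≠ m) (hj : i ≠ j) :
    (insertPivot m j L p).1 i = p.1 i := by
  simp [insertPivot, Equiv.swap_apply_of_ne_of_ne hm hj]

theorem insertPivot_fst_left (h : p.1 j = j) : (insertPivot m j L p).1 m = j := by
  simp [insertPivot, h]

theorem insertPivot_fst_right (h : p.1 m = m) : (insertPivot m j L p).1 j = m := by
  simp [insertPivot, h]

theorem mem_erase_erase {i : Fin n} :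
    i ∈ (J.erase m).erase j ↔ i ∈ J ∧ i ≠ m ∧ i ≠ j := by
  rw [Finset.mem_erase, Finset.mem_erase]; tauto

theorem insertPivot_mem (hL : L ≤ -1) (hm : m ∈ J) (hj : j ∈ J) (hjm : j ≤ m)
    (hp : p ∈ configs ((J.erase m).erase j) L m) : insertPivot m j L p ∈ configs J L (m + 1) := by
  have hmap := fun i hi => mapsTo_of_mem_configs hp (i := i) hi
  rw [mem_configs] at hp ⊢
  obtain ⟨h1, h2, h3, h4, h5, h6⟩ := hp
  have hfm : p.1 m = m := h4 m (by simp)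
  have hfj : p.1 j = j := h4 j (by simp)
  have key : ∀ i, i = m ∨ i = j ∨ (i ≠ m ∧ i ≠ j) := fun i => by tauto
  have hne : ∀ i, i ≠ m → i ≠ j → p.1 i ≠ m ∧ p.1 i ≠ j := fun i a b =>
    ⟨fun h => a (by have := h3 i; rw [h, hfm] at this; exact this.symm),
      fun h => b (by have := h3 i; rw [h, hfj] at this; exact this.symm)⟩
  refine ⟨fun i hi => ?_, fun i hi => ?_, fun i => ?_, fun i hi => ?_, fun i => ?_,
    fun i hi h => ?_⟩
  · rcases key i with rfl | rfl | ⟨a, b⟩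
    · rw [insertPivot_snd_left]; exact ⟨le_rfl, hL⟩
    · rw [insertPivot_snd_right]; exact ⟨le_rfl, hL⟩
    · rw [insertPivot_snd_of_ne a b]; exact h1 i (mem_erase_erase.mpr ⟨hi, a, b⟩)
  · have a : i ≠ m := fun h => hi (h ▸ hm)
    have b : i ≠ j := fun h => hi (h ▸ hj)
    rw [insertPivot_snd_of_ne a b]
    exact h2 i fun h => hi (mem_erase_erase.mp h).1
  · rcases key i with rfl | rfl | ⟨a, b⟩
    · rw [insertPivot_fst_left hfj, insertPivot_fst_right hfm]
    · rw [insertPivot_fst_right hfm, insertPivot_fst_left hfj]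
    · rw [insertPivot_fst_of_ne a b, insertPivot_fst_of_ne (hne i a b).1 (hne i a b).2, h3]
  · have a : i ≠ m := fun h => hi (h ▸ hm)
    have b : i ≠ j := fun h => hi (h ▸ hj)
    rw [insertPivot_fst_of_ne a b]
    exact h4 i fun h => hi (mem_erase_erase.mp h).1
  · rcases key i with rfl | rfl | ⟨a, b⟩
    · rw [insertPivot_fst_left hfj, insertPivot_snd_right, insertPivot_snd_left]
    · rw [insertPivot_fst_right hfm, insertPivot_snd_right, insertPivot_snd_left]
    · rw [insertPivot_fst_of_ne a b, insertPivot_snd_of_ne (hne i a b).1 (hne i a b).2,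
        insertPivot_snd_of_ne a b, h5]
  · have hjm' : (j : ℕ) ≤ m := hjm
    rcases key i with rfl | rfl | ⟨a, b⟩
    · rw [insertPivot_fst_left hfj]; omega
    · rw [insertPivot_fst_right hfm]; omega
    · rw [insertPivot_snd_of_ne a b] at h
      rw [insertPivot_fst_of_ne a b]
      have := h6 i (mem_erase_erase.mpr ⟨hi, a, b⟩) h
      omega

end Insert

/-- The configuration that is left when the pivot `(m, j)` is removed. -/
def removePivot (m j : Fin n) (p : Equiv.Perm (Fin n) × (Fin n → ℤ)) :
    Equiv.Perm (Fin n) × (Fin n → ℤ) :=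
  (p.1 * Equiv.swap m j, Function.update (Function.update p.2 m 0) j 0)

theorem removePivot_mem {J : Finset (Fin n)} {L : ℤ} {m j : Fin n}
    {p : Equiv.Perm (Fin n) × (Fin n → ℤ)} (hp : p ∈ configs J L (m + 1))
    (hj : p.1 m = j) : removePivot m j p ∈ configs ((J.erase m).erase j) L m := by
  rw [mem_configs] at hp ⊢
  obtain ⟨h1, h2, h3, h4, h5, h6⟩ := hp
  have hjm : p.1 j = m := by rw [← hj, h3]
  have key : ∀ i, i = m ∨ i = j ∨ (i ≠ m ∧ i ≠ j) := fun i => by tauto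
  have hne : ∀ i, i ≠ m → i ≠ j → p.1 i ≠ m ∧ p.1 i ≠ j := fun i a b =>
    ⟨fun h => b (by have := h3 i; rw [h, hj] at this; exact this.symm),
      fun h => a (by have := h3 i; rw [h, hjm] at this; exact this.symm)⟩
  have sm : (removePivot m j p).2 m = 0 := by
    by_cases h : m = j
    · subst h; simp [removePivot]
    · simp [removePivot, Function.update_of_ne h]
  have sj : (removePivot m j p).2 j = 0 := by simp [removePivot]
  have fm : (removePivot m j p).1 m = m := by simp [removePivot, hjm]
  have fj : (removePivot m j p).1 j = j := by simp [removePivot, hj]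
  have si : ∀ i, i ≠ m → i ≠ j → (removePivot m j p).2 i = p.2 i := fun i a b => by
    simp [removePivot, Function.update_of_ne a, Function.update_of_ne b]
  have fi : ∀ i, i ≠ m → i ≠ j → (removePivot m j p).1 i = p.1 i := fun i a b => by
    simp [removePivot, Equiv.swap_apply_of_ne_of_ne a b]
  refine ⟨fun i hi => ?_, fun i hi => ?_, fun i => ?_, fun i hi => ?_, fun i => ?_,
    fun i hi h => ?_⟩
  · obtain ⟨hi, a, b⟩ := mem_erase_erase.mp hi
    rw [si i a b]; exact h1 i hi
  · rcases key i with rfl | rfl | ⟨a, b⟩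
    · exact sm
    · exact sj
    · rw [si i a b]; exact h2 i fun h => hi (mem_erase_erase.mpr ⟨h, a, b⟩)
  · rcases key i with rfl | rfl | ⟨a, b⟩
    · rw [fm, fm]
    · rw [fj, fj]
    · rw [fi i a b, fi _ (hne i a b).1 (hne i a b).2, h3]
  · rcases key i with rfl | rfl | ⟨a, b⟩
    · exact fm
    · exact fj
    · rw [fi i a b]; exact h4 i fun h => hi (mem_erase_erase.mpr ⟨h, a, b⟩)
  · rcases key i with rfl | rfl | ⟨a, b⟩
    · rw [fm]
    · rw [fj]
    · rw [fi i a b, si i a b, si _ (hne i a b).1 (hne i a b).2, h5]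
  · obtain ⟨hi, a, b⟩ := mem_erase_erase.mp hi
    rw [si i a b] at h
    rw [fi i a b]
    have h7 := h6 i hi h
    have h8 := (hne i a b).1
    rw [Ne, Fin.ext_iff] at h8 a
    omega

/-- This has the shape of `partialIntegral_succ`. If `m` does not have level `L`, the configuration
is already admitted for `m`. If it does, its partner `j = σ(m)` is at most `m`, and removing the
orbit of `m` is inverse to inserting a pivot at `(m, j)`. -/
theorem sum_configs_succ {M : Type*} [AddCommMonoid M] (f : Equiv.Perm (Fin n) × (Fin n → ℤ) → M)
    {J : Finset (Fin n)} {m : Fin n} (hm : m ∈ J) {L : ℤ} (hL : L ≤ -1) :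
    ∑ p ∈ configs J L (m + 1), f p = ∑ p ∈ configs J L m, f p +
      ∑ j ∈ J.filter (· ≤ m), ∑ p ∈ configs ((J.erase m).erase j) L m, f (insertPivot m j L p) := by
  rw [← Finset.sum_filter_not_add_sum_filter (configs J L (m + 1)) fun p => p.2 m = L]
  congr 1
  · refine Finset.sum_congr ?_ fun _ _ => rfl
    ext p
    rw [Finset.mem_filter]
    constructor
    · rintro ⟨hp, hne⟩
      rw [mem_configs] at hp ⊢
      obtain ⟨h1, h2, h3, h4, h5, h6⟩ := hp
      refine ⟨h1, h2, h3, h4, h5, fun i hi h => ?_⟩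
      have h7 := h6 i hi h
      have n1 : (i : ℕ) ≠ m := fun h' => hne (Fin.ext h' ▸ h)
      have n2 : (p.1 i : ℕ) ≠ m := fun h' => hne (by
        have h8 : p.1 i = m := Fin.ext h'
        rw [← h8, h5, h])
      omega
    · intro hp
      rw [mem_configs] at hp ⊢
      obtain ⟨h1, h2, h3, h4, h5, h6⟩ := hp
      refine ⟨⟨h1, h2, h3, h4, h5, fun i hi h => ?_⟩, fun h => ?_⟩
      · have := h6 i hi h; omega
      · exact absurd (h6 m hm h).1 (lt_irrefl _)
  · rw [← Finset.sum_fiberwise_of_maps_to (s := (configs J L (m + 1)).filter fun p => p.2 m = L)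
      (t := J.filter (· ≤ m)) (g := fun p => p.1 m)]
    · refine Finset.sum_congr rfl fun j hj => ?_
      obtain ⟨hjJ, hjm⟩ := Finset.mem_filter.mp hj
      symm
      refine Finset.sum_bij' (fun p _ => insertPivot m j L p) (fun p _ => removePivot m j p)
        ?_ ?_ ?_ ?_ ?_
      · intro p hp
        simp only [Finset.mem_filter]
        exact ⟨⟨insertPivot_mem hL hm hjJ hjm hp, insertPivot_snd_left⟩,
          insertPivot_fst_left ((mem_configs.mp hp).2.2.2.1 j (by simp))⟩
      · intro p hp
        simp only [Finset.mem_filter] at hp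
        exact removePivot_mem hp.1.1 hp.2
      · intro p hp
        have h2 := (mem_configs.mp hp).2.1
        refine Prod.ext (by simp [insertPivot, removePivot, mul_assoc]) ?_
        funext i
        simp only [insertPivot, removePivot]
        by_cases hi : i = j
        · subst hi; simp [h2 i]
        · by_cases hi' : i = m
          · subst hi'; simp [Function.update_of_ne hi, h2 i]
          · simp [Function.update_of_ne hi, Function.update_of_ne hi']
      · intro p hp
        simp only [Finset.mem_filter] at hp
        have h5 := (mem_configs.mp hp.1.1).2.2.2.2.1
        have hmL := hp.1.2
        have hjL : p.2 j = L := by rw [← hp.2, h5, hmL]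
        refine Prod.ext (by simp [insertPivot, removePivot, mul_assoc]) ?_
        funext i
        simp only [insertPivot, removePivot]
        by_cases hi : i = j
        · subst hi; simp [hjL]
        · by_cases hi' : i = m
          · subst hi'; simp [Function.update_of_ne hi, hmL]
          · simp [Function.update_of_ne hi, Function.update_of_ne hi']
      · intro p hp; rfl
    · intro p hp
      rw [Finset.mem_filter] at hp ⊢
      refine ⟨mapsTo_of_mem_configs hp.1 hm, ?_⟩
      have := ((mem_configs.mp hp.1).2.2.2.2.2 m hm hp.2).2
      rw [Fin.le_def]; omega

theorem c2_insertPivot {σ : Equiv.Perm (Fin n)} {m j : Fin n} (hm : σ m = m) (hj : σ j = j)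
    (hjm : j ≠ m) : c2 (σ * Equiv.swap m j) = c2 σ + 1 := by
  have h : (Finset.univ.filter fun i => (σ * Equiv.swap m j) i ≠ i) =
      insert m (insert j (Finset.univ.filter fun i => σ i ≠ i)) := by
    ext i
    refine Finset.mem_filter.trans ?_
    simp only [Finset.mem_filter, Finset.mem_univ, true_and, Finset.mem_insert, Equiv.Perm.coe_mul,
      Function.comp_apply]
    by_cases h1 : i = m
    · subst h1; simp [hj, hjm]
    · by_cases h2 : i = j
      · subst h2; simp [hm, Ne.symm h1]
      · simp [Equiv.swap_apply_of_ne_of_ne h1 h2, h1, h2]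
  rw [c2, c2, h, Finset.card_insert_of_notMem, Finset.card_insert_of_notMem]
  · omega
  · simp [hj]
  · simp [hm, hjm.symm]

end Configurations

/-! ### The exponents contributed by pairs of indices. -/

section PairTerms

variable {n : ℕ} (e : Fin n → ℕ) {p p' : Equiv.Perm (Fin n) × (Fin n → ℤ)} {L : ℤ} {m j k : Fin n}

theorem pairTerm_of_le (hkm : k ≠ m) (hm : p.2 m = L) (hk : L ≤ p.2 k) :
    pairTerm e p m k = -L - 2 * (if p.2 k = L ∧ m < k ∧ k < p.1 m ∧ p.1 k < p.1 m then 1 else 0) +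
      min ((e k : ℤ) + eSig p.1 m k + L) 0 := by
  rw [pairTerm, hm, if_neg hkm.symm, min_eq_left hk, if_neg (fun h => absurd h.1 (not_lt.mpr hk))]
  simp only [eq_comm (a := L)]
  ring

theorem pairTerm_of_ge (hkm : k ≠ m) (hm : p.2 m = L) (hk : L ≤ p.2 k)
    (h : p.2 k = L → ¬ (m < p.1 k ∧ p.1 m < p.1 k)) (he : 0 ≤ (e m : ℤ) + eSig p.1 k m + p.2 k) :
    pairTerm e p k m = -L - 2 * (if L < p.2 k ∧ m < k then 1 else 0) := by
  rw [pairTerm, hm, if_neg hkm, min_eq_right hk, min_eq_right he,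
    if_neg (c := p.2 k = L ∧ _) (fun h' => h h'.1 ⟨h'.2.2.1, h'.2.2.2⟩)]
  ring

theorem eSig_nonneg (σ : Equiv.Perm (Fin n)) (i k : Fin n) : 0 ≤ eSig σ i k := by
  unfold eSig; split_ifs <;> omega

theorem eSig_eq_two {σ : Equiv.Perm (Fin n)} {i k : Fin n} (h1 : i < k) (h2 : σ i < k) :
    eSig σ i k = 2 := by
  rw [eSig, if_neg (fun h => absurd h.1 (not_le.mpr h1)), if_pos ⟨h1, h2⟩]

/-- The two orders of the pair together give what `diagExp` charges to `k`. The level `L` of the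
pivot is minimal, and indices that share it lie below `m` with their partners. Admissibility of `m`
makes the truncated minimum for the order `(k, m)` vanish. -/
theorem pairTerm_diag (hkm : k ≠ m) (hσ : p.1 m = m) (hm : p.2 m = L) (hk : L ≤ p.2 k)
    (hk' : p.2 k = L → k < m ∧ p.1 k < m) (he : 0 ≤ (e m : ℤ) + 1 + L) :
    pairTerm e p m k + pairTerm e p k m = -2 * (if k < m then L else L + 1) +
      min ((e k : ℤ) + (if k < m then 0 else 2) + L) 0 := by
  have hs : eSig p.1 m k = if k < m then 0 else 2 := by
    rw [eSig, hσ]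
    rcases lt_or_gt_of_ne hkm with h | h
    · rw [if_pos ⟨h.le, h.le⟩, if_pos h]
    · rw [if_neg (fun h' => absurd h'.1 (not_le.mpr h)), if_pos ⟨h, h⟩, if_neg (not_lt.mpr h.le)]
  have he' : 0 ≤ (e m : ℤ) + eSig p.1 k m + p.2 k := by
    have := eSig_nonneg p.1 k m
    rcases hk.eq_or_lt with h | h
    · rw [eSig_eq_two (hk' h.symm).1 (hk' h.symm).2]; omega
    · omega
  rw [pairTerm_of_le e hkm hm hk, pairTerm_of_ge e hkm hm hk
    (fun h h' => absurd h'.1 (not_lt.mpr (hk' h).2.le)) he', hs,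
    if_neg (fun h => absurd (h.2.1.trans h.2.2.1) (by rw [hσ]; exact lt_irrefl _))]
  rcases lt_or_gt_of_ne hkm with h | h
  · rw [if_neg (c := L < p.2 k ∧ _) (fun h' => absurd h'.2 (not_lt.mpr h.le)), if_pos h, if_pos h]
    ring
  · have : L < p.2 k := lt_of_le_of_ne hk fun h' => absurd (hk' h'.symm).1 (not_lt.mpr h.le)
    rw [if_pos (c := L < p.2 k ∧ _) ⟨this, h⟩, if_neg (not_lt.mpr h.le), if_neg (not_lt.mpr h.le)]
    ring

/-- For a pair of pivot indices, an index `k` strictly between `j` and `m` needs the correction by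
`1` in one of two ways. At level `L` the statistic `t` counts it, as both `k` and its partner lie
below `m`; at a higher level `τ` counts it, as `k` comes later in the partition. -/
theorem pairTerm_pair (hjm : j < m) (hkm : k ≠ m) (hkj : k ≠ j) (hσm : p.1 m = j) (hσj : p.1 j = m)
    (hm : p.2 m = L) (hj : p.2 j = L) (hk : L ≤ p.2 k) (hk' : p.2 k = L → k < m ∧ p.1 k < m)
    (hem : 0 ≤ (e m : ℤ) + L + 1) (hej : 0 ≤ (e j : ℤ) + L) :
    pairTerm e p m k + pairTerm e p k m + (pairTerm e p j k + pairTerm e p k j) =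
      -2 * ((if k < j then L else L + 1) + (if k < m then L else L + 1)) +
      2 * min ((e k : ℤ) + ((if k < j then 0 else 1) + (if k < m then 0 else 1)) + L) 0 := by
  have hs : ((if k < j then 0 else 1) + (if k < m then 0 else 1) : ℤ) =
      if k ≤ j ∧ k ≤ m then 0 else if j < k ∧ m < k then 2 else 1 := by
    rcases lt_or_gt_of_ne hkm with h | h
    · rcases lt_or_gt_of_ne hkj with h' | h'
      · rw [if_pos h, if_pos h', if_pos ⟨h'.le, h.le⟩]; rfl
      · rw [if_pos h, if_neg (not_lt.mpr h'.le), if_neg (fun c => absurd c.1 (not_le.mpr h')),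
          if_neg (fun c => absurd c.2 (not_lt.mpr h.le))]; rfl
    · have h' := hjm.trans h
      rw [if_neg (not_lt.mpr h.le), if_neg (not_lt.mpr h'.le), if_neg (fun c => absurd c.1 (not_le.mpr h')),
        if_pos ⟨h', h⟩]; rfl
  have hsm : eSig p.1 m k = (if k < j then 0 else 1) + (if k < m then 0 else 1) := by
    rw [hs, eSig, hσm]
    simp only [and_comm]
  have hsj : eSig p.1 j k = (if k < j then 0 else 1) + (if k < m then 0 else 1) := by
    rw [hs, eSig, hσj]
  have he' : 0 ≤ (e m : ℤ) + eSig p.1 k m + p.2 k := by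
    have := eSig_nonneg p.1 k m
    rcases hk.eq_or_lt with h | h
    · rw [eSig_eq_two (hk' h.symm).1 (hk' h.symm).2]; omega
    · omega
  have he'' : 0 ≤ (e j : ℤ) + eSig p.1 k j + p.2 k := by
    have := eSig_nonneg p.1 k j
    omega
  rw [pairTerm_of_le e hkm hm hk, pairTerm_of_ge e hkm hm hk
    (fun h h' => absurd h'.1 (not_lt.mpr (hk' h).2.le)) he', pairTerm_of_le e hkj hj hk,
    pairTerm_of_ge e hkj hj hk
    (fun h h' => absurd h'.2 (by rw [hσj]; exact not_lt.mpr (hk' h).2.le)) he'', hsm, hsj,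
    if_neg (fun h => absurd (h.2.1.trans h.2.2.1) (by rw [hσm]; exact not_lt.mpr hjm.le)), hσj]
  generalize min ((e k : ℤ) + ((if k < j then 0 else 1) + (if k < m then 0 else 1)) + L) 0 = x
  rcases hk.eq_or_lt with h | h
  · obtain ⟨h1, h2⟩ := hk' h.symm
    rw [if_neg (c := L < p.2 k ∧ m < k) (fun c => absurd c.1 (by omega)),
      if_neg (c := L < p.2 k ∧ j < k) (fun c => absurd c.1 (by omega)), if_pos h1]
    rcases lt_or_gt_of_ne hkj with h' | h'
    · rw [if_neg (fun c => absurd c.2.1 (not_lt.mpr h'.le)), if_pos h']; ring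
    · rw [if_pos ⟨h.symm, h', h1, h2⟩, if_neg (not_lt.mpr h'.le)]; ring
  · rw [if_neg (c := p.2 k = L ∧ _) (fun c => absurd c.1 h.ne')]
    rcases lt_or_gt_of_ne hkm with h1 | h1
    · rw [if_neg (c := L < p.2 k ∧ m < k) (fun c => absurd c.2 (not_lt.mpr h1.le)), if_pos h1]
      rcases lt_or_gt_of_ne hkj with h' | h'
      · rw [if_neg (fun c => absurd c.2 (not_lt.mpr h'.le)), if_pos h']; ring
      · rw [if_pos ⟨h, h'⟩, if_neg (not_lt.mpr h'.le)]; ring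
    · have h' := hjm.trans h1
      rw [if_pos ⟨h, h1⟩, if_pos ⟨h, h'⟩, if_neg (not_lt.mpr h1.le), if_neg (not_lt.mpr h'.le)]; ring

theorem pairTerm_self_diag (hσ : p.1 m = m) (hm : p.2 m = L) :
    pairTerm e p m m = min ((e m : ℤ) + L) 0 := by
  simp [pairTerm, eSig, hσ, hm]

theorem pairTerm_self_pair (hjm : j < m) (hσm : p.1 m = j) (hσj : p.1 j = m) (hm : p.2 m = L)
    (hj : p.2 j = L) (hem : 0 ≤ (e m : ℤ) + L + 1) (hej : 0 ≤ (e j : ℤ) + L) :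
    pairTerm e p m m + (pairTerm e p m j + pairTerm e p j m) + pairTerm e p j j = -2 * L := by
  have h1 : ¬ m ≤ j := not_le.mpr hjm
  have h2 : ¬ m < j := not_lt.mpr hjm.le
  simp only [pairTerm, eSig, hσm, hσj, hm, hj, hjm.ne, hjm.ne', hjm, hjm.le, h1, h2, lt_irrefl,
    le_refl, if_true, if_false, and_true, and_false, true_and, false_and, min_self]
  rw [min_eq_right (by omega), min_eq_right (by omega)]
  ring

theorem pairTerm_congr {i : Fin n} (h1 : p.1 i = p'.1 i) (h2 : p.2 i = p'.2 i)
    (h3 : p.1 k = p'.1 k) (h4 : p.2 k = p'.2 k) : pairTerm e p i k = pairTerm e p' i k := by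
  simp only [pairTerm, eSig, h1, h2, h3, h4]

end PairTerms

/-! ### The integral over a region as a sum over configurations. -/

section Terms

variable {F : Type*} [Field F] [ValuativeRel F] [TopologicalSpace F]
  [IsNonarchimedeanLocalField F] [MeasurableSpace F] [BorelSpace F] {n : ℕ}

open Classical in
/-- The contribution of a configuration. -/
def configTerm (ψ : AddChar F Circle) (ϖ : F) (v : Fin n → F) (e : Fin n → ℕ) (s : ℂ)
    (J : Finset (Fin n)) (p : Equiv.Perm (Fin n) × (Fin n → ℤ)) : ℂ :=
  if ∀ i ∈ J, 0 ≤ levelBound p.1 e i + p.2 i then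
    weilConstant ψ ϖ ^ J.card * ((1 - (resCard F : ℂ)⁻¹) * (resCard F : ℂ)⁻¹) ^ c2 p.1 *
      chi ϖ (-1) ^ (∑ i ∈ J, p.2 i) *
      (resCard F : ℂ) ^ ((s - 1) * ((∑ i ∈ J, p.2 i : ℤ) : ℂ) +
        ((∑ i ∈ J, ∑ k ∈ J, pairTerm e p i k : ℤ) : ℂ) / 2) *
      ∏ i ∈ J with p.1 i = i, xiOn ϖ v e (bSet e i (p.2 i) ∩ J) i (p.2 i)
  else 0

theorem sum_sum_insert {M : Type*} [AddCommMonoid M] (f : Fin n → Fin n → M) {J : Finset (Fin n)}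
    {m : Fin n} (hm : m ∉ J) :
    ∑ i ∈ insert m J, ∑ k ∈ insert m J, f i k =
      ∑ i ∈ J, ∑ k ∈ J, f i k + ∑ k ∈ J, (f m k + f k m) + f m m := by
  rw [Finset.sum_insert hm, Finset.sum_insert hm]
  simp only [Finset.sum_insert hm, Finset.sum_add_distrib]
  abel

theorem bSet_inter_insert (e : Fin n → ℕ) {i : Fin n} {lam : ℤ} {J : Finset (Fin n)} {m : Fin n}
    (h : m ∉ bSet e i lam) : bSet e i lam ∩ insert m J = bSet e i lam ∩ J :=
  Finset.inter_insert_of_notMem h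

/-- The set `B_i(λ)` of an index removed later is not affected by a pivot `m` of level `L`: at a
level above `L` the entry `e_m` is too large, and at level `L` itself `m` lies after `i`, where the
condition is stricter by `2`. -/
theorem notMem_bSet (e : Fin n → ℕ) {i m : Fin n} {lam L : ℤ} (hL : L ≤ lam)
    (hi : lam = L → i < m) (he : 0 ≤ (e m : ℤ) + 1 + L) : m ∉ bSet e i lam := by
  simp only [bSet, Finset.mem_filter, Finset.mem_univ, true_and, not_or]
  constructor
  · rintro ⟨h1, h2, -⟩
    have : lam ≠ L := fun h => absurd (hi h) (not_lt.mpr h1.le)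
    omega
  · rintro ⟨-, h2, -⟩
    omega

theorem notMem_bSet_of_nonneg (e : Fin n → ℕ) {i j : Fin n} {lam : ℤ}
    (he : 0 ≤ (e j : ℤ) + lam) : j ∉ bSet e i lam := by
  simp only [bSet, Finset.mem_filter, Finset.mem_univ, true_and, not_or]
  constructor
  · rintro ⟨-, h2, -⟩; omega
  · rintro ⟨-, h2, -⟩; omega

/-- Every ingredient of `configTerm` is a sum or product over indices or pairs. The parts that
involve `m` form `diagWeight`, and the sets `B_i` of the other indices do not see `m`. -/
theorem configTerm_insertPivot_diag (ψ : AddChar F Circle) (ϖ : F) (v : Fin n → F) (e : Fin n → ℕ)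
    (s : ℂ) {J : Finset (Fin n)} {m : Fin n} (hm : m ∈ J) {L : ℤ}
    {p : Equiv.Perm (Fin n) × (Fin n → ℤ)} (hp : p ∈ configs (J.erase m) L m) :
    configTerm ψ ϖ v e s J (insertPivot m m L p) =
      diagWeight ψ ϖ v e s (J.erase m) m L * configTerm ψ ϖ v e s (J.erase m) p := by
  obtain ⟨h1, h2, h3, h4, h5, h6⟩ := mem_configs.mp hp
  have hσ : p.1 m = m := h4 m (by simp)
  have fm : (insertPivot m m L p).1 m = m := insertPivot_fst_left hσ
  have sm : (insertPivot m m L p).2 m = L := insertPivot_snd_left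
  have fi : ∀ i ∈ J.erase m, (insertPivot m m L p).1 i = p.1 i := fun i hi =>
    insertPivot_fst_of_ne (Finset.ne_of_mem_erase hi) (Finset.ne_of_mem_erase hi)
  have si : ∀ i ∈ J.erase m, (insertPivot m m L p).2 i = p.2 i := fun i hi =>
    insertPivot_snd_of_ne (Finset.ne_of_mem_erase hi) (Finset.ne_of_mem_erase hi)
  have hc : c2 (insertPivot m m L p).1 = c2 p.1 := by
    rw [insertPivot, Equiv.swap_self]; exact congrArg c2 (mul_one p.1)
  set p' := insertPivot m m L p with hp'
  have hJ : insert m (J.erase m) = J := Finset.insert_erase hm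
  have hn := Finset.notMem_erase m J
  by_cases hadm : 0 ≤ (e m : ℤ) + 1 + L
  swap
  -- For `e_m + L ≤ -2` both sides vanish, the right one through the last case of `xiOn`.
  · rw [configTerm, if_neg, diagWeight, xiOn, if_neg (by omega), if_neg (by omega)]
    · ring
    · intro h
      have := h m hm
      rw [levelBound, fm, if_neg (lt_irrefl _), sm] at this
      exact hadm this
  have hiff : (∀ i ∈ J, 0 ≤ levelBound p'.1 e i + p'.2 i) ↔
      ∀ i ∈ J.erase m, 0 ≤ levelBound p.1 e i + p.2 i := by
    constructor
    · intro h i hi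
      have := h i (Finset.mem_of_mem_erase hi)
      rwa [levelBound, fi i hi, si i hi] at this
    · intro h i hi
      by_cases him : i = m
      · subst him
        rwa [levelBound, fm, if_neg (lt_irrefl _), sm]
      · have hi' := Finset.mem_erase.mpr ⟨him, hi⟩
        rw [levelBound, fi i hi', si i hi']
        exact h i hi'
  rw [configTerm, configTerm]
  by_cases hall : ∀ i ∈ J.erase m, 0 ≤ levelBound p.1 e i + p.2 i
  swap
  · rw [if_neg hall, if_neg fun h => hall (hiff.mp h), mul_zero]
  rw [if_pos hall, if_pos (hiff.mpr hall), hc]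
  have hsum : ∑ i ∈ J, p'.2 i = L + ∑ i ∈ J.erase m, p.2 i := by
    rw [← hJ, Finset.sum_insert hn, sm, Finset.sum_congr rfl si, hJ]
  have hpair : ∑ i ∈ J, ∑ k ∈ J, pairTerm e p' i k =
      ∑ i ∈ J.erase m, ∑ k ∈ J.erase m, pairTerm e p i k + diagExp e (J.erase m) m L := by
    conv_lhs => rw [← hJ]
    rw [sum_sum_insert _ hn, pairTerm_self_diag e fm sm, diagExp, add_assoc]
    congr 1
    · exact Finset.sum_congr rfl fun i hi => Finset.sum_congr rfl fun k hk =>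
        pairTerm_congr e (fi i hi) (si i hi) (fi k hk) (si k hk)
    · congr 1
      refine Finset.sum_congr rfl fun k hk => ?_
      refine pairTerm_diag e (Finset.ne_of_mem_erase hk) fm sm ?_ ?_ hadm
      · rw [si k hk]; exact (h1 k hk).1
      · rw [si k hk, fi k hk]; exact fun h => h6 k hk h
  have hprod : ∏ i ∈ J with p'.1 i = i, xiOn ϖ v e (bSet e i (p'.2 i) ∩ J) i (p'.2 i) =
      xiOn ϖ v e (bSet e m L ∩ J.erase m) m L *
        ∏ i ∈ J.erase m with p.1 i = i, xiOn ϖ v e (bSet e i (p.2 i) ∩ J.erase m) i (p.2 i) := by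
    conv_lhs => rw [← hJ]
    rw [Finset.prod_filter, Finset.prod_insert hn, if_pos fm, sm, bSet_inter_insert e (by simp [bSet]),
      Finset.prod_filter]
    congr 1
    refine Finset.prod_congr rfl fun i hi => ?_
    rw [fi i hi, si i hi, bSet_inter_insert e (notMem_bSet e (h1 i hi).1 (fun h => (h6 i hi h).1) hadm)]
  have hcard : J.card = (J.erase m).card + 1 := (Finset.card_erase_add_one hm).symm
  rw [hsum, hpair, hprod, hcard, diagWeight, zpow_add₀ (chi_ne_zero _ _), pow_succ]
  have hexp : (s - 1) * ((L + ∑ i ∈ J.erase m, p.2 i : ℤ) : ℂ) +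
      ((∑ i ∈ J.erase m, ∑ k ∈ J.erase m, pairTerm e p i k + diagExp e (J.erase m) m L : ℤ) : ℂ) / 2 =
      ((s - 1) * L + (diagExp e (J.erase m) m L : ℂ) / 2) + ((s - 1) *
        ((∑ i ∈ J.erase m, p.2 i : ℤ) : ℂ) +
        ((∑ i ∈ J.erase m, ∑ k ∈ J.erase m, pairTerm e p i k : ℤ) : ℂ) / 2) := by
    push_cast; ring
  rw [hexp, resCard_cpow_add]
  ring

/-- As for a single pivot, with the interactions of both indices collected in `pairWeight`. Neither
index is fixed, so there is no factor `ξ` for them, and the two equal powers `χ(-1)^L` cancel. -/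
theorem configTerm_insertPivot_pair (ψ : AddChar F Circle) (ϖ : F) (v : Fin n → F) (e : Fin n → ℕ)
    (s : ℂ) {J : Finset (Fin n)} {m j : Fin n} (hm : m ∈ J) (hj : j ∈ J) (hjm : j < m) {L : ℤ}
    {p : Equiv.Perm (Fin n) × (Fin n → ℤ)} (hp : p ∈ configs ((J.erase m).erase j) L m) :
    configTerm ψ ϖ v e s J (insertPivot m j L p) =
      pairWeight ψ ϖ e s ((J.erase m).erase j) m j L *
        configTerm ψ ϖ v e s ((J.erase m).erase j) p := by
  obtain ⟨h1, h2, h3, h4, h5, h6⟩ := mem_configs.mp hp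
  have hσm : p.1 m = m := h4 m (by simp)
  have hσj : p.1 j = j := h4 j (by simp)
  have fm : (insertPivot m j L p).1 m = j := insertPivot_fst_left hσj
  have sm : (insertPivot m j L p).2 m = L := insertPivot_snd_left
  have fj : (insertPivot m j L p).1 j = m := insertPivot_fst_right hσm
  have sj : (insertPivot m j L p).2 j = L := insertPivot_snd_right
  have fi : ∀ i ∈ (J.erase m).erase j, (insertPivot m j L p).1 i = p.1 i := fun i hi =>
    insertPivot_fst_of_ne (mem_erase_erase.mp hi).2.1 (mem_erase_erase.mp hi).2.2
  have si : ∀ i ∈ (J.erase m).erase j, (insertPivot m j L p).2 i = p.2 i := fun i hi =>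
    insertPivot_snd_of_ne (mem_erase_erase.mp hi).2.1 (mem_erase_erase.mp hi).2.2
  have hc : c2 (insertPivot m j L p).1 = c2 p.1 + 1 := c2_insertPivot hσm hσj hjm.ne
  set p' := insertPivot m j L p with hp'
  have hjm' : j ∈ J.erase m := Finset.mem_erase.mpr ⟨hjm.ne, hj⟩
  set K := (J.erase m).erase j with hK
  have hJ : insert m (insert j K) = J := by
    rw [hK, Finset.insert_erase hjm', Finset.insert_erase hm]
  have hnj : j ∉ K := Finset.notMem_erase j _
  have hnm : m ∉ insert j K := by rw [hK, Finset.insert_erase hjm']; exact Finset.notMem_erase m J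
  by_cases hadm : 0 ≤ (e m : ℤ) + L + 1 ∧ 0 ≤ (e j : ℤ) + L
  swap
  · rw [configTerm, if_neg, pairWeight, if_neg hadm, zero_mul]
    intro h
    have c1 := h m hm
    have c2 := h j hj
    rw [levelBound, fm, if_neg (not_lt.mpr hjm.le), sm] at c1
    rw [levelBound, fj, if_pos hjm, sj] at c2
    exact hadm ⟨by omega, c2⟩
  obtain ⟨hem, hej⟩ := hadm
  have hiff : (∀ i ∈ J, 0 ≤ levelBound p'.1 e i + p'.2 i) ↔
      ∀ i ∈ K, 0 ≤ levelBound p.1 e i + p.2 i := by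
    constructor
    · intro h i hi
      have := h i (mem_erase_erase.mp hi).1
      rwa [levelBound, fi i hi, si i hi] at this
    · intro h i hi
      by_cases him : i = m
      · subst him
        rw [levelBound, fm, if_neg (not_lt.mpr hjm.le), sm]; omega
      by_cases hij : i = j
      · subst hij
        rwa [levelBound, fj, if_pos hjm, sj]
      have hi' := mem_erase_erase.mpr ⟨hi, him, hij⟩
      rw [levelBound, fi i hi', si i hi']
      exact h i hi'
  rw [configTerm, configTerm]
  by_cases hall : ∀ i ∈ K, 0 ≤ levelBound p.1 e i + p.2 i
  swap
  · rw [if_neg hall, if_neg fun h => hall (hiff.mp h), mul_zero]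
  rw [if_pos hall, if_pos (hiff.mpr hall), hc]
  have hsum : ∑ i ∈ J, p'.2 i = (L + L) + ∑ i ∈ K, p.2 i := by
    rw [← hJ, Finset.sum_insert hnm, Finset.sum_insert hnj, sm, sj, Finset.sum_congr rfl si, add_assoc]
  have hpair : ∑ i ∈ J, ∑ k ∈ J, pairTerm e p' i k =
      ∑ i ∈ K, ∑ k ∈ K, pairTerm e p i k + pairExp e K m j L := by
    have hself := pairTerm_self_pair e hjm fm fj sm sj hem hej
    have hK1 : ∑ i ∈ K, ∑ k ∈ K, pairTerm e p' i k = ∑ i ∈ K, ∑ k ∈ K, pairTerm e p i k :=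
      Finset.sum_congr rfl fun i hi => Finset.sum_congr rfl fun k hk =>
        pairTerm_congr e (fi i hi) (si i hi) (fi k hk) (si k hk)
    have hK2 : ∑ k ∈ K, (pairTerm e p' m k + pairTerm e p' k m) +
        ∑ k ∈ K, (pairTerm e p' j k + pairTerm e p' k j) = pairExp e K m j L + 2 * L := by
      rw [pairExp, sub_add_cancel, ← Finset.sum_add_distrib]
      refine Finset.sum_congr rfl fun k hk => ?_
      have hk' := mem_erase_erase.mp hk
      refine pairTerm_pair e hjm hk'.2.1 hk'.2.2 fm fj sm sj ?_ ?_ hem hej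
      · rw [si k hk]; exact (h1 k hk).1
      · rw [si k hk, fi k hk]; exact fun h => h6 k hk h
    conv_lhs => rw [← hJ]
    rw [sum_sum_insert _ hnm, sum_sum_insert _ hnj, Finset.sum_insert hnj]
    linarith
  have hprod : ∏ i ∈ J with p'.1 i = i, xiOn ϖ v e (bSet e i (p'.2 i) ∩ J) i (p'.2 i) =
        ∏ i ∈ K with p.1 i = i, xiOn ϖ v e (bSet e i (p.2 i) ∩ K) i (p.2 i) := by
    conv_lhs => rw [← hJ]
    rw [Finset.prod_filter, Finset.prod_insert hnm, Finset.prod_insert hnj,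
      if_neg (by rw [fm]; exact hjm.ne), if_neg (by rw [fj]; exact hjm.ne'), one_mul, one_mul,
      Finset.prod_filter]
    refine Finset.prod_congr rfl fun i hi => ?_
    rw [fi i hi, si i hi, bSet_inter_insert e
      (notMem_bSet e (h1 i hi).1 (fun h => (h6 i hi h).1) (by omega)), bSet_inter_insert e
      (notMem_bSet_of_nonneg e (by have := (h1 i hi).1; omega))]
  have hcard : J.card = K.card + 2 := by
    rw [← hJ, Finset.card_insert_of_notMem hnm, Finset.card_insert_of_notMem hnj]
  rw [hsum, hpair, hprod, hcard, pairWeight, if_pos ⟨hem, hej⟩, zpow_add₀ (chi_ne_zero _ _),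
    zpow_add₀ (chi_ne_zero _ _), ← mul_zpow, chi_mul_self, one_zpow, pow_succ, pow_add, one_mul]
  have hexp : (s - 1) * ((L + L + ∑ i ∈ K, p.2 i : ℤ) : ℂ) +
      ((∑ i ∈ K, ∑ k ∈ K, pairTerm e p i k + pairExp e K m j L : ℤ) : ℂ) / 2 =
      ((s - 1) * (2 * L) + (pairExp e K m j L : ℂ) / 2) + ((s - 1) *
        ((∑ i ∈ K, p.2 i : ℤ) : ℂ) + ((∑ i ∈ K, ∑ k ∈ K, pairTerm e p i k : ℤ) : ℂ) / 2) := by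
    push_cast; ring
  rw [hexp, resCard_cpow_add]
  ring

theorem configTerm_empty (ψ : AddChar F Circle) (ϖ : F) (v : Fin n → F) (e : Fin n → ℕ) (s : ℂ) :
    configTerm ψ ϖ v e s ∅ (1, 0) = 1 := by
  simp [configTerm, c2]

/-- Both sides obey the same recursion, in the level and then in the number of admitted indices, and
both are `1` or `0` at level `0` according to whether `J` is empty. -/
theorem partialIntegral_eq (hq : Odd (resCard F)) {ψ : AddChar F Circle} (hψc : Continuous ψ)
    (hψ : HasOrderZero ψ) {ϖ : F} (hϖ : ϖ ∈ shell F 1) {v : Fin n → F} (hv : ∀ i, v i ∈ shell F 0)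
    (e : Fin n → ℕ) (s : ℂ) (N : ℕ) : ∀ J : Finset (Fin n),
      partialIntegral ψ ϖ v e s J (-N) n =
        ∑ p ∈ configs J (-N) n, configTerm ψ ϖ v e s J p := by
  induction N with
  | zero =>
    intro J
    rw [Nat.cast_zero, neg_zero, partialIntegral_integral, configs_zero_left]
    split_ifs with h
    · subst h; rw [Finset.sum_singleton, configTerm_empty]
    · rw [Finset.sum_empty]
  | succ N ih =>
    set L : ℤ := -((N + 1 : ℕ) : ℤ) with hL
    have hL1 : L ≤ -1 := by omega
    have hLN : L + 1 = -(N : ℤ) := by omega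
    have key : ∀ m : ℕ, m ≤ n → ∀ J : Finset (Fin n), partialIntegral ψ ϖ v e s J L m =
        ∑ p ∈ configs J L m, configTerm ψ ϖ v e s J p := by
      intro m
      induction m with
      | zero =>
        intro _ J
        rw [partialIntegral_zero, configs_zero_right, hLN, ih]
      | succ m ihm =>
        intro hmn J
        have ihm' := ihm (by omega)
        by_cases hmJ : (⟨m, by omega⟩ : Fin n) ∈ J
        · have h1 := partialIntegral_succ hq hψc hψ hϖ hv e s hmJ hL1
          have h2 := sum_configs_succ (configTerm ψ ϖ v e s J) hmJ hL1
          simp only at h1 h2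
          rw [h1, h2, ihm']
          congr 1
          have hfil : J.filter (· ≤ (⟨m, by omega⟩ : Fin n)) =
              insert ⟨m, by omega⟩ (J.filter (· < (⟨m, by omega⟩ : Fin n))) := by
            ext j
            simp only [Finset.mem_filter, Finset.mem_insert, le_iff_lt_or_eq]
            constructor
            · rintro ⟨h, h' | h'⟩
              exacts [.inr ⟨h, h'⟩, .inl h']
            · rintro (rfl | h)
              exacts [⟨hmJ, .inr rfl⟩, ⟨h.1, .inl h.2⟩]
          rw [hfil, Finset.sum_insert (by simp)]
          congr 1
          · rw [Finset.erase_idem, ihm', Finset.mul_sum]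
            exact Finset.sum_congr rfl fun p hp =>
              (configTerm_insertPivot_diag ψ ϖ v e s hmJ hp).symm
          · refine Finset.sum_congr rfl fun j hj => ?_
            rw [ihm', Finset.mul_sum]
            exact Finset.sum_congr rfl fun p hp => (configTerm_insertPivot_pair ψ ϖ v e s hmJ
              (Finset.mem_filter.mp hj).1 (Finset.mem_filter.mp hj).2 hp).symm
        · have h1 := partialIntegral_succ_of_notMem ψ ϖ v e s hmJ L
          have h2 := configs_succ_of_notMem hmJ L
          simp only at h1 h2
          rw [h1, h2, ihm']
    exact key n le_rfl

end Terms

/-! ### Partial sums of the tuples `ν`. -/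

section PartialSums

variable {r : ℕ}

theorem partialSum_zero (ν : Fin (r + 1) → ℤ) : partialSum ν 0 = ν 0 := by
  have hf : Finset.univ.filter (fun m : Fin (r + 1) => m ≤ 0) = {0} := by
    ext m; simp
  rw [partialSum, hf, Finset.sum_singleton]

theorem partialSum_succ (ν : Fin (r + 1) → ℤ) (l : Fin r) :
    partialSum ν l.succ = ν l.succ + partialSum ν l.castSucc := by
  have hf : Finset.univ.filter (fun m : Fin (r + 1) => m ≤ l.succ) =
      insert l.succ (Finset.univ.filter (fun m : Fin (r + 1) => m ≤ l.castSucc)) := by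
    ext m
    simp only [Finset.mem_filter, Finset.mem_univ, true_and, Finset.mem_insert, Fin.le_def,
      Fin.ext_iff, Fin.val_succ, Fin.val_castSucc]
    omega
  have hn : l.succ ∉ Finset.univ.filter (fun m : Fin (r + 1) => m ≤ l.castSucc) := by
    simp [Fin.le_def]
  rw [partialSum, hf, Finset.sum_insert hn, partialSum]

theorem partialSum_injective : Function.Injective (partialSum (r := r)) := by
  intro ν μ h
  funext l
  induction l using Fin.induction with
  | zero =>
    have h0 := congrFun h 0
    rwa [partialSum_zero, partialSum_zero] at h0
  | succ l _ =>
    have h1 := partialSum_succ ν l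
    have h2 := partialSum_succ μ l
    rw [h] at h1
    linarith

theorem partialSum_surjective : Function.Surjective (partialSum (r := r)) := by
  intro a
  refine ⟨Fin.cases (a 0) fun l => a l.succ - a l.castSucc, ?_⟩
  funext l
  induction l using Fin.induction with
  | zero => rw [partialSum_zero]; rfl
  | succ l ih => rw [partialSum_succ, ih, Fin.cases_succ]; ring

theorem partialSum_strictMono {ν : Fin (r + 1) → ℤ} (h : ∀ l, l ≠ 0 → 0 < ν l) :
    StrictMono (partialSum ν) := by
  intro l l' hl
  have h0 : ∀ m, l < m → 0 < ν m := fun m hm => h m (Fin.ne_zero_of_lt hm)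
  refine Finset.sum_lt_sum_of_subset (i := l') ?_ (by simp) (by simp [hl]) (h0 l' hl) ?_
  · intro m hm
    rw [Finset.mem_filter] at hm ⊢
    exact ⟨hm.1, hm.2.trans hl.le⟩
  · intro m _ hm
    simp only [Finset.mem_filter, Finset.mem_univ, true_and, not_le] at hm
    exact (h0 m hm).le

theorem pos_of_partialSum_strictMono {ν : Fin (r + 1) → ℤ} (h : StrictMono (partialSum ν))
    (l : Fin (r + 1)) (hl : l ≠ 0) : 0 < ν l := by
  obtain ⟨k, rfl⟩ := Fin.exists_succ_eq.mpr hl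
  have h1 := h (Fin.castSucc_lt_succ (i := k))
  rw [partialSum_succ] at h1
  linarith

end PartialSums

/-! ### The statistics of the formula as sums over pairs of indices. -/

section Levels

variable {n r : ℕ}

theorem mem_bMin_set (σ : Equiv.Perm (Fin n)) (e : Fin n → ℕ) (J : Finset (Fin n)) (m : ℕ) :
    m ∈ ({m | ∃ i ∈ J, i < σ i ∧ m = e i} ∪ {m | ∃ i ∈ J, σ i ≤ i ∧ m = e i + 1} : Set ℕ) ↔
      ∃ i ∈ J, (m : ℤ) = levelBound σ e i := by
  simp only [Set.mem_union, Set.mem_ofPred_eq, levelBound]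
  constructor
  · rintro (⟨i, hi, h, rfl⟩ | ⟨i, hi, h, rfl⟩)
    · exact ⟨i, hi, by rw [if_pos h]⟩
    · exact ⟨i, hi, by rw [if_neg (not_lt.mpr h)]; push_cast; rfl⟩
  · rintro ⟨i, hi, h⟩
    by_cases hs : i < σ i
    · rw [if_pos hs] at h
      exact .inl ⟨i, hi, hs, by exact_mod_cast h⟩
    · rw [if_neg hs] at h
      exact .inr ⟨i, hi, not_lt.mp hs, by exact_mod_cast h⟩

theorem neg_bMin_le_iff (σ : Equiv.Perm (Fin n)) (e : Fin n → ℕ) {J : Finset (Fin n)}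
    (hJ : J.Nonempty) (x : ℤ) : -(bMin σ e J : ℤ) ≤ x ↔ ∀ i ∈ J, 0 ≤ levelBound σ e i + x := by
  have hnat : ∀ i, ∃ m : ℕ, (m : ℤ) = levelBound σ e i := fun i => by
    unfold levelBound
    split_ifs
    · exact ⟨e i, rfl⟩
    · exact ⟨e i + 1, by push_cast; rfl⟩
  constructor
  · intro h i hi
    obtain ⟨m, hm⟩ := hnat i
    have := Nat.sInf_le ((mem_bMin_set σ e J m).mpr ⟨i, hi, hm⟩)
    rw [← hm]
    unfold bMin at h
    omega
  · intro h
    obtain ⟨i, hi⟩ := hJ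
    obtain ⟨m, hm⟩ := hnat i
    -- A block is non-empty, so its minimum is attained; the default value of `sInf` on the empty
    -- set does not occur.
    have hne : ({m | ∃ i ∈ J, i < σ i ∧ m = e i} ∪ {m | ∃ i ∈ J, σ i ≤ i ∧ m = e i + 1} :
        Set ℕ).Nonempty := ⟨m, (mem_bMin_set σ e J m).mpr ⟨i, hi, hm⟩⟩
    obtain ⟨k, hk, hk'⟩ := (mem_bMin_set σ e J _).mp (Nat.sInf_mem hne)
    have := h k hk
    rw [← hk'] at this
    unfold bMin
    omega

/-- The function on `{1, …, n}` with the value `ν_0 + ⋯ + ν_l` on `I_l`. -/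
def levelFn (I : Fin (r + 1) → Finset (Fin n)) (ν : Fin (r + 1) → ℤ) (i : Fin n) : ℤ :=
  ∑ l, if i ∈ I l then partialSum ν l else 0

theorem IsStablePartition.exists_index {σ : Equiv.Perm (Fin n)} {I : Fin (r + 1) → Finset (Fin n)}
    (h : IsStablePartition σ I) : ∃ f : Fin n → Fin (r + 1), Function.Surjective f ∧
      (∀ i l, i ∈ I l ↔ f i = l) ∧ ∀ i, f (σ i) = f i := by
  obtain ⟨h1, h2, h3, h4⟩ := h
  choose f hf using h3
  have hiff : ∀ i l, i ∈ I l ↔ f i = l := by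
    refine fun i l => ⟨fun hi => ?_, fun hi => hi ▸ hf i⟩
    by_contra hne
    exact Finset.disjoint_left.mp (h2 _ _ hne) (hf i) hi
  refine ⟨f, fun l => ?_, hiff, fun i => (hiff _ _).mp (h4 _ i (hf i))⟩
  obtain ⟨i, hi⟩ := h1 l
  exact ⟨i, (hiff i l).mp hi⟩

section Index

variable {I : Fin (r + 1) → Finset (Fin n)} {f : Fin n → Fin (r + 1)} (hf : ∀ i l, i ∈ I l ↔ f i = l)

include hf

theorem levelFn_eq (ν : Fin (r + 1) → ℤ) (i : Fin n) : levelFn I ν i = partialSum ν (f i) := by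
  simp only [levelFn, hf]
  simp

theorem block_eq (l : Fin (r + 1)) : I l = Finset.univ.filter fun i => f i = l := by
  ext i; simp [hf]

theorem nUpper_eq (l : Fin (r + 1)) : (nUpper I l : ℤ) = ∑ i, if l ≤ f i then 1 else 0 := by
  simp only [nUpper, block_eq hf, Finset.card_filter]
  rw [Finset.sum_comm]
  push_cast
  refine Finset.sum_congr rfl fun i _ => ?_
  rw [Finset.sum_ite_eq]
  simp

/-- Summation by parts: an index `i` in the block `f i` is counted by `ν_l` for all `l ≤ f i`, in
total by the partial sum up to its own block. -/
theorem sum_mul_nUpper (ν : Fin (r + 1) → ℤ) :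
    ∑ l, ν l * nUpper I l = ∑ i, levelFn I ν i := by
  simp only [nUpper_eq hf, levelFn_eq hf, partialSum, Finset.mul_sum]
  rw [Finset.sum_comm]
  refine Finset.sum_congr rfl fun i _ => ?_
  rw [Finset.sum_filter]
  simp

/-- A pair is counted by `ν_l` for all `l` up to the smaller of its two blocks. Since the partial
sums increase, that total is the smaller of the two levels. -/
theorem sum_mul_nUpper_sq {ν : Fin (r + 1) → ℤ} (hν : StrictMono (partialSum ν)) :
    ∑ l, ν l * (nUpper I l * nUpper I l) = ∑ i, ∑ k, min (levelFn I ν i) (levelFn I ν k) := by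
  have h : ∀ i k, min (levelFn I ν i) (levelFn I ν k) =
      ∑ l, ν l * ((if l ≤ f i then 1 else 0) * if l ≤ f k then 1 else 0) := fun i k => by
    rw [levelFn_eq hf, levelFn_eq hf, ← hν.monotone.map_min, partialSum, Finset.sum_filter]
    refine Finset.sum_congr rfl fun l _ => ?_
    by_cases h1 : l ≤ f i <;> by_cases h2 : l ≤ f k <;> simp [h1, h2]
  calc ∑ l, ν l * ((nUpper I l : ℤ) * nUpper I l)
      = ∑ l, ∑ i, ∑ k, ν l * ((if l ≤ f i then 1 else 0) * if l ≤ f k then 1 else 0) := by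
        refine Finset.sum_congr rfl fun l _ => ?_
        rw [nUpper_eq hf, Finset.sum_mul_sum, Finset.mul_sum]
        exact Finset.sum_congr rfl fun i _ => Finset.mul_sum ..
    _ = ∑ i, ∑ k, ∑ l, ν l * ((if l ≤ f i then 1 else 0) * if l ≤ f k then 1 else 0) := by
        rw [Finset.sum_comm]
        exact Finset.sum_congr rfl fun i _ => Finset.sum_comm
    _ = _ := by simp only [h]

theorem tau_eq {ν : Fin (r + 1) → ℤ} (hν : StrictMono (partialSum ν)) :
    (tau I : ℤ) = ∑ i, ∑ k, if levelFn I ν k < levelFn I ν i ∧ k < i then 1 else 0 := by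
  simp only [tau, Finset.card_filter, hf, levelFn_eq hf, hν.lt_iff_lt]
  push_cast
  rw [Finset.sum_comm, ← Finset.univ_product_univ, Finset.sum_product]
  refine Finset.sum_congr rfl fun i _ => Finset.sum_congr rfl fun k _ => ?_
  rw [Finset.sum_eq_single (f i)]
  · simp
  · intro l _ hl
    rw [if_neg fun h => hl h.1.symm]
  · simp

theorem tInv_eq (σ : Equiv.Perm (Fin n)) {ν : Fin (r + 1) → ℤ} (hν : StrictMono (partialSum ν)) :
    (tInv σ I : ℤ) = ∑ i, ∑ k,
      if levelFn I ν i = levelFn I ν k ∧ i < k ∧ k < σ i ∧ σ k < σ i then 1 else 0 := by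
  simp only [tInv, Finset.card_filter, hf, levelFn_eq hf, hν.injective.eq_iff]
  push_cast
  rw [Finset.sum_comm, ← Finset.univ_product_univ, Finset.sum_product]
  refine Finset.sum_congr rfl fun i _ => Finset.sum_congr rfl fun k _ => ?_
  rw [Finset.sum_eq_single (f i)]
  · simp [eq_comm]
  · intro l _ hl
    rw [if_neg fun h => hl h.1.symm]
  · simp

theorem sum_rho (σ : Equiv.Perm (Fin n)) (e : Fin n → ℕ) (ν : Fin (r + 1) → ℤ) :
    ∑ l, rhoTilde σ e (I l) (partialSum ν l) =
      (1 / 2) * ((∑ i, ∑ k, min ((e k : ℤ) + eSig σ i k + levelFn I ν i) 0 : ℤ) : ℂ) := by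
  simp only [rhoTilde, ← Finset.mul_sum, ← Int.cast_sum, levelFn_eq hf, block_eq hf]
  congr 2
  rw [← Finset.sum_fiberwise (s := Finset.univ) (g := f)]
  refine Finset.sum_congr rfl fun l _ => Finset.sum_congr rfl fun i hi => ?_
  rw [(Finset.mem_filter.mp hi).2]

theorem sum_pairTerm (σ : Equiv.Perm (Fin n)) (e : Fin n → ℕ) {ν : Fin (r + 1) → ℤ}
    (hν : StrictMono (partialSum ν)) :
    ∑ i, ∑ k, pairTerm e (σ, levelFn I ν) i k =
      ∑ i, levelFn I ν i - ∑ i, ∑ k, min (levelFn I ν i) (levelFn I ν k) - 2 * tau I -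
        2 * tInv σ I + ∑ i, ∑ k, min ((e k : ℤ) + eSig σ i k + levelFn I ν i) 0 := by
  rw [tau_eq hf hν, tInv_eq hf σ hν]
  have h : ∀ i k : Fin n, (if i = k then 0 else -min (levelFn I ν i) (levelFn I ν k)) =
      (if i = k then levelFn I ν i else 0) - min (levelFn I ν i) (levelFn I ν k) := by
    intro i k
    by_cases hik : i = k
    · subst hik; simp
    · simp [hik]
  simp only [pairTerm, h, Finset.sum_add_distrib, Finset.sum_sub_distrib, Finset.mul_sum,
    Finset.sum_ite_eq, Finset.mem_univ, if_true]

end Index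

end Levels

/-! ### The explicit formula as a sum over configurations. -/

section Formula

variable {F : Type*} [Field F] [ValuativeRel F] [TopologicalSpace F]
  [IsNonarchimedeanLocalField F] [MeasurableSpace F] [BorelSpace F] {n r : ℕ}

theorem prod_zpow_eq {α : Type*} (t : Finset α) {a : ℂ} (ha : a ≠ 0) (f : α → ℤ) :
    ∏ k ∈ t, a ^ f k = a ^ ∑ k ∈ t, f k := by
  classical
  induction t using Finset.induction_on with
  | empty => simp
  | insert x t hx ih => rw [Finset.prod_insert hx, Finset.sum_insert hx, zpow_add₀ ha, ih]

/-- The contribution of a configuration, without the condition of admissibility. -/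
def fullTerm (ψ : AddChar F Circle) (ϖ : F) (v : Fin n → F) (e : Fin n → ℕ) (s : ℂ)
    (σ : Equiv.Perm (Fin n)) (lam : Fin n → ℤ) : ℂ :=
  weilConstant ψ ϖ ^ n * ((1 - (resCard F : ℂ)⁻¹) * (resCard F : ℂ)⁻¹) ^ c2 σ *
    chi ϖ (-1) ^ (∑ i, lam i) *
    (resCard F : ℂ) ^ ((s - 1) * ((∑ i, lam i : ℤ) : ℂ) +
      ((∑ i, ∑ k, pairTerm e (σ, lam) i k : ℤ) : ℂ) / 2) *
    ∏ i with σ i = i, xi ϖ v e i (lam i)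

/-- Summing `½ ν n (2s - 1 - n)` over the blocks gives `(s - ½) ∑ λ_i - ½ ∑ min(λ_i, λ_k)`. The pair
terms leave out the diagonal of the second sum, which accounts for the shift from `s - ½` to `s -
1`. -/
theorem term_eq (ψ : AddChar F Circle) (ϖ : F) (v : Fin n → F) (e : Fin n → ℕ) (s : ℂ)
    {σ : Equiv.Perm (Fin n)} {I : Fin (r + 1) → Finset (Fin n)} (hI : IsStablePartition σ I)
    {ν : Fin (r + 1) → ℤ} (hν : StrictMono (partialSum ν)) :
    weilConstant ψ ϖ ^ n * ((1 - (resCard F : ℂ)⁻¹) ^ c2 σ *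
      ((resCard F : ℂ) ^ (-(c2 σ : ℤ) - tau I - tInv σ I) *
        ∏ l, (chi ϖ (-1) ^ (ν l * nUpper I l) *
          (resCard F : ℂ) ^ ((1 / 2) * (ν l : ℂ) * nUpper I l * (2 * s - 1 - nUpper I l) +
            rhoTilde σ e (I l) (partialSum ν l)) *
          ∏ i ∈ I l with σ i = i, xi ϖ v e i (partialSum ν l)))) =
      fullTerm ψ ϖ v e s σ (levelFn I ν) := by
  obtain ⟨f, hfs, hf, hfσ⟩ := hI.exists_index
  rw [Finset.prod_mul_distrib, Finset.prod_mul_distrib, prod_zpow_eq _ (chi_ne_zero _ _),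
    sum_mul_nUpper hf, prod_resCard_cpow, Finset.sum_add_distrib, sum_rho hf, fullTerm]
  have hxi : ∏ l, ∏ i ∈ I l with σ i = i, xi ϖ v e i (partialSum ν l) =
      ∏ i with σ i = i, xi ϖ v e i (levelFn I ν i) := by
    rw [← Finset.prod_fiberwise (s := Finset.univ.filter fun i => σ i = i) (g := f)]
    refine Finset.prod_congr rfl fun l _ => ?_
    have hset : (I l).filter (fun i => σ i = i) =
        (Finset.univ.filter fun i => σ i = i).filter fun i => f i = l := by
      ext i; simp [hf, and_comm]
    rw [hset]
    refine Finset.prod_congr rfl fun i hi => ?_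
    rw [levelFn_eq hf, (Finset.mem_filter.mp hi).2]
  have hq0 := resCard_ne_zero F
  have hsum : ∑ l, (1 / 2) * (ν l : ℂ) * nUpper I l * (2 * s - 1 - nUpper I l) =
      (s - 1 / 2) * ((∑ i, levelFn I ν i : ℤ) : ℂ) -
        ((∑ i, ∑ k, min (levelFn I ν i) (levelFn I ν k) : ℤ) : ℂ) / 2 := by
    rw [← sum_mul_nUpper hf, ← sum_mul_nUpper_sq hf hν]
    push_cast
    rw [Finset.mul_sum, Finset.sum_div, ← Finset.sum_sub_distrib]
    refine Finset.sum_congr rfl fun l _ => ?_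
    ring
  rw [hxi, hsum, sum_pairTerm hf σ e hν, mul_pow, inv_pow]
  have hexp : (resCard F : ℂ) ^ (-(c2 σ : ℤ) - tau I - tInv σ I) *
      (resCard F : ℂ) ^ ((s - 1 / 2) * ((∑ i, levelFn I ν i : ℤ) : ℂ) -
        ((∑ i, ∑ k, min (levelFn I ν i) (levelFn I ν k) : ℤ) : ℂ) / 2 +
        (1 / 2) * ((∑ i, ∑ k, min ((e k : ℤ) + eSig σ i k + levelFn I ν i) 0 : ℤ) : ℂ)) =
      ((resCard F : ℂ) ^ c2 σ)⁻¹ * (resCard F : ℂ) ^ ((s - 1) * ((∑ i, levelFn I ν i : ℤ) : ℂ) +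
        ((∑ i, levelFn I ν i - ∑ i, ∑ k, min (levelFn I ν i) (levelFn I ν k) - 2 * tau I -
        2 * tInv σ I + ∑ i, ∑ k, min ((e k : ℤ) + eSig σ i k + levelFn I ν i) 0 : ℤ) : ℂ) / 2) := by
    rw [← zpow_natCast, ← zpow_neg, ← Complex.cpow_intCast, ← Complex.cpow_intCast,
      ← resCard_cpow_add, ← resCard_cpow_add]
    generalize (∑ i, ∑ k, min (levelFn I ν i) (levelFn I ν k)) = B
    generalize (∑ i, ∑ k, min ((e k : ℤ) + eSig σ i k + levelFn I ν i) 0) = R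
    generalize (∑ i, levelFn I ν i) = A
    congr 1
    push_cast
    ring
  linear_combination weilConstant ψ ϖ ^ n * (1 - (resCard F : ℂ)⁻¹) ^ c2 σ *
    chi ϖ (-1) ^ (∑ i, levelFn I ν i) * (∏ i with σ i = i, xi ϖ v e i (levelFn I ν i)) * hexp

/-- The admissible `σ`-invariant functions with values between `-N` and `-1`. -/
def levelSet (e : Fin n → ℕ) (N : ℕ) (σ : Equiv.Perm (Fin n)) : Finset (Fin n → ℤ) :=
  (Fintype.piFinset fun _ => Finset.Icc (-(N : ℤ)) (-1)).filter fun lam =>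
    (∀ i, lam (σ i) = lam i) ∧ ∀ i, 0 ≤ levelBound σ e i + lam i

theorem mem_levelSet {e : Fin n → ℕ} {N : ℕ} {σ : Equiv.Perm (Fin n)} {lam : Fin n → ℤ} :
    lam ∈ levelSet e N σ ↔ (∀ i, -(N : ℤ) ≤ lam i ∧ lam i ≤ -1) ∧ (∀ i, lam (σ i) = lam i) ∧
      ∀ i, 0 ≤ levelBound σ e i + lam i := by
  simp [levelSet, Fintype.mem_piFinset]

theorem sum_configs_univ (ψ : AddChar F Circle) (ϖ : F) (v : Fin n → F) (e : Fin n → ℕ) (s : ℂ)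
    (N : ℕ) : ∑ p ∈ configs Finset.univ (-(N : ℤ)) n, configTerm ψ ϖ v e s Finset.univ p =
      ∑ σ : Equiv.Perm (Fin n) with σ ^ 2 = 1, ∑ lam ∈ levelSet e N σ,
        fullTerm ψ ϖ v e s σ lam := by
  have h1 : configs (Finset.univ : Finset (Fin n)) (-(N : ℤ)) n =
      ((Finset.univ.filter fun σ : Equiv.Perm (Fin n) => σ ^ 2 = 1) ×ˢ
        Fintype.piFinset fun _ => Finset.Icc (-(N : ℤ)) (-1)).filter
        fun p => ∀ i, p.2 (p.1 i) = p.2 i := by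
    ext p
    rw [mem_configs]
    simp only [Finset.mem_univ, true_implies, not_true_eq_false, false_implies, implies_true,
      true_and, Finset.mem_filter, Finset.mem_product, Fintype.mem_piFinset, Finset.mem_Icc,
      Fin.is_lt, and_true, and_self]
    have : p.1 ^ 2 = 1 ↔ ∀ i, p.1 (p.1 i) = i := by
      rw [Equiv.ext_iff]; simp [sq]
    rw [this]
    tauto
  rw [h1, Finset.sum_filter, Finset.sum_product]
  refine Finset.sum_congr rfl fun σ _ => ?_
  rw [levelSet, Finset.sum_filter]
  refine Finset.sum_congr rfl fun lam _ => ?_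
  by_cases h2 : ∀ i, lam (σ i) = lam i
  · rw [if_pos h2, configTerm]
    by_cases h3 : ∀ i, 0 ≤ levelBound σ e i + lam i
    · rw [if_pos fun i _ => h3 i, if_pos ⟨h2, h3⟩, fullTerm]
      simp only [Finset.inter_univ, Finset.card_univ, Fintype.card_fin]
      rfl
    · rw [if_neg fun h => h3 fun i => h i (Finset.mem_univ i), if_neg fun h => h3 h.2]
  · rw [if_neg h2, if_neg fun h => h2 h.1]

open Classical in
-- The blocks are the level sets of `λ` in increasing order of the levels, and `ν` lists the
-- successive differences. The bound `N` excludes nothing, as admissibility already forces `λ_i ≥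
-- -(e_i + 1)`; the bounds by `b_l` express admissibility on each block.
theorem sum_partitions (e : Fin n → ℕ) (σ : Equiv.Perm (Fin n)) {N : ℕ} (hN : ∀ i, e i + 1 ≤ N)
    (r : ℕ) (g : (Fin n → ℤ) → ℂ) :
    ∑ I : Fin (r + 1) → Finset (Fin n) with IsStablePartition σ I,
      ∑ ν ∈ (nuSet_finite σ e I).toFinset, g (levelFn I ν) =
    ∑ lam ∈ levelSet e N σ with (Finset.univ.image lam).card = r + 1, g lam := by
  rw [Finset.sum_sigma']
  refine Finset.sum_bij (fun p _ => levelFn p.1 p.2) ?_ ?_ ?_ ?_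
  · rintro ⟨I, ν⟩ hp
    simp only [Finset.mem_sigma, Finset.mem_filter, Finset.mem_univ, true_and,
      Set.Finite.mem_toFinset] at hp
    obtain ⟨hI, hν, hb⟩ := hp
    obtain ⟨f, hfs, hf, hfσ⟩ := hI.exists_index
    have hmono := partialSum_strictMono hν
    have hbound : ∀ i, 0 ≤ levelBound σ e i + levelFn I ν i := fun i => by
      rw [levelFn_eq hf]
      exact (neg_bMin_le_iff σ e (hI.1 _) _).mp (hb (f i)).1 i ((hf i _).mpr rfl)
    rw [Finset.mem_filter, mem_levelSet]
    refine ⟨⟨fun i => ⟨?_, ?_⟩, fun i => ?_, hbound⟩, ?_⟩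
    · have h1 := hbound i
      have h2 := hN i
      have h3 : levelBound σ e i ≤ e i + 1 := by unfold levelBound; split_ifs <;> omega
      change -(N : ℤ) ≤ levelFn I ν i
      omega
    · change levelFn I ν i ≤ -1
      rw [levelFn_eq hf]; exact (hb _).2
    · change levelFn I ν (σ i) = levelFn I ν i
      rw [levelFn_eq hf, levelFn_eq hf, hfσ]
    · have himg : Finset.univ.image (levelFn I ν) = Finset.univ.image (partialSum ν) := by
        ext x
        simp only [Finset.mem_image, Finset.mem_univ, true_and, levelFn_eq hf]
        exact ⟨fun ⟨i, hi⟩ => ⟨_, hi⟩, fun ⟨l, hl⟩ => by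
          obtain ⟨i, rfl⟩ := hfs l; exact ⟨i, hl⟩⟩
      change (Finset.univ.image (levelFn I ν)).card = r + 1
      rw [himg, Finset.card_image_of_injective _ hmono.injective]; simp
  · rintro ⟨I, ν⟩ hp ⟨I', ν'⟩ hp' heq
    simp only [Finset.mem_sigma, Finset.mem_filter, Finset.mem_univ, true_and,
      Set.Finite.mem_toFinset] at hp hp' heq
    obtain ⟨f, hfs, hf, -⟩ := hp.1.exists_index
    obtain ⟨f', hfs', hf', -⟩ := hp'.1.exists_index
    have hm := partialSum_strictMono hp.2.1
    have hm' := partialSum_strictMono hp'.2.1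
    have hrange : Set.range (partialSum ν) = Set.range (partialSum ν') := by
      rw [← hfs.range_comp, ← hfs'.range_comp]
      congr 1
      funext i
      have := congrFun heq i
      rwa [levelFn_eq hf, levelFn_eq hf'] at this
    have hsum := (hm.range_inj hm').mp hrange
    obtain rfl := partialSum_injective hsum
    have hII : I = I' := by
      funext l
      ext i
      rw [hf, hf']
      have := congrFun heq i
      rw [levelFn_eq hf, levelFn_eq hf'] at this
      rw [hm.injective this]
    subst hII
    rfl
  · intro lam hlam
    obtain ⟨hmem, hcard⟩ := Finset.mem_filter.mp hlam
    obtain ⟨h1, h2, h3⟩ := mem_levelSet.mp hmem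
    set a := (Finset.univ.image lam).orderEmbOfFin hcard with ha
    obtain ⟨ν, hν⟩ := partialSum_surjective a
    have hmono : StrictMono (partialSum ν) := by rw [hν]; exact a.strictMono
    have hex : ∀ i, ∃ l, a l = lam i := fun i => by
      have : lam i ∈ Set.range a := by
        rw [ha, Finset.range_orderEmbOfFin]; simp
      exact this
    have hex' : ∀ l, ∃ i, lam i = a l := fun l => by
      obtain ⟨i, _, hi⟩ := Finset.mem_image.mp
        (Finset.orderEmbOfFin_mem (Finset.univ.image lam) hcard l)
      exact ⟨i, hi⟩
    choose f hf using hex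
    set I : Fin (r + 1) → Finset (Fin n) := fun l => Finset.univ.filter fun i => f i = l with hI
    have hfI : ∀ i l, i ∈ I l ↔ f i = l := fun i l => by simp [hI]
    have hlev : levelFn I ν = lam := by
      funext i
      rw [levelFn_eq hfI, hν, hf]
    have hpart : IsStablePartition σ I := by
      refine ⟨fun l => ?_, fun l m hlm => ?_, fun i => ⟨f i, (hfI _ _).mpr rfl⟩, fun l i hi => ?_⟩
      · obtain ⟨i, hi⟩ := hex' l
        exact ⟨i, (hfI _ _).mpr (a.injective ((hf i).trans hi))⟩
      · rw [Finset.disjoint_left]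
        intro i hi hi'
        exact hlm (((hfI _ _).mp hi).symm.trans ((hfI _ _).mp hi'))
      · rw [hfI] at hi ⊢
        rw [← hi]
        exact a.injective (by rw [hf, hf, h2])
    refine ⟨⟨I, ν⟩, ?_, hlev⟩
    simp only [Finset.mem_sigma, Finset.mem_filter, Finset.mem_univ, true_and,
      Set.Finite.mem_toFinset]
    refine ⟨hpart, pos_of_partialSum_strictMono hmono, fun l => ?_⟩
    rw [hν, neg_bMin_le_iff σ e (hpart.1 l)]
    obtain ⟨i, hi⟩ := hex' l
    refine ⟨fun k hk => ?_, hi ▸ (h1 i).2⟩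
    rw [hfI] at hk
    rw [← hk, hf]
    exact h3 k
  · rintro ⟨I, ν⟩ _; rfl

theorem explicitFormula_eq (hn : 1 ≤ n) (ψ : AddChar F Circle) (ϖ : F) (v : Fin n → F)
    (e : Fin n → ℕ) (s : ℂ) {N : ℕ} (hN : ∀ i, e i + 1 ≤ N) :
    explicitFormula ψ ϖ v e s =
      ∑ p ∈ configs Finset.univ (-(N : ℤ)) n, configTerm ψ ϖ v e s Finset.univ p := by
  classical
  rw [sum_configs_univ, explicitFormula, Finset.mul_sum]
  refine Finset.sum_congr (by ext; simp) fun σ _ => ?_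
  have hfib : ∑ lam ∈ levelSet e N σ, fullTerm ψ ϖ v e s σ lam =
      ∑ r ∈ Finset.range n, ∑ lam ∈ levelSet e N σ with (Finset.univ.image lam).card = r + 1,
        fullTerm ψ ϖ v e s σ lam := by
    -- Level functions are sorted by their number of values, which is `r + 1`. It is positive
    -- because there is at least one index.
    rw [← Finset.sum_fiberwise_of_maps_to (t := Finset.range n)
      (g := fun lam => (Finset.univ.image lam).card - 1)]
    · refine Finset.sum_congr rfl fun r _ => Finset.sum_congr ?_ fun _ _ => rfl
      ext lam
      simp only [Finset.mem_filter, and_congr_right_iff]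
      intro _
      have : 0 < (Finset.univ.image lam).card :=
        Finset.card_pos.mpr ⟨lam ⟨0, hn⟩, Finset.mem_image_of_mem _ (Finset.mem_univ _)⟩
      omega
    · intro lam _
      have h1 : (Finset.univ.image lam).card ≤ n := by
        simpa using Finset.card_image_le (s := Finset.univ) (f := lam)
      rw [Finset.mem_range]
      omega
  rw [hfib, Finset.mul_sum, Finset.mul_sum]
  refine Finset.sum_congr rfl fun r _ => ?_
  rw [← sum_partitions e σ hN r, Finset.mul_sum, Finset.mul_sum]
  refine Finset.sum_congr (by ext; simp) fun I hI => ?_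
  rw [Finset.mul_sum, Finset.mul_sum, Finset.mul_sum]
  refine Finset.sum_congr rfl fun ν hν => ?_
  exact term_eq ψ ϖ v e s (Finset.mem_filter.mp hI).2
    (partialSum_strictMono ((Set.Finite.mem_toFinset _).mp hν).1)

end Formula

/-! ### Absolute convergence and the value of the full integral. -/

section Convergence

variable {F : Type*} [Field F] [ValuativeRel F] [TopologicalSpace F]
  [IsNonarchimedeanLocalField F] [MeasurableSpace F] [BorelSpace F] {n : ℕ}

theorem weightBound_neg (s : ℂ) (N : ℕ) :
    weightBound F n s (-(N : ℤ)) =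
      ENNReal.ofReal (((resCard F : ℝ) ^ (-(s.re - n))) ^ N) := by
  rw [weightBound, ← Real.rpow_natCast, ← Real.rpow_mul (Nat.cast_nonneg _)]
  congr 2
  push_cast
  ring

/-- With `t = q^{-(Re s - n)}`, admitting one more index at level `-(N + 1)` multiplies a common
bound for all `J` by at most `1 + (n + 1) t^{N+1}`, hence by at most the exponential of `(n + 1)
t^{N+1}`; there are `n` such steps at each level. -/
theorem partialLIntegral_le (hq : Odd (resCard F)) {ψ : AddChar F Circle} (hψc : Continuous ψ)
    {ϖ : F} (hϖ : ϖ ∈ shell F 1) {s : ℂ} (hs : (n : ℝ) ≤ s.re) (N : ℕ) :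
    ∀ J : Finset (Fin n), partialLIntegral ϖ s J (-(N : ℤ)) n ≤
      ENNReal.ofReal (Real.exp ((n + 1) * (n * ∑ k ∈ Finset.range N,
        ((resCard F : ℝ) ^ (-(s.re - n))) ^ (k + 1)))) := by
  set t : ℝ := (resCard F : ℝ) ^ (-(s.re - n)) with ht
  have ht0 : 0 ≤ t := Real.rpow_nonneg (Nat.cast_nonneg _) _
  induction N with
  | zero =>
    intro J
    simpa using partialLIntegral_integral ϖ s J n
  | succ N ih =>
    set L : ℤ := -((N + 1 : ℕ) : ℤ) with hL
    have hL1 : L ≤ -1 := by omega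
    have hLN : L + 1 = -(N : ℤ) := by omega
    set S : ℝ := ∑ k ∈ Finset.range N, t ^ (k + 1) with hS
    have key : ∀ m : ℕ, m ≤ n → ∀ J : Finset (Fin n), partialLIntegral ϖ s J L m ≤
        ENNReal.ofReal (Real.exp ((n + 1) * (n * S + m * t ^ (N + 1)))) := by
      intro m
      induction m with
      | zero =>
        intro _ J
        rw [partialLIntegral_zero, hLN]
        simpa using ih J
      | succ m ihm =>
        intro hmn J
        have ihm' := ihm (by omega)
        set A := ENNReal.ofReal (Real.exp ((n + 1) * (n * S + m * t ^ (N + 1)))) with hA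
        -- The factor collects at most one term without pivot, one with a diagonal pivot and `n`
        -- with an off-diagonal pivot.
        have hAA : A * (1 + (n + 1) * weightBound F n s L) ≤ ENNReal.ofReal
            (Real.exp ((n + 1) * (n * S + (m + 1 : ℕ) * t ^ (N + 1)))) := by
          have h0 : (0 : ℝ) ≤ (n + 1) * t ^ (N + 1) := by positivity
          have e1 : 1 + ((n : ENNReal) + 1) * weightBound F n s L =
              ENNReal.ofReal (1 + (n + 1) * t ^ (N + 1)) := by
            rw [hL, weightBound_neg, ENNReal.ofReal_add zero_le_one h0,
              ENNReal.ofReal_mul (by positivity), ENNReal.ofReal_one,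
              ENNReal.ofReal_add (by positivity) zero_le_one, ENNReal.ofReal_one,
              ENNReal.ofReal_natCast]
          rw [e1, hA, ← ENNReal.ofReal_mul (Real.exp_pos _).le]
          refine ENNReal.ofReal_le_ofReal ?_
          have h2 := Real.add_one_le_exp ((n + 1) * t ^ (N + 1))
          calc _ ≤ Real.exp ((n + 1) * (n * S + m * t ^ (N + 1))) *
                Real.exp ((n + 1) * t ^ (N + 1)) := by
                refine mul_le_mul_of_nonneg_left ?_ (Real.exp_pos _).le
                linarith
            _ = _ := by
                rw [← Real.exp_add]
                congr 1
                push_cast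
                ring
        refine le_trans ?_ hAA
        by_cases hmJ : (⟨m, by omega⟩ : Fin n) ∈ J
        · have h1 := partialLIntegral_succ hq hψc hϖ hs hmJ hL1
          simp only at h1
          refine h1.trans ?_
          have h2 : ∑ j ∈ J.filter (· < (⟨m, by omega⟩ : Fin n)), weightBound F n s L *
              partialLIntegral ϖ s ((J.erase ⟨m, by omega⟩).erase j) L m ≤
              n * (weightBound F n s L * A) := by
            refine (Finset.sum_le_card_nsmul _ _ (weightBound F n s L * A) fun j _ =>
              mul_le_mul_right (ihm' _) _).trans ?_
            rw [nsmul_eq_mul]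
            refine mul_le_mul_left (Nat.cast_le.mpr ?_) _
            simpa using Finset.card_le_univ (J.filter (· < (⟨m, by omega⟩ : Fin n)))
          calc _ ≤ A + (weightBound F n s L * A + n * (weightBound F n s L * A)) :=
                add_le_add (ihm' J) (add_le_add (mul_le_mul_right (ihm' _) _) h2)
            _ = _ := by ring
        · have h1 := partialLIntegral_succ_of_notMem ϖ s hmJ L
          simp only at h1
          rw [h1]
          refine (ihm' J).trans ?_
          calc A = A * 1 := (mul_one _).symm
            _ ≤ _ := mul_le_mul_right (le_self_add) _
    intro J
    refine (key n le_rfl J).trans (ENNReal.ofReal_le_ofReal (Real.exp_le_exp.mpr ?_))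
    rw [Finset.sum_range_succ, mul_add (n : ℝ)]

/-- For `Re s > n` the geometric series in `t` converges, so the bounds do not grow with `N`. -/
theorem exists_partialLIntegral_le (hq : Odd (resCard F)) {ψ : AddChar F Circle}
    (hψc : Continuous ψ) {ϖ : F} (hϖ : ϖ ∈ shell F 1) {s : ℂ} (hs : (n : ℝ) < s.re)
    (J : Finset (Fin n)) :
    ∃ C : ℝ, ∀ N : ℕ, partialLIntegral ϖ s J (-(N : ℤ)) n ≤ ENNReal.ofReal C := by
  set t : ℝ := (resCard F : ℝ) ^ (-(s.re - n)) with ht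
  have ht0 : 0 ≤ t := Real.rpow_nonneg (Nat.cast_nonneg _) _
  have ht1 : t < 1 := Real.rpow_lt_one_of_one_lt_of_neg
    (by exact_mod_cast one_lt_resCard F) (by linarith)
  have hsum : Summable fun k : ℕ => t ^ (k + 1) :=
    (summable_nat_add_iff 1).mpr (summable_geometric_of_lt_one ht0 ht1)
  refine ⟨Real.exp ((n + 1) * (n * ∑' k : ℕ, t ^ (k + 1))), fun N =>
    (partialLIntegral_le hq hψc hϖ hs.le N J).trans
      (ENNReal.ofReal_le_ofReal (Real.exp_le_exp.mpr ?_))⟩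
  have := hsum.sum_le_tsum (Finset.range N) fun k _ => by positivity
  gcongr

variable {ι : Type*}

theorem region_full {r : ι → ℕ} {m : ℕ} (hr : ∀ k, r k < m) (L : ℤ) {x : Sym2 ι → F} :
    x ∈ region F r L m ↔ ∀ k l, x s(k, l) ∈ P F L := by
  simp [mem_region, level, hr]

theorem monotone_region {r : ι → ℕ} {m : ℕ} (hr : ∀ k, r k < m) :
    Monotone fun N : ℕ => region F r (-(N : ℤ)) m := by
  intro N N' h x hx
  simp only [region_full hr] at hx ⊢
  exact fun k l => P_mono (by omega) (hx k l)

theorem iUnion_region [Finite ι] {r : ι → ℕ} {m : ℕ} (hr : ∀ k, r k < m) :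
    ⋃ N : ℕ, region F r (-(N : ℤ)) m = Set.univ := by
  refine Set.eq_univ_of_forall fun x => Set.mem_iUnion.mpr ?_
  choose b hb using fun z : Sym2 ι => exists_mem_P (x z)
  obtain ⟨M, hM⟩ := (Set.finite_range fun z => (-b z).toNat).bddAbove
  refine ⟨M, (region_full hr _).mpr fun k l => P_mono ?_ (hb s(k, l))⟩
  have : (-b s(k, l)).toNat ≤ M := hM ⟨_, rfl⟩
  omega

theorem integrable_integrand_subtype (hq : Odd (resCard F)) {ψ : AddChar F Circle}
    (hψc : Continuous ψ) {ϖ : F} (hϖ : ϖ ∈ shell F 1) {s : ℂ} (hs : (n : ℝ) < s.re)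
    (J : Finset (Fin n)) (b : ↥J → F) :
    Integrable (integrand ψ ϖ s b) (haarS F ↥J) := by
  have hr : ∀ k : ↥J, ((k : Fin n) : ℕ) < n := fun k => (k : Fin n).2
  obtain ⟨C, hC⟩ := exists_partialLIntegral_le hq hψc hϖ hs J
  refine ⟨(measurable_integrand hq hψc hϖ s b).aestronglyMeasurable, ?_⟩
  rw [hasFiniteIntegral_iff_enorm, ← setLIntegral_univ, ← iUnion_region hr,
    setLIntegral_iUnion_of_directed _ (monotone_region hr).directed_le]
  refine (iSup_le fun N => ?_).trans_lt (ENNReal.ofReal_lt_top (r := C))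
  simp only [enorm_integrand]
  exact hC N

/-- The regions of level `-N` exhaust all symmetric matrices, so their integrals tend to the full
integral. These integrals equal the explicit formula as soon as `N` exceeds every `e_i`. -/
theorem integral_integrand_subtype (hq : Odd (resCard F)) {ψ : AddChar F Circle}
    (hψc : Continuous ψ) (hψ : HasOrderZero ψ) {ϖ : F} (hϖ : ϖ ∈ shell F 1) {s : ℂ}
    (hs : (n : ℝ) < s.re) (hn : 1 ≤ n) {v : Fin n → F} (hv : ∀ i, v i ∈ shell F 0)
    (e : Fin n → ℕ) :
    ∫ x, integrand ψ ϖ s (fun k : ↥(Finset.univ : Finset (Fin n)) => v k * ϖ ^ e k) x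
      ∂haarS F ↥(Finset.univ : Finset (Fin n)) = explicitFormula ψ ϖ v e s := by
  have hr : ∀ k : ↥(Finset.univ : Finset (Fin n)), ((k : Fin n) : ℕ) < n := fun k => (k : Fin n).2
  have hint := integrable_integrand_subtype hq hψc hϖ hs Finset.univ
    (fun k : ↥(Finset.univ : Finset (Fin n)) => v k * ϖ ^ e k)
  have h1 := tendsto_setIntegral_of_monotone (μ := haarS F ↥(Finset.univ : Finset (Fin n)))
    (fun N : ℕ => measurableSet_region (F := F)
      (fun k : ↥(Finset.univ : Finset (Fin n)) => ((k : Fin n) : ℕ)) (-(N : ℤ)) n)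
    (monotone_region hr) hint.integrableOn
  rw [iUnion_region hr, setIntegral_univ] at h1
  refine tendsto_nhds_unique h1 (tendsto_const_nhds.congr' ?_)
  filter_upwards [Filter.eventually_ge_atTop (Finset.univ.sup fun i => e i + 1)] with N hN
  rw [explicitFormula_eq hn ψ ϖ v e s (N := N) fun i =>
    (Finset.le_sup (f := fun i => e i + 1) (Finset.mem_univ i)).trans hN]
  exact (partialIntegral_eq hq hψc hψ hϖ hv e s N Finset.univ).symm

end Convergence

/-! ### Independence of the index type. -/

section Reindex

variable {F : Type*} [Field F] [ValuativeRel F] [TopologicalSpace F]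
  [IsNonarchimedeanLocalField F] [MeasurableSpace F] [BorelSpace F]
  {ι O : Type*} [Fintype ι] [DecidableEq ι] [Fintype O] [DecidableEq O]

theorem integrand_reindex (ψ : AddChar F Circle) (ϖ : F) (s : ℂ) (b : ι → F) (ε : O ≃ ι)
    (x : Sym2 ι → F) :
    integrand ψ ϖ s (b ∘ ε) (x ∘ Sym2.map ε) = integrand ψ ϖ s b x := by
  rw [integrand, integrand]
  congr 1
  · rw [← cellFn_submatrix ϖ s (symM x) ε]
    rfl
  · rw [phase, phase, ← Equiv.prod_comp ε]
    rfl

/-- The bijection of unordered pairs induced by a bijection. -/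
def symCongr (ε : O ≃ ι) : Sym2 O ≃ Sym2 ι where
  toFun := Sym2.map ε
  invFun := Sym2.map ε.symm
  left_inv z := by rw [Sym2.map_map]; simp
  right_inv z := by rw [Sym2.map_map]; simp

theorem measurePreserving_reindex (ε : O ≃ ι) :
    MeasurePreserving (MeasurableEquiv.arrowCongr' (symCongr ε).symm (MeasurableEquiv.refl F))
      (haarS F ι) (haarS F O) :=
  measurePreserving_arrowCongr' _ _ _ _ fun _ => MeasurePreserving.id _

theorem integrand_arrowCongr (ψ : AddChar F Circle) (ϖ : F) (s : ℂ) (b : ι → F) (ε : O ≃ ι)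
    (x : Sym2 ι → F) :
    integrand ψ ϖ s (b ∘ ε)
      (MeasurableEquiv.arrowCongr' (symCongr ε).symm (MeasurableEquiv.refl F) x) =
        integrand ψ ϖ s b x :=
  integrand_reindex ψ ϖ s b ε x

theorem integral_integrand_reindex (ψ : AddChar F Circle) (ϖ : F) (s : ℂ) (b : ι → F)
    (ε : O ≃ ι) :
    ∫ x, integrand ψ ϖ s b x ∂haarS F ι = ∫ x, integrand ψ ϖ s (b ∘ ε) x ∂haarS F O := by
  rw [← (measurePreserving_reindex ε).integral_comp']
  simp only [integrand_arrowCongr]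

theorem integrable_integrand_reindex {ψ : AddChar F Circle} {ϖ : F} {s : ℂ} {b : ι → F}
    (ε : O ≃ ι) (h : Integrable (integrand ψ ϖ s (b ∘ ε)) (haarS F O)) :
    Integrable (integrand ψ ϖ s b) (haarS F ι) := by
  rw [← (measurePreserving_reindex ε).integrable_comp_emb
    (MeasurableEquiv.measurableEmbedding _)] at h
  exact h.congr (.of_forall fun x => integrand_arrowCongr ψ ϖ s b ε x)

end Reindex

/-! ### The Siegel series and its meromorphic continuation. -/

section Siegel

variable {F : Type*} [Field F] [ValuativeRel F] [TopologicalSpace F]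
  [IsNonarchimedeanLocalField F] [MeasurableSpace F] [BorelSpace F] {n : ℕ}

theorem siegelIntegrand_eq (hq : Odd (resCard F)) (ψ : AddChar F Circle) {ϖ : F}
    (hϖ : ϖ ∈ shell F 1) (b : Fin n → F) (s : ℂ) :
    siegelIntegrand ψ (chi ϖ) (Matrix.diagonal b) 0 s = integrand ψ ϖ s b := by
  funext x
  rw [siegelIntegrand, basisFn_w_mul_unip hϖ hq, integrand]
  refine congrArg₂ (· * ·) rfl ?_
  rw [phase, ← psi_sum, Matrix.trace, ← Finset.sum_neg_distrib]
  simp [symMatrix, Matrix.diagonal_mul]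

theorem integrable_siegelIntegrand (hq : Odd (resCard F)) {ψ : AddChar F Circle}
    (hψc : Continuous ψ) {ϖ : F} (hϖ : ϖ ∈ shell F 1) (b : Fin n → F) {s : ℂ}
    (hs : (n : ℝ) < s.re) :
    Integrable (siegelIntegrand ψ (chi ϖ) (Matrix.diagonal b) 0 s) (haarSym F n) := by
  rw [siegelIntegrand_eq hq ψ hϖ]
  exact integrable_integrand_reindex (Equiv.subtypeUnivEquiv Finset.mem_univ)
    (integrable_integrand_subtype hq hψc hϖ hs Finset.univ _)

theorem siegelIntegral_eq (hq : Odd (resCard F)) {ψ : AddChar F Circle}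
    (hψc : Continuous ψ) (hψ : HasOrderZero ψ) {ϖ : F} (hϖ : ϖ ∈ shell F 1) (hn : 1 ≤ n)
    {v : Fin n → F} (hv : ∀ i, v i ∈ shell F 0) (e : Fin n → ℕ) {s : ℂ} (hs : (n : ℝ) < s.re) :
    siegelIntegral ψ (chi ϖ) (Matrix.diagonal fun i => v i * ϖ ^ e i) 0 s =
      explicitFormula ψ ϖ v e s := by
  rw [siegelIntegral, siegelIntegrand_eq hq ψ hϖ,
    ← integral_integrand_subtype hq hψc hψ hϖ hs hn hv e]
  exact integral_integrand_reindex ψ ϖ s _ (Equiv.subtypeUnivEquiv Finset.mem_univ)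

theorem differentiable_explicitFormula (ψ : AddChar F Circle) (ϖ : F) (v : Fin n → F)
    (e : Fin n → ℕ) : Differentiable ℂ (explicitFormula ψ ϖ v e) := by
  have hq : (resCard F : ℂ) ≠ 0 := resCard_ne_zero F
  unfold explicitFormula
  refine (Differentiable.fun_sum fun σ _ => (Differentiable.fun_sum fun r _ =>
    Differentiable.fun_sum fun I _ => (Differentiable.fun_sum fun ν _ =>
      Differentiable.fun_finsetProd fun l _ => ?_).const_mul _).const_mul _).const_mul _
  refine (Differentiable.const_mul ?_ _).mul_const _
  refine Differentiable.const_cpow ?_ (.inl hq)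
  fun_prop

/-- The identity theorem: the difference of two continuations vanishes on a half-plane, so its order
is infinite at every point of the plane. Agreement on punctured neighbourhoods becomes agreement
everywhere because both functions are in normal form. -/
theorem isSiegelSeries_iff {ψ : AddChar F Circle} {ω : F → ℂ} {B : Matrix (Fin n) (Fin n) F}
    {t : ℕ} {E : ℂ → ℂ} (hE : Differentiable ℂ E) {c₀ : ℝ}
    (h : ∀ s : ℂ, c₀ < s.re →
      Integrable (siegelIntegrand ψ ω B t s) (haarSym F n) ∧ siegelIntegral ψ ω B t s = E s)
    (S : ℂ → ℂ) : IsSiegelSeries ψ ω B t S ↔ S = E := by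
  have hNF : MeromorphicNFOn E Set.univ := fun s _ => (hE.analyticAt s).meromorphicNFAt
  constructor
  · rintro ⟨hS, c, hc⟩
    -- A point inside both half-planes, at which `S` and `E` agree on a full neighbourhood.
    set z : ℂ := ((max c c₀ + 1 : ℝ) : ℂ) with hz
    have hmer : MeromorphicOn (S - E) Set.univ := fun s hs =>
      (hS hs).meromorphicAt.sub (hNF hs).meromorphicAt
    have hzero : meromorphicOrderAt (S - E) z = ⊤ := by
      rw [meromorphicOrderAt_eq_top_iff]
      refine Filter.Eventually.filter_mono nhdsWithin_le_nhds ?_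
      have hopen : IsOpen {s : ℂ | max c c₀ < s.re} :=
        isOpen_lt continuous_const Complex.continuous_re
      have hmem : z ∈ {s : ℂ | max c c₀ < s.re} := by
        change max c c₀ < z.re
        rw [hz, Complex.ofReal_re]
        linarith
      filter_upwards [hopen.mem_nhds hmem] with s hs
      obtain ⟨h1, h2⟩ := max_lt_iff.mp hs
      rw [Pi.sub_apply, (hc s h1).2, (h s h2).2, sub_self]
    funext s
    have htop : meromorphicOrderAt (S - E) s = ⊤ := by
      by_contra hne
      exact hmer.meromorphicOrderAt_ne_top_of_isPreconnected isPreconnected_univ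
        (Set.mem_univ s) (Set.mem_univ z) hne hzero
    rw [meromorphicOrderAt_eq_top_iff] at htop
    have heq : S =ᶠ[nhdsWithin s {s}ᶜ] E := by
      filter_upwards [htop] with u hu
      exact sub_eq_zero.mp hu
    exact (((hS (Set.mem_univ s)).eventuallyEq_nhdsNE_iff_eventuallyEq_nhds
      (hNF (Set.mem_univ s))).mp heq).eq_of_nhds
  · rintro rfl
    exact ⟨hNF, c₀, fun s hs => ⟨(h s hs).1, (h s hs).2.symm⟩⟩

end Siegel

end RamifiedSiegel

end

theorem theorem4p1 {F : Type*} [Field F] [ValuativeRel F] [TopologicalSpace F]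
    [IsNonarchimedeanLocalField F] [MeasurableSpace F] [BorelSpace F]
    (hq : Odd (RamifiedSiegel.resCard F))
    (ψ : AddChar F Circle) (hψc : Continuous ψ) (hψ : RamifiedSiegel.HasOrderZero ψ)
    (π : 𝒪[F]) (hπ : Irreducible π)
    (n : ℕ) (hn : 1 ≤ n) (v : Fin n → 𝒪[F]ˣ) (e : Fin n → ℕ) (he : Monotone e)
    (B : Matrix (Fin n) (Fin n) F)
    (hB : B = Matrix.diagonal fun i => ((v i : 𝒪[F]) : F) * (π : F) ^ e i) :
    (∀ s : ℂ, (n : ℝ) < s.re →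
      Integrable (RamifiedSiegel.siegelIntegrand ψ (RamifiedSiegel.chi (π : F)) B 0 s)
          (RamifiedSiegel.haarSym F n) ∧
        RamifiedSiegel.siegelIntegral ψ (RamifiedSiegel.chi (π : F)) B 0 s =
          RamifiedSiegel.explicitFormula ψ (π : F) (fun i => ((v i : 𝒪[F]) : F)) e s) ∧
    ∀ S : ℂ → ℂ,
      RamifiedSiegel.IsSiegelSeries ψ (RamifiedSiegel.chi (π : F)) B 0 S ↔
        S = RamifiedSiegel.explicitFormula ψ (π : F) (fun i => ((v i : 𝒪[F]) : F)) e := by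
  have hϖ : (π : F) ∈ RamifiedSiegel.shell F 1 := RamifiedSiegel.ord_irreducible hπ
  have hv : ∀ i, ((v i : 𝒪[F]) : F) ∈ RamifiedSiegel.shell F 0 :=
    fun i => RamifiedSiegel.ord_unit (v i)
  subst hB
  refine ⟨fun s hs => ?_, fun S => RamifiedSiegel.isSiegelSeries_iff
    (RamifiedSiegel.differentiable_explicitFormula ψ _ _ e) (c₀ := n) (fun s hs => ?_) S⟩ <;>
  exact ⟨RamifiedSiegel.integrable_siegelIntegrand hq hψc hϖ _ hs,
    RamifiedSiegel.siegelIntegral_eq hq hψc hψ hϖ hn hv e hs⟩
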